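/- Let $n \ge 3$. For $a \in \mathbb{R}^n\setminus\{0\}$ consider the metric $\bar g_{ij} = (1+|y+a|^{2-n})^{\frac{4}{n-2}}\,\delta_{ij}$ on $\mathbb{R}^n \setminus \{-a\}$ (the doubled Schwarzschild metric in the translated coordinates $y = x-a$). For $0<r<|a|$ let $B_r=\{|y|\le r\}$ be the coordinate ball of radius $r$ centered at the origin $y=0$ (i.e. at $x=a$), let $\mathscr{H}^{n-1}_{\bar g}$ and $\mathrm{vol}_{\bar g}$ denote area and volume with respect to $\bar g$, and let $\omega_{n-1}$ be the Euclidean area of the unit sphere in $\mathbb{R}^n$. Fix $R>0$. In what follows $|a|\to\infty$, $0<r\le R$, and the constants in the $O$-terms (and the threshold for $|a|$ from which they hold) depend only on $n$ and $R$. (i) The unperturbed coordinate balls satisfy $$\mathscr{H}_{\bar g}^{n-1}(\partial B_r) = \omega_{n-1} r^{n-1} (1+|a|^{2-n})^{\frac{2(n-1)}{n-2}} \Big[ 1 + \frac{(n-1) r^2}{|a|^{2n-2}} (1+|a|^{2-n})^{-2} + \frac{n(n-1)^2}{2(n+2)} \frac{r^4}{|a|^{2n}} + O(|a|^{-2n-1})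 \Big],$$ $$\mathrm{vol}_{\bar g}(B_r) = \frac1n \omega_{n-1} r^{n} (1+|a|^{2-n})^{\frac{2n}{n-2}} \Big[ 1 + \frac{n r^2}{|a|^{2n-2}} (1+|a|^{2-n})^{-2} + \frac{n^2(n-1)}{2(n+4)} \frac{r^4}{|a|^{2n}} + O(|a|^{-2n-1}) \Big].$$ (ii) Define $f:\partial B_r \to \mathbb{R}$ by $$f(y) = \frac{(n-1) r}{n+1}\, \frac{|a|^2 r^2 - n \langle a,y\rangle^2}{|a|^{n+2}} + c,$$ where $c$ is the unique constant with $\int_{\partial B_r} f\, d\mu_{\bar g} = 0$. Let $\Sigma = \{\exp_y(f(y)\,\nu(y)) : y \in \partial B_r\}$, where $\exp$ is the exponential map of $\bar g$ and $\nu$ is the outward unit normal to $\partial B_r$ with respect to $\bar g$, and let $\Omega$ be the region enclosed by $\Sigma$, i.e. the union of the bounded connected components of $\mathbb{R}^n\setminus\Sigma$. For $|a|$ sufficiently large (depending only on $n$ and $R$), the map $y\mapsto \exp_y(f(y)\nu(y))$ is well defined, continuous and injective on $\partial B_r$, the set $\Omega$ is open and connected with $\partial\Omega=\Sigma$ and $-a\notin\overline\Omega$,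 and $\mathscr{H}_{\bar g}^{n-1}(\Sigma)$ and $\mathrm{vol}_{\bar g}(\Omega)$ are finite. Moreover, $$\mathscr{H}_{\bar g}^{n-1}(\Sigma) = (n^{n-1}\omega_{n-1})^{\frac1n}\, \mathrm{vol}_{\bar g}(\Omega)^{\frac{n-1}{n}} \Big[ 1 - \frac{2(n-2)(n-1)^2}{(n+1)(n+2)(n+4)} \frac{r^4}{|a|^{2n}} + O(|a|^{-2n-1}) \Big].$$ (iii) In particular, $\Sigma$ has strictly better isoperimetric ratio than a Euclidean ball: for every $r_0>0$ there is $A_1$ such that $\mathscr{H}_{\bar g}^{n-1}(\Sigma) < (n^{n-1}\omega_{n-1})^{\frac1n}\, \mathrm{vol}_{\bar g}(\Omega)^{\frac{n-1}{n}}$ whenever $r_0\le r\le R$ and $|a|\ge A_1$. -/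

import Mathlib

open MeasureTheory

noncomputable section

namespace OffCenter

/-- Euclidean space `ℝⁿ`. -/
abbrev E (n : ℕ) := EuclideanSpace ℝ (Fin n)

/-- The harmonic function `u(y) = 1 + |y + a|^{2-n}` on `ℝⁿ ∖ {-a}`. -/
def u {n : ℕ} (a y : E n) : ℝ := 1 + ‖y + a‖ ^ (2 - (n : ℝ))

/-- The metric coefficients `g_{ij}(y) = u(y)^{4/(n-2)} δ_{ij}` of the doubled Schwarzschild metric,
in the coordinates `y = x - a`, on `ℝⁿ ∖ {-a}`. -/
def metric {n : ℕ} (a y : E n) : Matrix (Fin n) (Fin n) ℝ :=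
  u a y ^ ((4 : ℝ) / ((n : ℝ) - 2)) • (1 : Matrix (Fin n) (Fin n) ℝ)

/-- The inner product `g_y(v, w) = ∑ g_{ij}(y) vⁱ wʲ`. -/
def metricInner {n : ℕ} (a y v w : E n) : ℝ := ∑ i, ∑ j, metric a y i j * v i * w j

/-- The partial derivative `∂_i g_{jl}` at `y`. -/
def metricDeriv {n : ℕ} (a y : E n) (i j l : Fin n) : ℝ :=
  fderiv ℝ (fun z : E n => metric a z j l) y (EuclideanSpace.single i 1)

/-- The Christoffel symbols `Γ^k_{ij} = ½ g^{kl} (∂_i g_{jl} + ∂_j g_{il} - ∂_l g_{ij})`. -/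
def christoffel {n : ℕ} (a y : E n) (k i j : Fin n) : ℝ :=
  1 / 2 * ∑ l, (metric a y)⁻¹ k l *
    (metricDeriv a y i j l + metricDeriv a y j i l - metricDeriv a y l i j)

/-- The right-hand side `-Γ^k_{ij} vⁱ vʲ` of the geodesic equation. -/
def geodesicAccel {n : ℕ} (a y v : E n) : E n :=
  WithLp.toLp 2 fun k => -∑ i, ∑ j, christoffel a y k i j * v i * v j

/-- `γ : [0,1] → ℝⁿ ∖ {-a}` is a geodesic with velocity `γ'`. -/
def IsGeodesic {n : ℕ} (a : E n) (γ γ' : ℝ → E n) : Prop :=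
  ∀ t ∈ Set.Icc (0 : ℝ) 1, γ t ≠ -a ∧
    HasDerivWithinAt γ (γ' t) (Set.Icc 0 1) t ∧
    HasDerivWithinAt γ' (geodesicAccel a (γ t) (γ' t)) (Set.Icc 0 1) t

/-- `z = exp_y(v)`: there is a geodesic on `[0,1]` that starts at `y` with velocity `v` and ends
at `z`. -/
def IsExp {n : ℕ} (a y v z : E n) : Prop :=
  ∃ γ γ' : ℝ → E n, IsGeodesic a γ γ' ∧ γ 0 = y ∧ γ' 0 = v ∧ γ 1 = z

/-- `ν` is the outward unit normal at `y`, with respect to the metric, of the coordinate sphere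
centered at the origin through `y` (whose tangent space at `y` is the Euclidean orthogonal
complement of `y`). -/
def IsOuterUnitNormal {n : ℕ} (a y ν : E n) : Prop :=
  (∀ w : E n, inner ℝ y w = 0 → metricInner a y ν w = 0) ∧
    metricInner a y ν ν = 1 ∧ 0 < inner ℝ y ν

/-- The `(n-1)`-dimensional Hausdorff measure of the metric. The metric is `λ² δ` with
`λ = u^{2/(n-2)}`, so it is the Euclidean `(n-1)`-dimensional Hausdorff measure (normalized to be
Lebesgue measure on hyperplanes) with density `λ^{n-1} = u^{2(n-1)/(n-2)}`. -/
def area {n : ℕ} (a : E n) : Measure (E n) :=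
  (μHE[n - 1] : Measure (E n)).withDensity fun y =>
    ENNReal.ofReal (u a y ^ (2 * ((n : ℝ) - 1) / ((n : ℝ) - 2)))

/-- The Riemannian volume measure `√(det g_{ij}) dy`. -/
def vol {n : ℕ} (a : E n) : Measure (E n) :=
  (volume : Measure (E n)).withDensity fun y => ENNReal.ofReal (Real.sqrt (metric a y).det)

/-- `ω_{n-1}`, the area of the unit sphere in `ℝⁿ`. -/
def omega (n : ℕ) : ℝ := ((μHE[n - 1] : Measure (E n)) (Metric.sphere 0 1)).toReal

/-- The function `f` on `∂B_r`, with additive constant `c`. -/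
def f {n : ℕ} (a : E n) (r c : ℝ) (y : E n) : ℝ :=
  ((n : ℝ) - 1) * r / ((n : ℝ) + 1) *
    ((‖a‖ ^ 2 * r ^ 2 - (n : ℝ) * (inner ℝ a y) ^ 2) / ‖a‖ ^ (n + 2)) + c

/-- The normalization `∫_{∂B_r} f dμ_g = 0` of the constant `c`. -/
def MeanZero {n : ℕ} (a : E n) (r c : ℝ) : Prop :=
  ∫ y in Metric.sphere (0 : E n) r, f a r c y ∂(area a) = 0

/-- The normal graph `Σ = {exp_y(f(y) ν(y)) : y ∈ ∂B_r}`. -/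
def graph {n : ℕ} (a : E n) (r c : ℝ) : Set (E n) :=
  {z | ∃ y ∈ Metric.sphere (0 : E n) r, ∃ ν, IsOuterUnitNormal a y ν ∧ IsExp a y (f a r c y • ν) z}

/-- The region enclosed by a set `S` in `ℝⁿ`: the union of the bounded connected components of
the complement of `S`. -/
def enclosed {n : ℕ} (S : Set (E n)) : Set (E n) :=
  {x | x ∉ S ∧ Bornology.IsBounded (connectedComponentIn Sᶜ x)}

end OffCenter

end

/-!
# Off-center isoperimetric regions in the doubled Schwarzschild metric

The metric is conformally flat, `g = λ² δ` with `λ = u ^ (2 / (n - 2))`, and in polar coordinates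
around the origin `u` depends only on the radius and on the cosine `t` of the angle with `a`. Up to
the constant factor `centerFactor = 1 + |a| ^ (2 - n)` it is `1 + η P(k, t)`, where `k = r / |a|`,
`η = O(|a| ^ (2 - n))`, and `P = pot` is the nonconstant part of the fundamental solution. The area
formula for radial graphs (`area_radialGraph`) and polar coordinates therefore turn the area of a
radial graph `r (1 + φ(t))`, and the volume that it encloses, into integrals over `[-1, 1]` against
the law of `t` (`area_radialMap_sphere`, `vol_radialMap_ball`). All that is used of this law is an
integration by parts formula (`IsZonal`): it yields the moments, and the mean value property of
harmonic functions, by which the terms linear in `P` integrate to zero.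

**Expansions.** The function `f` corresponds to a relative displacement `φ` of order `|a| ^ (-n)`,
to leading order `g (1 - n t²)` with `g = (n - 1) / (n + 1) x` and `x = r² |a| ^ (-n)`. Up to
`O(|a| ^ (-2n - 1))` only the terms quadratic in `(η, φ)` and the mean of `φ` contribute
(`weighted_factor_expansion`, `areaMean_expansion`, `volMean_expansion_general`). Putting `φ = 0`
gives the expansions for coordinate balls. In the ratio of the area to the power `(n - 1) / n` of
the volume the mean of `φ` and the terms of order `|a| ^ (2 - 2n)` cancel, and there remains
`1 + n (n - 1)² / ((n + 2) (n + 4)) x² - 2 (n - 1)² / (n + 2) x g + (n - 1) (n + 1) / (n + 2) g²`.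
The chosen `g` is the minimizer of this quadratic polynomial, and the minimum is
`1 - 2 (n - 2) (n - 1)² / ((n + 1) (n + 2) (n + 4)) x²` (`isoperimetricRatio_expansion`).

**Geodesics.** The surface `Σ` is made of end points of geodesics rather than of straight segments.
Since `∇ log λ = O(1 / |a|)` near the ball, the geodesic equation shows that
`exp_y(f ν) - (y + φ y)` is bounded, and Lipschitz in `y`, with constants
`O(|φ|² / |a|) = O(|a| ^ (-2n - 1))` (`norm_expMap_sub_le`, `norm_expMap_sub_sub_le`). Extending the
displacements homogeneously to the whole space gives two bi-Lipschitz homeomorphisms of `ℝⁿ` that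
are close to the identity and even closer to each other (`exists_perturbation`). One maps the sphere
to the radial graph, the other one maps it to `Σ`. Hence `Σ` is embedded, it encloses the image of
the open ball, and area and volume differ from those of the radial graph by factors
`1 + O(|a| ^ (-2n - 1))`, which do not affect the expansion (`area_vol_image_le`,
`graph_properties`).

**Strict inequality.** For `r ≥ r₀` the quartic term is at least a positive multiple of
`|a| ^ (-2n)`, so it dominates the error for large `|a|`.
-/

namespace OffCenter

open Metric Set Filter Topology Module Asymptotics
open scoped NNReal ENNReal Pointwise

/-! ### Measures that agree locally up to a factor -/

theorem measure_le_of_locally_le {X : Type*} [TopologicalSpace X] [SecondCountableTopology X]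
    [MeasurableSpace X] [OpensMeasurableSpace X] (μ ν : Measure X)
    (h : ∀ x, ∃ U ∈ 𝓝 x, ∀ A ⊆ U, MeasurableSet A → μ A ≤ ν A) : μ ≤ ν := by
  choose U hU hUA using h
  obtain ⟨s, hs, hcov⟩ :=
    TopologicalSpace.countable_cover_nhds fun x => interior_mem_nhds.2 (hU x)
  rw [Measure.le_iff]
  intro A hA
  rcases s.eq_empty_or_nonempty with rfl | hne
  · have : A = ∅ := by
      have h1 : (univ : Set X) = ∅ := by simpa using hcov.symm
      exact eq_empty_of_subset_empty (h1 ▸ subset_univ A)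
    simp [this]
  obtain ⟨x, hx⟩ := hs.exists_eq_range hne
  set V : ℕ → Set X := fun k => interior (U (x k)) with hV
  have hVm : ∀ k, MeasurableSet (V k) := fun k => isOpen_interior.measurableSet
  have hVc : ⋃ k, V k = univ := by
    rw [← hcov, hx, biUnion_range]
  have hAeq : A = ⋃ k, A ∩ disjointed V k := by
    rw [← inter_iUnion, iUnion_disjointed, hVc, inter_univ]
  have hm : ∀ k, MeasurableSet (A ∩ disjointed V k) := fun k =>
    hA.inter (MeasurableSet.disjointed hVm k)
  have hd : Pairwise (Function.onFun Disjoint fun k => A ∩ disjointed V k) := fun i j hij =>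
    ((disjoint_disjointed V) hij).mono inter_subset_right inter_subset_right
  rw [hAeq, measure_iUnion hd hm, measure_iUnion hd hm]
  refine ENNReal.tsum_le_tsum fun k => hUA (x k) _ ?_ (hm k)
  exact (inter_subset_right.trans (disjointed_subset V k)).trans interior_subset

/-- Two measures agree if every point has, for each factor `K > 1`, a neighborhood on whose
measurable subsets the measures agree up to the factor `K`. This replaces differentiation of
measures: no finiteness is needed. -/
theorem measure_eq_of_locally_comparable {X : Type*} [TopologicalSpace X]
    [SecondCountableTopology X] [MeasurableSpace X] [OpensMeasurableSpace X] (μ ν : Measure X)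
    (h : ∀ K : ℝ≥0, 1 < K → ∀ x, ∃ U ∈ 𝓝 x, ∀ A ⊆ U, MeasurableSet A →
      μ A ≤ K * ν A ∧ ν A ≤ K * μ A) : μ = ν := by
  have key : ∀ μ ν : Measure X, (∀ K : ℝ≥0, 1 < K → μ ≤ (K : ℝ≥0∞) • ν) → μ ≤ ν := by
    intro μ ν hK
    rw [Measure.le_iff]
    intro A _
    refine le_of_forall_gt fun c hc => ?_
    by_contra hcon
    rw [not_lt] at hcon
    -- `ν A < c ≤ μ A ≤ K ν A` for all `K > 1` is impossible
    have hlim : Tendsto (fun K : ℝ≥0 => (K : ℝ≥0∞) * ν A) (𝓝[>] 1)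
        (𝓝 (((1 : ℝ≥0) : ℝ≥0∞) * ν A)) := by
      refine ENNReal.Tendsto.mul_const ?_ (Or.inl (by simp))
      exact (ENNReal.continuous_coe.tendsto _).mono_left nhdsWithin_le_nhds
    have h2 : c ≤ ((1 : ℝ≥0) : ℝ≥0∞) * ν A := by
      refine ge_of_tendsto hlim ?_
      filter_upwards [self_mem_nhdsWithin] with K hK1
      exact hcon.trans (by simpa using hK K hK1 A)
    simp at h2
    exact absurd hc (not_lt.mpr h2)
  apply le_antisymm
  · refine key _ _ fun K hK => measure_le_of_locally_le _ _ fun x => ?_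
    obtain ⟨U, hU, hA⟩ := h K hK x
    exact ⟨U, hU, fun A hAU hm => by simpa using (hA A hAU hm).1⟩
  · refine key _ _ fun K hK => measure_le_of_locally_le _ _ fun x => ?_
    obtain ⟨U, hU, hA⟩ := h K hK x
    exact ⟨U, hU, fun A hAU hm => by simpa using (hA A hAU hm).2⟩

/-! ### Hausdorff measure under maps that do not increase distances much -/

/-- If `f ∘ g⁻¹` is `K`-Lipschitz on `g '' A`, then `f '' A` is at most `K ^ d` times as large as
`g '' A`. The hypothesis is stated for the pair `(f, g)` so that no inverse of `g` has to be named;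
it implies that `f` factors through `g` on `A`. -/
theorem hausdorffE_image_le {X Y Z : Type*} [EMetricSpace X] [MeasurableSpace X]
    [BorelSpace X] [EMetricSpace Y] [MeasurableSpace Y] [BorelSpace Y] (d : ℕ)
    (f : Z → X) (g : Z → Y) (A : Set Z) (K : ℝ≥0)
    (h : ∀ x ∈ A, ∀ y ∈ A, edist (f x) (f y) ≤ K * edist (g x) (g y)) :
    (μHE[d] : Measure X) (f '' A) ≤ (K : ℝ≥0∞) ^ d * (μHE[d] : Measure Y) (g '' A) := by
  rcases A.eq_empty_or_nonempty with rfl | hne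
  · simp
  have : Nonempty Z := hne.to_subtype.map Subtype.val
  have hinv : ∀ y ∈ g '' A, Function.invFunOn g A y ∈ A ∧ g (Function.invFunOn g A y) = y :=
    fun y hy => ⟨Function.invFunOn_mem hy, Function.invFunOn_eq hy⟩
  have hfg : f '' A = (fun y => f (Function.invFunOn g A y)) '' (g '' A) := by
    ext z
    constructor
    · rintro ⟨x, hx, rfl⟩
      refine ⟨g x, ⟨x, hx, rfl⟩, ?_⟩
      have h1 := hinv (g x) ⟨x, hx, rfl⟩
      have h2 := h _ h1.1 _ hx
      rw [h1.2, edist_self, mul_zero] at h2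
      exact edist_le_zero.1 h2
    · rintro ⟨y, hy, rfl⟩
      exact ⟨_, (hinv y hy).1, rfl⟩
  have hL : LipschitzOnWith K (fun y => f (Function.invFunOn g A y)) (g '' A) := by
    intro y hy z hz
    have := h _ (hinv y hy).1 _ (hinv z hz).1
    rwa [(hinv y hy).2, (hinv z hz).2] at this
  rw [hfg]
  have := hL.hausdorffMeasure_image_le (d := (d : ℝ)) (by positivity)
  simp only [Measure.euclideanHausdorffMeasure_def, Measure.smul_apply, ENNReal.smul_def,
    smul_eq_mul]
  rw [mul_left_comm]
  gcongr
  simpa using this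

/-! ### The area of radial graphs over the sphere -/

section RadialGraph

variable {V : Type*} [NormedAddCommGroup V] [InnerProductSpace ℝ V]

/-- Central projection of `V` to the hyperplane `p + pᗮ`, followed by the orthogonal projection
to `pᗮ`. -/
noncomputable def gnomonic (p x : V) : (ℝ ∙ p)ᗮ :=
  (ℝ ∙ p)ᗮ.orthogonalProjectionOnto ((inner ℝ p x)⁻¹ • x)

theorem coe_gnomonic {p x : V} (hp : ‖p‖ = 1) (hx : inner ℝ p x ≠ 0) :
    (gnomonic p x : V) = (inner ℝ p x)⁻¹ • x - p := by
  have h := Submodule.starProjection_orthogonal_val (K := (ℝ ∙ p)) ((inner ℝ p x)⁻¹ • x)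
  simp only [gnomonic]
  rw [← Submodule.starProjection_apply, h, Submodule.starProjection_unit_singleton ℝ hp,
    inner_smul_right, inv_mul_cancel₀ hx, one_smul]

/-- The differential at the unit vector `p`, on the tangent space of the sphere, of the radial
graph `θ ↦ S ⟪e, θ⟫ • θ`, where `s = S ⟪e, p⟫` and `s' = S' ⟪e, p⟫`. -/
noncomputable def graphDiff (e p : V) (s s' : ℝ) : (ℝ ∙ p)ᗮ →ₗ[ℝ] V :=
  (s • LinearMap.id + s' • (innerₛₗ ℝ e).smulRight p) ∘ₗ (ℝ ∙ p)ᗮ.subtype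

theorem graphDiff_apply (e p : V) (s s' : ℝ) (v : (ℝ ∙ p)ᗮ) :
    graphDiff e p s s' v = s • (v : V) + (s' * inner ℝ e (v : V)) • p := by
  simp [graphDiff, smul_smul]

theorem inner_graphDiff {e p : V} (hp : ‖p‖ = 1) (s s' : ℝ) (v w : (ℝ ∙ p)ᗮ) :
    inner ℝ (graphDiff e p s s' v) (graphDiff e p s s' w) =
      s ^ 2 * inner ℝ (v : V) w + s' ^ 2 * inner ℝ e (v : V) * inner ℝ e (w : V) := by
  have hv : inner ℝ p (v : V) = 0 := Submodule.mem_orthogonal_singleton_iff_inner_right.1 v.2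
  have hw : inner ℝ p (w : V) = 0 := Submodule.mem_orthogonal_singleton_iff_inner_right.1 w.2
  have hv' : inner ℝ (v : V) p = 0 := by rw [real_inner_comm, hv]
  rw [graphDiff_apply, graphDiff_apply]
  simp only [inner_add_left, inner_add_right, real_inner_smul_left, real_inner_smul_right, hw, hv',
    real_inner_self_eq_norm_sq, hp]
  ring

theorem norm_le_norm_graphDiff {e p : V} (hp : ‖p‖ = 1) (s s' : ℝ)
    (v : (ℝ ∙ p)ᗮ) : s * ‖v‖ ≤ ‖graphDiff e p s s' v‖ := by
  apply le_of_sq_le_sq _ (norm_nonneg _)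
  rw [← real_inner_self_eq_norm_sq, inner_graphDiff hp, mul_pow, real_inner_self_eq_norm_sq]
  have : 0 ≤ (s' * inner ℝ e (v : V)) ^ 2 := sq_nonneg _
  simp only [Submodule.coe_norm]
  nlinarith

variable [FiniteDimensional ℝ V]

theorem finrank_orthogonal_unit {p : V} (hp : ‖p‖ = 1) :
    finrank ℝ (ℝ ∙ p)ᗮ = finrank ℝ V - 1 := by
  have hp0 : p ≠ 0 := by rintro rfl; simp at hp
  have h := (ℝ ∙ p).finrank_add_finrank_orthogonal
  rw [finrank_span_singleton hp0] at h
  omega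

/-- The Jacobian of the radial graph: its square is `s^{2(d-1)} (s² + s'² |e^T|²)` with
`d = dim V - 1`, by the rank one update formula for determinants. -/
theorem normDet_graphDiff {e p : V} (he : ‖e‖ = 1) (hp : ‖p‖ = 1) {s : ℝ} (hs : 0 < s) (s' : ℝ)
    (hV : 2 ≤ finrank ℝ V) :
    (graphDiff e p s s').normDet =
      s ^ (finrank ℝ V - 2) * √(s ^ 2 + s' ^ 2 * (1 - inner ℝ e p ^ 2)) := by
  have h1 : inner ℝ e p ^ 2 ≤ 1 := by
    have := abs_real_inner_le_norm e p
    rw [he, hp, mul_one] at this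
    nlinarith [abs_nonneg (inner ℝ e p), sq_abs (inner ℝ e p)]
  have hnn : 0 ≤ s ^ 2 + s' ^ 2 * (1 - inner ℝ e p ^ 2) := by
    have := mul_nonneg (sq_nonneg s') (sub_nonneg.2 h1)
    positivity
  rw [← sq_eq_sq₀ (LinearMap.normDet_nonneg _) (by positivity), mul_pow, Real.sq_sqrt hnn]
  set b := stdOrthonormalBasis ℝ (ℝ ∙ p)ᗮ with hb
  have hgram := (graphDiff e p s s').normDet_sq_eq_det_gram b
  simp only [RCLike.ofReal_real_eq_id, id] at hgram
  rw [hgram]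
  set w : Fin (finrank ℝ (ℝ ∙ p)ᗮ) → ℝ := fun i => (s' / s) * inner ℝ e (b i : V) with hw
  have hmat : Matrix.gram ℝ (fun i => graphDiff e p s s' (b i)) =
      (s ^ 2) • (1 + Matrix.replicateCol Unit w * Matrix.replicateRow Unit w) := by
    ext i j
    rw [Matrix.gram_apply, inner_graphDiff hp, ← Submodule.coe_inner,
      orthonormal_iff_ite.1 b.orthonormal i j]
    simp only [Matrix.smul_apply, Matrix.add_apply, Matrix.one_apply, Matrix.mul_apply,
      Matrix.replicateCol_apply, Matrix.replicateRow_apply, hw, smul_eq_mul]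
    simp
    field_simp
    split_ifs <;> ring
  rw [hmat, Matrix.det_smul, Matrix.det_one_add_replicateCol_mul_replicateRow, Fintype.card_fin]
  have hsum : w ⬝ᵥ w = (s' / s) ^ 2 * (1 - inner ℝ e p ^ 2) := by
    have h2 : ∑ i, inner ℝ e (b i : V) ^ 2 = 1 - inner ℝ e p ^ 2 := by
      set e' := (ℝ ∙ p)ᗮ.orthogonalProjectionOnto e with he'
      have h3 : ∀ i, inner ℝ e (b i : V) = inner ℝ e' (b i) := fun i => by
        rw [he', real_inner_comm, real_inner_comm (b i),
          Submodule.inner_orthogonalProjectionOnto_eq_of_mem_left]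
      have h4 : (e' : V) = e - inner ℝ p e • p := by
        rw [he', ← Submodule.starProjection_apply,
          Submodule.starProjection_orthogonal_val, Submodule.starProjection_unit_singleton ℝ hp]
      have h5 := b.sum_sq_norm_inner_left e'
      simp only [h3]
      have h6 : ∑ i, inner ℝ e' (b i) ^ 2 = ‖e'‖ ^ 2 := by
        rw [← h5]
        simp
      rw [h6, Submodule.coe_norm, h4, ← real_inner_self_eq_norm_sq]
      simp only [inner_sub_left, inner_sub_right, real_inner_smul_left, real_inner_smul_right,
        norm_smul, real_inner_self_eq_norm_sq, he, hp, real_inner_comm p e, Real.norm_eq_abs,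
        mul_one,
        sq_abs]
      ring
    simp only [dotProduct, hw]
    rw [← h2, Finset.mul_sum]
    exact Finset.sum_congr rfl fun i _ => by ring
  rw [hsum, finrank_orthogonal_unit hp]
  obtain ⟨k, hk⟩ := Nat.exists_eq_add_of_le hV
  have e1 : finrank ℝ V - 1 = k + 1 := by omega
  have e2 : finrank ℝ V - 2 = k := by omega
  rw [e1, e2]
  field_simp
  ring

variable [MeasurableSpace V] [BorelSpace V]

/-- The cone from the origin over the gnomonic image of `A` in the hyperplane `⟪p, ·⟫ = 1`, of
height one, has volume `1 / dim V` times that of its base: by Cavalieri's principle, since the slice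
at height `x` is the base scaled by `x`. -/
theorem volume_cone {p : V} (hp : ‖p‖ = 1) {A : Set V} (hA : MeasurableSet A)
    (hA1 : ∀ x ∈ A, ‖x‖ = 1 ∧ 0 < inner ℝ p x) :
    finrank ℝ V * volume {y : V | inner ℝ p y ∈ Ioo (0 : ℝ) 1 ∧ ‖y‖⁻¹ • y ∈ A} =
      volume (gnomonic p '' A) := by
  have hp0 : p ≠ 0 := by rintro rfl; simp at hp
  have : Nontrivial V := ⟨p, 0, hp0⟩
  have hn : 0 < finrank ℝ V := finrank_pos
  set C := {y : V | inner ℝ p y ∈ Ioo (0 : ℝ) 1 ∧ ‖y‖⁻¹ • y ∈ A} with hC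
  have hCm : MeasurableSet C := by
    refine MeasurableSet.inter ?_ ?_
    · exact (measurableSet_Ioo).preimage (by fun_prop : Measurable fun y : V => inner ℝ p y)
    · exact hA.preimage (by fun_prop : Measurable fun y : V => ‖y‖⁻¹ • y)
  have hslice : ∀ x : ℝ, μHE[finrank ℝ V - 1] (C ∩ AffineSubspace.mk' (x • p +ᵥ (0 : V)) (ℝ ∙ p)ᗮ)
      = (Ioo (0 : ℝ) 1).indicator (fun x => ENNReal.ofReal (x ^ (finrank ℝ V - 1)) *
          volume (gnomonic p '' A)) x := by
    intro x
    by_cases hx : x ∈ Ioo (0 : ℝ) 1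
    · rw [indicator_of_mem hx]
      have hset : C ∩ AffineSubspace.mk' (x • p +ᵥ (0 : V)) (ℝ ∙ p)ᗮ =
          (fun w : (ℝ ∙ p)ᗮ => x • p + (w : V)) '' (x • (gnomonic p '' A)) := by
        have hmem : ∀ y : V, y ∈ AffineSubspace.mk' (x • p +ᵥ (0 : V)) (ℝ ∙ p)ᗮ ↔
            inner ℝ p y = x := by
          intro y
          rw [AffineSubspace.mem_mk', Submodule.mem_orthogonal_singleton_iff_inner_right]
          simp only [vadd_eq_add, add_zero, vsub_eq_sub, inner_sub_right, real_inner_smul_right,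
            real_inner_self_eq_norm_sq, hp]
          constructor <;> intro h <;> linarith
        ext y
        constructor
        · rintro ⟨⟨-, hy2⟩, hy3⟩
          have hy3 := (hmem y).1 hy3
          have hy0 : y ≠ 0 := by
            rintro rfl
            simp at hy3
            exact hx.1.ne hy3
          have hny : 0 < ‖y‖ := norm_pos_iff.2 hy0
          refine ⟨x • gnomonic p (‖y‖⁻¹ • y), smul_mem_smul_set ⟨_, hy2, rfl⟩, ?_⟩
          have hpos := (hA1 _ hy2).2
          simp only [Submodule.coe_smul]
          rw [coe_gnomonic hp hpos.ne', real_inner_smul_right, hy3, smul_sub, smul_smul, smul_smul]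
          have : x * (‖y‖⁻¹ * x)⁻¹ * ‖y‖⁻¹ = 1 := by
            have := hx.1.ne'
            field_simp
          rw [this]
          simp
        · rintro ⟨w, ⟨w', ⟨z, hz, rfl⟩, rfl⟩, rfl⟩
          have hpos := (hA1 _ hz).2
          have e1 : x • p + ((x • gnomonic p z : (ℝ ∙ p)ᗮ) : V) = (x * (inner ℝ p z)⁻¹) • z := by
            simp only [Submodule.coe_smul]
            rw [coe_gnomonic hp hpos.ne', smul_sub, smul_smul]
            abel
          have hc : 0 < x * (inner ℝ p z)⁻¹ := mul_pos hx.1 (inv_pos.2 hpos)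
          have e2 : inner ℝ p ((x * (inner ℝ p z)⁻¹) • z) = x := by
            rw [real_inner_smul_right, mul_assoc, inv_mul_cancel₀ hpos.ne', mul_one]
          change x • p + ((x • gnomonic p z : (ℝ ∙ p)ᗮ) : V) ∈ _
          rw [e1]
          refine ⟨⟨by rw [e2]; exact hx, ?_⟩, (hmem _).2 e2⟩
          rw [norm_smul, (hA1 _ hz).1, mul_one, Real.norm_of_nonneg hc.le, smul_smul,
            inv_mul_cancel₀ hc.ne', one_smul]
          exact hz
      have hiso : Isometry (fun w : (ℝ ∙ p)ᗮ => x • p + (w : V)) :=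
        Isometry.of_dist_eq fun v w => by
          simp only [dist_add_left]
          rfl
      rw [hset, hiso.euclideanHausdorffMeasure_image,
        Measure.euclideanHausdorffMeasure_smul₀ _ hx.1.ne',
        ← finrank_orthogonal_unit hp, InnerProductSpace.euclideanHausdorffMeasure_eq_volume,
        ENNReal.smul_def, smul_eq_mul, finrank_orthogonal_unit hp]
      congr 1
      rw [ENNReal.ofReal_pow hx.1.le, ENNReal.coe_pow, ← Real.enorm_of_nonneg hx.1.le]
      rfl
    · rw [indicator_of_notMem hx]
      have : C ∩ AffineSubspace.mk' (x • p +ᵥ (0 : V)) (ℝ ∙ p)ᗮ = ∅ := by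
        rw [eq_empty_iff_forall_notMem]
        rintro y ⟨hy1, hy2⟩
        have hy2 : y ∈ AffineSubspace.mk' (x • p +ᵥ (0 : V)) (ℝ ∙ p)ᗮ := hy2
        rw [AffineSubspace.mem_mk', Submodule.mem_orthogonal_singleton_iff_inner_right] at hy2
        simp only [vadd_eq_add, add_zero, vsub_eq_sub, inner_sub_right, real_inner_smul_right,
            real_inner_self_eq_norm_sq, hp] at hy2
        apply hx
        have : inner ℝ p y = x := by linarith
        exact this ▸ hy1.1
      rw [this, measure_empty]
  have hvol := EuclideanGeometry.euclideanHausdorffMeasure_eq_lintegral (0 : V) hp0 hCm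
  rw [InnerProductSpace.euclideanHausdorffMeasure_eq_volume] at hvol
  rw [hvol]
  simp only [hslice]
  rw [lintegral_indicator measurableSet_Ioo, lintegral_mul_const _ (by fun_prop), ← mul_assoc,
    ← mul_assoc]
  have hint : ∫⁻ x in Ioo (0 : ℝ) 1, ENNReal.ofReal (x ^ (finrank ℝ V - 1)) =
      (finrank ℝ V : ℝ≥0∞)⁻¹ := by
    rw [Measure.restrict_congr_set Ioo_ae_eq_Ioc, ← ofReal_integral_eq_lintegral_ofReal,
      ← intervalIntegral.integral_of_le zero_le_one, integral_pow]
    · have : ((finrank ℝ V - 1 : ℕ) : ℝ) + 1 = finrank ℝ V := by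
        rw [Nat.cast_sub hn]; simp
      rw [this, Nat.sub_add_cancel hn, one_pow, zero_pow hn.ne', sub_zero, one_div,
        ENNReal.ofReal_inv_of_pos (by exact_mod_cast hn), ENNReal.ofReal_natCast]
    · exact (intervalIntegral.intervalIntegrable_pow _).1
    · filter_upwards [ae_restrict_mem measurableSet_Ioc] with y hy
      exact pow_nonneg hy.1.le _
  rw [hint, ← ofReal_norm, hp]
  simp only [ENNReal.ofReal_one, mul_one]
  rw [ENNReal.mul_inv_cancel (by exact_mod_cast hn.ne') (by simp), one_mul]

/-- Central projection to the tangent hyperplane does not decrease area: the sector of the unit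
ball over `A` is contained in the cone over the projection of `A`. -/
theorem toSphere_le_volume_gnomonic {p : V} (hp : ‖p‖ = 1) {A : Set (sphere (0 : V) 1)}
    (hA : MeasurableSet A) (hA1 : ∀ x ∈ A, 0 < inner ℝ p (x : V)) :
    (volume : Measure V).toSphere A ≤ volume (gnomonic p '' (Subtype.val '' A)) := by
  have hAm : MeasurableSet ((Subtype.val : sphere (0 : V) 1 → V) '' A) :=
    MeasurableSet.subtype_image isClosed_sphere.measurableSet hA
  rw [Measure.toSphere_apply' _ hA, ← volume_cone hp hAm]
  · gcongr
    rintro y ⟨t, ht, z, ⟨x, hx, rfl⟩, rfl⟩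
    have hx1 : ‖(x : V)‖ = 1 := by simp
    have h1 : inner ℝ p (x : V) ≤ 1 := by
      have := real_inner_le_norm p (x : V)
      rwa [hp, hx1, mul_one] at this
    refine ⟨?_, ?_⟩
    · simp only [real_inner_smul_right]
      exact ⟨mul_pos ht.1 (hA1 x hx), by nlinarith [ht.1, ht.2, hA1 x hx]⟩
    · have : ‖t • (x : V)‖⁻¹ • t • (x : V) = x := by
        rw [norm_smul, hx1, mul_one, Real.norm_of_nonneg ht.1.le, smul_smul,
          inv_mul_cancel₀ ht.1.ne', one_smul]
      exact ⟨x, hx, this.symm⟩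
  · rintro _ ⟨x, hx, rfl⟩
    exact ⟨by simp, hA1 x hx⟩

/-- Near `p` central projection to the tangent hyperplane almost preserves area: the cone over the
projection of `A`, scaled by `δ`, is contained in the sector of the unit ball over `A`. -/
theorem volume_gnomonic_le_toSphere {p : V} (hp : ‖p‖ = 1) {δ : ℝ} (hδ : 0 < δ)
    {A : Set (sphere (0 : V) 1)} (hA : MeasurableSet A)
    (hA1 : ∀ x ∈ A, δ ≤ inner ℝ p (x : V)) :
    ENNReal.ofReal (δ ^ finrank ℝ V) * volume (gnomonic p '' (Subtype.val '' A)) ≤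
      (volume : Measure V).toSphere A := by
  have hAm : MeasurableSet ((Subtype.val : sphere (0 : V) 1 → V) '' A) :=
    MeasurableSet.subtype_image isClosed_sphere.measurableSet hA
  rw [Measure.toSphere_apply' _ hA, ← volume_cone hp hAm, mul_left_comm]
  · gcongr
    rw [← abs_of_pos (pow_pos hδ _), ← Measure.addHaar_smul]
    apply measure_mono
    rintro _ ⟨y, ⟨hy1, ⟨x, hx, hxy⟩⟩, rfl⟩
    have hx1 : ‖(x : V)‖ = 1 := by simp
    have hy0 : y ≠ 0 := by
      rintro rfl
      simp at hy1
    have hny : 0 < ‖y‖ := norm_pos_iff.2 hy0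
    have hyx : y = ‖y‖ • (x : V) := by
      rw [hxy, smul_smul, mul_inv_cancel₀ hny.ne', one_smul]
    refine ⟨δ * ‖y‖, ⟨by positivity, ?_⟩, x, ⟨x, hx, rfl⟩, ?_⟩
    · have h1 := hA1 x hx
      have h2 := hy1.2
      rw [hyx, real_inner_smul_right] at h2
      nlinarith
    · simp only
      rw [mul_smul, ← hyx]
  · rintro _ ⟨x, hx, rfl⟩
    exact ⟨by simp, hδ.trans_le (hA1 x hx)⟩

end RadialGraph

/-! ### Local and global comparison with the linear model -/

section RadialGraphArea

variable {V : Type*} [NormedAddCommGroup V] [InnerProductSpace ℝ V]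

/-- On the unit sphere near `p`, a map whose differential at `p` vanishes on the tangent space
`pᗮ` has small Lipschitz constant. -/
theorem exists_nhds_lipschitz_of_tangential_deriv_zero {W : Type*} [NormedAddCommGroup W]
    [NormedSpace ℝ W] {p : V} (hp : ‖p‖ = 1) {F : V → W} {N : V →L[ℝ] W}
    (hF : HasStrictFDerivAt F N p) (hN : ∀ v, inner ℝ p v = 0 → N v = 0) {c : ℝ} (hc : 0 < c) :
    ∃ U ∈ 𝓝 p, ∀ x ∈ U, ∀ y ∈ U, ‖x‖ = 1 → ‖y‖ = 1 → ‖F x - F y‖ ≤ c * ‖x - y‖ := by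
  have hc2 : (0 : ℝ) < c / 2 := by linarith
  obtain ⟨U, hU, hUF⟩ := hF.approximates_deriv_on_nhds (c := ⟨c / 2, hc2.le⟩) (Or.inr hc2)
  set δ : ℝ := c / (2 * (‖N p‖ + 1)) with hδ
  have hNp : 0 < ‖N p‖ + 1 := by positivity
  have hδ0 : 0 < δ := by positivity
  refine ⟨U ∩ ball p δ, inter_mem hU (ball_mem_nhds _ hδ0), ?_⟩
  rintro x ⟨hxU, hxp⟩ y ⟨hyU, hyp⟩ hx hy
  have h1 := hUF x hxU y hyU
  have h2 : N (x - y) = inner ℝ p (x - y) • N p := by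
    have := hN ((x - y) - inner ℝ p (x - y) • p) (by
      rw [inner_sub_right, real_inner_smul_right, real_inner_self_eq_norm_sq, hp]; ring)
    rw [map_sub, map_smul, sub_eq_zero] at this
    exact this
  have h3 : |inner ℝ p (x - y)| ≤ δ * ‖x - y‖ := by
    have e1 : inner ℝ p (x - y) = inner ℝ (p - (1 / 2 : ℝ) • (x + y)) (x - y) := by
      have : inner ℝ (x + y) (x - y) = 0 := by
        simp only [inner_add_left, inner_sub_right, real_inner_self_eq_norm_sq, hx, hy,
          real_inner_comm x y]
        ring
      rw [inner_sub_left, real_inner_smul_left, this, mul_zero, sub_zero]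
    rw [e1]
    refine (abs_real_inner_le_norm _ _).trans ?_
    gcongr
    have e2 : p - (1 / 2 : ℝ) • (x + y) = (1 / 2 : ℝ) • (p - x) + (1 / 2 : ℝ) • (p - y) := by
      module
    rw [e2]
    refine (norm_add_le _ _).trans ?_
    rw [norm_smul, norm_smul, Real.norm_of_nonneg (by norm_num)]
    rw [mem_ball', dist_eq_norm] at hxp hyp
    linarith
  calc ‖F x - F y‖ = ‖(F x - F y - N (x - y)) + N (x - y)‖ := by rw [sub_add_cancel]
    _ ≤ c / 2 * ‖x - y‖ + δ * ‖x - y‖ * ‖N p‖ := by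
      refine (norm_add_le _ _).trans (add_le_add h1 ?_)
      rw [h2, norm_smul, Real.norm_eq_abs]
      gcongr
    _ ≤ c * ‖x - y‖ := by
      have : δ * ‖N p‖ ≤ c / 2 := by
        rw [hδ, div_mul_eq_mul_div, div_le_div_iff₀ (by positivity) (by norm_num)]
        nlinarith [norm_nonneg (N p)]
      nlinarith [norm_nonneg (x - y)]

theorem hasStrictFDerivAt_gnomonic {p : V} (hp : ‖p‖ = 1) :
    HasStrictFDerivAt (gnomonic p) ((ℝ ∙ p)ᗮ.orthogonalProjectionOnto) p := by
  have hpp : inner ℝ p p = (1 : ℝ) := by rw [real_inner_self_eq_norm_sq, hp]; norm_num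
  have h1 : HasStrictFDerivAt (fun x : V => inner ℝ p x) (innerSL ℝ p) p :=
    (innerSL ℝ p).hasStrictFDerivAt
  have h2 : HasStrictFDerivAt (fun x : V => (inner ℝ p x)⁻¹) (-(innerSL ℝ p)) p := by
    have := (hasStrictDerivAt_inv (x := inner ℝ p p) (by rw [hpp]; norm_num)).comp_hasStrictFDerivAt
      p h1
    rw [hpp] at this
    simpa [Function.comp_def] using this
  have h3 := h2.smul (hasStrictFDerivAt_id p)
  have h4 := ((ℝ ∙ p)ᗮ.orthogonalProjectionOnto).hasStrictFDerivAt.comp p h3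
  refine h4.congr_fderiv ?_
  ext v
  have hz : (ℝ ∙ p)ᗮ.orthogonalProjectionOnto p = 0 := by
    apply Submodule.orthogonalProjectionOnto_eq_zero_iff.2
    rw [Submodule.orthogonal_orthogonal]
    exact Submodule.mem_span_singleton_self p
  simp [hp, hz]

/-- Near `p` the radial graph `x ↦ S ⟪e, x⟫ • x` over the sphere is almost isometric to the
linear image of the gnomonic chart. -/
theorem exists_nhds_radialGraph_comparable {e p : V} (hp : ‖p‖ = 1) {S : ℝ → ℝ} {s' : ℝ}
    (hS : HasStrictDerivAt S s' (inner ℝ e p)) (hs : 0 < S (inner ℝ e p)) {K : ℝ} (hK : 1 < K) :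
    ∃ U ∈ 𝓝 p, ∀ x ∈ U, ∀ y ∈ U, ‖x‖ = 1 → ‖y‖ = 1 →
      ‖S (inner ℝ e x) • x - S (inner ℝ e y) • y‖ ≤
        K * ‖graphDiff e p (S (inner ℝ e p)) s' (gnomonic p x - gnomonic p y)‖ ∧
      ‖graphDiff e p (S (inner ℝ e p)) s' (gnomonic p x - gnomonic p y)‖ ≤
        K * ‖S (inner ℝ e x) • x - S (inner ℝ e y) • y‖ := by
  set s := S (inner ℝ e p) with hsdef
  set T := (ℝ ∙ p)ᗮ with hT
  -- the identity minus the chart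
  have hF1 : HasStrictFDerivAt (fun x => x - (gnomonic p x : V))
      (ContinuousLinearMap.id ℝ V - T.subtypeL ∘L T.orthogonalProjectionOnto) p :=
    (hasStrictFDerivAt_id p).sub
      (T.subtypeL.hasStrictFDerivAt.comp p (hasStrictFDerivAt_gnomonic hp))
  have hproj : ∀ v : V, inner ℝ p v = 0 → (T.orthogonalProjectionOnto v : V) = v := fun v hv =>
    Submodule.starProjection_eq_self_iff.2 (Submodule.mem_orthogonal_singleton_iff_inner_right.2 hv)
  obtain ⟨U1, hU1, h1⟩ := exists_nhds_lipschitz_of_tangential_deriv_zero hp hF1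
    (fun v hv => by simp [hproj v hv]) (c := 1 / 2) (by norm_num)
  -- the radial graph minus its linearization in the chart
  let G : V →L[ℝ] V := s • ContinuousLinearMap.id ℝ V + s' • (innerSL ℝ e).smulRight p
  have hG : ∀ v : T, G v = graphDiff e p s s' v := fun v => by
    rw [graphDiff_apply]
    simp [G, smul_smul]
  have hΨ : HasStrictFDerivAt (fun x : V => S (inner ℝ e x) • x) G p := by
    have h1 : HasStrictFDerivAt (fun x : V => inner ℝ e x) (innerSL ℝ e) p :=
      (innerSL ℝ e).hasStrictFDerivAt
    refine ((hS.comp_hasStrictFDerivAt p h1).smul (hasStrictFDerivAt_id p)).congr_fderiv ?_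
    ext v
    simp [G, smul_smul, hsdef]
  have hF2 : HasStrictFDerivAt (fun x => S (inner ℝ e x) • x - G (gnomonic p x : V))
      (G - G ∘L T.subtypeL ∘L T.orthogonalProjectionOnto) p :=
    hΨ.sub (G.hasStrictFDerivAt.comp p
      (T.subtypeL.hasStrictFDerivAt.comp p (hasStrictFDerivAt_gnomonic hp)))
  have hK0 : 0 < K := by linarith
  set η : ℝ := 1 - 1 / K with hη
  have hη0 : 0 < η := by
    have : 1 / K < 1 := by rw [div_lt_one hK0]; exact hK
    linarith
  obtain ⟨U2, hU2, h2⟩ := exists_nhds_lipschitz_of_tangential_deriv_zero hp hF2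
    (fun v hv => by simp [hproj v hv]) (c := η * s / 2) (by positivity)
  refine ⟨U1 ∩ U2, inter_mem hU1 hU2, ?_⟩
  rintro x ⟨hx1, hx2⟩ y ⟨hy1, hy2⟩ hx hy
  have a1 := h1 x hx1 y hy1 hx hy
  have a2 := h2 x hx2 y hy2 hx hy
  set w := gnomonic p x - gnomonic p y with hw
  have b1 : ‖x - y‖ ≤ 2 * ‖w‖ := by
    have e1 : x - (gnomonic p x : V) - (y - (gnomonic p y : V)) = (x - y) - (w : V) := by
      rw [hw, Submodule.coe_sub]; abel
    rw [e1] at a1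
    have := norm_sub_norm_le (x - y) (w : V)
    rw [← Submodule.coe_norm] at this
    linarith
  have b2 : ‖S (inner ℝ e x) • x - S (inner ℝ e y) • y - graphDiff e p s s' w‖ ≤ η * s * ‖w‖ := by
    have e1 : S (inner ℝ e x) • x - G (gnomonic p x : V) - (S (inner ℝ e y) • y -
        G (gnomonic p y : V)) =
          S (inner ℝ e x) • x - S (inner ℝ e y) • y - graphDiff e p s s' w := by
      rw [← hG, hw, Submodule.coe_sub, map_sub]; abel
    rw [e1] at a2
    have : 0 < η * s / 2 := by positivity
    nlinarith
  have b3 := norm_le_norm_graphDiff (e := e) hp s s' w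
  have b4 : ‖S (inner ℝ e x) • x - S (inner ℝ e y) • y - graphDiff e p s s' w‖ ≤
      η * ‖graphDiff e p s s' w‖ := by nlinarith
  have b5 := norm_sub_norm_le (S (inner ℝ e x) • x - S (inner ℝ e y) • y) (graphDiff e p s s' w)
  have b6 := norm_sub_norm_le (graphDiff e p s s' w) (S (inner ℝ e x) • x - S (inner ℝ e y) • y)
  rw [norm_sub_rev (graphDiff e p s s' w)] at b6
  set X := ‖S (inner ℝ e x) • x - S (inner ℝ e y) • y‖
  set Y := ‖graphDiff e p s s' w‖
  have hY : 0 ≤ Y := norm_nonneg _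
  have hηK : 1 + η ≤ K := by
    have : (K - 1) ^ 2 / K = K + 1 / K - 2 := by field_simp; ring
    have := div_nonneg (sq_nonneg (K - 1)) hK0.le
    linarith
  constructor
  · nlinarith
  · have : Y / K ≤ X := by
      have : Y / K = Y - η * Y := by rw [hη]; ring
      linarith
    rw [div_le_iff₀ hK0] at this
    linarith

theorem exists_one_lt_pow_le (m : ℕ) {K : ℝ≥0} (hK : 1 < K) : ∃ k : ℝ≥0, 1 < k ∧ k ^ m ≤ K := by
  have h : Tendsto (fun k : ℝ≥0 => k ^ m) (𝓝[>] 1) (𝓝 (1 ^ m)) :=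
    ((continuous_pow m).tendsto 1).mono_left nhdsWithin_le_nhds
  rw [one_pow] at h
  obtain ⟨k, hk1, hk2⟩ := ((h.eventually (gt_mem_nhds hK)).and self_mem_nhdsWithin).exists
  exact ⟨k, hk2, hk1.le⟩

variable [FiniteDimensional ℝ V] [MeasurableSpace V] [BorelSpace V]

/-- The Jacobian of the radial graph of `S ⟪e, ·⟫` over the unit sphere, at a point with
`⟪e, ·⟫ = t`. -/
noncomputable def graphJacobian (d : ℕ) (S S' : ℝ → ℝ) (t : ℝ) : ℝ :=
  S t ^ (d - 2) * √(S t ^ 2 + S' t ^ 2 * (1 - t ^ 2))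

/-- **Area formula** for radial graphs over the unit sphere. Near each point the graph is almost
isometric to a linear image of the gnomonic chart, so the two measures agree locally up to factors
arbitrarily close to one. -/
theorem area_radialGraph (hV : 2 ≤ finrank ℝ V) {e : V} (he : ‖e‖ = 1) {S S' : ℝ → ℝ}
    (hS : ∀ t ∈ Icc (-1 : ℝ) 1, HasStrictDerivAt S (S' t) t) (hpos : ∀ t ∈ Icc (-1 : ℝ) 1, 0 < S t)
    (hS' : ContinuousOn S' (Icc (-1) 1)) {A : Set (sphere (0 : V) 1)} (hA : MeasurableSet A) :
    μHE[finrank ℝ V - 1] ((fun θ : sphere (0 : V) 1 => S (inner ℝ e (θ : V)) • (θ : V)) '' A) =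
      ∫⁻ θ in A, ENNReal.ofReal (graphJacobian (finrank ℝ V) S S' (inner ℝ e (θ : V)))
        ∂(volume : Measure V).toSphere := by
  set d := finrank ℝ V with hd
  set X := sphere (0 : V) 1 with hX
  have hnorm : ∀ θ : X, ‖(θ : V)‖ = 1 := fun θ => by simp
  have ht : ∀ θ : X, inner ℝ e (θ : V) ∈ Icc (-1 : ℝ) 1 := fun θ => by
    have := abs_real_inner_le_norm e (θ : V)
    rw [he, hnorm, mul_one] at this
    exact abs_le.1 this
  set Ψ : X → V := fun θ => S (inner ℝ e (θ : V)) • (θ : V) with hΨ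
  have hScont : ContinuousOn S (Icc (-1) 1) := fun t h =>
    (hS t h).hasDerivAt.continuousAt.continuousWithinAt
  have hcontt : Continuous fun θ : X => inner ℝ e (θ : V) := by fun_prop
  have hSc : Continuous fun θ : X => S (inner ℝ e (θ : V)) := hScont.comp_continuous hcontt ht
  have hS'c : Continuous fun θ : X => S' (inner ℝ e (θ : V)) := hS'.comp_continuous hcontt ht
  have hΨc : Continuous Ψ := hSc.smul continuous_subtype_val
  have hΨi : Function.Injective Ψ := fun x y h => by
    have h1 : S (inner ℝ e (x : V)) = S (inner ℝ e (y : V)) := by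
      have := congrArg norm h
      simp only [hΨ, norm_smul, hnorm, mul_one] at this
      rwa [Real.norm_of_nonneg (hpos _ (ht x)).le, Real.norm_of_nonneg (hpos _ (ht y)).le] at this
    simp only [hΨ, h1] at h
    exact Subtype.ext (smul_right_injective V (hpos _ (ht y)).ne' h)
  have hemb : MeasurableEmbedding Ψ := hΨc.measurableEmbedding hΨi
  set J : X → ℝ := fun θ => graphJacobian d S S' (inner ℝ e (θ : V)) with hJ
  have hJc : Continuous J := by
    simp only [hJ, graphJacobian]
    exact (hSc.pow _).mul ((hSc.pow 2).add ((hS'c.pow 2).mul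
      (continuous_const.sub (hcontt.pow 2)))).sqrt
  have hJpos : ∀ θ, 0 < J θ := fun θ => by
    have h1 := hpos _ (ht θ)
    have h2 : 0 ≤ 1 - (inner ℝ e (θ : V)) ^ 2 := by
      have := ht θ
      nlinarith [this.1, this.2]
    have h3 := mul_nonneg (sq_nonneg (S' (inner ℝ e (θ : V)))) h2
    simp only [hJ, graphJacobian]
    positivity
  set τ := (volume : Measure V).toSphere with hτ
  have hmain : (μHE[d - 1] : Measure V).comap Ψ = τ.withDensity fun θ => ENNReal.ofReal (J θ) := by
    refine measure_eq_of_locally_comparable _ _ fun K' hK' p => ?_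
    obtain ⟨K, hK, hKK⟩ := exists_one_lt_pow_le (d - 1 + 1 + 1) hK'
    have hK0 : (0 : ℝ) < K := by
      have : (1 : ℝ) < K := hK
      linarith
    have hp := hnorm p
    obtain ⟨U1, hU1, h1⟩ := exists_nhds_radialGraph_comparable (e := e) hp (hS _ (ht p))
      (hpos _ (ht p)) (K := K) hK
    set L := graphDiff e (p : V) (S (inner ℝ e (p : V))) (S' (inner ℝ e (p : V))) with hL
    have hLJ : L.normDet = J p := by
      rw [hL, normDet_graphDiff he hp (hpos _ (ht p)) _ hV]
      rfl
    -- the height of the spherical patch over the tangent plane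
    obtain ⟨δ, hδ0, hδ1, hδK⟩ : ∃ δ : ℝ, 0 < δ ∧ δ < 1 ∧ 1 ≤ K * δ ^ d := by
      have hlim : Tendsto (fun δ : ℝ => K * δ ^ d) (𝓝[<] 1) (𝓝 (K * 1 ^ d)) :=
        ((by fun_prop : Continuous fun δ : ℝ => (K : ℝ) * δ ^ d).tendsto 1).mono_left
          nhdsWithin_le_nhds
      rw [one_pow, mul_one] at hlim
      have hK1 : (1 : ℝ) < K := hK
      obtain ⟨δ, ⟨ha, hb⟩, hc⟩ := (((hlim.eventually (lt_mem_nhds hK1)).and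
        self_mem_nhdsWithin).and (mem_nhdsWithin_of_mem_nhds
          (lt_mem_nhds (zero_lt_one' ℝ)))).exists
      exact ⟨δ, hc, hb, ha.le⟩
    have hpp : inner ℝ (p : V) (p : V) = (1 : ℝ) := by
      rw [real_inner_self_eq_norm_sq, hp]; norm_num
    have hU2 : {x : X | δ < inner ℝ (p : V) (x : V)} ∈ 𝓝 p := by
      apply (isOpen_lt continuous_const (by fun_prop)).mem_nhds
      simp only [mem_ofPred_eq, hpp, hδ1]
    have hU3 : {x : X | J x < K * J p ∧ J p < K * J x} ∈ 𝓝 p := by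
      have hK1 : (1 : ℝ) < K := hK
      apply (IsOpen.inter (isOpen_lt hJc continuous_const)
        (isOpen_lt continuous_const (continuous_const.mul hJc))).mem_nhds
      have h0 := hJpos p
      exact ⟨lt_mul_of_one_lt_left h0 hK1, lt_mul_of_one_lt_left h0 hK1⟩
    have hU1' : (Subtype.val ⁻¹' U1 : Set X) ∈ 𝓝 p := continuous_subtype_val.continuousAt hU1
    refine ⟨_, inter_mem hU1' (inter_mem hU2 hU3), fun A hAU hAm => ?_⟩
    have hLγ : (fun x : X => L (gnomonic (p : V) x)) '' A =
        L '' (gnomonic (p : V) '' (Subtype.val '' A)) := by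
      rw [image_image, image_image]
    have hHL : μHE[d - 1] ((fun x : X => L (gnomonic (p : V) x)) '' A) =
        ENNReal.ofReal (J p) * volume (gnomonic (p : V) '' (Subtype.val '' A)) := by
      rw [hLγ, hd, ← finrank_orthogonal_unit hp,
        L.euclideanHausdorffMeasure_image_eq_normDet_mul_volume,
        hLJ]
    have hH1 : μHE[d - 1] (Ψ '' A) ≤ (K : ℝ≥0∞) ^ (d - 1) *
        (ENNReal.ofReal (J p) * volume (gnomonic (p : V) '' (Subtype.val '' A))) := by
      rw [← hHL]
      refine hausdorffE_image_le _ _ _ _ _ fun x hx y hy => ?_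
      have := (h1 x (hAU hx).1 y (hAU hy).1 (hnorm x) (hnorm y)).1
      rw [map_sub] at this
      rw [edist_eq_enorm_sub, edist_eq_enorm_sub, ← ofReal_norm, ← ofReal_norm,
        ← ENNReal.ofReal_coe_nnreal, ← ENNReal.ofReal_mul hK0.le]
      exact ENNReal.ofReal_le_ofReal this
    have hH2 : ENNReal.ofReal (J p) * volume (gnomonic (p : V) '' (Subtype.val '' A)) ≤
        (K : ℝ≥0∞) ^ (d - 1) * μHE[d - 1] (Ψ '' A) := by
      rw [← hHL]
      refine hausdorffE_image_le _ _ _ _ _ fun x hx y hy => ?_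
      have := (h1 x (hAU hx).1 y (hAU hy).1 (hnorm x) (hnorm y)).2
      rw [map_sub] at this
      rw [edist_eq_enorm_sub, edist_eq_enorm_sub, ← ofReal_norm, ← ofReal_norm,
        ← ENNReal.ofReal_coe_nnreal, ← ENNReal.ofReal_mul hK0.le]
      exact ENNReal.ofReal_le_ofReal this
    have hτ1 : τ A ≤ volume (gnomonic (p : V) '' (Subtype.val '' A)) :=
      toSphere_le_volume_gnomonic hp hAm fun x hx => hδ0.trans (hAU hx).2.1
    have hτ2 : volume (gnomonic (p : V) '' (Subtype.val '' A)) ≤ K * τ A := by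
      have h := volume_gnomonic_le_toSphere hp hδ0 hAm fun x hx => (hAU hx).2.1.le
      calc volume (gnomonic (p : V) '' (Subtype.val '' A))
          ≤ ENNReal.ofReal (K * δ ^ d) * volume (gnomonic (p : V) '' (Subtype.val '' A)) := by
            refine le_mul_of_one_le_left' ?_
            rw [← ENNReal.ofReal_one]
            exact ENNReal.ofReal_le_ofReal hδK
        _ ≤ K * τ A := by
            rw [ENNReal.ofReal_mul hK0.le, ENNReal.ofReal_coe_nnreal, mul_assoc]
            gcongr
    have hI1 : ∫⁻ θ in A, ENNReal.ofReal (J θ) ∂τ ≤ K * (ENNReal.ofReal (J p) * τ A) := by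
      calc ∫⁻ θ in A, ENNReal.ofReal (J θ) ∂τ ≤ ∫⁻ _ in A, K * ENNReal.ofReal (J p) ∂τ := by
            refine setLIntegral_mono' hAm fun x hx => ?_
            rw [← ENNReal.ofReal_coe_nnreal, ← ENNReal.ofReal_mul hK0.le]
            exact ENNReal.ofReal_le_ofReal (hAU hx).2.2.1.le
        _ = K * (ENNReal.ofReal (J p) * τ A) := by
            rw [setLIntegral_const, mul_assoc]
    have hI2 : ENNReal.ofReal (J p) * τ A ≤ K * ∫⁻ θ in A, ENNReal.ofReal (J θ) ∂τ := by
      rw [← setLIntegral_const, ← lintegral_const_mul _ (by fun_prop)]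
      refine setLIntegral_mono' hAm fun x hx => ?_
      rw [← ENNReal.ofReal_coe_nnreal, ← ENNReal.ofReal_mul hK0.le]
      exact ENNReal.ofReal_le_ofReal (hAU hx).2.2.2.le
    rw [hemb.comap_apply, withDensity_apply _ hAm]
    have hKK' : (K : ℝ≥0∞) ^ (d - 1 + 1 + 1) ≤ K' := by exact_mod_cast hKK
    constructor
    · calc μHE[d - 1] (Ψ '' A) ≤ (K : ℝ≥0∞) ^ (d - 1) * (ENNReal.ofReal (J p) * (K * τ A)) := by
            refine hH1.trans ?_
            gcongr
        _ = (K : ℝ≥0∞) ^ (d - 1 + 1) * (ENNReal.ofReal (J p) * τ A) := by ring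
        _ ≤ (K : ℝ≥0∞) ^ (d - 1 + 1) * (K * ∫⁻ θ in A, ENNReal.ofReal (J θ) ∂τ) := by gcongr
        _ = (K : ℝ≥0∞) ^ (d - 1 + 1 + 1) * ∫⁻ θ in A, ENNReal.ofReal (J θ) ∂τ := by ring
        _ ≤ K' * ∫⁻ θ in A, ENNReal.ofReal (J θ) ∂τ := by gcongr
    · calc ∫⁻ θ in A, ENNReal.ofReal (J θ) ∂τ ≤ K * (ENNReal.ofReal (J p) *
            volume (gnomonic (p : V) '' (Subtype.val '' A))) := by
            refine hI1.trans ?_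
            gcongr
        _ ≤ K * ((K : ℝ≥0∞) ^ (d - 1) * μHE[d - 1] (Ψ '' A)) := by gcongr
        _ ≤ K * (K * ((K : ℝ≥0∞) ^ (d - 1) * μHE[d - 1] (Ψ '' A))) := by
            exact le_mul_of_one_le_left' (by exact_mod_cast hK.le)
        _ = (K : ℝ≥0∞) ^ (d - 1 + 1 + 1) * μHE[d - 1] (Ψ '' A) := by ring
        _ ≤ K' * μHE[d - 1] (Ψ '' A) := by gcongr
  rw [← hemb.comap_apply, hmain, withDensity_apply _ hA]

end RadialGraphArea

/-! ### Zonal functions on the sphere -/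

theorem hasDerivAt_integral_of_isCompact {X : Type*} [TopologicalSpace X] [T2Space X]
    [MeasurableSpace X] [OpensMeasurableSpace X] (μ : Measure X) [IsFiniteMeasure μ] {K : Set X}
    (hK : IsCompact K) (hμ : ∀ᵐ x ∂μ, x ∈ K) {U : Set ℝ} (hU : IsOpen U)
    {F F' : ℝ → X → ℝ} (hF : ∀ k ∈ U, ContinuousOn (F k) K)
    (hF' : ContinuousOn (Function.uncurry F') (U ×ˢ K))
    (hd : ∀ k ∈ U, ∀ x ∈ K, HasDerivAt (fun k => F k x) (F' k x) k) {k : ℝ} (hk : k ∈ U) :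
    HasDerivAt (fun k => ∫ x, F k x ∂μ) (∫ x, F' k x ∂μ) k := by
  obtain ⟨ε, hε, hεU⟩ := Metric.nhds_basis_closedBall.mem_iff.1 (hU.mem_nhds hk)
  have hμK : μ.restrict K = μ := Measure.restrict_eq_self_of_ae_mem hμ
  have hmeas : ∀ f : X → ℝ, ContinuousOn f K → AEStronglyMeasurable f μ := fun f hf => by
    rw [← hμK]
    exact hf.aestronglyMeasurable_of_isCompact hK hK.measurableSet
  obtain ⟨C, hC⟩ := ((isCompact_closedBall k ε).prod hK).exists_bound_of_continuousOn
    (hF'.mono (prod_mono hεU subset_rfl))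
  have hF'k : ContinuousOn (F' k) K :=
    hF'.comp (by fun_prop : Continuous fun x : X => (k, x)).continuousOn fun x hx => ⟨hk, hx⟩
  obtain ⟨C', hC'⟩ := hK.exists_bound_of_continuousOn (hF k hk)
  refine (hasDerivAt_integral_of_dominated_loc_of_deriv_le (bound := fun _ => C)
    (Metric.ball_mem_nhds k hε) ?_ ?_ (hmeas _ hF'k) ?_ (integrable_const _) ?_).2
  · filter_upwards [hU.mem_nhds hk] with k' hk'
    exact hmeas _ (hF k' hk')
  · exact Integrable.of_bound (hmeas _ (hF k hk)) C' (hμ.mono hC')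
  · filter_upwards [hμ] with x hx k' hk'
    exact hC (k', x) ⟨ball_subset_closedBall hk', hx⟩
  · filter_upwards [hμ] with x hx k' hk'
    exact hd k' (hεU (ball_subset_closedBall hk')) x hx

section Zonal

variable {V : Type*} [NormedAddCommGroup V] [InnerProductSpace ℝ V]

theorem inner_mem_Icc {e : V} (he : ‖e‖ = 1) (θ : sphere (0 : V) 1) :
    inner ℝ e (θ : V) ∈ Icc (-1 : ℝ) 1 := by
  have := abs_real_inner_le_norm e (θ : V)
  rw [he, norm_eq_of_mem_sphere, mul_one] at this
  exact abs_le.1 this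

variable [FiniteDimensional ℝ V]

theorem sum_sq_inner_orthogonal {e : V} (he : ‖e‖ = 1) (x : V) :
    ∑ i, inner ℝ (stdOrthonormalBasis ℝ (ℝ ∙ e)ᗮ i : V) x ^ 2 = ‖x‖ ^ 2 - inner ℝ e x ^ 2 := by
  set b := stdOrthonormalBasis ℝ (ℝ ∙ e)ᗮ with hb
  set x' := (ℝ ∙ e)ᗮ.orthogonalProjectionOnto x with hx'
  have h3 : ∀ i, inner ℝ (b i : V) x = inner ℝ (b i) x' := fun i => by
    rw [hx', Submodule.inner_orthogonalProjectionOnto_eq_of_mem_left]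
  have h4 : (x' : V) = x - inner ℝ e x • e := by
    rw [hx', ← Submodule.starProjection_apply,
      Submodule.starProjection_orthogonal_val, Submodule.starProjection_unit_singleton ℝ he]
  have h6 : ∑ i, inner ℝ (b i) x' ^ 2 = ‖x'‖ ^ 2 := by
    rw [← b.sum_sq_norm_inner_right x']
    simp
  simp only [h3]
  rw [h6, Submodule.coe_norm, h4, ← real_inner_self_eq_norm_sq]
  simp only [inner_sub_left, inner_sub_right, real_inner_smul_left, real_inner_smul_right,
    norm_smul, real_inner_self_eq_norm_sq, he, real_inner_comm e x, Real.norm_eq_abs, mul_one,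
    sq_abs]
  ring

variable [MeasurableSpace V] [BorelSpace V]

/-- The measure `toSphere`, defined through volumes of sectors, is the surface measure of the
sphere. This is the area formula for the constant radial graph. -/
theorem toSphere_eq_hausdorff (hV : 2 ≤ finrank ℝ V) {A : Set (sphere (0 : V) 1)}
    (hA : MeasurableSet A) :
    (volume : Measure V).toSphere A = μHE[finrank ℝ V - 1] (Subtype.val '' A) := by
  have : Nontrivial V := finrank_pos_iff.1 (by omega : 0 < finrank ℝ V)
  obtain ⟨e, he⟩ := exists_norm_eq V (zero_le_one' ℝ)
  have := area_radialGraph hV he (S := fun _ => 1) (S' := fun _ => 0)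
    (fun t _ => hasStrictDerivAt_const t 1) (fun _ _ => one_pos) continuousOn_const hA
  simpa [graphJacobian] using this.symm

theorem measurePreserving_toSphere (hV : 2 ≤ finrank ℝ V) (R : V ≃ₗᵢ[ℝ] V) :
    MeasurePreserving
      (fun θ : sphere (0 : V) 1 => (⟨R θ, by simp⟩ : sphere (0 : V) 1))
      (volume : Measure V).toSphere (volume : Measure V).toSphere := by
  have hmeas : Measurable (fun θ : sphere (0 : V) 1 => (⟨R θ, by simp⟩ : sphere (0 : V) 1)) :=
    (Continuous.subtype_mk (by fun_prop) _).measurable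
  refine ⟨hmeas, ?_⟩
  ext A hA
  rw [Measure.map_apply hmeas hA, toSphere_eq_hausdorff hV (hmeas hA), toSphere_eq_hausdorff hV hA,
    ← R.isometry.euclideanHausdorffMeasure_image]
  congr 1
  ext y
  constructor
  · rintro ⟨_, ⟨θ, hθ, rfl⟩, rfl⟩
    exact ⟨_, hθ, rfl⟩
  · rintro ⟨θ, hθ, rfl⟩
    refine ⟨R.symm θ, ⟨⟨R.symm θ, by simp⟩, ?_, rfl⟩, by simp⟩
    simpa using hθ

/-- The law of `⟪e, θ⟫` for `θ` uniformly distributed on the unit sphere. -/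
noncomputable def zonalLaw (e : V) : Measure ℝ :=
  ((volume : Measure V).toSphere univ)⁻¹ •
    Measure.map (fun θ : sphere (0 : V) 1 => inner ℝ e (θ : V)) (volume : Measure V).toSphere

theorem measurable_inner_sphere (e : V) :
    Measurable fun θ : sphere (0 : V) 1 => inner ℝ e (θ : V) := by fun_prop

/-- The law depends only on the length of `e`: a reflection maps `e` to `e'`. All computations can
therefore be made with one fixed measure on `[-1, 1]`. -/
theorem zonalLaw_eq (hV : 2 ≤ finrank ℝ V) {e e' : V} (h : ‖e‖ = ‖e'‖) :
    zonalLaw e = zonalLaw e' := by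
  unfold zonalLaw
  congr 1
  set R := Submodule.reflection (ℝ ∙ (e - e'))ᗮ
  have hR : R e = e' := Submodule.reflection_sub h
  have hcomp : (fun θ : sphere (0 : V) 1 => inner ℝ e (θ : V)) =
      (fun θ : sphere (0 : V) 1 => inner ℝ e' (θ : V)) ∘
        fun θ : sphere (0 : V) 1 => ⟨R θ, by simp⟩ := by
    funext θ
    simp only [Function.comp]
    rw [← hR, R.inner_map_map]
  rw [hcomp, ← Measure.map_map (measurable_inner_sphere e')
    (measurePreserving_toSphere hV R).measurable, (measurePreserving_toSphere hV R).map_eq]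

theorem toSphere_univ_ne_zero (hV : 2 ≤ finrank ℝ V) :
    (volume : Measure V).toSphere univ ≠ 0 := by
  have : Nontrivial V := finrank_pos_iff.1 (by omega : 0 < finrank ℝ V)
  exact Measure.measure_univ_ne_zero.2 (Measure.toSphere_ne_zero _)

theorem isProbabilityMeasure_zonalLaw (hV : 2 ≤ finrank ℝ V) (e : V) :
    IsProbabilityMeasure (zonalLaw e) := by
  refine ⟨?_⟩
  rw [zonalLaw, Measure.smul_apply, Measure.map_apply (measurable_inner_sphere e) .univ,
    preimage_univ, smul_eq_mul, ENNReal.inv_mul_cancel (toSphere_univ_ne_zero hV)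
    (measure_ne_top _ _)]

theorem zonalLaw_ae {e : V} (he : ‖e‖ = 1) : ∀ᵐ t ∂(zonalLaw e), t ∈ Icc (-1 : ℝ) 1 := by
  refine Measure.ae_smul_measure ?_ _
  exact (ae_map_iff (p := fun t => t ∈ Icc (-1 : ℝ) 1) (measurable_inner_sphere e).aemeasurable
    measurableSet_Icc).2 (Eventually.of_forall fun θ => inner_mem_Icc he θ)

theorem integral_zonalLaw (e : V) {F : ℝ → ℝ} (hF : ContinuousOn F (Icc (-1) 1)) (he : ‖e‖ = 1) :
    ∫ t, F t ∂(zonalLaw e) = ((volume : Measure V).toSphere univ).toReal⁻¹ *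
      ∫ θ, F (inner ℝ e (θ : V)) ∂(volume : Measure V).toSphere := by
  rw [zonalLaw, integral_smul_measure, integral_map (measurable_inner_sphere e).aemeasurable,
    ENNReal.toReal_inv, smul_eq_mul]
  have : ∀ᵐ t ∂(Measure.map (fun θ : sphere (0 : V) 1 => inner ℝ e (θ : V))
      (volume : Measure V).toSphere),
      t ∈ Icc (-1 : ℝ) 1 :=
    (ae_map_iff (p := fun t => t ∈ Icc (-1 : ℝ) 1) (measurable_inner_sphere e).aemeasurable
      measurableSet_Icc).2 (Eventually.of_forall fun θ => inner_mem_Icc he θ)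
  rw [← Measure.restrict_eq_self_of_ae_mem this]
  exact hF.aestronglyMeasurable_of_isCompact isCompact_Icc measurableSet_Icc

/-- Invariance of the sphere under the reflections that act in the plane of the orthonormal pair
`e, e'`, differentiated with respect to the angle of the reflection. -/
theorem integral_toSphere_rotation (hV : 2 ≤ finrank ℝ V) {e e' : V} (he : ‖e‖ = 1) (he' : ‖e'‖ = 1)
    (hee' : inner ℝ e e' = 0) {G G' : ℝ → ℝ} (hG : ∀ t ∈ Icc (-1 : ℝ) 1, HasDerivAt G (G' t) t)
    (hG' : ContinuousOn G' (Icc (-1) 1)) :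
    ∫ θ : sphere (0 : V) 1, (inner ℝ e (θ : V) * G (inner ℝ e (θ : V)) -
      inner ℝ e' (θ : V) ^ 2 * G' (inner ℝ e (θ : V))) ∂(volume : Measure V).toSphere = 0 := by
  set τ := (volume : Measure V).toSphere
  set X : sphere (0 : V) 1 → ℝ := fun θ => inner ℝ e (θ : V) with hX
  set Y : sphere (0 : V) 1 → ℝ := fun θ => inner ℝ e' (θ : V) with hY
  have hXc : Continuous X := by fun_prop
  have hYc : Continuous Y := by fun_prop
  have hGc : ContinuousOn G (Icc (-1) 1) := fun t ht => (hG t ht).continuousAt.continuousWithinAt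
  let ρ : ℝ → V ≃ₗᵢ[ℝ] V := fun φ =>
    Submodule.reflection (ℝ ∙ (-Real.sin (φ / 2) • e + Real.cos (φ / 2) • e'))ᗮ
  have hρ : ∀ φ (x : V), inner ℝ e (ρ φ x) = Real.cos φ * inner ℝ e x + Real.sin φ * inner ℝ e' x ∧
      inner ℝ e' (ρ φ x) = Real.sin φ * inner ℝ e x - Real.cos φ * inner ℝ e' x := by
    intro φ x
    set w : V := -Real.sin (φ / 2) • e + Real.cos (φ / 2) • e' with hw
    have hee2 : inner ℝ e' e = 0 := by rw [real_inner_comm]; exact hee'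
    have hsc := Real.sin_sq_add_cos_sq (φ / 2)
    have hs : Real.sin φ = 2 * Real.sin (φ / 2) * Real.cos (φ / 2) := by
      rw [← Real.sin_two_mul]; ring_nf
    have hc : Real.cos φ = 1 - 2 * Real.sin (φ / 2) ^ 2 := by
      have h := Real.cos_two_mul (φ / 2)
      rw [show 2 * (φ / 2) = φ by ring] at h
      linarith
    have hw1 : ‖w‖ = 1 := by
      have : ‖w‖ ^ 2 = 1 := by
        rw [← real_inner_self_eq_norm_sq, hw]
        simp only [inner_add_left, inner_add_right, real_inner_smul_left, real_inner_smul_right,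
          real_inner_self_eq_norm_sq, he, he', hee', hee2, norm_smul,
          Real.norm_eq_abs, mul_one, sq_abs, abs_neg]
        linear_combination hsc
      nlinarith [norm_nonneg w]
    have hrefl : ρ φ x = x - (2 * inner ℝ w x) • w := by
      change Submodule.reflection (ℝ ∙ w)ᗮ x = _
      rw [Submodule.reflection_orthogonal_apply, Submodule.reflection_apply,
        Submodule.starProjection_unit_singleton ℝ hw1]
      module
    rw [hrefl]
    constructor
    · simp only [hw, inner_sub_right, inner_add_left, inner_add_right, real_inner_smul_left,
        real_inner_smul_right, real_inner_self_eq_norm_sq, he, hee']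
      rw [hs, hc]
      ring
    · simp only [hw, inner_sub_right, inner_add_left, inner_add_right, real_inner_smul_left,
        real_inner_smul_right, real_inner_self_eq_norm_sq, he', hee2]
      rw [hs, hc]
      linear_combination (-2 * inner ℝ e' x) * hsc
  have hmem : ∀ φ θ, Real.cos φ * X θ + Real.sin φ * Y θ ∈ Icc (-1 : ℝ) 1 := fun φ θ => by
    have := inner_mem_Icc he ⟨ρ φ θ, by simp⟩
    rwa [(hρ φ θ).1] at this
  -- the integral of `Y * G X` over the reflected sphere does not depend on the angle
  set F : ℝ → sphere (0 : V) 1 → ℝ := fun φ θ =>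
    (Real.sin φ * X θ - Real.cos φ * Y θ) * G (Real.cos φ * X θ + Real.sin φ * Y θ) with hF
  have hconst : ∀ φ, ∫ θ, F φ θ ∂τ = ∫ θ, Y θ * G (X θ) ∂τ := by
    intro φ
    have hmp := measurePreserving_toSphere hV (ρ φ)
    have hcont : Continuous fun θ => Y θ * G (X θ) :=
      hYc.mul (hGc.comp_continuous hXc fun θ => inner_mem_Icc he θ)
    have hmap : ∫ θ, Y θ * G (X θ) ∂τ = ∫ θ, Y θ * G (X θ) ∂(Measure.map
        (fun θ : sphere (0 : V) 1 => (⟨ρ φ θ, by simp⟩ : sphere (0 : V) 1)) τ) := by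
      rw [hmp.map_eq]
    rw [hmap, integral_map hmp.measurable.aemeasurable hcont.aestronglyMeasurable]
    refine integral_congr_ae (Eventually.of_forall fun θ => ?_)
    simp only [hF, hX, hY]
    rw [(hρ φ θ).1, (hρ φ θ).2]
  set F' : ℝ → sphere (0 : V) 1 → ℝ := fun φ θ =>
    (Real.cos φ * X θ + Real.sin φ * Y θ) * G (Real.cos φ * X θ + Real.sin φ * Y θ) +
    (Real.sin φ * X θ - Real.cos φ * Y θ) * (G' (Real.cos φ * X θ + Real.sin φ * Y θ) *
      (-Real.sin φ * X θ + Real.cos φ * Y θ)) with hF'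
  have hz : Continuous fun q : ℝ × sphere (0 : V) 1 =>
      Real.cos q.1 * X q.2 + Real.sin q.1 * Y q.2 := by fun_prop
  have hder : HasDerivAt (fun φ => ∫ θ, F φ θ ∂τ) (∫ θ, F' 0 θ ∂τ) 0 := by
    refine hasDerivAt_integral_of_isCompact τ isCompact_univ
      (Eventually.of_forall fun _ => mem_univ _)
      isOpen_univ (fun φ _ => Continuous.continuousOn ?_) (Continuous.continuousOn ?_)
      (fun φ _ θ _ => ?_) (mem_univ _)
    · exact (by fun_prop : Continuous fun θ => Real.sin φ * X θ - Real.cos φ * Y θ).mul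
        (hGc.comp_continuous (by fun_prop) (hmem φ))
    · have h1 := hGc.comp_continuous hz fun q => hmem q.1 q.2
      have h2 := hG'.comp_continuous hz fun q => hmem q.1 q.2
      exact (hz.mul h1).add ((by fun_prop : Continuous fun q : ℝ × sphere (0 : V) 1 =>
        Real.sin q.1 * X q.2 - Real.cos q.1 * Y q.2).mul (h2.mul (by fun_prop)))
    · have h1 : HasDerivAt (fun φ => Real.cos φ * X θ + Real.sin φ * Y θ)
          (-Real.sin φ * X θ + Real.cos φ * Y θ) φ :=
        ((Real.hasDerivAt_cos φ).mul_const _).add ((Real.hasDerivAt_sin φ).mul_const _)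
      have h2 : HasDerivAt (fun φ => Real.sin φ * X θ - Real.cos φ * Y θ)
          (Real.cos φ * X θ - -Real.sin φ * Y θ) φ :=
        ((Real.hasDerivAt_sin φ).mul_const _).sub ((Real.hasDerivAt_cos φ).mul_const _)
      have h3 := (hG _ (hmem φ θ)).comp φ h1
      refine (h2.mul h3).congr_deriv ?_
      simp only [hF', Function.comp]
      ring
  have h0 : HasDerivAt (fun φ => ∫ θ, F φ θ ∂τ) 0 0 := by
    simp only [hconst]
    exact hasDerivAt_const _ _
  have := hder.unique h0
  rw [← this]
  refine integral_congr_ae (Eventually.of_forall fun θ => ?_)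
  simp [hF', hX, hY]
  ring

/-- Integration by parts for zonal functions: the sum of `integral_toSphere_rotation` over an
orthonormal basis of the complement of `e`. It contains all that is needed about the law of
`⟪e, θ⟫`, whose density `(1 - t²) ^ ((d - 3) / 2)` is never used. -/
theorem zonalLaw_integral_by_parts (hV : 2 ≤ finrank ℝ V) {e : V} (he : ‖e‖ = 1) {G G' : ℝ → ℝ}
    (hG : ∀ t ∈ Icc (-1 : ℝ) 1, HasDerivAt G (G' t) t) (hG' : ContinuousOn G' (Icc (-1) 1)) :
    ((finrank ℝ V : ℝ) - 1) * ∫ t, t * G t ∂(zonalLaw e) =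
      ∫ t, (1 - t ^ 2) * G' t ∂(zonalLaw e) := by
  have hGc : ContinuousOn G (Icc (-1) 1) := fun t ht => (hG t ht).continuousAt.continuousWithinAt
  rw [integral_zonalLaw e (F := fun t => t * G t) (continuousOn_id.mul hGc) he,
    integral_zonalLaw e (F := fun t => (1 - t ^ 2) * G' t)
      ((by fun_prop : Continuous fun t : ℝ => 1 - t ^ 2).continuousOn.mul hG') he]
  set τ := (volume : Measure V).toSphere
  set X : sphere (0 : V) 1 → ℝ := fun θ => inner ℝ e (θ : V) with hX
  have hXc : Continuous X := by fun_prop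
  have hGX : Continuous fun θ => G (X θ) := hGc.comp_continuous hXc (inner_mem_Icc he)
  have hG'X : Continuous fun θ => G' (X θ) := hG'.comp_continuous hXc (inner_mem_Icc he)
  have hint : ∀ f : sphere (0 : V) 1 → ℝ, Continuous f → Integrable f τ := fun f hf =>
    hf.integrable_of_hasCompactSupport (HasCompactSupport.of_compactSpace _)
  set b := stdOrthonormalBasis ℝ (ℝ ∙ e)ᗮ with hb
  have hsum : ∑ i, ∫ θ, (X θ * G (X θ) - inner ℝ (b i : V) (θ : V) ^ 2 * G' (X θ)) ∂τ = 0 := by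
    refine Finset.sum_eq_zero fun i _ => ?_
    refine integral_toSphere_rotation hV he ?_ ?_ hG hG'
    · have := b.orthonormal.1 i
      rwa [Submodule.coe_norm] at this
    · exact Submodule.mem_orthogonal_singleton_iff_inner_right.1 (b i).2
  have hcb : ∀ i, Continuous fun θ : sphere (0 : V) 1 =>
      X θ * G (X θ) - inner ℝ (b i : V) (θ : V) ^ 2 * G' (X θ) := fun i =>
    (hXc.mul hGX).sub (((by fun_prop : Continuous fun θ : sphere (0 : V) 1 =>
      inner ℝ (b i : V) (θ : V)).pow 2).mul hG'X)
  rw [← integral_finsetSum _ fun i _ => hint _ (hcb i)] at hsum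
  have hpt : ∀ θ : sphere (0 : V) 1,
      ∑ i, (X θ * G (X θ) - inner ℝ (b i : V) (θ : V) ^ 2 * G' (X θ)) =
      ((finrank ℝ V : ℝ) - 1) * (X θ * G (X θ)) - (1 - X θ ^ 2) * G' (X θ) := fun θ => by
    rw [Finset.sum_sub_distrib, Finset.sum_const, ← Finset.sum_mul, hb, sum_sq_inner_orthogonal he,
      Finset.card_univ, Fintype.card_fin, finrank_orthogonal_unit he, norm_eq_of_mem_sphere,
      nsmul_eq_mul, Nat.cast_sub (by omega)]
    simp [hX]
  simp only [hpt] at hsum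
  have hc1 : Continuous fun θ => ((finrank ℝ V : ℝ) - 1) * (X θ * G (X θ)) :=
    continuous_const.mul (hXc.mul hGX)
  have hc2 : Continuous fun θ => (1 - X θ ^ 2) * G' (X θ) :=
    (continuous_const.sub (hXc.pow 2)).mul hG'X
  rw [integral_sub (hint _ hc1) (hint _ hc2), integral_const_mul, sub_eq_zero] at hsum
  rw [mul_left_comm, ← hsum]

end Zonal

/-! ### Moments and mean values of the zonal law -/

/-- The properties of the law of `⟪e, θ⟫`, `θ` uniform on the unit sphere of a `d`-dimensional
Euclidean space, on which the expansions rest. -/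
structure IsZonal (d : ℝ) (m : Measure ℝ) : Prop where
  prob : IsProbabilityMeasure m
  ae_mem : ∀ᵐ t ∂m, t ∈ Icc (-1 : ℝ) 1
  by_parts : ∀ G G' : ℝ → ℝ, (∀ t ∈ Icc (-1 : ℝ) 1, HasDerivAt G (G' t) t) →
    ContinuousOn G' (Icc (-1) 1) → (d - 1) * ∫ t, t * G t ∂m = ∫ t, (1 - t ^ 2) * G' t ∂m

theorem isZonal_zonalLaw {V : Type*} [NormedAddCommGroup V] [InnerProductSpace ℝ V]
    [FiniteDimensional ℝ V] [MeasurableSpace V] [BorelSpace V] (hV : 2 ≤ finrank ℝ V) {e : V}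
    (he : ‖e‖ = 1) : IsZonal (finrank ℝ V) (zonalLaw e) where
  prob := isProbabilityMeasure_zonalLaw hV e
  ae_mem := zonalLaw_ae he
  by_parts _ _ := zonalLaw_integral_by_parts hV he

namespace IsZonal

variable {d : ℝ} {m : Measure ℝ}

theorem integrable (h : IsZonal d m) {F : ℝ → ℝ} (hF : ContinuousOn F (Icc (-1) 1)) :
    Integrable F m := by
  have := h.prob
  rw [← Measure.restrict_eq_self_of_ae_mem h.ae_mem]
  exact hF.integrableOn_compact isCompact_Icc

theorem integral_id (h : IsZonal d m) (hd : 1 < d) : ∫ t, t ∂m = 0 := by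
  have := h.by_parts (fun _ => 1) (fun _ => 0) (fun t _ => hasDerivAt_const t 1) continuousOn_const
  simp only [mul_one, mul_zero, integral_zero, mul_eq_zero] at this
  exact this.resolve_left (by linarith)

theorem integral_sq (h : IsZonal d m) (hd : 1 < d) : ∫ t, t ^ 2 ∂m = 1 / d := by
  have := h.prob
  have h1 := h.by_parts (fun t => t) (fun _ => 1) (fun t _ => hasDerivAt_id t) continuousOn_const
  simp only [mul_one] at h1
  rw [integral_sub (h.integrable continuousOn_const) (h.integrable (by fun_prop))] at h1
  simp only [← pow_two, integral_const, probReal_univ, smul_eq_mul] at h1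
  field_simp
  linarith

theorem integral_cube (h : IsZonal d m) (hd : 1 < d) : ∫ t, t ^ 3 ∂m = 0 := by
  have h1 := h.by_parts (fun t => t ^ 2) (fun t => 2 * t)
    (fun t _ => by simpa using hasDerivAt_pow 2 t) (by fun_prop)
  have e1 : ∫ t, (1 - t ^ 2) * (2 * t) ∂m = 2 * ∫ t, t ∂m - 2 * ∫ t, t ^ 3 ∂m := by
    rw [← integral_const_mul, ← integral_const_mul, ← integral_sub (h.integrable (by fun_prop))
      (h.integrable (by fun_prop))]
    congr 1 with t
    ring
  have e2 : ∫ t, t * t ^ 2 ∂m = ∫ t, t ^ 3 ∂m := by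
    congr 1 with t
    ring
  rw [e1, e2, h.integral_id hd] at h1
  have : (d + 1) * ∫ t, t ^ 3 ∂m = 0 := by linarith
  exact (mul_eq_zero.1 this).resolve_left (by linarith)

theorem integral_pow_four (h : IsZonal d m) (hd : 1 < d) :
    ∫ t, t ^ 4 ∂m = 3 / (d * (d + 2)) := by
  have h1 := h.by_parts (fun t => t ^ 3) (fun t => 3 * t ^ 2)
    (fun t _ => by simpa using hasDerivAt_pow 3 t) (by fun_prop)
  have e1 : ∫ t, (1 - t ^ 2) * (3 * t ^ 2) ∂m = 3 * ∫ t, t ^ 2 ∂m - 3 * ∫ t, t ^ 4 ∂m := by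
    rw [← integral_const_mul, ← integral_const_mul, ← integral_sub (h.integrable (by fun_prop))
      (h.integrable (by fun_prop))]
    congr 1 with t
    ring
  have e2 : ∫ t, t * t ^ 3 ∂m = ∫ t, t ^ 4 ∂m := by
    congr 1 with t
    ring
  rw [e1, e2, h.integral_sq hd] at h1
  have hd0 : d ≠ 0 := by linarith
  have hd2 : d + 2 ≠ 0 := by linarith
  rw [eq_div_iff (by positivity)]
  have h2 : (d + 2) * ∫ t, t ^ 4 ∂m = 3 * (1 / d) := by linarith
  calc (∫ t, t ^ 4 ∂m) * (d * (d + 2)) = d * ((d + 2) * ∫ t, t ^ 4 ∂m) := by ring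
    _ = 3 := by rw [h2]; field_simp

theorem base_pos {k t : ℝ} (hk : k ∈ Ioo (-1 : ℝ) 1) (ht : t ∈ Icc (-1 : ℝ) 1) :
    0 < 1 + 2 * k * t + k ^ 2 := by
  rcases le_total 0 k with h | h
  · nlinarith [hk.1, hk.2, ht.1, ht.2, mul_nonneg h (by linarith [ht.1] : 0 ≤ 1 + t),
      sq_pos_of_pos (by linarith [hk.2] : 0 < 1 - k)]
  · nlinarith [hk.1, hk.2, ht.1, ht.2, mul_nonneg (neg_nonneg.2 h) (by linarith [ht.2] : 0 ≤ 1 - t),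
      sq_pos_of_pos (by linarith [hk.1] : 0 < 1 + k)]

/-- **Mean value property** of the fundamental solution `|x|^{2-d}` over spheres of radius `k < 1`
centered at a unit vector. The derivative of the mean in `k` satisfies a first order differential
equation, by integration by parts, whose only solution bounded at `k = 0` is zero. -/
theorem integral_fundamental (h : IsZonal d m) (hd : 1 < d) {k : ℝ} (hk : k ∈ Ico (0 : ℝ) 1) :
    ∫ t, (1 + 2 * k * t + k ^ 2) ^ ((2 - d) / 2) ∂m = 1 := by
  have := h.prob
  set U : Set ℝ := Ioo (-1) 1 with hU
  set w : ℝ → ℝ → ℝ := fun k t => 1 + 2 * k * t + k ^ 2 with hw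
  have hwpos : ∀ k ∈ U, ∀ t ∈ Icc (-1 : ℝ) 1, 0 < w k t := fun k hk t ht => base_pos hk ht
  have hwd : ∀ k t, HasDerivAt (fun k => w k t) (2 * (t + k)) k := fun k t => by
    have := (((hasDerivAt_id k).const_mul 2).mul_const t).const_add 1 |>.add (hasDerivAt_pow 2 k)
    refine this.congr_deriv ?_
    simp
    ring
  have hwd' : ∀ k t, HasDerivAt (fun t => w k t) (2 * k) t := fun k t => by
    have := (((hasDerivAt_id t).const_mul (2 * k)).const_add 1).add_const (k ^ 2)
    refine this.congr_deriv ?_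
    simp
  have hwc : Continuous fun q : ℝ × ℝ => w q.1 q.2 := by simp only [hw]; fun_prop
  have hpow : ∀ s : ℝ, ContinuousOn (fun q : ℝ × ℝ => w q.1 q.2 ^ s) (U ×ˢ Icc (-1) 1) := fun s =>
    hwc.continuousOn.rpow_const fun q hq => Or.inl (hwpos _ hq.1 _ hq.2).ne'
  have hpow' : ∀ s : ℝ, ∀ k ∈ U, ContinuousOn (fun t => w k t ^ s) (Icc (-1) 1) := fun s k hk =>
    (hpow s).comp (by fun_prop : Continuous fun t : ℝ => (k, t)).continuousOn fun t ht => ⟨hk, ht⟩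
  -- the derivative of the mean in `k`, up to a factor
  set I : ℝ → ℝ := fun k => ∫ t, (t + k) * w k t ^ (-d / 2) ∂m with hI
  have hMd : ∀ k ∈ U, HasDerivAt (fun k => ∫ t, w k t ^ ((2 - d) / 2) ∂m) ((2 - d) * I k) k := by
    intro k hk
    have := hasDerivAt_integral_of_isCompact m isCompact_Icc h.ae_mem isOpen_Ioo
      (F := fun k t => w k t ^ ((2 - d) / 2))
      (F' := fun k t => (2 - d) * ((t + k) * w k t ^ (-d / 2)))
      (fun k hk => hpow' _ k hk)
      (continuousOn_const.mul
        ((by fun_prop : Continuous fun q : ℝ × ℝ => q.2 + q.1).continuousOn.mul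
        (hpow (-d / 2)))) (fun k hk t ht => by
          refine ((hwd k t).rpow_const (Or.inl (hwpos k hk t ht).ne')).congr_deriv ?_
          rw [show (2 - d) / 2 - 1 = -d / 2 by ring]
          ring) hk
    rwa [integral_const_mul] at this
  have hId : ∀ k ∈ U, HasDerivAt I
      (∫ t, (w k t ^ (-d / 2) - d * (t + k) ^ 2 * w k t ^ (-d / 2 - 1)) ∂m) k := by
    intro k hk
    have hcont : ContinuousOn (Function.uncurry fun k t =>
        w k t ^ (-d / 2) - d * (t + k) ^ 2 * w k t ^ (-d / 2 - 1)) (U ×ˢ Icc (-1) 1) :=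
      (hpow (-d / 2)).sub ((by fun_prop : Continuous fun q : ℝ × ℝ =>
        d * (q.2 + q.1) ^ 2).continuousOn.mul (hpow (-d / 2 - 1)))
    refine hasDerivAt_integral_of_isCompact m isCompact_Icc h.ae_mem isOpen_Ioo
      (F := fun k t => (t + k) * w k t ^ (-d / 2))
      (F' := fun k t => w k t ^ (-d / 2) - d * (t + k) ^ 2 * w k t ^ (-d / 2 - 1))
      (fun k hk => (by fun_prop : Continuous fun t : ℝ => t + k).continuousOn.mul (hpow' _ k hk))
      hcont (fun k hk t ht => ?_) hk
    refine (((hasDerivAt_id k).const_add t).mul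
      ((hwd k t).rpow_const (p := -d / 2) (Or.inl (hwpos k hk t ht).ne'))).congr_deriv ?_
    simp only [id]
    ring
  -- integration by parts gives the differential equation `k I' = -(d - 1) I`
  have hODE : ∀ k ∈ U, (d - 1) * I k =
      -k * ∫ t, (w k t ^ (-d / 2) - d * (t + k) ^ 2 * w k t ^ (-d / 2 - 1)) ∂m := by
    intro k hk
    have h1 := h.by_parts (fun t => w k t ^ (-d / 2)) (fun t => -d * k * w k t ^ (-d / 2 - 1))
      (fun t ht => by
        refine ((hwd' k t).rpow_const (Or.inl (hwpos k hk t ht).ne')).congr_deriv ?_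
        ring)
      (continuousOn_const.mul (hpow' _ k hk))
    have i1 : Integrable (fun t => t * w k t ^ (-d / 2)) m :=
      h.integrable (continuousOn_id.mul (hpow' _ k hk))
    have i2 : Integrable (fun t => w k t ^ (-d / 2)) m := h.integrable (hpow' _ k hk)
    have i3 : Integrable (fun t => d * (t + k) ^ 2 * w k t ^ (-d / 2 - 1)) m :=
      h.integrable ((by fun_prop : Continuous fun t : ℝ => d * (t + k) ^ 2).continuousOn.mul
        (hpow' _ k hk))
    have e1 : I k = ∫ t, t * w k t ^ (-d / 2) ∂m + k * ∫ t, w k t ^ (-d / 2) ∂m := by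
      rw [← integral_const_mul, ← integral_add i1 (i2.const_mul k)]
      refine integral_congr_ae (Eventually.of_forall fun t => ?_)
      simp only
      ring
    have e2 : ∫ t, (1 - t ^ 2) * (-d * k * w k t ^ (-d / 2 - 1)) ∂m =
        -d * k * ∫ t, w k t ^ (-d / 2) ∂m + k * ∫ t, d * (t + k) ^ 2 * w k t ^ (-d / 2 - 1) ∂m := by
      rw [← integral_const_mul, ← integral_const_mul,
        ← integral_add (i2.const_mul _) (i3.const_mul k)]
      refine integral_congr_ae ?_
      filter_upwards [h.ae_mem] with t ht
      have hwp := hwpos k hk t ht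
      have : w k t ^ (-d / 2) = w k t * w k t ^ (-d / 2 - 1) := by
        rw [← Real.rpow_one_add' hwp.le]
        · congr 1; ring
        · intro hcon
          linarith
      rw [this]
      simp only [hw]
      ring
    rw [e2] at h1
    rw [integral_sub i2 i3, e1]
    linarith
  have hI0 : ∀ k ∈ Ico (0 : ℝ) 1, (2 - d) * I k = 0 := by
    have hJd : ∀ k ∈ Ioo (0 : ℝ) 1, HasDerivAt (fun k => k ^ (d - 1) * I k) 0 k := by
      intro k hk
      have hkU : k ∈ U := ⟨by linarith [hk.1], hk.2⟩
      refine ((Real.hasDerivAt_rpow_const (p := d - 1) (Or.inl hk.1.ne')).mul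
        (hId k hkU)).congr_deriv ?_
      have h1 := hODE k hkU
      have h2 : k ^ (d - 1) = k * k ^ (d - 1 - 1) := by
        rw [← Real.rpow_one_add' hk.1.le]
        · congr 1; ring
        · intro hcon
          linarith
      rw [h2]
      linear_combination k ^ (d - 1 - 1) * h1
    have hJc : ContinuousOn (fun k => k ^ (d - 1) * I k) (Ico 0 1) := by
      refine ContinuousOn.mul ?_ ?_
      · exact (Real.continuous_rpow_const (by linarith)).continuousOn
      · intro k hk
        exact (hId k ⟨by linarith [hk.1], hk.2⟩).continuousAt.continuousWithinAt
    intro k hk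
    rcases eq_or_lt_of_le hk.1 with rfl | hk0
    · have : I 0 = 0 := by
        have h1 := hODE 0 (by constructor <;> norm_num)
        rw [neg_zero, zero_mul] at h1
        exact (mul_eq_zero.1 h1).resolve_left (by linarith)
      rw [this, mul_zero]
    · obtain ⟨c, -, hc⟩ := exists_hasDerivAt_eq_slope (fun k => k ^ (d - 1) * I k) (fun _ => 0) hk0
        (hJc.mono fun x hx => ⟨hx.1, hx.2.trans_lt hk.2⟩)
        (fun x hx => hJd x ⟨hx.1, hx.2.trans hk.2⟩)
      have h1 : k ^ (d - 1) * I k - 0 ^ (d - 1) * I 0 = 0 := by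
        rw [eq_comm, div_eq_zero_iff] at hc
        exact hc.resolve_right (by linarith)
      rw [Real.zero_rpow (by linarith), zero_mul, sub_zero] at h1
      rw [(mul_eq_zero.1 h1).resolve_left (Real.rpow_pos_of_pos hk0 _).ne', mul_zero]
  have hc : ∀ x ∈ Icc (0 : ℝ) k, (fun k => ∫ t, w k t ^ ((2 - d) / 2) ∂m) x =
      (fun k => ∫ t, w k t ^ ((2 - d) / 2) ∂m) 0 := by
    refine constant_of_has_deriv_right_zero ?_ ?_
    · intro x hx
      exact (hMd x ⟨by linarith [hx.1], hx.2.trans_lt hk.2⟩).continuousAt.continuousWithinAt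
    · intro x hx
      have h1 := hMd x ⟨by linarith [hx.1], hx.2.trans hk.2⟩
      rw [hI0 x ⟨hx.1, hx.2.trans hk.2⟩] at h1
      exact h1.hasDerivWithinAt
  have := hc k ⟨hk.1, le_rfl⟩
  simp only [hw] at this ⊢
  rw [this]
  simp

end IsZonal

/-! ### Bookkeeping for expansions in powers of a large parameter -/

theorem isBigO_one_add_rpow_two (s : ℝ) :
    (fun x : ℝ => (1 + x) ^ s - (1 + s * x)) =O[𝓝 0] fun x => x ^ 2 := by
  have h := (Real.one_add_rpow_hasFPowerSeriesAt_zero (a := s)).isBigO_sub_partialSum_pow 2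
  have h2 : (fun x : ℝ => ‖x‖ ^ 2) = fun x => x ^ 2 := by
    funext x
    simp
  rw [h2] at h
  refine h.congr_left fun x => ?_
  simp [FormalMultilinearSeries.partialSum, binomialSeries, FormalMultilinearSeries.coeff_ofScalars,
    Finset.sum_range_succ]
  ring

theorem isBigO_one_add_rpow_four (s : ℝ) :
    (fun x : ℝ => (1 + x) ^ s - (1 + s * x + s * (s - 1) / 2 * x ^ 2 +
      s * (s - 1) * (s - 2) / 6 * x ^ 3)) =O[𝓝 0] fun x => x ^ 4 := by
  have h := (Real.one_add_rpow_hasFPowerSeriesAt_zero (a := s)).isBigO_sub_partialSum_pow 4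
  have h2 : (fun x : ℝ => ‖x‖ ^ 4) = fun x => x ^ 4 := by
    funext x
    rw [Real.norm_eq_abs, Even.pow_abs (by decide)]
  rw [h2] at h
  refine h.congr_left fun x => ?_
  have e2 : Ring.choose s 2 = s * (s - 1) / 2 := by
    rw [Ring.choose_eq_smul]
    simp [descPochhammer_succ_right, Polynomial.smeval_mul]
    ring
  have h2' : Polynomial.smeval (2 : Polynomial ℤ) s = 2 := by
    have := Polynomial.smeval_natCast (R := ℤ) s 2
    simpa using this
  have e3 : Ring.choose s 3 = s * (s - 1) * (s - 2) / 6 := by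
    rw [Ring.choose_eq_smul]
    simp [descPochhammer_succ_right, Polynomial.smeval_mul, Nat.factorial, h2']
    ring
  simp [FormalMultilinearSeries.partialSum, binomialSeries, FormalMultilinearSeries.coeff_ofScalars,
    Finset.sum_range_succ, e2, e3]
  ring

/-- `F = O(ρ ^ s)` along the filter `L`. All expansions are identities modulo such terms; the
exponent is a real number so that powers of `ρ` with exponents depending on the dimension fit. -/
def OP {α : Type*} (L : Filter α) (ρ : α → ℝ) (s : ℝ) (F : α → ℝ) : Prop :=
  F =O[L] fun q => ρ q ^ s

namespace OP

variable {α : Type*} {L : Filter α} {ρ : α → ℝ} {s s' s'' : ℝ} {F G H : α → ℝ}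

theorem mono (hρ : Tendsto ρ L atTop) (h : OP L ρ s F) (hs : s ≤ s') : OP L ρ s' F := by
  refine IsBigO.trans h (IsBigO.of_bound 1 ?_)
  filter_upwards [hρ.eventually_ge_atTop 1] with q hq
  have h0 : (0 : ℝ) < ρ q := by linarith
  rw [Real.norm_of_nonneg (Real.rpow_nonneg h0.le _),
    Real.norm_of_nonneg (Real.rpow_nonneg h0.le _),
    one_mul]
  exact Real.rpow_le_rpow_of_exponent_le hq hs

theorem congr' (h : OP L ρ s F) (hFG : ∀ᶠ q in L, F q = G q) : OP L ρ s G :=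
  IsBigO.congr' h hFG EventuallyEq.rfl

theorem congr (h : OP L ρ s F) (hFG : ∀ q, F q = G q) : OP L ρ s G :=
  IsBigO.congr_left h hFG

theorem add (h : OP L ρ s F) (h' : OP L ρ s G) : OP L ρ s fun q => F q + G q :=
  IsBigO.add h h'

theorem sub (h : OP L ρ s F) (h' : OP L ρ s G) : OP L ρ s fun q => F q - G q :=
  IsBigO.sub h h'

theorem neg (h : OP L ρ s F) : OP L ρ s fun q => -F q :=
  IsBigO.neg_left h

theorem const_mul (c : ℝ) (h : OP L ρ s F) : OP L ρ s fun q => c * F q :=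
  IsBigO.const_mul_left h c

theorem mul (hρ : Tendsto ρ L atTop) (h : OP L ρ s F) (h' : OP L ρ s' G) (hs : s + s' ≤ s'') :
    OP L ρ s'' fun q => F q * G q := by
  refine OP.mono hρ (s := s + s') ?_ hs
  refine (IsBigO.mul h h').congr' EventuallyEq.rfl ?_
  filter_upwards [hρ.eventually_gt_atTop 0] with q hq
  rw [Real.rpow_add hq]

theorem sq (hρ : Tendsto ρ L atTop) (h : OP L ρ s F) (hs : s + s ≤ s'') :
    OP L ρ s'' fun q => F q ^ 2 :=
  (h.mul hρ h hs).congr fun _ => (pow_two _).symm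

theorem const (c : ℝ) : OP L ρ 0 fun _ => c := by
  unfold OP
  simp only [Real.rpow_zero]
  exact isBigO_const_const c one_ne_zero L

theorem of_bound (C : ℝ) (h : ∀ᶠ q in L, |F q| ≤ C) : OP L ρ 0 F := by
  unfold OP
  simp only [Real.rpow_zero]
  exact IsBigO.of_bound C (h.mono fun q hq => by simpa using hq)

theorem rpow_self : OP L ρ s fun q => ρ q ^ s := isBigO_refl _ _

theorem tendsto_zero (hρ : Tendsto ρ L atTop) (h : OP L ρ s F) (hs : s < 0) :
    Tendsto F L (𝓝 0) := by
  refine IsBigO.trans_tendsto h ?_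
  have := (tendsto_rpow_neg_atTop (y := -s) (by linarith)).comp hρ
  simpa [Function.comp_def] using this

theorem pow (hρ : Tendsto ρ L atTop) (h : OP L ρ s F) (k : ℕ) (hs : k * s ≤ s'') :
    OP L ρ s'' fun q => F q ^ k := by
  refine OP.mono hρ (s := k * s) ?_ hs
  refine (IsBigO.pow h k).congr' EventuallyEq.rfl ?_
  filter_upwards [hρ.eventually_gt_atTop 0] with q hq
  rw [← Real.rpow_natCast, ← Real.rpow_mul hq.le, mul_comm]

theorem one_add_rpow (hρ : Tendsto ρ L atTop) (h : OP L ρ s F) (hs : s < 0) (p : ℝ) :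
    OP L ρ (2 * s) fun q => (1 + F q) ^ p - (1 + p * F q) :=
  ((isBigO_one_add_rpow_two p).comp_tendsto (h.tendsto_zero hρ hs)).trans
    (h.pow hρ 2 (by norm_num))

theorem one_add_rpow_sub_one (hρ : Tendsto ρ L atTop) (h : OP L ρ s F) (hs : s < 0) (p : ℝ) :
    OP L ρ s fun q => (1 + F q) ^ p - 1 :=
  (((h.one_add_rpow hρ hs p).mono hρ (by linarith)).add (h.const_mul p)).congr fun q => by ring

theorem one_add_rpow_bounded (hρ : Tendsto ρ L atTop) (h : OP L ρ s F) (hs : s < 0) (p : ℝ) :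
    OP L ρ 0 fun q => (1 + F q) ^ p :=
  (((h.one_add_rpow_sub_one hρ hs p).mono hρ hs.le).add (OP.const 1)).congr fun q => by ring

theorem one_add_rpow_four (hρ : Tendsto ρ L atTop) (h : OP L ρ s F) (hs : s < 0) (p : ℝ) :
    OP L ρ (4 * s) fun q => (1 + F q) ^ p - (1 + p * F q + p * (p - 1) / 2 * F q ^ 2 +
      p * (p - 1) * (p - 2) / 6 * F q ^ 3) :=
  ((isBigO_one_add_rpow_four p).comp_tendsto (h.tendsto_zero hρ hs)).trans
    (h.pow hρ 4 (by norm_num))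

theorem eventually_pos (hρ : Tendsto ρ L atTop) (h : OP L ρ s F) (hs : s < 0) :
    ∀ᶠ q in L, |F q| ≤ 1 / 2 := by
  have := (h.tendsto_zero hρ hs).eventually
    (Metric.closedBall_mem_nhds 0 (by norm_num : (0:ℝ) < 1 / 2))
  filter_upwards [this] with q hq
  simpa using hq

/-- Averages of uniform `O(ρ ^ s)` terms. -/
theorem integral {ι X : Type*} [MeasurableSpace X] {l : Filter ι} {ρ : ι → ℝ} {T : Set X}
    {m : Measure X} [IsProbabilityMeasure m] (hm : ∀ᵐ t ∂m, t ∈ T) {F : ι × X → ℝ}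
    (hρ : Tendsto ρ l atTop)
    (h : OP (l ×ˢ 𝓟 T) (fun q => ρ q.1) s F) : OP l ρ s fun i => ∫ t, F (i, t) ∂m := by
  obtain ⟨C, hC⟩ := h.bound
  rw [eventually_prod_principal_iff] at hC
  refine IsBigO.of_bound C ?_
  filter_upwards [hC, hρ.eventually_gt_atTop 0] with i hi hi0
  have := norm_integral_le_of_norm_le_const (μ := m) (f := fun t => F (i, t)) (C := C * ‖ρ i ^ s‖)
    (hm.mono fun t ht => hi t ht)
  simpa using this

theorem comp_fst {ι X : Type*} {l : Filter ι} {ρ : ι → ℝ} {T : Filter X} {F : ι → ℝ}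
    (h : OP l ρ s F) : OP (l ×ˢ T) (fun q => ρ q.1) s fun q => F q.1 :=
  IsBigO.comp_tendsto h tendsto_fst

end OP

/-! ### Expansion of the conformal factor along a perturbed sphere -/

/-- The non-constant part of the fundamental solution at distance `k` from a unit vector, in a
direction with cosine `t`. -/
noncomputable def pot (d k t : ℝ) : ℝ := (1 + 2 * k * t + k ^ 2) ^ ((2 - d) / 2) - 1

/-- The coefficient of `k` in the expansion of `pot d k t`, a zonal harmonic of degree one. -/
noncomputable def harm1 (d t : ℝ) : ℝ := (2 - d) * t

/-- The coefficient of `k ^ 2` in the expansion of `pot d k t`, a zonal harmonic of degree two. -/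
noncomputable def harm2 (d t : ℝ) : ℝ := (d - 2) / 2 * (d * t ^ 2 - 1)

/-- The coefficient of `k ^ 3` in the expansion of `pot d k t`, a zonal harmonic of degree three. -/
noncomputable def harm3 (d t : ℝ) : ℝ := d * (d - 2) / 2 * t - (d - 2) * d * (d + 2) / 6 * t ^ 3

section Pointwise

variable {α : Type*} {L : Filter α} {ρ : α → ℝ} {d : ℝ} {k t φ : α → ℝ}

theorem OP.base (hρ : Tendsto ρ L atTop) (hk : OP L ρ (-1) k) (ht : OP L ρ 0 t) :
    OP L ρ (-1) fun q => 2 * k q * t q + k q ^ 2 :=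
  (((hk.const_mul 2).mul hρ ht (by norm_num)).add (hk.sq hρ (by norm_num)))

/-- Taylor expansion of the potential in `k = O(ρ⁻¹)`. -/
theorem pot_expansion (hρ : Tendsto ρ L atTop) (hk : OP L ρ (-1) k) (ht : OP L ρ 0 t) :
    OP L ρ (-4) fun q => pot d (k q) (t q) -
      (k q * harm1 d (t q) + k q ^ 2 * harm2 d (t q) + k q ^ 3 * harm3 d (t q)) := by
  have hX := OP.base hρ hk ht
  have h4 := (hX.one_add_rpow_four hρ (by norm_num) ((2 - d) / 2)).mono hρ
    (by norm_num : 4 * (-1 : ℝ) ≤ -4)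
  set s := (2 - d) / 2 with hs
  have hk4 : OP L ρ (-4) fun q => k q ^ 4 := hk.pow hρ 4 (by norm_num)
  -- the terms of order at least four in `k`
  have hr : OP L ρ (-4) fun q => k q ^ 4 * (s * (s - 1) / 2 + s * (s - 1) * (s - 2) / 6 *
      (12 * t q ^ 2 + 6 * (k q * t q) + k q ^ 2)) := by
    refine hk4.mul hρ (s' := 0) ?_ (by norm_num)
    refine (OP.const _).add (OP.const_mul _ ?_)
    refine OP.add (OP.add ((ht.sq hρ (by norm_num)).const_mul _)
      (((hk.mul hρ ht (by norm_num)).const_mul _))) (hk.sq hρ (by norm_num))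
  refine (h4.add hr).congr fun q => ?_
  simp only [pot, harm1, harm2, harm3]
  rw [show (1 : ℝ) + 2 * k q * t q + k q ^ 2 = 1 + (2 * k q * t q + k q ^ 2) by ring, ← hs]
  have : d = 2 - 2 * s := by rw [hs]; ring
  rw [this]
  ring

theorem OP.pot (hρ : Tendsto ρ L atTop) (hk : OP L ρ (-1) k) (ht : OP L ρ 0 t) :
    OP L ρ (-1) fun q => pot d (k q) (t q) := by
  refine ((OP.base hρ hk ht).one_add_rpow_sub_one hρ (by norm_num) ((2 - d) / 2)).congr fun q => ?_
  simp only [OffCenter.pot]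
  ring_nf

theorem OP.harm1 (ht : OP L ρ 0 t) : OP L ρ 0 fun q => harm1 d (t q) := ht.const_mul _

theorem OP.harm2 (hρ : Tendsto ρ L atTop) (ht : OP L ρ 0 t) : OP L ρ 0 fun q => harm2 d (t q) :=
  (((ht.sq hρ (by norm_num)).const_mul _).sub (OP.const 1)).const_mul _

theorem OP.harm3 (hρ : Tendsto ρ L atTop) (ht : OP L ρ 0 t) : OP L ρ 0 fun q => harm3 d (t q) :=
  (ht.const_mul _).sub ((ht.pow hρ 3 (by norm_num)).const_mul _)

/-- The effect on the potential of a relative displacement `φ = O(ρ ^ (-d))` of the radius: only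
its first derivative in `k`, up to second order in `k`, matters. -/
theorem pot_shift (hρ : Tendsto ρ L atTop) (hd : 3 ≤ d) (hk : OP L ρ (-1) k) (ht : OP L ρ 0 t)
    (hφ : OP L ρ (-d) φ) :
    OP L ρ (-d - 3) fun q => pot d (k q * (1 + φ q)) (t q) - pot d (k q) (t q) -
      φ q * (k q * harm1 d (t q) + 2 * k q ^ 2 * harm2 d (t q)) := by
  have hX := OP.base hρ hk ht
  set X : α → ℝ := fun q => 2 * k q * t q + k q ^ 2 with hXdef
  set s := (2 - d) / 2 with hs
  set δ : α → ℝ := fun q => 2 * k q * t q * φ q + k q ^ 2 * (2 * φ q + φ q ^ 2) with hδdef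
  have hkφ : OP L ρ (-d - 1) fun q => k q * φ q := hk.mul hρ hφ (by linarith)
  have hδ : OP L ρ (-d - 1) δ := by
    refine OP.congr (F := fun q => k q * φ q * (2 * t q + k q * (2 + φ q))) ?_ fun q => ?_
    · refine hkφ.mul hρ (s' := 0) ?_ (by linarith)
      refine (ht.const_mul 2).add (hk.mul hρ (s' := 0) ?_ (by norm_num))
      exact (OP.const 2).add (hφ.mono hρ (by linarith))
    · simp only [hδdef]; ring
  have hinv := hX.one_add_rpow_bounded hρ (by norm_num) (-1)
  have hδQ : OP L ρ (-d - 1) fun q => δ q * (1 + X q) ^ (-1 : ℝ) := hδ.mul hρ hinv (by linarith)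
  have h1 := hδQ.one_add_rpow hρ (by linarith) s
  have hQs := hX.one_add_rpow_bounded hρ (by norm_num) s
  have h2 := hQs.mul hρ h1 (s'' := -d - 3) (by linarith)
  have h3 := (hX.one_add_rpow hρ (by norm_num) (s - 1)).mono hρ (by norm_num : 2 * (-1 : ℝ) ≤ -2)
  have h4 := hδ.mul hρ (h3.const_mul s) (s'' := -d - 3) (by linarith)
  -- the terms of order at least three in `k`, or quadratic in `φ`
  have h5 : OP L ρ (-d - 3) fun q => s * k q * φ q *
      (k q * φ q * (1 + 2 * (s - 1) * k q * t q) + k q ^ 2 * (4 * (s - 1) * t q) +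
      (s - 1) * k q ^ 2 * (2 * t q + 2 * k q + k q * φ q)) := by
    have hk2 : OP L ρ (-2) fun q => k q ^ 2 := hk.sq hρ (by norm_num)
    refine OP.mul hρ (s := -d - 1) (s' := -2) ((hkφ.const_mul s).congr fun q => by ring) ?_
      (by linarith)
    refine OP.add (OP.add ?_ ?_) ?_
    · refine hkφ.mul hρ (s' := 0) ?_ (by linarith)
      exact OP.add (OP.const 1) (OP.mul hρ (hk.const_mul _) ht (by norm_num))
    · exact hk2.mul hρ (ht.const_mul _) (by norm_num)
    · refine OP.mul hρ (hk2.const_mul _) (s' := 0) ?_ (by norm_num)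
      refine OP.add (OP.add (ht.const_mul 2) ((hk.mono hρ (s' := 0) (by norm_num)).const_mul 2)) ?_
      exact hkφ.mono hρ (by linarith)
  refine ((h2.add h4).add h5).congr' ?_
  filter_upwards [hX.eventually_pos hρ (by norm_num), hδQ.eventually_pos hρ (by linarith)]
    with q hXq hδq
  have hQ : 0 < 1 + X q := by linarith [(abs_le.1 hXq).1]
  have hQ' : 0 < 1 + δ q * (1 + X q) ^ (-1 : ℝ) := by linarith [(abs_le.1 hδq).1]
  have hmul : (1 + X q) ^ s * (1 + δ q * (1 + X q) ^ (-1 : ℝ)) ^ s = (1 + X q + δ q) ^ s := by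
    rw [← Real.mul_rpow hQ.le hQ'.le, Real.rpow_neg_one]
    congr 1
    field_simp
  have hQs1 : (1 + X q) ^ s * (1 + X q) ^ (-1 : ℝ) = (1 + X q) ^ (s - 1) := by
    rw [← Real.rpow_add hQ]; rfl
  have e1 : pot d (k q * (1 + φ q)) (t q) = (1 + X q + δ q) ^ s - 1 := by
    simp only [pot, hXdef, hδdef, hs]
    ring_nf
  have e2 : pot d (k q) (t q) = (1 + X q) ^ s - 1 := by
    simp only [pot, hXdef, hs]
    ring_nf
  rw [e1, e2, mul_sub, hmul, mul_add, mul_one]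
  have e3 : (1 + X q) ^ s * (s * (δ q * (1 + X q) ^ (-1 : ℝ))) = s * δ q * (1 + X q) ^ (s - 1) := by
    rw [← hQs1]; ring
  rw [e3]
  have hdd : d = 2 - 2 * s := by rw [hs]; ring
  simp only [harm1, harm2, hδdef, hXdef]
  rw [hdd]
  ring

theorem OP.mul_sub_mul {F F₀ G G₀ : α → ℝ} {s₁ s₂ s₃ s₄ s : ℝ} (hρ : Tendsto ρ L atTop)
    (h₁ : OP L ρ s₁ fun q => F q - F₀ q) (h₂ : OP L ρ s₂ G) (h₃ : OP L ρ s₃ F₀)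
    (h₄ : OP L ρ s₄ fun q => G q - G₀ q) (h12 : s₁ + s₂ ≤ s) (h34 : s₃ + s₄ ≤ s) :
    OP L ρ s fun q => F q * G q - F₀ q * G₀ q :=
  ((h₁.mul hρ h₂ h12).add (h₃.mul hρ h₄ h34)).congr fun q => by ring

/-- The terms of the expansion of `(1 + η * pot d (k * (1 + φ)) t) ^ s * W` that are quadratic in
the small quantities. -/
noncomputable def quadTerms (d s w₁ η k g t : ℝ) : ℝ :=
  s * η * g * (1 - d * t ^ 2) * (k * harm1 d t + 2 * k ^ 2 * harm2 d t) +
  s * (s - 1) / 2 * η ^ 2 * (k ^ 2 * harm1 d t ^ 2 + 2 * k ^ 3 * (harm1 d t * harm2 d t) +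
    k ^ 4 * (harm2 d t ^ 2 + 2 * (harm1 d t * harm3 d t))) +
  s * (s - 1) * (s - 2) / 6 * η ^ 3 * k ^ 3 * harm1 d t ^ 3 +
  s * w₁ * η * g * (1 - d * t ^ 2) * (k * harm1 d t + k ^ 2 * harm2 d t)

/-- Expansion up to `O(ρ ^ (-2 d - 1))` of a power of the conformal factor on the sphere displaced
by `φ`, times a weight `W = 1 + w₁ φ + w₂ + …`. The linear terms `s * η * pot` and `w₁ * φ` are kept
exactly, because their means are known exactly; of the displacement only the leading part
`g * (1 - d * t ^ 2)` enters the quadratic terms. -/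
theorem weighted_factor_expansion {η g W w₂ : α → ℝ} {s w₁ : ℝ} (hρ : Tendsto ρ L atTop)
    (hd : 3 ≤ d) (hk : OP L ρ (-1) k) (ht : OP L ρ 0 t) (hη : OP L ρ (2 - d) η)
    (hg : OP L ρ (-d) g)
    (hφ : OP L ρ (1 - 2 * d) fun q => φ q - g q * (1 - d * t q ^ 2))
    (hw₂ : OP L ρ (-2 * d) w₂)
    (hW : OP L ρ (-2 * d - 1) fun q => W q - (1 + w₁ * φ q + w₂ q)) :
    OP L ρ (-2 * d - 1) fun q => (1 + η q * pot d (k q * (1 + φ q)) (t q)) ^ s * W q -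
      (1 + s * (η q * pot d (k q) (t q)) + w₁ * φ q + w₂ q +
        quadTerms d s w₁ (η q) (k q) (g q) (t q)) := by
  have hψ : OP L ρ 0 fun q => 1 - d * t q ^ 2 :=
    (OP.const 1).sub ((ht.sq hρ (by norm_num)).const_mul d)
  have hgψ : OP L ρ (-d) fun q => g q * (1 - d * t q ^ 2) := hg.mul hρ hψ (by linarith)
  have hφd : OP L ρ (-d) φ := ((hφ.mono hρ (by linarith)).add hgψ).congr fun q => by ring
  have H1 : OP L ρ 0 fun q => harm1 d (t q) := ht.harm1
  have H2 : OP L ρ 0 fun q => harm2 d (t q) := ht.harm2 hρ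
  have H3 : OP L ρ 0 fun q => harm3 d (t q) := ht.harm3 hρ
  have hk2 : OP L ρ (-2) fun q => k q ^ 2 := hk.sq hρ (by norm_num)
  have hk3 : OP L ρ (-3) fun q => k q ^ 3 := hk.pow hρ 3 (by norm_num)
  have kh1 : OP L ρ (-1) fun q => k q * harm1 d (t q) := hk.mul hρ H1 (by norm_num)
  have kh2 : OP L ρ (-2) fun q => k q ^ 2 * harm2 d (t q) := hk2.mul hρ H2 (by norm_num)
  have kh3 : OP L ρ (-3) fun q => k q ^ 3 * harm3 d (t q) := hk3.mul hρ H3 (by norm_num)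
  have hA : OP L ρ (-1) fun q => k q * harm1 d (t q) + 2 * k q ^ 2 * harm2 d (t q) :=
    (kh1.add ((kh2.mono hρ (by norm_num)).const_mul 2)).congr fun q => by ring
  -- `Y = Y₀ + η g ψ (k h₁ + 2 k² h₂)` up to the error
  set Y : α → ℝ := fun q => η q * pot d (k q * (1 + φ q)) (t q) with hY
  set Y₀ : α → ℝ := fun q => η q * pot d (k q) (t q) with hY₀
  have hY₀o : OP L ρ (1 - d) Y₀ := hη.mul hρ (OP.pot hρ hk ht) (by linarith)
  have D1 : OP L ρ (-2 * d - 1) fun q => Y q - (Y₀ q + η q * φ q *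
      (k q * harm1 d (t q) + 2 * k q ^ 2 * harm2 d (t q))) :=
    (hη.mul hρ (pot_shift hρ hd hk ht hφd) (by linarith)).congr fun q => by
      simp only [hY, hY₀]; ring
  have D2 : OP L ρ (-2 * d - 1) fun q => η q * φ q *
      (k q * harm1 d (t q) + 2 * k q ^ 2 * harm2 d (t q)) - η q * (g q * (1 - d * t q ^ 2)) *
      (k q * harm1 d (t q) + 2 * k q ^ 2 * harm2 d (t q)) :=
    ((hη.mul hρ hφ (s'' := 3 - 3 * d) (by linarith)).mul hρ hA (by linarith)).congr
      fun q => by ring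
  have D3 : OP L ρ (1 - 2 * d) fun q => η q * φ q *
      (k q * harm1 d (t q) + 2 * k q ^ 2 * harm2 d (t q)) :=
    (hη.mul hρ hφd (s'' := 2 - 2 * d) (by linarith)).mul hρ hA (by linarith)
  have hYY : OP L ρ (1 - 2 * d) fun q => Y q - Y₀ q :=
    ((D1.mono hρ (by linarith)).add D3).congr fun q => by ring
  have hYo : OP L ρ (1 - d) Y := ((hYY.mono hρ (by linarith)).add hY₀o).congr fun q => by ring
  have hY₀2 : OP L ρ (2 - 2 * d) fun q => Y₀ q ^ 2 := hY₀o.sq hρ (by linarith)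
  have hYsq : OP L ρ (2 - 3 * d) fun q => Y q ^ 2 - Y₀ q ^ 2 :=
    (OP.mul_sub_mul hρ hYY hYo hY₀o hYY (by linarith) (by linarith)).congr fun q => by ring
  have hYcu : OP L ρ (-2 * d - 1) fun q => Y q ^ 3 - Y₀ q ^ 3 :=
    (OP.mul_sub_mul hρ hYsq hYo hY₀2 hYY (by linarith) (by linarith)).congr fun q => by ring
  -- powers of `Y₀`
  have hpe := pot_expansion (d := d) hρ hk ht
  have hpo := OP.pot (d := d) hρ hk ht
  have P1 : OP L ρ (-3) fun q => pot d (k q) (t q) -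
      (k q * harm1 d (t q) + k q ^ 2 * harm2 d (t q)) :=
    ((hpe.mono hρ (by norm_num)).add kh3).congr fun q => by ring
  have P0 : OP L ρ (-2) fun q => pot d (k q) (t q) - k q * harm1 d (t q) :=
    ((P1.mono hρ (by norm_num)).add kh2).congr fun q => by ring
  have hE : OP L ρ (-1) fun q => k q * harm1 d (t q) + k q ^ 2 * harm2 d (t q) +
      k q ^ 3 * harm3 d (t q) :=
    (kh1.add (kh2.mono hρ (by norm_num))).add (kh3.mono hρ (by norm_num))
  have P2 : OP L ρ (-5) fun q => pot d (k q) (t q) ^ 2 - (k q ^ 2 * harm1 d (t q) ^ 2 +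
      2 * k q ^ 3 * (harm1 d (t q) * harm2 d (t q)) +
      k q ^ 4 * (harm2 d (t q) ^ 2 + 2 * (harm1 d (t q) * harm3 d (t q)))) := by
    have a := OP.mul_sub_mul (s := -5) hρ hpe hpo hE hpe (by norm_num) (by norm_num)
    have b : OP L ρ (-5) fun q => 2 * ((k q ^ 2 * harm2 d (t q)) * (k q ^ 3 * harm3 d (t q))) +
        (k q ^ 3 * harm3 d (t q)) * (k q ^ 3 * harm3 d (t q)) :=
      ((kh2.mul hρ kh3 (by norm_num)).const_mul 2).add (kh3.mul hρ kh3 (by norm_num))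
    exact (a.add b).congr fun q => by ring
  have P3 : OP L ρ (-4) fun q => pot d (k q) (t q) ^ 3 - (k q * harm1 d (t q)) ^ 3 := by
    have a := OP.mul_sub_mul (s := -3) hρ P0 hpo kh1 P0 (by norm_num) (by norm_num)
    have b := OP.mul_sub_mul (s := -4) hρ a hpo (kh1.mul hρ kh1 (s'' := -2) (by norm_num)) P0
      (by norm_num) (by norm_num)
    exact b.congr fun q => by ring
  have hη2 : OP L ρ (4 - 2 * d) fun q => η q ^ 2 := hη.sq hρ (by linarith)
  have hη3 : OP L ρ (6 - 3 * d) fun q => η q ^ 3 := hη.pow hρ 3 (by push_cast; linarith)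
  have Q2 := hη2.mul hρ P2 (s'' := -2 * d - 1) (by linarith)
  have Q3 := hη3.mul hρ P3 (s'' := -2 * d - 1) (by linarith)
  have T := (hYo.one_add_rpow_four hρ (by linarith) s).mono hρ
    (by linarith : 4 * (1 - d) ≤ -2 * d - 1)
  -- the cross term
  have C1 : OP L ρ (-1 - d) fun q => Y q - η q * (k q * harm1 d (t q) + k q ^ 2 * harm2 d (t q)) :=
    ((hYY.mono hρ (by linarith)).add (hη.mul hρ P1 (by linarith))).congr fun q => by
      simp only [hY₀]; ring
  have C2 : OP L ρ (1 - d) fun q => η q * (k q * harm1 d (t q) + k q ^ 2 * harm2 d (t q)) :=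
    hη.mul hρ (kh1.add (kh2.mono hρ (by norm_num))) (by linarith)
  have C3 := OP.mul_sub_mul (s := -2 * d - 1) hρ C1 hφd C2 hφ (by linarith) (by linarith)
  -- higher order terms of the power
  have hY2 : OP L ρ (2 - 2 * d) fun q => Y q ^ 2 := hYo.sq hρ (by linarith)
  have hY3 : OP L ρ (3 - 3 * d) fun q => Y q ^ 3 := hYo.pow hρ 3 (by push_cast; linarith)
  have R2 : OP L ρ (2 - 2 * d) fun q => (1 + Y q) ^ s - (1 + s * Y q) :=
    ((hYo.one_add_rpow hρ (by linarith) s).mono hρ (by linarith))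
  have hwφ : OP L ρ (-d) fun q => w₁ * φ q + w₂ q :=
    (hφd.const_mul w₁).add (hw₂.mono hρ (by linarith))
  have R3 := R2.mul hρ hwφ (s'' := -2 * d - 1) (by linarith)
  have R4 := (hYo.const_mul s).mul hρ hw₂ (s'' := -2 * d - 1) (by linarith)
  have hYs := hYo.one_add_rpow_bounded hρ (by linarith) s
  have R5 := hYs.mul hρ hW (s'' := -2 * d - 1) (by linarith)
  have S1 := (D1.add D2).const_mul s
  have S2 := ((hYsq.mono hρ (by linarith : 2 - 3 * d ≤ -2 * d - 1)).add Q2).const_mul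
    (s * (s - 1) / 2)
  have S3 := (hYcu.add Q3).const_mul (s * (s - 1) * (s - 2) / 6)
  have S4 := C3.const_mul (s * w₁)
  refine ((((T.add S1).add (S2.add S3)).add S4).add ((R3.add R4).add R5)).congr fun q => ?_
  simp only [quadTerms, hY, hY₀]
  ring

end Pointwise

/-! ### Averages of the expansion -/

theorem IsZonal.integral_quartic {d : ℝ} {m : Measure ℝ} (h : IsZonal d m) (hd : 1 < d)
    (c₀ c₁ c₂ c₃ c₄ : ℝ) :
    ∫ t, (c₀ + c₁ * t + c₂ * t ^ 2 + c₃ * t ^ 3 + c₄ * t ^ 4) ∂m =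
      c₀ + c₂ / d + 3 * c₄ / (d * (d + 2)) := by
  have := h.prob
  have i1 : Integrable (fun t : ℝ => c₁ * t) m := h.integrable (by fun_prop)
  have i2 : Integrable (fun t : ℝ => c₂ * t ^ 2) m := h.integrable (by fun_prop)
  have i3 : Integrable (fun t : ℝ => c₃ * t ^ 3) m := h.integrable (by fun_prop)
  have i4 : Integrable (fun t : ℝ => c₄ * t ^ 4) m := h.integrable (by fun_prop)
  have i0 : Integrable (fun _ : ℝ => c₀) m := integrable_const _
  have j1 : Integrable (fun t : ℝ => c₀ + c₁ * t) m := i0.add i1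
  have j2 : Integrable (fun t : ℝ => c₀ + c₁ * t + c₂ * t ^ 2) m := j1.add i2
  have j3 : Integrable (fun t : ℝ => c₀ + c₁ * t + c₂ * t ^ 2 + c₃ * t ^ 3) m := j2.add i3
  rw [integral_add j3 i4, integral_add j2 i3, integral_add j1 i2, integral_add i0 i1,
    integral_const_mul, integral_const_mul,
    integral_const_mul, integral_const_mul, h.integral_id hd, h.integral_sq hd, h.integral_cube hd,
    h.integral_pow_four hd]
  simp
  ring

/-- The mean of the quadratic terms, from the moments up to order four; odd powers of `t` and the
cubic term drop out. -/
theorem IsZonal.integral_quadTerms {d : ℝ} {m : Measure ℝ} (h : IsZonal d m) (hd : 1 < d)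
    (s w₁ η k g : ℝ) :
    ∫ t, quadTerms d s w₁ η k g t ∂m =
      s * (s - 1) / 2 * η ^ 2 * (k ^ 2 * ((d - 2) ^ 2 / d) +
        k ^ 4 * ((d - 2) ^ 2 * (d - 1) / (2 * (d + 2)))) -
      s * (2 + w₁) * η * k ^ 2 * g * ((d - 2) * (d - 1) / (d + 2)) := by
  have hd0 : d ≠ 0 := by linarith
  have hd2 : d + 2 ≠ 0 := by linarith
  have e : ∀ t, quadTerms d s w₁ η k g t =
      (s * η * g * (2 + w₁) * k ^ 2 * (-(d - 2) / 2) +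
        s * (s - 1) / 2 * η ^ 2 * k ^ 4 * ((d - 2) ^ 2 / 4)) +
      (s * η * g * (1 + w₁) * k * (2 - d) +
        s * (s - 1) / 2 * η ^ 2 * 2 * k ^ 3 * ((d - 2) ^ 2 / 2)) * t +
      (s * η * g * (2 + w₁) * k ^ 2 * (d * (d - 2)) + s * (s - 1) / 2 * η ^ 2 *
        (k ^ 2 * (d - 2) ^ 2 + k ^ 4 * (-(d - 2) ^ 2 / 2 * d - (d - 2) ^ 2 * d))) * t ^ 2 +
      (-(s * η * g * (1 + w₁) * k * (2 - d) * d) -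
        s * (s - 1) / 2 * η ^ 2 * 2 * k ^ 3 * ((d - 2) ^ 2 / 2 * d) +
        s * (s - 1) * (s - 2) / 6 * η ^ 3 * k ^ 3 * (2 - d) ^ 3) * t ^ 3 +
      (-(s * η * g * (2 + w₁) * k ^ 2 * (d ^ 2 * (d - 2) / 2)) + s * (s - 1) / 2 * η ^ 2 *
        k ^ 4 * ((d - 2) ^ 2 / 4 * d ^ 2 + (d - 2) ^ 2 * d * (d + 2) / 3)) * t ^ 4 := by
    intro t
    simp only [quadTerms, harm1, harm2, harm3]
    ring
  simp only [e]
  rw [h.integral_quartic hd]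
  field_simp
  ring

/-- The mean of the expansion `weighted_factor_expansion`: the potential has mean zero by the mean
value property, and the mean of the quadratic terms is `IsZonal.integral_quadTerms`. -/
theorem IsZonal.integral_weighted_factor {ι : Type*} {l : Filter ι} {ρ κ η g : ι → ℝ}
    {φ W w₂ : ι × ℝ → ℝ} {d s w₁ : ℝ} {m : Measure ℝ} (h : IsZonal d m) (hd : 3 ≤ d)
    (hρ : Tendsto ρ l atTop) (hκ : OP l ρ (-1) κ) (hκ0 : ∀ᶠ i in l, 0 ≤ κ i)
    (hη : OP l ρ (2 - d) η) (hg : OP l ρ (-d) g)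
    (hφ : OP (l ×ˢ 𝓟 (Icc (-1) 1)) (fun q => ρ q.1) (1 - 2 * d)
      fun q => φ q - g q.1 * (1 - d * q.2 ^ 2))
    (hw₂ : OP (l ×ˢ 𝓟 (Icc (-1) 1)) (fun q => ρ q.1) (-2 * d) w₂)
    (hW : OP (l ×ˢ 𝓟 (Icc (-1) 1)) (fun q => ρ q.1) (-2 * d - 1)
      fun q => W q - (1 + w₁ * φ q + w₂ q))
    (hφc : ∀ᶠ i in l, ContinuousOn (fun t => φ (i, t)) (Icc (-1) 1))
    (hWc : ∀ᶠ i in l, ContinuousOn (fun t => W (i, t)) (Icc (-1) 1))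
    (hwc : ∀ᶠ i in l, ContinuousOn (fun t => w₂ (i, t)) (Icc (-1) 1)) :
    OP l ρ (-2 * d - 1) fun i =>
      ∫ t, (1 + η i * pot d (κ i * (1 + φ (i, t))) t) ^ s * W (i, t) ∂m -
      (1 + (s * (s - 1) / 2 * (η i) ^ 2 * ((κ i) ^ 2 * ((d - 2) ^ 2 / d) +
          (κ i) ^ 4 * ((d - 2) ^ 2 * (d - 1) / (2 * (d + 2)))) -
          s * (2 + w₁) * η i * (κ i) ^ 2 * g i * ((d - 2) * (d - 1) / (d + 2))) +
        w₁ * ∫ t, φ (i, t) ∂m + ∫ t, w₂ (i, t) ∂m) := by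
  have := h.prob
  set L := l ×ˢ 𝓟 (Icc (-1 : ℝ) 1) with hL
  have hρL : Tendsto (fun q : ι × ℝ => ρ q.1) L atTop := hρ.comp tendsto_fst
  have ht : OP L (fun q => ρ q.1) 0 fun q => q.2 :=
    OP.of_bound 1 (eventually_prod_principal_iff.2 (Eventually.of_forall fun i t ht => abs_le.2 ht))
  have hκL : OP L (fun q => ρ q.1) (-1) fun q => κ q.1 := hκ.comp_fst
  have hηL : OP L (fun q => ρ q.1) (2 - d) fun q => η q.1 := hη.comp_fst
  have hgL : OP L (fun q => ρ q.1) (-d) fun q => g q.1 := hg.comp_fst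
  have hψ : OP L (fun q => ρ q.1) 0 fun q => 1 - d * q.2 ^ 2 :=
    (OP.const 1).sub ((ht.sq hρL (by norm_num)).const_mul d)
  have hφd : OP L (fun q => ρ q.1) (-d) φ :=
    ((hφ.mono hρL (by linarith)).add (hgL.mul hρL hψ (by linarith))).congr fun q => by ring
  have key := weighted_factor_expansion (s := s) hρL hd hκL ht hηL hgL hφ hw₂ hW
  have hint := OP.integral h.ae_mem hρ key
  refine hint.congr' ?_
  -- continuity, uniformly in the parameter
  have hk' : OP L (fun q => ρ q.1) (-1) fun q => κ q.1 * (1 + φ q) :=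
    hκL.mul hρL ((OP.const 1).add (hφd.mono hρL (by linarith))) (by norm_num)
  have hY := hηL.mul hρL (OP.pot (d := d) hρL hk' ht) (s'' := 1 - d) (by linarith)
  have b1 := eventually_prod_principal_iff.1 (hk'.eventually_pos hρL (by norm_num))
  have b2 := eventually_prod_principal_iff.1 (hY.eventually_pos hρL (by linarith))
  filter_upwards [b1, b2, hφc, hWc, hwc, hκ0, hκ.eventually_pos hρ (by norm_num)]
    with i hi1 hi2 c1 c2 c3 k0 k1
  have hki : κ i ∈ Ico (0 : ℝ) 1 := ⟨k0, by linarith [(abs_le.1 k1).2]⟩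
  have cpot : ContinuousOn (fun t => pot d (κ i) t) (Icc (-1) 1) := by
    unfold pot
    refine ContinuousOn.sub (ContinuousOn.rpow_const (by fun_prop) fun t ht => Or.inl ?_)
      continuousOn_const
    exact (IsZonal.base_pos ⟨by linarith [hki.1], hki.2⟩ ht).ne'
  have cF : ContinuousOn (fun t => (1 + η i * pot d (κ i * (1 + φ (i, t))) t) ^ s * W (i, t))
      (Icc (-1) 1) := by
    refine ContinuousOn.mul (ContinuousOn.rpow_const ?_ fun t ht => Or.inl ?_) c2
    · unfold pot
      refine continuousOn_const.add (continuousOn_const.mul (ContinuousOn.sub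
        (ContinuousOn.rpow_const ?_ fun t ht => Or.inl ?_) continuousOn_const))
      · have cκ : ContinuousOn (fun t => κ i * (1 + φ (i, t))) (Icc (-1) 1) :=
          continuousOn_const.mul (continuousOn_const.add c1)
        exact (continuousOn_const.add ((continuousOn_const.mul cκ).mul continuousOn_id)).add
          (cκ.pow 2)
      have := abs_le.1 (hi1 t ht)
      exact (IsZonal.base_pos ⟨by linarith [this.1], by linarith [this.2]⟩ ht).ne'
    · have := abs_le.1 (hi2 t ht)
      linarith [this.1]
  have cq : ContinuousOn (fun t => quadTerms d s w₁ (η i) (κ i) (g i) t) (Icc (-1) 1) := by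
    unfold quadTerms harm1 harm2 harm3
    fun_prop
  have ipot : ∫ t, pot d (κ i) t ∂m = 0 := by
    unfold pot
    rw [integral_sub _ (integrable_const _), h.integral_fundamental (by linarith) hki]
    · simp
    · refine h.integrable (ContinuousOn.rpow_const (by fun_prop) fun t ht => Or.inl ?_)
      exact (IsZonal.base_pos ⟨by linarith [hki.1], hki.2⟩ ht).ne'
  have I1 := h.integrable cF
  have I2 : Integrable (fun t => s * (η i * pot d (κ i) t)) m :=
    ((h.integrable cpot).const_mul _).const_mul _
  have I3 : Integrable (fun t => w₁ * φ (i, t)) m := (h.integrable c1).const_mul _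
  have I4 := h.integrable c3
  have I5 := h.integrable cq
  have I0 : Integrable (fun _ : ℝ => (1 : ℝ)) m := integrable_const _
  have J2 : Integrable (fun t => 1 + s * (η i * pot d (κ i) t)) m := I0.add I2
  have J3 : Integrable (fun t => 1 + s * (η i * pot d (κ i) t) + w₁ * φ (i, t)) m := J2.add I3
  have J4 : Integrable (fun t => 1 + s * (η i * pot d (κ i) t) + w₁ * φ (i, t) + w₂ (i, t)) m :=
    J3.add I4
  have J5 : Integrable (fun t => 1 + s * (η i * pot d (κ i) t) + w₁ * φ (i, t) + w₂ (i, t) +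
      quadTerms d s w₁ (η i) (κ i) (g i) t) m := J4.add I5
  rw [integral_sub I1 J5, integral_add J4 I5, integral_add J3 I4, integral_add J2 I3,
    integral_add I0 I2, integral_const_mul, integral_const_mul,
    integral_const_mul, ipot, h.integral_quadTerms (by linarith)]
  simp
  ring

/-! ### The normal perturbation in polar coordinates -/

/-- The limit `ρ → ∞`, uniformly in the radius `r ∈ (0, R]`. -/
noncomputable def farLim (R : ℝ) : Filter (ℝ × ℝ) := 𝓟 (Ioc 0 R) ×ˢ atTop

/-- The value of the conformal factor at the center of the sphere. -/
noncomputable def centerFactor (d ρ : ℝ) : ℝ := 1 + ρ ^ (2 - d)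

/-- The relative size of the non-constant part of the conformal factor. -/
noncomputable def relSize (d ρ : ℝ) : ℝ := ρ ^ (2 - d) / centerFactor d ρ

/-- The conformal factor on the sphere of radius `r`, divided by its value at the center. -/
noncomputable def relFactor (d r ρ t : ℝ) : ℝ := 1 + relSize d ρ * pot d (r / ρ) t

/-- The amplitude of the perturbation, relative to the radius. -/
noncomputable def amplitude (d r ρ : ℝ) : ℝ := (d - 1) / (d + 1) * r ^ 2 * ρ ^ (-d)

/-- The additive constant of the perturbation, relative to the radius. -/
noncomputable def meanShift (m : Measure ℝ) (d r ρ : ℝ) : ℝ :=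
  -(amplitude d r ρ * (∫ t, (1 - d * t ^ 2) * relFactor d r ρ t ^ (2 * (d - 1) / (d - 2)) ∂m) /
    ∫ t, relFactor d r ρ t ^ (2 * (d - 1) / (d - 2)) ∂m)

/-- The relative radial displacement: the perturbation function divided by `r` and by the length
of a Euclidean unit vector. -/
noncomputable def relDisp (m : Measure ℝ) (d r ρ t : ℝ) : ℝ :=
  (amplitude d r ρ * (1 - d * t ^ 2) + meanShift m d r ρ) *
    (centerFactor d ρ * relFactor d r ρ t) ^ (-2 / (d - 2))

/-- The derivative of `relFactor` in `t`. -/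
noncomputable def relFactorDeriv (d r ρ t : ℝ) : ℝ :=
  relSize d ρ * ((2 - d) * (r / ρ) * (1 + 2 * (r / ρ) * t + (r / ρ) ^ 2) ^ ((2 - d) / 2 - 1))

/-- The derivative of `relDisp` in `t`. -/
noncomputable def relDispDeriv (m : Measure ℝ) (d r ρ t : ℝ) : ℝ :=
  amplitude d r ρ * (-2 * d * t) * (centerFactor d ρ * relFactor d r ρ t) ^ (-2 / (d - 2)) +
  (amplitude d r ρ * (1 - d * t ^ 2) + meanShift m d r ρ) *
    (centerFactor d ρ * relFactorDeriv d r ρ t * (-2 / (d - 2)) *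
      (centerFactor d ρ * relFactor d r ρ t) ^ (-2 / (d - 2) - 1))

section Limits

variable {R d : ℝ}

theorem tendsto_snd_farLim (R : ℝ) : Tendsto (fun q : ℝ × ℝ => q.2) (farLim R) atTop :=
  tendsto_snd

theorem eventually_farLim (R : ℝ) :
    ∀ᶠ q in farLim R, 0 < q.1 ∧ q.1 ≤ R ∧ 1 ≤ q.2 ∧ 2 * R ≤ q.2 := by
  have h1 : ∀ᶠ q in farLim R, q.1 ∈ Ioc 0 R := tendsto_fst.eventually (mem_principal_self _)
  filter_upwards [h1, (tendsto_snd_farLim R).eventually_ge_atTop 1,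
    (tendsto_snd_farLim R).eventually_ge_atTop (2 * R)] with q h h' h''
  exact ⟨h.1, h.2, h', h''⟩

theorem OP.radius : OP (farLim R) (fun q => q.2) 0 fun q => q.1 :=
  OP.of_bound R ((eventually_farLim R).mono fun q h => abs_le.2 ⟨by linarith [h.1], h.2.1⟩)

theorem OP.ratio : OP (farLim R) (fun q => q.2) (-1) fun q => q.1 / q.2 :=
  (OP.radius.mul (tendsto_snd_farLim R) OP.rpow_self (by norm_num : (0 : ℝ) + -1 ≤ -1)).congr
    fun q => by rw [Real.rpow_neg_one]; rfl

theorem OP.centerFactor_rpow (hd : 3 ≤ d) (s : ℝ) :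
    OP (farLim R) (fun q => q.2) (2 - d) fun q => centerFactor d q.2 ^ s - 1 :=
  (OP.rpow_self (s := 2 - d)).one_add_rpow_sub_one (tendsto_snd_farLim R) (by linarith) s

theorem OP.centerFactor_rpow_bounded (hd : 3 ≤ d) (s : ℝ) :
    OP (farLim R) (fun q => q.2) 0 fun q => centerFactor d q.2 ^ s :=
  (OP.rpow_self (s := 2 - d)).one_add_rpow_bounded (tendsto_snd_farLim R) (by linarith) s

theorem bound_relSize (hd : 3 ≤ d) :
    OP (farLim R) (fun q => q.2) (2 - d) fun q => relSize d q.2 :=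
  ((OP.rpow_self (s := 2 - d)).mul (tendsto_snd_farLim R) (OP.centerFactor_rpow_bounded hd (-1))
    (by linarith : 2 - d + 0 ≤ 2 - d)).congr fun q => by
      rw [Real.rpow_neg_one]; rfl

theorem bound_amplitude : OP (farLim R) (fun q => q.2) (-d) fun q => amplitude d q.1 q.2 :=
  ((OP.radius.sq (tendsto_snd_farLim R) (by norm_num : (0 : ℝ) + 0 ≤ 0)).const_mul _).mul
    (tendsto_snd_farLim R) OP.rpow_self (by linarith)

/-- The limit `ρ → ∞`, uniformly in `r ∈ (0, R]` and `t ∈ [-1, 1]`. -/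
noncomputable def farLimCos (R : ℝ) : Filter ((ℝ × ℝ) × ℝ) := farLim R ×ˢ 𝓟 (Icc (-1) 1)

theorem tendsto_farLimCos (R : ℝ) :
    Tendsto (fun q : (ℝ × ℝ) × ℝ => q.1.2) (farLimCos R) atTop :=
  (tendsto_snd_farLim R).comp tendsto_fst

theorem OP.cosine : OP (farLimCos R) (fun q => q.1.2) 0 fun q => q.2 :=
  OP.of_bound 1 (eventually_prod_principal_iff.2 (Eventually.of_forall fun _ _ ht => abs_le.2 ht))

theorem OP.legendre : OP (farLimCos R) (fun q => q.1.2) 0 fun q => 1 - d * q.2 ^ 2 :=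
  (OP.const 1).sub ((OP.cosine.sq (tendsto_farLimCos R) (by norm_num)).const_mul d)

theorem bound_relFactor_sub_one (hd : 3 ≤ d) :
    OP (farLimCos R) (fun q => q.1.2) (1 - d) fun q => relFactor d q.1.1 q.1.2 q.2 - 1 :=
  ((bound_relSize hd).comp_fst.mul (tendsto_farLimCos R)
    (OP.pot (tendsto_farLimCos R) OP.ratio.comp_fst OP.cosine) (by linarith)).congr
      fun q => by simp only [relFactor]; ring

theorem bound_relFactor_rpow (hd : 3 ≤ d) (s : ℝ) :
    OP (farLimCos R) (fun q => q.1.2) (1 - d) fun q => relFactor d q.1.1 q.1.2 q.2 ^ s - 1 :=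
  ((bound_relFactor_sub_one hd).one_add_rpow_sub_one (tendsto_farLimCos R) (by linarith) s).congr
    fun q => by rw [add_sub_cancel]

theorem eventually_relFactor_pos (hd : 3 ≤ d) :
    ∀ᶠ q in farLim R, ∀ t ∈ Icc (-1 : ℝ) 1, 1 / 2 ≤ relFactor d q.1 q.2 t := by
  have := eventually_prod_principal_iff.1
    ((bound_relFactor_sub_one (R := R) hd).eventually_pos (tendsto_farLimCos R) (by linarith))
  filter_upwards [this] with q hq t ht
  have := (abs_le.1 (hq t ht)).1
  linarith

theorem centerFactor_pos {ρ : ℝ} (hρ : 0 < ρ) : 0 < centerFactor d ρ := by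
  have := Real.rpow_pos_of_pos hρ (2 - d)
  unfold centerFactor
  linarith

theorem ratio_mem {r ρ : ℝ} (hr : 0 < r) (hρ : r < ρ) : r / ρ ∈ Ioo (0 : ℝ) 1 :=
  ⟨div_pos hr (hr.trans hρ), (div_lt_one (hr.trans hρ)).2 hρ⟩

theorem factor_pos {k t ρ : ℝ} (hρ : 0 < ρ) (hk : k ∈ Ioo (-1 : ℝ) 1) (ht : t ∈ Icc (-1 : ℝ) 1) :
    0 < 1 + relSize d ρ * pot d k t := by
  have hpot : -1 < pot d k t := by
    have := Real.rpow_pos_of_pos (IsZonal.base_pos hk ht) ((2 - d) / 2)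
    unfold pot
    linarith
  have hs0 : 0 < ρ ^ (2 - d) := Real.rpow_pos_of_pos hρ _
  have hs : 0 < relSize d ρ := div_pos hs0 (centerFactor_pos hρ)
  have hs1 : relSize d ρ < 1 := by
    unfold relSize
    rw [div_lt_one (centerFactor_pos hρ)]
    unfold centerFactor
    linarith
  nlinarith

theorem relFactor_pos {r ρ t : ℝ} (hr : 0 < r) (hρ : r < ρ) (ht : t ∈ Icc (-1 : ℝ) 1) :
    0 < relFactor d r ρ t := by
  have hk := ratio_mem hr hρ
  exact factor_pos (hr.trans hρ) ⟨by linarith [hk.1], hk.2⟩ ht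

theorem hasStrictDerivAt_relFactor {r ρ t : ℝ} (hr : 0 < r) (hρ : r < ρ)
    (ht : t ∈ Icc (-1 : ℝ) 1) :
    HasStrictDerivAt (relFactor d r ρ) (relFactorDeriv d r ρ t) t := by
  have hk := ratio_mem hr hρ
  have hb := IsZonal.base_pos ⟨by linarith [hk.1], hk.2⟩ ht
  have h1 : HasStrictDerivAt (fun t : ℝ => 1 + 2 * (r / ρ) * t + (r / ρ) ^ 2) (2 * (r / ρ)) t := by
    simpa using (((hasStrictDerivAt_id t).const_mul (2 * (r / ρ))).const_add 1).add_const
      ((r / ρ) ^ 2)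
  have h2 := HasStrictDerivAt.const_mul (relSize d ρ)
    (((Real.hasStrictDerivAt_rpow_const_of_ne hb.ne' ((2 - d) / 2)).comp t h1).sub_const 1)
  have h3 := h2.const_add 1
  refine h3.congr_deriv ?_
  simp only [relFactorDeriv]
  ring

theorem hasStrictDerivAt_relDisp {m : Measure ℝ} {r ρ t : ℝ} (hr : 0 < r) (hρ : r < ρ)
    (ht : t ∈ Icc (-1 : ℝ) 1) (hz : 0 < relFactor d r ρ t) :
    HasStrictDerivAt (relDisp m d r ρ) (relDispDeriv m d r ρ t) t := by
  have hpos : 0 < centerFactor d ρ * relFactor d r ρ t :=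
    mul_pos (centerFactor_pos (hr.trans hρ)) hz
  have h1 := (Real.hasStrictDerivAt_rpow_const_of_ne hpos.ne' (-2 / (d - 2))).comp t
    ((hasStrictDerivAt_relFactor (d := d) hr hρ ht).const_mul (centerFactor d ρ))
  have h2 : HasStrictDerivAt (fun t : ℝ => amplitude d r ρ * (1 - d * t ^ 2) + meanShift m d r ρ)
      (amplitude d r ρ * (-2 * d * t)) t := by
    have := ((((hasStrictDerivAt_pow 2 t).const_mul d).const_sub 1).const_mul
      (amplitude d r ρ)).add_const (meanShift m d r ρ)
    refine this.congr_deriv ?_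
    push_cast
    ring
  refine (h2.mul h1).congr_deriv ?_
  simp only [relDispDeriv, Function.comp_apply]
  ring

theorem continuousOn_relFactor {r ρ : ℝ} (hr : 0 < r) (hρ : r < ρ) :
    ContinuousOn (relFactor d r ρ) (Icc (-1) 1) := fun _ ht =>
  (hasStrictDerivAt_relFactor hr hρ ht).hasDerivAt.continuousAt.continuousWithinAt

theorem continuousOn_relDispDeriv {m : Measure ℝ} {r ρ : ℝ} (hr : 0 < r) (hρ : r < ρ)
    (hz : ∀ t ∈ Icc (-1 : ℝ) 1, 0 < relFactor d r ρ t) :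
    ContinuousOn (relDispDeriv m d r ρ) (Icc (-1) 1) := by
  have hk := ratio_mem hr hρ
  have hpos : ∀ t ∈ Icc (-1 : ℝ) 1, centerFactor d ρ * relFactor d r ρ t ≠ 0 := fun t ht =>
    (mul_pos (centerFactor_pos (hr.trans hρ)) (hz t ht)).ne'
  have c1 := continuousOn_relFactor (d := d) hr hρ
  have c2 : ContinuousOn (relFactorDeriv d r ρ) (Icc (-1) 1) := by
    unfold relFactorDeriv
    refine continuousOn_const.mul (continuousOn_const.mul
      (ContinuousOn.rpow_const (by fun_prop) fun t ht => Or.inl ?_))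
    exact (IsZonal.base_pos ⟨by linarith [hk.1], hk.2⟩ ht).ne'
  have c3 : ∀ s : ℝ, ContinuousOn (fun t => (centerFactor d ρ * relFactor d r ρ t) ^ s)
      (Icc (-1) 1) := fun s =>
    (continuousOn_const.mul c1).rpow_const fun t ht => Or.inl (hpos t ht)
  unfold relDispDeriv
  refine ContinuousOn.add (ContinuousOn.mul (by fun_prop) (c3 _)) ?_
  exact ContinuousOn.mul (by fun_prop) (((continuousOn_const.mul c2).mul continuousOn_const).mul
    (c3 _))

end Limits

section Expansion

variable {R d : ℝ} {m : Measure ℝ}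

/-- The function `1 - d * t ^ 2` is a multiple of the degree two zonal harmonic, so it has mean
zero. -/
theorem IsZonal.integral_legendre (h : IsZonal d m) (hd : 1 < d) :
    ∫ t, (1 - d * t ^ 2) ∂m = 0 := by
  have hd0 : d ≠ 0 := by linarith
  have := h.integral_quartic hd 1 0 (-d) 0 0
  have e : ∀ t : ℝ, 1 - d * t ^ 2 = 1 + 0 * t + -d * t ^ 2 + 0 * t ^ 3 + 0 * t ^ 4 :=
    fun t => by ring
  simp only [e]
  rw [this]
  field_simp
  ring

theorem IsZonal.integral_legendre_sq (h : IsZonal d m) (hd : 1 < d) :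
    ∫ t, (1 - d * t ^ 2) ^ 2 ∂m = 2 * (d - 1) / (d + 2) := by
  have hd0 : d ≠ 0 := by linarith
  have hd2 : d + 2 ≠ 0 := by linarith
  have := h.integral_quartic hd 1 0 (-2 * d) 0 (d ^ 2)
  have e : ∀ t : ℝ, (1 - d * t ^ 2) ^ 2 = 1 + 0 * t + -2 * d * t ^ 2 + 0 * t ^ 3 + d ^ 2 * t ^ 4 :=
    fun t => by ring
  simp only [e]
  rw [this]
  field_simp
  ring

theorem OP.average {s : ℝ} {F : (ℝ × ℝ) × ℝ → ℝ} (h : IsZonal d m)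
    (hF : OP (farLimCos R) (fun q => q.1.2) s F) :
    OP (farLim R) (fun q => q.2) s fun q => ∫ t, F (q, t) ∂m := by
  have := h.prob
  unfold farLimCos at hF
  exact OP.integral (ρ := fun q : ℝ × ℝ => q.2) (T := Icc (-1) 1) h.ae_mem (tendsto_snd_farLim R) hF

theorem bound_meanShift (h : IsZonal d m) (hd : 3 ≤ d) :
    OP (farLim R) (fun q => q.2) (1 - 2 * d) fun q => meanShift m d q.1 q.2 := by
  have := h.prob
  obtain ⟨p, hp⟩ : ∃ p : ℝ, p = 2 * (d - 1) / (d - 2) := ⟨_, rfl⟩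
  have hρ := tendsto_snd_farLim R
  have hz := bound_relFactor_rpow (R := R) hd p
  have h0 : OP (farLimCos R) (fun q => q.1.2) (1 - d) fun q =>
      (1 - d * q.2 ^ 2) * (relFactor d q.1.1 q.1.2 q.2 ^ p - 1) :=
    OP.legendre.mul (tendsto_farLimCos R) hz (by linarith)
  have h1 : OP (farLim R) (fun q => q.2) (1 - d) fun q =>
      ∫ t, (1 - d * t ^ 2) * (relFactor d q.1 q.2 t ^ p - 1) ∂m := OP.average h h0
  have h2 : OP (farLim R) (fun q => q.2) (1 - d) fun q =>
      ∫ t, (relFactor d q.1 q.2 t ^ p - 1) ∂m := OP.average h hz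
  have hI : ∀ᶠ q in farLim R,
      (∫ t, (1 - d * t ^ 2) * (relFactor d q.1 q.2 t ^ p - 1) ∂m =
        ∫ t, (1 - d * t ^ 2) * relFactor d q.1 q.2 t ^ p ∂m) ∧
      ∫ t, (relFactor d q.1 q.2 t ^ p - 1) ∂m = ∫ t, relFactor d q.1 q.2 t ^ p ∂m - 1 := by
    filter_upwards [eventually_farLim R, eventually_relFactor_pos (R := R) hd] with q hq hz
    have c : ContinuousOn (fun t => relFactor d q.1 q.2 t ^ p) (Icc (-1) 1) :=
      (continuousOn_relFactor hq.1 (by linarith)).rpow_const fun t ht =>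
        Or.inl (by linarith [hz t ht])
    constructor
    · simp only [mul_sub, mul_one]
      have i1 : Integrable (fun t => (1 - d * t ^ 2) * relFactor d q.1 q.2 t ^ p) m :=
        h.integrable (ContinuousOn.mul (by fun_prop) c)
      have i2 : Integrable (fun t : ℝ => 1 - d * t ^ 2) m := h.integrable (by fun_prop)
      rw [integral_sub i1 i2, h.integral_legendre (by linarith), sub_zero]
    · rw [integral_sub (h.integrable c) (integrable_const _)]
      simp
  have h1' := h1.congr' (G := fun q => ∫ t, (1 - d * t ^ 2) * relFactor d q.1 q.2 t ^ p ∂m)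
    (hI.mono fun q hq => hq.1)
  have h2' : OP (farLim R) (fun q => q.2) (1 - d) fun q =>
      (∫ t, relFactor d q.1 q.2 t ^ p ∂m) - 1 := by
    refine h2.congr' ?_
    filter_upwards [hI] with q hq
    rw [hq.2]
  have h3 := h2'.one_add_rpow_bounded hρ (by linarith) (-1)
  have h4 : OP (farLim R) (fun q => q.2) (1 - 2 * d) fun q => amplitude d q.1 q.2 *
      (∫ t, (1 - d * t ^ 2) * relFactor d q.1 q.2 t ^ p ∂m) :=
    bound_amplitude.mul hρ h1' (by linarith)
  refine ((h4.mul hρ h3 (s'' := 1 - 2 * d) (by linarith)).neg).congr fun q => ?_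
  simp only [meanShift, ← hp]
  rw [Real.rpow_neg_one, add_sub_cancel, div_eq_mul_inv]

/-- The leading coefficient of the relative displacement. -/
noncomputable def leadCoeff (d r ρ : ℝ) : ℝ := amplitude d r ρ * centerFactor d ρ ^ (-2 / (d - 2))

theorem bound_leadCoeff (hd : 3 ≤ d) :
    OP (farLim R) (fun q => q.2) (-d) fun q => leadCoeff d q.1 q.2 :=
  bound_amplitude.mul (tendsto_snd_farLim R) (OP.centerFactor_rpow_bounded hd _) (by linarith)

theorem eventually_farLimCos (hd : 3 ≤ d) : ∀ᶠ q in farLimCos R, 0 < q.1.1 ∧ q.1.1 < q.1.2 ∧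
    q.2 ∈ Icc (-1 : ℝ) 1 ∧ 0 < relFactor d q.1.1 q.1.2 q.2 := by
  refine eventually_prod_principal_iff.2 ?_
  filter_upwards [eventually_farLim R, eventually_relFactor_pos (R := R) hd] with q hq hz t ht
  exact ⟨hq.1, by linarith, ht, by linarith [hz t ht]⟩

theorem bound_relDisp (h : IsZonal d m) (hd : 3 ≤ d) :
    OP (farLimCos R) (fun q => q.1.2) (1 - 2 * d)
      fun q => relDisp m d q.1.1 q.1.2 q.2 - leadCoeff d q.1.1 q.1.2 * (1 - d * q.2 ^ 2) := by
  have hρ := tendsto_farLimCos R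
  have hz := bound_relFactor_rpow (R := R) hd (-2 / (d - 2))
  have hz0 : OP (farLimCos R) (fun q => q.1.2) 0
      fun q => relFactor d q.1.1 q.1.2 q.2 ^ (-2 / (d - 2)) :=
    ((hz.mono hρ (by linarith)).add (OP.const 1)).congr fun q => by ring
  have a1 := ((bound_leadCoeff (R := R) hd).comp_fst.mul hρ (OP.legendre (d := d))
    (by linarith : -d + 0 ≤ -d)).mul hρ hz (by linarith : -d + (1 - d) ≤ 1 - 2 * d)
  have a2 := ((bound_meanShift (R := R) h hd).comp_fst.mul hρ
    (OP.centerFactor_rpow_bounded (R := R) hd (-2 / (d - 2))).comp_fst (s'' := 1 - 2 * d)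
    (by linarith)).mul hρ hz0 (s'' := 1 - 2 * d) (by linarith)
  refine (a1.add a2).congr' ?_
  filter_upwards [eventually_farLimCos (R := R) hd] with q hq
  simp only [relDisp, leadCoeff]
  rw [Real.mul_rpow (centerFactor_pos (hq.1.trans hq.2.1)).le hq.2.2.2.le]
  ring

theorem bound_relDispDeriv (h : IsZonal d m) (hd : 3 ≤ d) :
    OP (farLimCos R) (fun q => q.1.2) (1 - 2 * d)
      fun q => relDispDeriv m d q.1.1 q.1.2 q.2 - leadCoeff d q.1.1 q.1.2 * (-2 * d * q.2) := by
  have hρ := tendsto_farLimCos R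
  have hz := bound_relFactor_rpow (R := R) hd (-2 / (d - 2))
  have hz1 := bound_relFactor_rpow (R := R) hd (-2 / (d - 2) - 1)
  have hz0 : OP (farLimCos R) (fun q => q.1.2) 0
      fun q => relFactor d q.1.1 q.1.2 q.2 ^ (-2 / (d - 2) - 1) :=
    ((hz1.mono hρ (by linarith)).add (OP.const 1)).congr fun q => by ring
  have hc := (OP.centerFactor_rpow_bounded (R := R) hd (-2 / (d - 2))).comp_fst
    (T := 𝓟 (Icc (-1 : ℝ) 1))
  have a1 := ((bound_leadCoeff (R := R) hd).comp_fst.mul hρ (OP.cosine.const_mul (-2 * d))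
    (by linarith : -d + 0 ≤ -d)).mul hρ hz (by linarith : -d + (1 - d) ≤ 1 - 2 * d)
  have hA : OP (farLimCos R) (fun q => q.1.2) (-d) fun q =>
      amplitude d q.1.1 q.1.2 * (1 - d * q.2 ^ 2) + meanShift m d q.1.1 q.1.2 :=
    (bound_amplitude.comp_fst.mul hρ OP.legendre (by linarith)).add
      ((bound_meanShift (R := R) h hd).comp_fst.mono hρ (by linarith))
  have hk := (OP.ratio (R := R)).comp_fst (T := 𝓟 (Icc (-1 : ℝ) 1))
  have hb := (OP.base hρ hk OP.cosine).one_add_rpow_bounded hρ (by norm_num) ((2 - d) / 2 - 1)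
  have hD := (bound_relSize (R := R) hd).comp_fst.mul hρ ((hk.const_mul (2 - d)).mul hρ hb
    (by norm_num : (-1 : ℝ) + 0 ≤ -1)) (s'' := 1 - d) (by linarith)
  have a2 := hA.mul hρ ((hD.const_mul (-2 / (d - 2))).mul hρ (hc.mul hρ hz0
    (by norm_num : (0 : ℝ) + 0 ≤ 0)) (by linarith : 1 - d + 0 ≤ 1 - d))
    (by linarith : -d + (1 - d) ≤ 1 - 2 * d)
  refine (a1.add a2).congr' ?_
  filter_upwards [eventually_farLimCos (R := R) hd] with q hq
  have hc0 := centerFactor_pos (d := d) (hq.1.trans hq.2.1)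
  simp only [relDispDeriv, leadCoeff, relFactorDeriv]
  rw [Real.mul_rpow hc0.le hq.2.2.2.le, Real.mul_rpow hc0.le hq.2.2.2.le,
    Real.rpow_sub_one hc0.ne' (-2 / (d - 2))]
  have : ∀ x y : ℝ, centerFactor d q.1.2 * x * (-2 / (d - 2)) *
      (centerFactor d q.1.2 ^ (-2 / (d - 2)) / centerFactor d q.1.2 * y) =
      -2 / (d - 2) * x * (centerFactor d q.1.2 ^ (-2 / (d - 2)) * y) := fun x y => by
    field_simp
  rw [this, add_assoc 1 _ _]
  ring

end Expansion

section GraphExpansion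

variable {R : ℝ} {n : ℕ} {m : Measure ℝ}

/-! ### Expansion of area and volume of the radial graph -/

theorem eventually_relDisp (h : IsZonal n m) (hn : 3 ≤ n) :
    ∀ᶠ q in farLim R, ∀ t ∈ Icc (-1 : ℝ) 1, |relDisp m n q.1 q.2 t| ≤ 1 / 2 := by
  have hd : (3 : ℝ) ≤ n := by exact_mod_cast hn
  have hρ := tendsto_farLimCos R
  have h1 : OP (farLimCos R) (fun q => q.1.2) (-n) fun q => relDisp m n q.1.1 q.1.2 q.2 :=
    (((bound_relDisp (R := R) h hd).mono hρ (by linarith)).add ((bound_leadCoeff hd).comp_fst.mul hρ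
      (OP.legendre (d := n)) (by linarith))).congr fun q => by ring
  exact eventually_prod_principal_iff.1 (h1.eventually_pos hρ (by linarith))

theorem continuousOn_relDisp (hn : 3 ≤ n) : ∀ᶠ q in farLim R,
    ContinuousOn (fun t => relDisp m n q.1 q.2 t) (Icc (-1) 1) := by
  have hd : (3 : ℝ) ≤ n := by exact_mod_cast hn
  filter_upwards [eventually_farLim R, eventually_relFactor_pos (R := R) hd] with q hq hz t ht
  exact (hasStrictDerivAt_relDisp hq.1 (by linarith) ht
    (by linarith [hz t ht])).hasDerivAt.continuousAt.continuousWithinAt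

/-- The area element of the radial graph of `1 + relDisp` relative to that of the unit sphere. -/
noncomputable def areaWeight (m : Measure ℝ) (n : ℕ) (r ρ t : ℝ) : ℝ :=
  (1 + relDisp m n r ρ t) ^ (n - 2) *
    √((1 + relDisp m n r ρ t) ^ 2 + relDispDeriv m n r ρ t ^ 2 * (1 - t ^ 2))

/-- The area element up to `O(ρ ^ (-2 n - 1))`; its quadratic part collects `(1 + φ) ^ (n - 1)` and
half the squared slope of the graph. -/
theorem bound_areaWeight (h : IsZonal n m) (hn : 3 ≤ n) :
    OP (farLimCos R) (fun q => q.1.2) (-2 * n - 1) fun q =>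
      areaWeight m n q.1.1 q.1.2 q.2 - (1 + ((n : ℝ) - 1) * relDisp m n q.1.1 q.1.2 q.2 +
        (leadCoeff n q.1.1 q.1.2) ^ 2 * (((n : ℝ) - 1) * (n - 2) / 2 * (1 - n * q.2 ^ 2) ^ 2 +
          2 * n ^ 2 * (q.2 ^ 2 - q.2 ^ 4))) := by
  obtain ⟨d, hdn⟩ : ∃ d : ℝ, d = n := ⟨_, rfl⟩
  rw [← hdn] at h ⊢
  have hd : 3 ≤ d := by rw [hdn]; exact_mod_cast hn
  have hρ := tendsto_farLimCos R
  have hφ := bound_relDisp (R := R) h hd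
  have hφ' := bound_relDispDeriv (R := R) h hd
  have hg := (bound_leadCoeff (R := R) hd).comp_fst (T := 𝓟 (Icc (-1 : ℝ) 1))
  have ht := OP.cosine (R := R)
  have hψ := OP.legendre (R := R) (d := d)
  set φ : (ℝ × ℝ) × ℝ → ℝ := fun q => relDisp m d q.1.1 q.1.2 q.2 with hφdef
  set φ' : (ℝ × ℝ) × ℝ → ℝ := fun q => relDispDeriv m d q.1.1 q.1.2 q.2 with hφ'def
  set g : (ℝ × ℝ) × ℝ → ℝ := fun q => leadCoeff d q.1.1 q.1.2 with hgdef
  have hgψ : OP (farLimCos R) (fun q => q.1.2) (-d) fun q => g q * (1 - d * q.2 ^ 2) :=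
    hg.mul hρ hψ (by linarith)
  have hgt : OP (farLimCos R) (fun q => q.1.2) (-d) fun q => g q * (-2 * d * q.2) :=
    hg.mul hρ (ht.const_mul _) (by linarith)
  have hφo : OP (farLimCos R) (fun q => q.1.2) (-d) φ :=
    ((hφ.mono hρ (by linarith)).add hgψ).congr fun q => by ring
  have hφ'o : OP (farLimCos R) (fun q => q.1.2) (-d) φ' :=
    ((hφ'.mono hρ (by linarith)).add hgt).congr fun q => by ring
  have hφ2 : OP (farLimCos R) (fun q => q.1.2) (1 - 3 * d) fun q =>
      φ q ^ 2 - (g q * (1 - d * q.2 ^ 2)) ^ 2 :=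
    (OP.mul_sub_mul hρ hφ hφo hgψ hφ (by linarith) (by linarith)).congr fun q => by ring
  have hφ'2 : OP (farLimCos R) (fun q => q.1.2) (1 - 3 * d) fun q =>
      φ' q ^ 2 - (g q * (-2 * d * q.2)) ^ 2 :=
    (OP.mul_sub_mul hρ hφ' hφ'o hgt hφ' (by linarith) (by linarith)).congr fun q => by ring
  have hs : OP (farLimCos R) (fun q => q.1.2) 0 fun q => 1 - q.2 ^ 2 :=
    (OP.const 1).sub (ht.sq hρ (by norm_num))
  have hq2 : OP (farLimCos R) (fun q => q.1.2) (-2 * d) fun q => φ' q ^ 2 * (1 - q.2 ^ 2) :=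
    (hφ'o.sq hρ (s'' := -2 * d) (by linarith)).mul hρ hs (by linarith)
  have hinv := hφo.one_add_rpow_sub_one hρ (by linarith) (-2)
  have hinv0 := hφo.one_add_rpow_bounded hρ (by linarith) (-2)
  have hQ : OP (farLimCos R) (fun q => q.1.2) (-2 * d)
    fun q => φ' q ^ 2 * (1 - q.2 ^ 2) * (1 + φ q) ^ (-2 : ℝ) := hq2.mul hρ hinv0 (by linarith)
  set Q : (ℝ × ℝ) × ℝ → ℝ := fun q => φ' q ^ 2 * (1 - q.2 ^ 2) * (1 + φ q) ^ (-2 : ℝ) with hQdef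
  have hQ1 : OP (farLimCos R) (fun q => q.1.2) (-2 * d - 1)
      fun q => Q q - (g q * (-2 * d * q.2)) ^ 2 * (1 - q.2 ^ 2) :=
    ((hq2.mul hρ hinv (by linarith)).add (hφ'2.mul hρ hs (by linarith))).congr fun q => by
      simp only [hQdef]; ring
  have hsq := (hQ.one_add_rpow hρ (by linarith) (1 / 2)).mono hρ
    (by linarith : 2 * (-2 * d) ≤ -2 * d - 1)
  have hp4 := (hφo.one_add_rpow_four hρ (by linarith) (d - 1)).mono hρ
    (by linarith : 4 * -d ≤ -2 * d - 1)
  have hφ3 : OP (farLimCos R) (fun q => q.1.2) (-2 * d - 1) fun q => φ q ^ 3 :=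
    hφo.pow hρ 3 (by push_cast; linarith)
  have hps := hφo.one_add_rpow_sub_one hρ (by linarith) (d - 1)
  have hpb := hφo.one_add_rpow_bounded hρ (by linarith) (d - 1)
  have e1 := hpb.mul hρ hsq (s'' := -2 * d - 1) (by linarith)
  have e2 := hps.mul hρ (hQ.const_mul (1 / 2)) (s'' := -2 * d - 1) (by linarith)
  have e3 := hQ1.const_mul (1 / 2)
  have e4 := hφ3.const_mul ((d - 1) * (d - 1 - 1) * (d - 1 - 2) / 6)
  have e5 := (hφ2.mono hρ (by linarith : 1 - 3 * d ≤ -2 * d - 1)).const_mul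
    ((d - 1) * (d - 1 - 1) / 2)
  refine (((e1.add e2).add (e3.add e4)).add (hp4.add e5)).congr' ?_
  filter_upwards [hφo.eventually_pos hρ (by linarith), eventually_farLimCos (R := R) hd]
    with q hq hq'
  have h1φ : 0 < 1 + φ q := by linarith [(abs_le.1 hq).1]
  have hQ0 : 0 ≤ Q q := by
    have : q.2 ^ 2 ≤ 1 := by nlinarith [hq'.2.2.1.1, hq'.2.2.1.2]
    exact mul_nonneg (mul_nonneg (sq_nonneg _) (by linarith)) (Real.rpow_nonneg h1φ.le _)
  have hW : areaWeight m n q.1.1 q.1.2 q.2 = (1 + φ q) ^ (d - 1) * (1 + Q q) ^ (1 / 2 : ℝ) := by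
    have c1 : (1 + φ q) ^ (2 : ℝ) * (1 + φ q) ^ (-2 : ℝ) = 1 := by
      rw [← Real.rpow_add h1φ]; norm_num
    have c2 : (1 + φ q) ^ 2 + φ' q ^ 2 * (1 - q.2 ^ 2) = (1 + φ q) ^ (2 : ℝ) * (1 + Q q) := by
      simp only [hQdef, mul_add, mul_one]
      rw [Real.rpow_two] at c1 ⊢
      linear_combination (-(φ' q ^ 2 * (1 - q.2 ^ 2))) * c1
    have c3 : (1 + φ q) ^ (n - 2) = (1 + φ q) ^ (d - 2) := by
      rw [← Real.rpow_natCast, Nat.cast_sub (by omega), hdn]; rfl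
    simp only [areaWeight, ← hdn]
    change (1 + φ q) ^ (n - 2) * √((1 + φ q) ^ 2 + φ' q ^ 2 * (1 - q.2 ^ 2)) = _
    rw [c2, c3, Real.sqrt_eq_rpow, Real.mul_rpow (Real.rpow_nonneg h1φ.le _) (by linarith),
      ← Real.rpow_mul h1φ.le, ← mul_assoc, ← Real.rpow_add h1φ]
    congr 2
    ring
  rw [hW]
  ring

theorem average_weight (h : IsZonal n m) (hn : 3 ≤ n) (g A B : ℝ) :
    ∫ t, g ^ 2 * (A * (1 - n * t ^ 2) ^ 2 + B * (t ^ 2 - t ^ 4)) ∂m =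
      g ^ 2 * (A * (2 * (n - 1) / (n + 2)) + B * ((n - 1) / (n * (n + 2)))) := by
  have hd : (1 : ℝ) < n := by exact_mod_cast (by omega : 1 < n)
  have hd0 : (n : ℝ) ≠ 0 := by linarith
  have hd2 : (n : ℝ) + 2 ≠ 0 := by linarith
  have e : ∀ t : ℝ, g ^ 2 * (A * (1 - n * t ^ 2) ^ 2 + B * (t ^ 2 - t ^ 4)) =
      g ^ 2 * A + 0 * t + g ^ 2 * (-2 * n * A + B) * t ^ 2 + 0 * t ^ 3 +
        g ^ 2 * (A * n ^ 2 - B) * t ^ 4 := fun t => by ring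
  simp only [e]
  rw [h.integral_quartic hd]
  field_simp
  ring

/-- The area of the radial graph relative to its leading term. -/
noncomputable def areaMean (m : Measure ℝ) (n : ℕ) (r ρ : ℝ) : ℝ :=
  ∫ t, (1 + relSize n ρ * pot n (r / ρ * (1 + relDisp m n r ρ t)) t) ^
    (2 * ((n : ℝ) - 1) / (n - 2)) * areaWeight m n r ρ t ∂m

/-- The area of the radial graph, with the mean of `relDisp` kept as an exact term. It will cancel
in the isoperimetric ratio. -/
theorem areaMean_expansion (h : IsZonal n m) (hn : 3 ≤ n) :
    OP (farLim R) (fun q => q.2) (-2 * n - 1) fun q => areaMean m n q.1 q.2 -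
      (1 + (((n : ℝ) - 1) * (relSize n q.2 ^ 2 * (q.1 / q.2) ^ 2) +
          n * (n - 1) ^ 2 / (2 * (n + 2)) * (relSize n q.2 ^ 2 * (q.1 / q.2) ^ 4)) -
        2 * (n - 1) ^ 2 * (n + 1) / (n + 2) *
          (relSize n q.2 * (q.1 / q.2) ^ 2 * leadCoeff n q.1 q.2) +
        (n - 1) * (∫ t, relDisp m n q.1 q.2 t ∂m) +
        leadCoeff n q.1 q.2 ^ 2 * ((n - 1) / (n + 2) * ((n - 1) * (n - 2) + 2 * n))) := by
  have hd : (3 : ℝ) ≤ n := by exact_mod_cast hn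
  have hd2 : (n : ℝ) - 2 ≠ 0 := by linarith
  have hd2' : (n : ℝ) + 2 ≠ 0 := by linarith
  have hd0 : (n : ℝ) ≠ 0 := by linarith
  have hφ := bound_relDisp (R := R) h hd
  have hW := bound_areaWeight (R := R) h hn
  have hg := bound_leadCoeff (R := R) hd
  have hw₂ : OP (farLimCos R) (fun q => q.1.2) (-2 * n) fun q => (leadCoeff n q.1.1 q.1.2) ^ 2 *
      (((n : ℝ) - 1) * (n - 2) / 2 * (1 - n * q.2 ^ 2) ^ 2 + 2 * n ^ 2 * (q.2 ^ 2 - q.2 ^ 4)) := by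
    have hρ := tendsto_farLimCos R
    refine (hg.comp_fst.sq hρ (s'' := -2 * n) (by linarith)).mul hρ (s' := 0) ?_ (by linarith)
    exact ((OP.legendre.sq hρ (by norm_num)).const_mul _).add
      (((OP.cosine.sq hρ (by norm_num)).sub (OP.cosine.pow hρ 4 (by norm_num))).const_mul _)
  unfold farLimCos at hφ hW hw₂
  have key := h.integral_weighted_factor (s := 2 * ((n : ℝ) - 1) / (n - 2)) (w₁ := (n : ℝ) - 1) hd
    (tendsto_snd_farLim R) OP.ratio ((eventually_farLim R).mono fun q hq => by
      have := hq.2.2.1; exact div_nonneg hq.1.le (by linarith)) (bound_relSize hd) hg hφ hw₂ hW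
    (continuousOn_relDisp hn) ?_ (Eventually.of_forall fun q => by dsimp only; fun_prop)
  · refine key.congr fun q => ?_
    simp only [average_weight h hn]
    change areaMean m n q.1 q.2 - _ = _
    congr 1
    generalize leadCoeff (n : ℝ) q.1 q.2 = g
    generalize ∫ t, relDisp m n q.1 q.2 t ∂m = I
    generalize relSize (n : ℝ) q.2 = η
    generalize q.1 / q.2 = κ
    field_simp
    ring
  · filter_upwards [eventually_farLim R, eventually_relFactor_pos (R := R) hd,
      continuousOn_relDisp (R := R) hn] with q hq hz hc
    have hc' := continuousOn_relDispDeriv (m := m) (d := n) hq.1 (by linarith)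
      (fun t ht => by linarith [hz t ht] : ∀ t ∈ Icc (-1 : ℝ) 1, 0 < relFactor n q.1 q.2 t)
    unfold areaWeight
    have hc1 := (continuousOn_const (c := (1 : ℝ))).add hc
    exact (hc1.pow _).mul (ContinuousOn.sqrt ((hc1.pow 2).add ((hc'.pow 2).mul (by fun_prop))))

/-! ### Expansion of the enclosed volume -/

theorem IsZonal.integrable_prod {d : ℝ} (h : IsZonal d m) {F : ℝ × ℝ → ℝ}
    (hF : ContinuousOn F (Icc 0 1 ×ˢ Icc (-1) 1)) :
    Integrable F ((volume.restrict (Icc (0 : ℝ) 1)).prod m) := by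
  have := h.prob
  have e : (volume.restrict (Icc (0 : ℝ) 1)).prod m =
      ((volume : Measure ℝ).prod m).restrict (Icc 0 1 ×ˢ Icc (-1) 1) := by
    rw [← Measure.prod_restrict, Measure.restrict_eq_self_of_ae_mem h.ae_mem]
  rw [e]
  exact hF.integrableOn_compact (isCompact_Icc.prod isCompact_Icc)

theorem integral_mul_pow_Icc (hn : 1 ≤ n) (k : ℕ) :
    ∫ x in Icc (0 : ℝ) 1, (n : ℝ) * x ^ (n - 1) * x ^ k = n / (n + k) := by
  have h0 : (n : ℝ) + k ≠ 0 := by positivity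
  have e : ∀ x : ℝ, (n : ℝ) * x ^ (n - 1) * x ^ k = n * x ^ (n - 1 + k) := fun x => by
    rw [pow_add]; ring
  simp only [e]
  rw [integral_Icc_eq_integral_Ioc, ← intervalIntegral.integral_of_le zero_le_one,
    intervalIntegral.integral_const_mul, integral_pow]
  have : ((n - 1 + k : ℕ) : ℝ) + 1 = n + k := by
    rw [Nat.cast_add, Nat.cast_sub hn]; push_cast; ring
  rw [this]
  simp
  ring

/-- Integration in the radial variable `x ∈ [0, 1]`, with density `n * x ^ (n - 1)`, of an expansion
in even powers of `x`. -/
theorem OP.radial_average {s : ℝ} (hn : 1 ≤ n) {F : (ℝ × ℝ) × ℝ → ℝ} {c₀ c₂ c₄ : ℝ × ℝ → ℝ}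
    (h : OP (farLim R ×ˢ 𝓟 (Icc (0 : ℝ) 1)) (fun q => q.1.2) s fun q =>
      F q - (c₀ q.1 + c₂ q.1 * q.2 ^ 2 + c₄ q.1 * q.2 ^ 4))
    (hi : ∀ᶠ q in farLim R, IntegrableOn (fun x : ℝ => n * x ^ (n - 1) * F (q, x)) (Icc 0 1)) :
    OP (farLim R) (fun q => q.2) s fun q => (∫ x in Icc (0 : ℝ) 1, n * x ^ (n - 1) * F (q, x)) -
      (c₀ q + n / (n + 2) * c₂ q + n / (n + 4) * c₄ q) := by
  have hp : IsProbabilityMeasure (volume.restrict (Icc (0 : ℝ) 1)) := ⟨by simp⟩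
  have hρ := tendsto_snd_farLim R
  have hx : OP (farLim R ×ˢ 𝓟 (Icc (0 : ℝ) 1)) (fun q => q.1.2) 0
      fun q => (n : ℝ) * q.2 ^ (n - 1) := by
    refine OP.of_bound n (eventually_prod_principal_iff.2 (Eventually.of_forall fun q x hx => ?_))
    dsimp only
    rw [abs_mul, abs_pow, abs_of_nonneg hx.1, Nat.abs_cast]
    exact mul_le_of_le_one_right (Nat.cast_nonneg n) (pow_le_one₀ hx.1 hx.2)
  have h1 := hx.mul (hρ.comp tendsto_fst) h (zero_add s).le
  have h2 := OP.integral (ρ := fun q : ℝ × ℝ => q.2) (T := Icc (0 : ℝ) 1)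
    (m := volume.restrict (Icc (0 : ℝ) 1))
    (ae_restrict_mem measurableSet_Icc) hρ h1
  refine h2.congr' ?_
  filter_upwards [hi] with q hq
  have i0 : IntegrableOn (fun x : ℝ => c₀ q * (n * x ^ (n - 1) * x ^ 0)) (Icc 0 1) :=
    Continuous.integrableOn_Icc (by fun_prop)
  have i2 : IntegrableOn (fun x : ℝ => c₂ q * (n * x ^ (n - 1) * x ^ 2)) (Icc 0 1) :=
    Continuous.integrableOn_Icc (by fun_prop)
  have i4 : IntegrableOn (fun x : ℝ => c₄ q * (n * x ^ (n - 1) * x ^ 4)) (Icc 0 1) :=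
    Continuous.integrableOn_Icc (by fun_prop)
  have i02 : IntegrableOn (fun x : ℝ => c₀ q * (n * x ^ (n - 1) * x ^ 0) +
      c₂ q * (n * x ^ (n - 1) * x ^ 2)) (Icc 0 1) := i0.add i2
  have i024 : IntegrableOn (fun x : ℝ => c₀ q * (n * x ^ (n - 1) * x ^ 0) +
      c₂ q * (n * x ^ (n - 1) * x ^ 2) + c₄ q * (n * x ^ (n - 1) * x ^ 4)) (Icc 0 1) := i02.add i4
  have e : ∀ x : ℝ, n * x ^ (n - 1) * (F (q, x) - (c₀ q + c₂ q * x ^ 2 + c₄ q * x ^ 4)) =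
      n * x ^ (n - 1) * F (q, x) - (c₀ q * (n * x ^ (n - 1) * x ^ 0) +
      c₂ q * (n * x ^ (n - 1) * x ^ 2) + c₄ q * (n * x ^ (n - 1) * x ^ 4)) := fun x => by ring
  have hn0 : (n : ℝ) ≠ 0 := by positivity
  simp only [e]
  rw [integral_sub hq i024, integral_add i02 i4, integral_add i0 i2, integral_const_mul,
    integral_const_mul, integral_const_mul, integral_mul_pow_Icc hn, integral_mul_pow_Icc hn,
    integral_mul_pow_Icc hn]
  push_cast
  rw [add_zero, div_self hn0]
  ring

/-- The integrand of the volume of the region enclosed by the radial graph of `1 + φ`, in polar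
coordinates scaled to `x ∈ [0, 1]`, relative to its leading term. -/
noncomputable def volIntegrand (φ : ℝ → ℝ) (n : ℕ) (r ρ x t : ℝ) : ℝ :=
  (1 + relSize n ρ * pot n (x * (r / ρ) * (1 + φ t)) t) ^ (2 * (n : ℝ) / (n - 2)) * (1 + φ t) ^ n

/-- The volume of the region enclosed by the radial graph of `1 + φ`, relative to its leading
term. -/
noncomputable def volMean (φ : ℝ → ℝ) (m : Measure ℝ) (n : ℕ) (r ρ : ℝ) : ℝ :=
  ∫ x in Icc (0 : ℝ) 1, n * x ^ (n - 1) * ∫ t, volIntegrand φ n r ρ x t ∂m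

theorem volIntegrand_base_pos {φ : ℝ × ℝ → ℝ → ℝ} (hn : 3 ≤ n)
    (hφb : ∀ᶠ q in farLim R, ∀ t ∈ Icc (-1 : ℝ) 1, |φ q t| ≤ 1 / 2) :
    ∀ᶠ q in farLim R, ∀ x ∈ Icc (0 : ℝ) 1, ∀ t ∈ Icc (-1 : ℝ) 1,
      x * (q.1 / q.2) * (1 + φ q t) ∈ Ico (0 : ℝ) 1 ∧
      0 < 1 + relSize n q.2 * pot n (x * (q.1 / q.2) * (1 + φ q t)) t := by
  have hd : (3 : ℝ) ≤ n := by exact_mod_cast hn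
  filter_upwards [hφb, eventually_farLim R, OP.ratio.eventually_pos (tendsto_snd_farLim R)
    (by norm_num)] with q hφ hq hκ x hx t ht
  have h1 := abs_le.1 (hφ t ht)
  have h2 := (abs_le.1 hκ).2
  have hρ : 0 < q.2 := by linarith [hq.2.2.1]
  have hκ0 : 0 < q.1 / q.2 := div_pos hq.1 hρ
  have hxk : 0 ≤ x * (q.1 / q.2) := mul_nonneg hx.1 hκ0.le
  have hxk' : x * (q.1 / q.2) ≤ 1 / 2 := by nlinarith [hx.2]
  have hk : x * (q.1 / q.2) * (1 + φ q t) ∈ Ico (0 : ℝ) 1 := by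
    constructor
    · exact mul_nonneg hxk (by linarith)
    · nlinarith
  exact ⟨hk, factor_pos hρ ⟨by linarith [hk.1], hk.2⟩ ht⟩

theorem continuousOn_volIntegrand {φ : ℝ × ℝ → ℝ → ℝ} (hn : 3 ≤ n)
    (hφb : ∀ᶠ q in farLim R, ∀ t ∈ Icc (-1 : ℝ) 1, |φ q t| ≤ 1 / 2)
    (hφc : ∀ᶠ q in farLim R, ContinuousOn (φ q) (Icc (-1) 1)) :
    ∀ᶠ q in farLim R, ContinuousOn (fun z : ℝ × ℝ => volIntegrand (φ q) n q.1 q.2 z.1 z.2)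
      (Icc 0 1 ×ˢ Icc (-1) 1) := by
  filter_upwards [hφc, volIntegrand_base_pos hn hφb] with q hc hb
  have c1 : ContinuousOn (fun z : ℝ × ℝ => 1 + φ q z.2) (Icc 0 1 ×ˢ Icc (-1) 1) :=
    continuousOn_const.add (hc.comp continuousOn_snd fun z hz => hz.2)
  have c2 : ContinuousOn (fun z : ℝ × ℝ => z.1 * (q.1 / q.2) * (1 + φ q z.2))
      (Icc 0 1 ×ˢ Icc (-1) 1) := ContinuousOn.mul (by fun_prop) c1
  unfold volIntegrand pot
  refine ContinuousOn.mul (ContinuousOn.rpow_const (continuousOn_const.add (continuousOn_const.mul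
    (ContinuousOn.sub (ContinuousOn.rpow_const ?_ fun z hz => Or.inl ?_) continuousOn_const)))
    fun z hz => Or.inl (hb z.1 hz.1 z.2 hz.2).2.ne') (c1.pow n)
  · exact (continuousOn_const.add ((continuousOn_const.mul c2).mul continuousOn_snd)).add (c2.pow 2)
  · have := (hb z.1 hz.1 z.2 hz.2).1
    exact (IsZonal.base_pos ⟨by linarith [this.1], this.2⟩ hz.2).ne'

/-- The volume enclosed by a radial graph with displacement `g * (1 - n * t ^ 2)` to leading order.
It is used for the coordinate ball (`φ = 0`) and for `relDisp`. -/
theorem volMean_expansion_general (h : IsZonal n m) (hn : 3 ≤ n) {φ : ℝ × ℝ → ℝ → ℝ} {g : ℝ × ℝ → ℝ}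
    (hg : OP (farLim R) (fun q => q.2) (-n) g)
    (hφ : OP (farLimCos R) (fun q => q.1.2) (1 - 2 * n)
      fun q => φ q.1 q.2 - g q.1 * (1 - n * q.2 ^ 2))
    (hφb : ∀ᶠ q in farLim R, ∀ t ∈ Icc (-1 : ℝ) 1, |φ q t| ≤ 1 / 2)
    (hφc : ∀ᶠ q in farLim R, ContinuousOn (φ q) (Icc (-1) 1)) :
    OP (farLim R) (fun q => q.2) (-2 * n - 1) fun q => volMean (φ q) m n q.1 q.2 -
      (1 + (n * (relSize n q.2 ^ 2 * (q.1 / q.2) ^ 2) +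
          n ^ 2 * (n - 1) / (2 * (n + 4)) * (relSize n q.2 ^ 2 * (q.1 / q.2) ^ 4)) -
        2 * n ^ 2 * (n - 1) / (n + 2) * (relSize n q.2 * (q.1 / q.2) ^ 2 * g q) +
        n * (∫ t, φ q t ∂m) + g q ^ 2 * (n * (n - 1) ^ 2 / (n + 2))) := by
  have hd : (3 : ℝ) ≤ n := by exact_mod_cast hn
  have hd2 : (n : ℝ) - 2 ≠ 0 := by linarith
  have hd2' : (n : ℝ) + 2 ≠ 0 := by linarith
  have hd4' : (n : ℝ) + 4 ≠ 0 := by linarith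
  have hd0 : (n : ℝ) ≠ 0 := by linarith
  have hρc := tendsto_farLimCos R
  -- the expansion of the weight `(1 + φ) ^ n`
  have hφd : OP (farLimCos R) (fun q => q.1.2) (-n) fun q => φ q.1 q.2 :=
    ((hφ.mono hρc (by linarith)).add (hg.comp_fst.mul hρc (OP.legendre (d := n))
      (by linarith))).congr fun q => by ring
  have hgψ : OP (farLimCos R) (fun q => q.1.2) (-n) fun q => g q.1 * (1 - n * q.2 ^ 2) :=
    hg.comp_fst.mul hρc OP.legendre (by linarith)
  have hφ2 : OP (farLimCos R) (fun q => q.1.2) (-2 * n - 1) fun q =>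
      φ q.1 q.2 ^ 2 - (g q.1 * (1 - n * q.2 ^ 2)) ^ 2 :=
    (OP.mul_sub_mul hρc hφ hφd hgψ hφ (by linarith) (by linarith)).congr fun q => by ring
  have hφ3 : OP (farLimCos R) (fun q => q.1.2) (-2 * n - 1) fun q => φ q.1 q.2 ^ 3 :=
    hφd.pow hρc 3 (by push_cast; linarith)
  have hW : OP (farLimCos R) (fun q => q.1.2) (-2 * n - 1) fun q => (1 + φ q.1 q.2) ^ n -
      (1 + n * φ q.1 q.2 + n * (n - 1) / 2 * (g q.1 ^ 2 * (1 - n * q.2 ^ 2) ^ 2)) := by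
    have := (hφd.one_add_rpow_four hρc (by linarith) n).mono hρc
      (by linarith : 4 * -(n : ℝ) ≤ -2 * n - 1)
    refine ((this.add (hφ3.const_mul ((n : ℝ) * (n - 1) * (n - 2) / 6))).add
      (hφ2.const_mul ((n : ℝ) * (n - 1) / 2))).congr fun q => ?_
    rw [Real.rpow_natCast]
    ring
  have hw₂ : OP (farLimCos R) (fun q => q.1.2) (-2 * n) fun q =>
      (n : ℝ) * (n - 1) / 2 * (g q.1 ^ 2 * (1 - n * q.2 ^ 2) ^ 2) :=
    ((hg.comp_fst.sq hρc (s'' := -2 * n) (by linarith)).mul hρc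
      (OP.legendre.sq hρc (by norm_num : (0 : ℝ) + 0 ≤ 0)) (by linarith)).const_mul _
  -- everything is uniform in the scaling factor `x`
  have hmap : Tendsto (fun q : ((ℝ × ℝ) × ℝ) × ℝ => (q.1.1, q.2))
      ((farLim R ×ˢ 𝓟 (Icc (0 : ℝ) 1)) ×ˢ 𝓟 (Icc (-1) 1)) (farLimCos R) :=
    (tendsto_fst.comp tendsto_fst).prodMk tendsto_snd
  have hfst : Tendsto (fun q : (ℝ × ℝ) × ℝ => q.1) (farLim R ×ˢ 𝓟 (Icc (0 : ℝ) 1)) (farLim R) :=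
    tendsto_fst
  have hx : OP (farLim R ×ˢ 𝓟 (Icc (0 : ℝ) 1)) (fun q => q.1.2) 0 fun q => q.2 :=
    OP.of_bound 1 (eventually_prod_principal_iff.2 (Eventually.of_forall fun q x hx =>
      abs_le.2 ⟨by linarith [hx.1], hx.2⟩))
  have hρx := (tendsto_snd_farLim R).comp hfst
  have key := h.integral_weighted_factor (l := farLim R ×ˢ 𝓟 (Icc (0 : ℝ) 1))
    (ρ := fun q => q.1.2) (κ := fun q => q.2 * (q.1.1 / q.1.2)) (η := fun q => relSize n q.1.2)
    (g := fun q => g q.1) (φ := fun q => φ q.1.1 q.2) (W := fun q => (1 + φ q.1.1 q.2) ^ n)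
    (w₂ := fun q => (n : ℝ) * (n - 1) / 2 * (g q.1.1 ^ 2 * (1 - n * q.2 ^ 2) ^ 2))
    (s := 2 * (n : ℝ) / (n - 2)) (w₁ := n) hd hρx
    (hx.mul hρx OP.ratio.comp_fst (by norm_num)) (eventually_prod_principal_iff.2
      ((eventually_farLim R).mono fun q hq x hx =>
        mul_nonneg hx.1 (div_nonneg hq.1.le (by linarith [hq.2.2.1]))))
    (bound_relSize hd).comp_fst hg.comp_fst (IsBigO.comp_tendsto hφ hmap)
    (IsBigO.comp_tendsto hw₂ hmap) (IsBigO.comp_tendsto hW hmap)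
    (hfst.eventually hφc)
    ((hfst.eventually hφc).mono fun q hq => (continuousOn_const.add hq).pow n)
    (Eventually.of_forall fun q => by dsimp only; fun_prop)
  have hw : ∀ g : ℝ, ∫ t, (n : ℝ) * (n - 1) / 2 * (g ^ 2 * (1 - n * t ^ 2) ^ 2) ∂m =
      g ^ 2 * (n * (n - 1) ^ 2 / (n + 2)) := by
    intro g
    rw [integral_const_mul, integral_const_mul, h.integral_legendre_sq (by linarith)]
    field_simp
  simp only [hw] at key
  have key2 := OP.radial_average (n := n) (by omega)
    (F := fun q => ∫ t, volIntegrand (φ q.1) n q.1.1 q.1.2 q.2 t ∂m)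
    (c₀ := fun q => 1 + n * (∫ t, φ q t ∂m) + g q ^ 2 * (n * (n - 1) ^ 2 / (n + 2)))
    (c₂ := fun q => n * (n + 2) / n * (relSize n q.2 ^ 2 * (q.1 / q.2) ^ 2) -
      2 * n * (n - 1) * (relSize n q.2 * (q.1 / q.2) ^ 2 * g q))
    (c₄ := fun q => n * (n - 1) / 2 * (relSize n q.2 ^ 2 * (q.1 / q.2) ^ 4))
    (key.congr fun q => ?_) ?_
  · refine key2.congr fun q => ?_
    change volMean (φ q) m n q.1 q.2 - _ = _
    congr 1
    generalize g q = g
    generalize ∫ t, φ q t ∂m = I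
    generalize relSize (n : ℝ) q.2 = η
    generalize q.1 / q.2 = κ
    field_simp
    ring
  · change (∫ t, volIntegrand (φ q.1) n q.1.1 q.1.2 q.2 t ∂m) - _ = _
    congr 1
    generalize g q.1 = g
    generalize ∫ t, φ q.1 t ∂m = I
    generalize relSize (n : ℝ) q.1.2 = η
    generalize q.1.1 / q.1.2 = κ
    field_simp
    ring
  · filter_upwards [continuousOn_volIntegrand hn hφb hφc] with q hq
    have := h.prob
    have h1 := (h.integrable_prod hq).integral_prod_left
    have hb : ∀ᵐ x ∂volume.restrict (Icc (0 : ℝ) 1), ‖(n : ℝ) * x ^ (n - 1)‖ ≤ n := by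
      filter_upwards [ae_restrict_mem measurableSet_Icc] with x hx
      rw [norm_mul, norm_pow, Real.norm_of_nonneg hx.1, Real.norm_of_nonneg (Nat.cast_nonneg n)]
      exact mul_le_of_le_one_right (Nat.cast_nonneg n) (pow_le_one₀ hx.1 hx.2)
    exact h1.bdd_mul (by fun_prop) hb

/-! ### The isoperimetric ratio of the radial graph -/

theorem bound_average_relDisp (h : IsZonal n m) (hn : 3 ≤ n) :
    OP (farLim R) (fun q => q.2) (1 - 2 * n) fun q => ∫ t, relDisp m n q.1 q.2 t ∂m := by
  have hd : (3 : ℝ) ≤ n := by exact_mod_cast hn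
  refine (OP.average h (bound_relDisp (R := R) h hd)).congr' ?_
  filter_upwards [continuousOn_relDisp (R := R) (m := m) hn] with q hq
  rw [integral_sub (h.integrable hq) (h.integrable (by fun_prop)), integral_const_mul,
    h.integral_legendre (by linarith), mul_zero, sub_zero]

/-- The area of the round sphere relative to its leading term. -/
noncomputable def sphereMean (m : Measure ℝ) (n : ℕ) (r ρ : ℝ) : ℝ :=
  ∫ t, relFactor n r ρ t ^ (2 * ((n : ℝ) - 1) / (n - 2)) ∂m

theorem sphereMean_expansion_aux (h : IsZonal n m) (hn : 3 ≤ n) :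
    OP (farLim R) (fun q => q.2) (-2 * n - 1) fun q => sphereMean m n q.1 q.2 -
      (1 + (((n : ℝ) - 1) * (relSize n q.2 ^ 2 * (q.1 / q.2) ^ 2) +
          n * (n - 1) ^ 2 / (2 * (n + 2)) * (relSize n q.2 ^ 2 * (q.1 / q.2) ^ 4))) := by
  have hd : (3 : ℝ) ≤ n := by exact_mod_cast hn
  have hd2 : (n : ℝ) - 2 ≠ 0 := by linarith
  have hd2' : (n : ℝ) + 2 ≠ 0 := by linarith
  have hd0 : (n : ℝ) ≠ 0 := by linarith
  have hz : ∀ {α : Type} (l : Filter α) (ρ : α → ℝ) (s : ℝ), OP l ρ s fun _ => (0 : ℝ) :=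
    fun l ρ s => isBigO_zero _ _
  have key := h.integral_weighted_factor (l := farLim R) (ρ := fun q => q.2)
    (κ := fun q => q.1 / q.2) (η := fun q => relSize n q.2) (g := fun _ => 0) (φ := fun _ => 0)
    (W := fun _ => 1) (w₂ := fun _ => 0) (s := 2 * ((n : ℝ) - 1) / (n - 2)) (w₁ := 0) hd
    (tendsto_snd_farLim R) OP.ratio
    ((eventually_farLim R).mono fun q hq => div_nonneg hq.1.le (by linarith [hq.2.2.1]))
    (bound_relSize hd) (hz _ _ _) ((hz _ _ _).congr fun q => by ring) (hz _ _ _)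
    ((hz _ _ _).congr fun q => by ring)
    (Eventually.of_forall fun q => continuousOn_const)
    (Eventually.of_forall fun q => continuousOn_const)
    (Eventually.of_forall fun q => continuousOn_const)
  refine key.congr fun q => ?_
  simp only [add_zero, mul_one, integral_zero, mul_zero]
  change sphereMean m n q.1 q.2 - _ = _
  congr 1
  generalize relSize (n : ℝ) q.2 = η
  generalize q.1 / q.2 = κ
  field_simp
  ring

theorem relSize_sq_mul {r ρ : ℝ} (hρ : 0 < ρ) :
    relSize n ρ ^ 2 * (r / ρ) ^ 2 =
      r ^ 2 / ρ ^ (2 * (n : ℝ) - 2) * centerFactor n ρ ^ (-2 : ℝ) := by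
  have hc := centerFactor_pos (d := n) hρ
  have e : ρ ^ (2 * (n : ℝ) - 2) = ρ ^ 2 / (ρ ^ (2 - (n : ℝ))) ^ 2 := by
    rw [eq_div_iff (by positivity), ← Real.rpow_two, ← Real.rpow_mul hρ.le, ← Real.rpow_add hρ,
      ← Real.rpow_natCast]
    congr 1
    push_cast
    ring
  rw [e, Real.rpow_neg hc.le, Real.rpow_two]
  unfold relSize
  field_simp

theorem rpow_neg_sq {ρ : ℝ} (hρ : 0 < ρ) : (ρ ^ (-(n : ℝ))) ^ 2 = 1 / ρ ^ (2 * n) := by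
  rw [Real.rpow_neg hρ.le, Real.rpow_natCast, inv_pow, one_div, ← pow_mul, mul_comm]

theorem bound_quartic : OP (farLim R) (fun q => q.2) (-2 * n) fun q => q.1 ^ 4 / q.2 ^ (2 * n) := by
  have hρ := tendsto_snd_farLim R
  refine ((OP.radius.pow hρ 4 (s'' := 0) (by norm_num)).mul hρ
    (OP.rpow_self (s := -2 * (n : ℝ))) (by linarith : 0 + -2 * (n : ℝ) ≤ -2 * n)).congr' ?_
  filter_upwards [eventually_farLim R] with q hq
  have h0 : 0 < q.2 := by linarith [hq.2.2.1]
  rw [neg_mul, Real.rpow_neg h0.le, show 2 * (n : ℝ) = ((2 * n : ℕ) : ℝ) by push_cast; rfl,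
    Real.rpow_natCast]
  rfl

theorem bound_quartic_mul (hn : 3 ≤ n) (s : ℝ) :
    OP (farLim R) (fun q => q.2) (-2 * n - 1) fun q =>
      q.1 ^ 4 / q.2 ^ (2 * n) * centerFactor n q.2 ^ s - q.1 ^ 4 / q.2 ^ (2 * n) := by
  have hd : (3 : ℝ) ≤ n := by exact_mod_cast hn
  exact (bound_quartic.mul (tendsto_snd_farLim R) (OP.centerFactor_rpow hd s)
    (by linarith)).congr fun q => by ring

/-- The three quadratic terms in the expansions are all multiples of `r ^ 4 / ρ ^ (2 n)`, up to
powers of `centerFactor = 1 + O(ρ ^ (2 - n))`. -/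
theorem quartic_eq {r ρ : ℝ} (hρ : 0 < ρ) (hn : 3 ≤ n) :
    relSize n ρ ^ 2 * (r / ρ) ^ 4 = r ^ 4 / ρ ^ (2 * n) * centerFactor n ρ ^ (-2 : ℝ) ∧
    relSize n ρ * (r / ρ) ^ 2 * leadCoeff n r ρ = (n - 1) / (n + 1) *
      (r ^ 4 / ρ ^ (2 * n) * centerFactor n ρ ^ (-2 / ((n : ℝ) - 2) - 1)) ∧
    leadCoeff n r ρ ^ 2 = ((n - 1) / (n + 1)) ^ 2 *
      (r ^ 4 / ρ ^ (2 * n) * centerFactor n ρ ^ (-2 / ((n : ℝ) - 2) * 2)) := by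
  have hc := centerFactor_pos (d := n) hρ
  have h1 := rpow_neg_sq (n := n) hρ
  have h2 : ρ ^ (2 - (n : ℝ)) = ρ ^ 2 * ρ ^ (-(n : ℝ)) := by
    rw [sub_eq_add_neg, Real.rpow_add hρ, Real.rpow_two]
  have h3 : ∀ X : ℝ, X / ρ ^ (2 * n) = X * (ρ ^ (-(n : ℝ))) ^ 2 := fun X => by
    rw [h1]; ring
  rw [h3]
  refine ⟨?_, ?_, ?_⟩
  · rw [Real.rpow_neg hc.le, Real.rpow_two]
    unfold relSize
    rw [h2]
    field_simp
  · rw [Real.rpow_sub_one hc.ne']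
    unfold relSize leadCoeff amplitude
    rw [h2]
    field_simp
  · rw [Real.rpow_mul hc.le, Real.rpow_two]
    unfold leadCoeff amplitude
    ring

/-- The area of the coordinate sphere. The factor `centerFactor ^ (-2)` is needed only in the term
of order `ρ ^ (2 - 2 n)`; in the quartic term it changes nothing up to the admitted error. -/
theorem sphereMean_expansion (h : IsZonal n m) (hn : 3 ≤ n) :
    OP (farLim R) (fun q => q.2) (-2 * n - 1) fun q => sphereMean m n q.1 q.2 -
      (1 + ((n : ℝ) - 1) * q.1 ^ 2 / q.2 ^ (2 * (n : ℝ) - 2) * centerFactor n q.2 ^ (-2 : ℝ) +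
        n * (n - 1) ^ 2 / (2 * (n + 2)) * (q.1 ^ 4 / q.2 ^ (2 * n))) := by
  refine ((sphereMean_expansion_aux h hn).add ((bound_quartic_mul (R := R) hn (-2)).const_mul
    ((n : ℝ) * (n - 1) ^ 2 / (2 * (n + 2))))).congr' ?_
  filter_upwards [eventually_farLim R] with q hq
  have h0 : 0 < q.2 := by linarith [hq.2.2.1]
  rw [relSize_sq_mul h0, (quartic_eq h0 hn).1]
  ring

theorem ballMean_expansion (h : IsZonal n m) (hn : 3 ≤ n) :
    OP (farLim R) (fun q => q.2) (-2 * n - 1) fun q => volMean (fun _ => 0) m n q.1 q.2 -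
      (1 + (n : ℝ) * q.1 ^ 2 / q.2 ^ (2 * (n : ℝ) - 2) * centerFactor n q.2 ^ (-2 : ℝ) +
        n ^ 2 * (n - 1) / (2 * (n + 4)) * (q.1 ^ 4 / q.2 ^ (2 * n))) := by
  have key := volMean_expansion_general (R := R) h hn (φ := fun _ _ => 0) (g := fun _ => 0)
    (isBigO_zero _ _) ((isBigO_zero _ _).congr_left fun q => by simp)
    (Eventually.of_forall fun q t _ => by norm_num)
    (Eventually.of_forall fun q => continuousOn_const)
  refine (key.add ((bound_quartic_mul (R := R) hn (-2)).const_mul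
    ((n : ℝ) ^ 2 * (n - 1) / (2 * (n + 4))))).congr' ?_
  filter_upwards [eventually_farLim R] with q hq
  have h0 : 0 < q.2 := by linarith [hq.2.2.1]
  rw [relSize_sq_mul h0, (quartic_eq h0 hn).1, integral_zero]
  ring

theorem bound_quadratic_terms (h : IsZonal n m) (hn : 3 ≤ n) :
    OP (farLim R) (fun q => q.2) (2 - 2 * n) (fun q => relSize n q.2 ^ 2 * (q.1 / q.2) ^ 2) ∧
    OP (farLim R) (fun q => q.2) (2 - 2 * n) (fun q => relSize n q.2 ^ 2 * (q.1 / q.2) ^ 4) ∧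
    OP (farLim R) (fun q => q.2) (2 - 2 * n)
      (fun q => relSize n q.2 * (q.1 / q.2) ^ 2 * leadCoeff n q.1 q.2) ∧
    OP (farLim R) (fun q => q.2) (2 - 2 * n) (fun q => ∫ t, relDisp m n q.1 q.2 t ∂m) ∧
    OP (farLim R) (fun q => q.2) (2 - 2 * n) (fun q => leadCoeff n q.1 q.2 ^ 2) := by
  have hd : (3 : ℝ) ≤ n := by exact_mod_cast hn
  have hρf := tendsto_snd_farLim R
  have hI := bound_average_relDisp (R := R) h hn
  have hg := bound_leadCoeff (R := R) hd
  have hη := bound_relSize (R := R) hd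
  have hκ2 : OP (farLim R) (fun q => q.2) (-2) fun q => (q.1 / q.2) ^ 2 :=
    OP.ratio.sq hρf (by norm_num)
  have hκ4 : OP (farLim R) (fun q => q.2) (-4) fun q => (q.1 / q.2) ^ 4 :=
    OP.ratio.pow hρf 4 (by norm_num)
  have hη2 := hη.sq hρf (s'' := 4 - 2 * n) (by linarith)
  have t1 := hη2.mul hρf hκ2 (s'' := 2 - 2 * n) (by linarith)
  have t2 := hη2.mul hρf hκ4 (s'' := 2 - 2 * n) (by linarith)
  have t3 := (hη.mul hρf hκ2 (s'' := -n) (by linarith)).mul hρf hg (s'' := 2 - 2 * n) (by linarith)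
  have t4 := hI.mono hρf (by linarith : 1 - 2 * (n : ℝ) ≤ 2 - 2 * n)
  have t5 := hg.sq hρf (s'' := 2 - 2 * n) (by linarith)
  exact ⟨t1, t2, t3, t4, t5⟩

theorem bound_areaMean_sub_one (h : IsZonal n m) (hn : 3 ≤ n) :
    OP (farLim R) (fun q => q.2) (2 - 2 * n) fun q => areaMean m n q.1 q.2 - 1 := by
  have hd : (3 : ℝ) ≤ n := by exact_mod_cast hn
  have hρf := tendsto_snd_farLim R
  obtain ⟨t1, t2, t3, t4, t5⟩ := bound_quadratic_terms (R := R) h hn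
  have hA := areaMean_expansion (R := R) h hn
  refine OP.congr ((hA.mono hρf (by linarith)).add (((((t1.const_mul ((n : ℝ) - 1)).add
    (t2.const_mul ((n : ℝ) * (n - 1) ^ 2 / (2 * (n + 2))))).sub (t3.const_mul
    (2 * ((n : ℝ) - 1) ^ 2 * (n + 1) / (n + 2)))).add (t4.const_mul ((n : ℝ) - 1))).add
    (t5.const_mul (((n : ℝ) - 1) / (n + 2) * ((n - 1) * (n - 2) + 2 * n))))) fun q => ?_
  ring

theorem volMean_expansion (h : IsZonal n m) (hn : 3 ≤ n) :
    OP (farLim R) (fun q => q.2) (-2 * n - 1) fun q =>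
      volMean (relDisp m n q.1 q.2) m n q.1 q.2 -
      (1 + (n * (relSize n q.2 ^ 2 * (q.1 / q.2) ^ 2) +
          n ^ 2 * (n - 1) / (2 * (n + 4)) * (relSize n q.2 ^ 2 * (q.1 / q.2) ^ 4)) -
        2 * n ^ 2 * (n - 1) / (n + 2) * (relSize n q.2 * (q.1 / q.2) ^ 2 * leadCoeff n q.1 q.2) +
        n * (∫ t, relDisp m n q.1 q.2 t ∂m) +
        leadCoeff n q.1 q.2 ^ 2 * (n * (n - 1) ^ 2 / (n + 2))) := by
  have hd : (3 : ℝ) ≤ n := by exact_mod_cast hn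
  exact volMean_expansion_general h hn (bound_leadCoeff hd) (bound_relDisp h hd)
    (eventually_relDisp h hn) (continuousOn_relDisp hn)

theorem bound_volMean_sub_one (h : IsZonal n m) (hn : 3 ≤ n) :
    OP (farLim R) (fun q => q.2) (2 - 2 * n)
      fun q => volMean (relDisp m n q.1 q.2) m n q.1 q.2 - 1 := by
  have hd : (3 : ℝ) ≤ n := by exact_mod_cast hn
  have hρf := tendsto_snd_farLim R
  obtain ⟨t1, t2, t3, t4, t5⟩ := bound_quadratic_terms (R := R) h hn
  have hB := volMean_expansion (R := R) h hn
  refine OP.congr ((hB.mono hρf (by linarith)).add (((((t1.const_mul (n : ℝ)).add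
    (t2.const_mul ((n : ℝ) ^ 2 * (n - 1) / (2 * (n + 4))))).sub (t3.const_mul
    (2 * (n : ℝ) ^ 2 * (n - 1) / (n + 2)))).add (t4.const_mul (n : ℝ))).add
    (t5.const_mul ((n : ℝ) * (n - 1) ^ 2 / (n + 2))))) fun q => ?_
  ring

/-- The isoperimetric ratio of a region whose area and volume agree with those of the radial graph
up to relative errors `e.1 * ρ ^ (-2 * n - 1)` and `e.2 * ρ ^ (-2 * n - 1)`. -/
theorem isoperimetricRatio_expansion (h : IsZonal n m) (hn : 3 ≤ n) (K : ℝ) :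
    OP (farLim R ×ˢ 𝓟 (Icc (-K) K ×ˢ Icc (-K) K)) (fun q => q.1.2) (-2 * n - 1) fun q =>
      (areaMean m n q.1.1 q.1.2 * (1 + q.2.1 * q.1.2 ^ (-2 * (n : ℝ) - 1))) *
        (volMean (relDisp m n q.1.1 q.1.2) m n q.1.1 q.1.2 *
          (1 + q.2.2 * q.1.2 ^ (-2 * (n : ℝ) - 1))) ^ (-(((n : ℝ) - 1) / n)) -
      (1 - 2 * ((n : ℝ) - 2) * (n - 1) ^ 2 / ((n + 1) * (n + 2) * (n + 4)) *
        (q.1.1 ^ 4 / q.1.2 ^ (2 * n))) := by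
  have hd : (3 : ℝ) ≤ n := by exact_mod_cast hn
  have hd0 : (n : ℝ) ≠ 0 := by linarith
  have hρf := tendsto_snd_farLim R
  obtain ⟨σ, hσ⟩ : ∃ σ : ℝ, σ = -2 * n - 1 := ⟨_, rfl⟩
  have hA := areaMean_expansion (R := R) h hn
  have hB := volMean_expansion (R := R) h hn
  have hα := bound_areaMean_sub_one (R := R) h hn
  have hβ := bound_volMean_sub_one (R := R) h hn
  -- the difference of the two expansions
  have hmain : OP (farLim R) (fun q => q.2) σ fun q => areaMean m n q.1 q.2 - 1 -
      ((n : ℝ) - 1) / n * (volMean (relDisp m n q.1 q.2) m n q.1 q.2 - 1) -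
      (-(2 * ((n : ℝ) - 2) * (n - 1) ^ 2 / ((n + 1) * (n + 2) * (n + 4)) *
        (q.1 ^ 4 / q.2 ^ (2 * n)))) := by
    have b1 := (bound_quartic_mul (R := R) hn (-2)).const_mul
      ((n : ℝ) * (n - 1) ^ 2 / ((n + 2) * (n + 4)))
    have b2 := (bound_quartic_mul (R := R) hn (-2 / ((n : ℝ) - 2) - 1)).const_mul
      (-(2 * ((n : ℝ) - 1) ^ 2 / (n + 2) * ((n - 1) / (n + 1))))
    have b3 := (bound_quartic_mul (R := R) hn (-2 / ((n : ℝ) - 2) * 2)).const_mul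
      (((n : ℝ) - 1) * (n + 1) / (n + 2) * ((n - 1) / (n + 1)) ^ 2)
    rw [hσ]
    refine ((hA.sub (hB.const_mul (((n : ℝ) - 1) / n))).add ((b1.add b2).add b3)).congr' ?_
    filter_upwards [eventually_farLim R] with q hq
    have h0 : 0 < q.2 := by linarith [hq.2.2.1]
    obtain ⟨x1, x2, x3⟩ := quartic_eq (r := q.1) h0 hn
    have hd1' : (n : ℝ) + 1 ≠ 0 := by linarith
    have hd2' : (n : ℝ) + 2 ≠ 0 := by linarith
    have hd4' : (n : ℝ) + 4 ≠ 0 := by linarith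
    rw [x1, x2, x3]
    generalize q.1 ^ 4 / q.2 ^ (2 * n) = X
    generalize centerFactor (n : ℝ) q.2 ^ (-2 : ℝ) = c1
    generalize centerFactor (n : ℝ) q.2 ^ (-2 / ((n : ℝ) - 2) - 1) = c2
    generalize centerFactor (n : ℝ) q.2 ^ (-2 / ((n : ℝ) - 2) * 2) = c3
    generalize ∫ t, relDisp m n q.1 q.2 t ∂m = I
    generalize areaMean m n q.1 q.2 = A
    generalize volMean (relDisp m n q.1 q.2) m n q.1 q.2 = B
    generalize relSize (n : ℝ) q.2 ^ 2 * (q.1 / q.2) ^ 2 = Y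
    field_simp
    ring
  -- the relative errors
  set L := farLim R ×ˢ 𝓟 (Icc (-K) K ×ˢ Icc (-K) K) with hL
  have hρ : Tendsto (fun q : (ℝ × ℝ) × ℝ × ℝ => q.1.2) L atTop := hρf.comp tendsto_fst
  have hs : OP L (fun q => q.1.2) σ fun q => q.1.2 ^ σ := OP.rpow_self
  have k1 : OP L (fun q => q.1.2) 0 fun q => q.2.1 :=
    OP.of_bound K (eventually_prod_principal_iff.2 (Eventually.of_forall fun q e he =>
      abs_le.2 he.1))
  have k2 : OP L (fun q => q.1.2) 0 fun q => q.2.2 :=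
    OP.of_bound K (eventually_prod_principal_iff.2 (Eventually.of_forall fun q e he =>
      abs_le.2 he.2))
  have hα' := hα.comp_fst (T := 𝓟 (Icc (-K) K ×ˢ Icc (-K) K))
  have hβ' := hβ.comp_fst (T := 𝓟 (Icc (-K) K ×ˢ Icc (-K) K))
  have hm' := hmain.comp_fst (T := 𝓟 (Icc (-K) K ×ˢ Icc (-K) K))
  have ke1 := k1.mul hρ hs (s'' := σ) (by linarith)
  have ke2 := k2.mul hρ hs (s'' := σ) (by linarith)
  have a1 : OP L (fun q => q.1.2) σ
      fun q => areaMean m n q.1.1 q.1.2 * (q.2.1 * q.1.2 ^ σ) :=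
    (((hα'.mono hρ (s' := 0) (by linarith)).add (OP.const 1)).mul hρ ke1 (by linarith)).congr
      fun q => by ring
  have a2 : OP L (fun q => q.1.2) σ fun q =>
      volMean (relDisp m n q.1.1 q.1.2) m n q.1.1 q.1.2 * (q.2.2 * q.1.2 ^ σ) :=
    (((hβ'.mono hρ (s' := 0) (by linarith)).add (OP.const 1)).mul hρ ke2 (by linarith)).congr
      fun q => by ring
  have hα1 := hα'.add (a1.mono hρ (by linarith : σ ≤ 2 - 2 * n))
  have hβ1 := hβ'.add (a2.mono hρ (by linarith : σ ≤ 2 - 2 * n))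
  have c1 := (hβ1.one_add_rpow hρ (by linarith) (-(((n : ℝ) - 1) / n)))
  have c2 := (((OP.const 1).add (hα1.mono hρ (s' := 0) (by linarith))).mul hρ c1 (s'' := σ)
    (by linarith))
  have c3 := (hα1.mul hρ hβ1 (s'' := σ) (by linarith)).const_mul (-(((n : ℝ) - 1) / n))
  have c4 := (a1.sub (a2.const_mul (((n : ℝ) - 1) / n))).add hm'
  rw [← hσ]
  refine ((c2.add c3).add c4).congr fun q => ?_
  rw [show (1 : ℝ) + (volMean (relDisp m n q.1.1 q.1.2) m n q.1.1 q.1.2 - 1 +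
    volMean (relDisp m n q.1.1 q.1.2) m n q.1.1 q.1.2 * (q.2.2 * q.1.2 ^ σ)) =
    volMean (relDisp m n q.1.1 q.1.2) m n q.1.1 q.1.2 * (1 + q.2.2 * q.1.2 ^ σ) by ring]
  ring

end GraphExpansion

/-! ### Polar coordinates and radial graphs -/

section Polar

variable {V : Type*} [NormedAddCommGroup V] [InnerProductSpace ℝ V] [FiniteDimensional ℝ V]
  [MeasurableSpace V] [BorelSpace V]

theorem lintegral_polar (hV : 2 ≤ finrank ℝ V) {F : V → ℝ≥0∞} (hF : Measurable F) :
    ∫⁻ z, F z = ∫⁻ θ, (∫⁻ s in Ioi (0 : ℝ),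
      ENNReal.ofReal (s ^ (finrank ℝ V - 1)) * F (s • (θ : V))) ∂(volume : Measure V).toSphere := by
  have : Nontrivial V := finrank_pos_iff.1 (by omega : 0 < finrank ℝ V)
  have hmp := (volume : Measure V).measurePreserving_homeomorphUnitSphereProd
  have h1 : ∫⁻ z, F z = ∫⁻ z : ({0}ᶜ : Set V), F z ∂((volume : Measure V).comap (↑)) := by
    rw [lintegral_subtype_comap (measurableSet_singleton (0 : V)).compl F, restrict_compl_singleton]
  have hG : Measurable fun p : sphere (0 : V) 1 × Ioi (0 : ℝ) => F ((p.2 : ℝ) • (p.1 : V)) :=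
    hF.comp (Continuous.measurable (by fun_prop))
  have h2 := hmp.lintegral_comp hG
  have h3 : ∀ z : ({0}ᶜ : Set V), ((homeomorphUnitSphereProd V z).2 : ℝ) •
      ((homeomorphUnitSphereProd V z).1 : V) = z := fun z => by
    have hz : ‖(z : V)‖ ≠ 0 := norm_ne_zero_iff.2 z.2
    simp [smul_smul, hz]
  simp only [h3] at h2
  rw [h1, h2, lintegral_prod _ hG.aemeasurable]
  refine lintegral_congr fun θ => ?_
  have hm : Measurable fun s : Ioi (0 : ℝ) => F ((s : ℝ) • (θ : V)) :=
    hF.comp (Continuous.measurable (by fun_prop))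
  have hp : Measurable fun s : Ioi (0 : ℝ) => ENNReal.ofReal ((s : ℝ) ^ (finrank ℝ V - 1)) := by
    fun_prop
  rw [Measure.volumeIoiPow, lintegral_withDensity_eq_lintegral_mul _ hp hm,
    ← lintegral_subtype_comap measurableSet_Ioi]
  rfl

theorem lintegral_zonal_ofReal (hV : 2 ≤ finrank ℝ V) {e : V} (he : ‖e‖ = 1) {F : ℝ → ℝ}
    (hF : ContinuousOn F (Icc (-1) 1)) (hF0 : ∀ t ∈ Icc (-1 : ℝ) 1, 0 ≤ F t) :
    ∫⁻ θ : sphere (0 : V) 1, ENNReal.ofReal (F (inner ℝ e (θ : V))) ∂(volume : Measure V).toSphere =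
      (volume : Measure V).toSphere univ * ENNReal.ofReal (∫ t, F t ∂(zonalLaw e)) := by
  have hc : Continuous fun θ : sphere (0 : V) 1 => F (inner ℝ e (θ : V)) :=
    hF.comp_continuous (by fun_prop) fun θ => inner_mem_Icc he θ
  have hi : Integrable (fun θ : sphere (0 : V) 1 => F (inner ℝ e (θ : V)))
      (volume : Measure V).toSphere := by
    rw [← integrableOn_univ]
    exact hc.continuousOn.integrableOn_compact isCompact_univ
  have h0 := toSphere_univ_ne_zero hV
  have h1 := measure_ne_top (volume : Measure V).toSphere univ
  rw [← ofReal_integral_eq_lintegral_ofReal hi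
    (Eventually.of_forall fun θ => hF0 _ (inner_mem_Icc he θ)), integral_zonalLaw e hF he,
    ENNReal.ofReal_mul (by positivity), ← ENNReal.toReal_inv, ENNReal.ofReal_toReal
      (ENNReal.inv_ne_top.2 h0), ← mul_assoc, ENNReal.mul_inv_cancel h0 h1, one_mul]

/-- The measure `μHE` on a radial graph, parametrized by the unit sphere. -/
theorem restrict_radialGraph (hV : 2 ≤ finrank ℝ V) {e : V} (he : ‖e‖ = 1) {S S' : ℝ → ℝ}
    (hS : ∀ t ∈ Icc (-1 : ℝ) 1, HasStrictDerivAt S (S' t) t) (hpos : ∀ t ∈ Icc (-1 : ℝ) 1, 0 < S t)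
    (hS' : ContinuousOn S' (Icc (-1) 1)) :
    (μHE[finrank ℝ V - 1] : Measure V).restrict
      (range fun θ : sphere (0 : V) 1 => S (inner ℝ e (θ : V)) • (θ : V)) =
    Measure.map (fun θ : sphere (0 : V) 1 => S (inner ℝ e (θ : V)) • (θ : V))
      ((volume : Measure V).toSphere.withDensity fun θ =>
        ENNReal.ofReal (graphJacobian (finrank ℝ V) S S' (inner ℝ e (θ : V)))) := by
  have hSc : ContinuousOn S (Icc (-1) 1) := fun t ht =>
    (hS t ht).hasDerivAt.continuousAt.continuousWithinAt
  have hG : Continuous fun θ : sphere (0 : V) 1 => S (inner ℝ e (θ : V)) • (θ : V) :=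
    (hSc.comp_continuous (by fun_prop) fun θ => inner_mem_Icc he θ).smul continuous_subtype_val
  ext B hB
  rw [Measure.restrict_apply hB, Measure.map_apply hG.measurable hB,
    withDensity_apply _ (hG.measurable hB), ← area_radialGraph hV he hS hpos hS'
      (hG.measurable hB), image_preimage_eq_inter_range]

/-- The area of a radial graph with respect to a continuous density depending only on the angle
to `e`. -/
theorem lintegral_radialGraph (hV : 2 ≤ finrank ℝ V) {e : V} (he : ‖e‖ = 1) {S S' : ℝ → ℝ}
    (hS : ∀ t ∈ Icc (-1 : ℝ) 1, HasStrictDerivAt S (S' t) t) (hpos : ∀ t ∈ Icc (-1 : ℝ) 1, 0 < S t)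
    (hS' : ContinuousOn S' (Icc (-1) 1)) {w : V → ℝ} (hw : Measurable w) {F : ℝ → ℝ}
    (hF : ContinuousOn F (Icc (-1) 1)) (hF0 : ∀ t ∈ Icc (-1 : ℝ) 1, 0 ≤ F t)
    (hwF : ∀ θ : sphere (0 : V) 1, w (S (inner ℝ e (θ : V)) • (θ : V)) = F (inner ℝ e (θ : V))) :
    ∫⁻ z in range (fun θ : sphere (0 : V) 1 => S (inner ℝ e (θ : V)) • (θ : V)),
      ENNReal.ofReal (w z) ∂(μHE[finrank ℝ V - 1] : Measure V) =
    (volume : Measure V).toSphere univ *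
      ENNReal.ofReal (∫ t, F t * graphJacobian (finrank ℝ V) S S' t ∂(zonalLaw e)) := by
  have hSc : ContinuousOn S (Icc (-1) 1) := fun t ht =>
    (hS t ht).hasDerivAt.continuousAt.continuousWithinAt
  have hG : Continuous fun θ : sphere (0 : V) 1 => S (inner ℝ e (θ : V)) • (θ : V) :=
    (hSc.comp_continuous (by fun_prop) fun θ => inner_mem_Icc he θ).smul continuous_subtype_val
  have hJ : ContinuousOn (graphJacobian (finrank ℝ V) S S') (Icc (-1) 1) :=
    (hSc.pow _).mul (ContinuousOn.sqrt ((hSc.pow 2).add ((hS'.pow 2).mul (by fun_prop))))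
  have hJ0 : ∀ t ∈ Icc (-1 : ℝ) 1, 0 ≤ graphJacobian (finrank ℝ V) S S' t := fun t ht =>
    mul_nonneg (pow_nonneg (hpos t ht).le _) (Real.sqrt_nonneg _)
  have hJm : Measurable fun θ : sphere (0 : V) 1 =>
      ENNReal.ofReal (graphJacobian (finrank ℝ V) S S' (inner ℝ e (θ : V))) :=
    (hJ.comp_continuous (by fun_prop) fun θ => inner_mem_Icc he θ).measurable.ennreal_ofReal
  have hwG : Measurable fun θ : sphere (0 : V) 1 =>
      ENNReal.ofReal (w (S (inner ℝ e (θ : V)) • (θ : V))) :=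
    hw.ennreal_ofReal.comp hG.measurable
  rw [restrict_radialGraph hV he hS hpos hS', lintegral_map hw.ennreal_ofReal hG.measurable,
    lintegral_withDensity_eq_lintegral_mul _ hJm hwG,
    ← lintegral_zonal_ofReal hV he (F := fun t => F t * graphJacobian (finrank ℝ V) S S' t)
      (hF.mul hJ) fun t ht => mul_nonneg (hF0 t ht) (hJ0 t ht)]
  refine lintegral_congr fun θ => ?_
  rw [Pi.mul_apply, hwF, ← ENNReal.ofReal_mul (hJ0 _ (inner_mem_Icc he θ)), mul_comm]

/-- The radial rescaling `x ↦ S(⟪e, x/|x|⟫) x`, which maps a sphere centered at the origin onto a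
radial graph. -/
noncomputable def radialMap (e : V) (S : ℝ → ℝ) (x : V) : V := S (inner ℝ e x / ‖x‖) • x

theorem radialMap_smul {e : V} {S : ℝ → ℝ} (θ : sphere (0 : V) 1) {s : ℝ} (hs : 0 < s) :
    radialMap e S (s • (θ : V)) = (s * S (inner ℝ e (θ : V))) • (θ : V) := by
  have h1 : ‖s • (θ : V)‖ = s := by
    rw [norm_smul, norm_eq_of_mem_sphere, mul_one, Real.norm_of_nonneg hs.le]
  rw [radialMap, h1, real_inner_smul_right, mul_div_cancel_left₀ _ hs.ne', smul_smul, mul_comm]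

theorem radialMap_image_sphere {e : V} {S : ℝ → ℝ} {r : ℝ} (hr : 0 < r) :
    radialMap e S '' sphere 0 r =
      range fun θ : sphere (0 : V) 1 => (r * S (inner ℝ e (θ : V))) • (θ : V) := by
  ext z
  constructor
  · rintro ⟨x, hx, rfl⟩
    have hx' : ‖x‖ = r := by simpa using hx
    have hθ : ‖r⁻¹ • x‖ = 1 := by
      rw [norm_smul, hx', norm_inv, Real.norm_of_nonneg hr.le, inv_mul_cancel₀ hr.ne']
    refine ⟨⟨r⁻¹ • x, by simpa using hθ⟩, ?_⟩
    dsimp only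
    rw [← radialMap_smul ⟨r⁻¹ • x, by simpa using hθ⟩ hr]
    dsimp only
    rw [smul_inv_smul₀ hr.ne']
  · rintro ⟨θ, rfl⟩
    exact ⟨r • (θ : V), by simp [norm_smul, abs_of_pos hr], radialMap_smul θ hr⟩

theorem smul_mem_radialMap_image_ball {e : V} (he : ‖e‖ = 1) {S : ℝ → ℝ}
    (hpos : ∀ t ∈ Icc (-1 : ℝ) 1, 0 < S t) {r : ℝ} (θ : sphere (0 : V) 1) {s : ℝ} (hs : 0 < s) :
    s • (θ : V) ∈ radialMap e S '' ball 0 r ↔ s < r * S (inner ℝ e (θ : V)) := by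
  have hθ0 : (θ : V) ≠ 0 := ne_zero_of_mem_unit_sphere θ
  have hSθ := hpos _ (inner_mem_Icc he θ)
  constructor
  · rintro ⟨x, hx, hxs⟩
    have hx0 : x ≠ 0 := by
      rintro rfl
      rw [radialMap, smul_zero] at hxs
      exact (smul_ne_zero hs.ne' hθ0) hxs.symm
    have hxn : 0 < ‖x‖ := norm_pos_iff.2 hx0
    set θ' : sphere (0 : V) 1 := ⟨‖x‖⁻¹ • x, by simp [norm_smul, hx0]⟩ with hθ'
    have hxθ : x = ‖x‖ • (θ' : V) := by simp [hθ', smul_smul, hx0]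
    have hSθ' := hpos _ (inner_mem_Icc he θ')
    rw [hxθ, radialMap_smul θ' hxn] at hxs
    have hn := congrArg norm hxs
    have n1 : ‖(θ : V)‖ = 1 := norm_eq_of_mem_sphere θ
    have n2 : ‖(θ' : V)‖ = 1 := norm_eq_of_mem_sphere θ'
    rw [norm_smul, norm_smul (α := ℝ) s, n1, n2, mul_one, mul_one,
      Real.norm_of_nonneg (by positivity), Real.norm_of_nonneg hs.le] at hn
    have : (θ' : V) = θ := by
      rw [hn] at hxs
      exact smul_right_injective V hs.ne' hxs
    rw [this] at hn
    rw [← hn]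
    rw [mem_ball_zero_iff] at hx
    exact mul_lt_mul_of_pos_right hx hSθ
  · intro h
    refine ⟨(s / S (inner ℝ e (θ : V))) • (θ : V), ?_, ?_⟩
    · rw [mem_ball_zero_iff, norm_smul, norm_eq_of_mem_sphere, mul_one,
        Real.norm_of_nonneg (by positivity), div_lt_iff₀ hSθ]
      exact h
    · rw [radialMap_smul θ (by positivity), div_mul_cancel₀ _ hSθ.ne']

/-- The volume of the region enclosed by a radial graph with respect to a density, in polar
coordinates rescaled to the unit interval. -/
theorem lintegral_radialMap_ball (hV : 2 ≤ finrank ℝ V) {e : V} (he : ‖e‖ = 1) {S : ℝ → ℝ}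
    (hpos : ∀ t ∈ Icc (-1 : ℝ) 1, 0 < S t) {r : ℝ} (hr : 0 < r)
    (hB : MeasurableSet (radialMap e S '' ball 0 r)) {w : V → ℝ} (hw : Measurable w)
    {F : ℝ × ℝ → ℝ} (hF : ContinuousOn F (Icc 0 1 ×ˢ Icc (-1) 1))
    (hF0 : ∀ x ∈ Icc (0 : ℝ) 1, ∀ t ∈ Icc (-1 : ℝ) 1, 0 ≤ F (x, t))
    (hwF : ∀ θ : sphere (0 : V) 1, ∀ x ∈ Ioo (0 : ℝ) 1,
      (r * S (inner ℝ e (θ : V))) ^ finrank ℝ V * x ^ (finrank ℝ V - 1) *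
        w ((x * (r * S (inner ℝ e (θ : V)))) • (θ : V)) = F (x, inner ℝ e (θ : V))) :
    ∫⁻ z in radialMap e S '' ball 0 r, ENNReal.ofReal (w z) =
      (volume : Measure V).toSphere univ *
        ENNReal.ofReal (∫ x in Icc (0 : ℝ) 1, ∫ t, F (x, t) ∂(zonalLaw e)) := by
  have hz := isZonal_zonalLaw hV he
  have hprob := hz.prob
  set B := radialMap e S '' ball 0 r with hBdef
  have hFm : Measurable fun z => B.indicator (fun z => ENNReal.ofReal (w z)) z :=
    hw.ennreal_ofReal.indicator hB
  rw [← lintegral_indicator hB, lintegral_polar hV hFm]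
  -- the substitution `s = x * (r * S)` on each ray
  have hray : ∀ θ : sphere (0 : V) 1, (∫⁻ s in Ioi (0 : ℝ),
      ENNReal.ofReal (s ^ (finrank ℝ V - 1)) *
        B.indicator (fun z => ENNReal.ofReal (w z)) (s • (θ : V))) =
      ∫⁻ x in Icc (0 : ℝ) 1, ENNReal.ofReal (F (x, inner ℝ e (θ : V))) := by
    intro θ
    have hc : 0 < r * S (inner ℝ e (θ : V)) := mul_pos hr (hpos _ (inner_mem_Icc he θ))
    set c := r * S (inner ℝ e (θ : V)) with hcdef
    have hd : finrank ℝ V = finrank ℝ V - 1 + 1 := by omega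
    have e1 : ∫⁻ s in Ioi (0 : ℝ), ENNReal.ofReal (s ^ (finrank ℝ V - 1)) *
        B.indicator (fun z => ENNReal.ofReal (w z)) (s • (θ : V)) =
        ∫⁻ s in Ioo 0 c, ENNReal.ofReal (s ^ (finrank ℝ V - 1) * w (s • (θ : V))) := by
      rw [← lintegral_indicator measurableSet_Ioi, ← lintegral_indicator measurableSet_Ioo]
      refine lintegral_congr fun s => ?_
      by_cases hs : 0 < s
      · rw [indicator_of_mem (mem_Ioi.2 hs)]
        have hmem := smul_mem_radialMap_image_ball he hpos (r := r) θ hs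
        by_cases hsc : s < c
        · rw [indicator_of_mem (mem_Ioo.2 ⟨hs, hsc⟩), indicator_of_mem (hmem.2 hsc),
            ENNReal.ofReal_mul (by positivity)]
        · rw [indicator_of_notMem (fun h => hsc (hmem.1 h)),
            indicator_of_notMem (s := Ioo 0 c) (fun h => hsc h.2),
            mul_zero]
      · rw [indicator_of_notMem (s := Ioi 0) (fun h => hs h),
          indicator_of_notMem (s := Ioo 0 c) (fun h => hs h.1)]
    have e2 : Ioo 0 c = (fun x : ℝ => x * c) '' Ioo 0 1 := by
      rw [image_mul_right_Ioo 0 1 hc, zero_mul, one_mul]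
    rw [e1, e2, lintegral_image_eq_lintegral_abs_deriv_mul measurableSet_Ioo
      (fun x _ => ((hasDerivAt_id' x).mul_const c).hasDerivWithinAt)
      (mul_left_injective₀ hc.ne').injOn, setLIntegral_congr Ioo_ae_eq_Icc.symm]
    refine setLIntegral_congr_fun measurableSet_Ioo fun x hx => ?_
    rw [one_mul, abs_of_pos hc, ← ENNReal.ofReal_mul hc.le, ← hwF θ x hx]
    congr 1
    have hcd := pow_succ c (finrank ℝ V - 1)
    rw [← hd] at hcd
    rw [← hcdef, hcd, mul_pow]
    ring
  simp only [hray]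
  have hFθ : ContinuousOn (fun p : sphere (0 : V) 1 × ℝ => F (p.2, inner ℝ e (p.1 : V)))
      (univ ×ˢ Icc 0 1) :=
    hF.comp (by fun_prop) fun p hp => ⟨hp.2, inner_mem_Icc he p.1⟩
  have hae : AEMeasurable (fun p : sphere (0 : V) 1 × ℝ =>
      ENNReal.ofReal (F (p.2, inner ℝ e (p.1 : V))))
      ((volume : Measure V).toSphere.prod (volume.restrict (Icc (0 : ℝ) 1))) := by
    refine AEMeasurable.ennreal_ofReal ?_
    have : (volume : Measure V).toSphere.prod (volume.restrict (Icc (0 : ℝ) 1)) =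
        ((volume : Measure V).toSphere.prod (volume : Measure ℝ)).restrict (univ ×ˢ Icc 0 1) := by
      rw [← Measure.prod_restrict, Measure.restrict_univ]
    rw [this]
    exact hFθ.aemeasurable (MeasurableSet.univ.prod measurableSet_Icc)
  rw [lintegral_lintegral_swap hae]
  have e3 : ∫⁻ x in Icc (0 : ℝ) 1, (∫⁻ θ, ENNReal.ofReal (F (x, inner ℝ e (θ : V)))
      ∂(volume : Measure V).toSphere) = ∫⁻ x in Icc (0 : ℝ) 1,
        (volume : Measure V).toSphere univ * ENNReal.ofReal (∫ t, F (x, t) ∂(zonalLaw e)) := by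
    refine setLIntegral_congr_fun measurableSet_Icc fun x hx => ?_
    exact lintegral_zonal_ofReal hV he (F := fun t => F (x, t))
      (hF.comp (by fun_prop) fun t ht => ⟨hx, ht⟩) (hF0 x hx)
  have hi := (hz.integrable_prod hF).integral_prod_left
  rw [e3, lintegral_const_mul' _ _ (measure_ne_top _ _), ← ofReal_integral_eq_lintegral_ofReal hi]
  filter_upwards [ae_restrict_mem measurableSet_Icc] with x hx
  exact integral_nonneg_of_ae (hz.ae_mem.mono fun t ht => hF0 x hx t ht)

end Polar

variable {n : ℕ}

/-! ### Area and volume for the conformal metric -/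

theorem u_pos (a y : E n) : 0 < u a y := by
  have := Real.rpow_nonneg (norm_nonneg (y + a)) (2 - (n : ℝ))
  unfold u
  linarith

theorem measurable_u (a : E n) : Measurable (u a) := by
  unfold u
  fun_prop

/-- The conformal factor in polar coordinates depends only on the radius and on the cosine of the
angle with `a`. -/
theorem u_smul {a : E n} (ha : 0 < ‖a‖) (θ : sphere (0 : E n) 1) {s : ℝ}
    (hb : 0 ≤ 1 + 2 * (s / ‖a‖) * inner ℝ (‖a‖⁻¹ • a) (θ : E n) + (s / ‖a‖) ^ 2) :
    u a (s • (θ : E n)) = centerFactor n ‖a‖ *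
      (1 + relSize n ‖a‖ * pot n (s / ‖a‖) (inner ℝ (‖a‖⁻¹ • a) (θ : E n))) := by
  have hθ : ‖(θ : E n)‖ = 1 := norm_eq_of_mem_sphere θ
  have hc := centerFactor_pos (d := n) ha
  have h1 : ‖s • (θ : E n) + a‖ ^ 2 = ‖a‖ ^ 2 *
      (1 + 2 * (s / ‖a‖) * inner ℝ (‖a‖⁻¹ • a) (θ : E n) + (s / ‖a‖) ^ 2) := by
    rw [norm_add_sq_real, norm_smul, hθ, mul_one, real_inner_smul_left, real_inner_smul_left,
      Real.norm_eq_abs, sq_abs, real_inner_comm]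
    field_simp
    ring
  have h2 : ‖s • (θ : E n) + a‖ ^ (2 - (n : ℝ)) = ‖a‖ ^ (2 - (n : ℝ)) *
      (1 + 2 * (s / ‖a‖) * inner ℝ (‖a‖⁻¹ • a) (θ : E n) + (s / ‖a‖) ^ 2) ^
        ((2 - (n : ℝ)) / 2) := by
    have e : ∀ x : ℝ, 0 ≤ x → x ^ (2 - (n : ℝ)) = (x ^ 2) ^ ((2 - (n : ℝ)) / 2) := fun x hx => by
      rw [← Real.rpow_natCast, ← Real.rpow_mul hx]
      congr 1
      push_cast
      ring
    rw [e _ (norm_nonneg _), h1, Real.mul_rpow (by positivity) hb, ← e _ ha.le]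
  unfold u
  rw [h2]
  unfold pot relSize
  field_simp
  unfold centerFactor
  ring

theorem sqrt_det_metric (hn : 3 ≤ n) (a y : E n) :
    Real.sqrt (metric a y).det = u a y ^ (2 * (n : ℝ) / (n - 2)) := by
  have hd : (3 : ℝ) ≤ n := by exact_mod_cast hn
  have hd2 : (n : ℝ) - 2 ≠ 0 := by linarith
  have hu := u_pos a y
  unfold metric
  rw [Matrix.det_smul, Matrix.det_one, mul_one, Fintype.card_fin, Real.sqrt_eq_rpow,
    ← Real.rpow_natCast, ← Real.rpow_mul hu.le, ← Real.rpow_mul hu.le]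
  congr 1
  field_simp
  ring

theorem vol_eq (hn : 3 ≤ n) (a : E n) : vol a = (volume : Measure (E n)).withDensity fun y =>
    ENNReal.ofReal (u a y ^ (2 * (n : ℝ) / (n - 2))) := by
  unfold vol
  simp only [sqrt_det_metric hn]

theorem vol_apply (hn : 3 ≤ n) (a : E n) {B : Set (E n)} (hB : MeasurableSet B) :
    vol a B = ∫⁻ y in B, ENNReal.ofReal (u a y ^ (2 * (n : ℝ) / (n - 2))) := by
  rw [vol_eq hn, withDensity_apply _ hB]

theorem area_apply (a : E n) {B : Set (E n)} (hB : MeasurableSet B) :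
    area a B = ∫⁻ y in B, ENNReal.ofReal (u a y ^ (2 * ((n : ℝ) - 1) / ((n : ℝ) - 2)))
      ∂(μHE[n - 1] : Measure (E n)) := by
  rw [area, withDensity_apply _ hB]

theorem isZonal_euclidean (hn : 3 ≤ n) {e : E n} (he : ‖e‖ = 1) : IsZonal n (zonalLaw e) := by
  have := isZonal_zonalLaw (V := E n) (by rw [finrank_euclideanSpace_fin]; omega) he
  rwa [finrank_euclideanSpace_fin] at this

theorem two_le_finrank (hn : 3 ≤ n) : 2 ≤ finrank ℝ (E n) := by
  rw [finrank_euclideanSpace_fin]; omega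

theorem norm_direction {a : E n} (ha : 0 < ‖a‖) : ‖‖a‖⁻¹ • a‖ = 1 := by
  rw [norm_smul, norm_inv, norm_norm, inv_mul_cancel₀ ha.ne']

theorem omega_eq (hn : 3 ≤ n) : omega n = ((volume : Measure (E n)).toSphere univ).toReal := by
  rw [toSphere_eq_hausdorff (two_le_finrank hn) MeasurableSet.univ, image_univ,
    Subtype.range_coe_subtype, finrank_euclideanSpace_fin, omega]
  rfl

theorem toSphere_univ (hn : 3 ≤ n) :
    (volume : Measure (E n)).toSphere univ = ENNReal.ofReal (omega n) := by
  rw [omega_eq hn, ENNReal.ofReal_toReal (measure_ne_top _ _)]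

theorem omega_pos (hn : 3 ≤ n) : 0 < omega n := by
  rw [omega_eq hn]
  exact ENNReal.toReal_pos (toSphere_univ_ne_zero (two_le_finrank hn)) (measure_ne_top _ _)

theorem factor_nonneg {r ρ t φ : ℝ} (hr : 0 < r) (hρ : 2 * r ≤ ρ) (hφ : |φ| ≤ 1 / 2) :
    r * (1 + φ) / ρ ∈ Ioo (0 : ℝ) 1 ∧ (t ∈ Icc (-1 : ℝ) 1 →
      0 < 1 + 2 * (r * (1 + φ) / ρ) * t + (r * (1 + φ) / ρ) ^ 2 ∧
      0 < 1 + relSize n ρ * pot n (r * (1 + φ) / ρ) t) := by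
  have h := abs_le.1 hφ
  have hρ0 : 0 < ρ := by linarith
  have hk : r * (1 + φ) / ρ ∈ Ioo (0 : ℝ) 1 := by
    constructor
    · exact div_pos (mul_pos hr (by linarith)) hρ0
    · rw [div_lt_one hρ0]
      nlinarith
  exact ⟨hk, fun ht => ⟨IsZonal.base_pos ⟨by linarith [hk.1], hk.2⟩ ht,
    factor_pos hρ0 ⟨by linarith [hk.1], hk.2⟩ ht⟩⟩

/-- The area of the radial graph of `r (1 + φ)`. -/
theorem area_radialMap_sphere (hn : 3 ≤ n) {a : E n} {r : ℝ} (hr : 0 < r) (hρ : 2 * r ≤ ‖a‖)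
    {φ φ' : ℝ → ℝ} (hφ : ∀ t ∈ Icc (-1 : ℝ) 1, HasStrictDerivAt φ (φ' t) t)
    (hφ' : ContinuousOn φ' (Icc (-1) 1)) (hφb : ∀ t ∈ Icc (-1 : ℝ) 1, |φ t| ≤ 1 / 2) :
    area a (radialMap (‖a‖⁻¹ • a) (fun t => 1 + φ t) '' sphere 0 r) =
      ENNReal.ofReal (omega n * (r ^ (n - 1) *
        centerFactor n ‖a‖ ^ (2 * ((n : ℝ) - 1) / (n - 2)) *
        ∫ t, (1 + relSize n ‖a‖ * pot n (r / ‖a‖ * (1 + φ t)) t) ^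
          (2 * ((n : ℝ) - 1) / (n - 2)) *
          ((1 + φ t) ^ (n - 2) * √((1 + φ t) ^ 2 + φ' t ^ 2 * (1 - t ^ 2)))
          ∂(zonalLaw (‖a‖⁻¹ • a)))) := by
  have hρ0 : 0 < ‖a‖ := by linarith
  have he := norm_direction hρ0
  have hc := centerFactor_pos (d := n) hρ0
  set e := ‖a‖⁻¹ • a with hedef
  set p := 2 * ((n : ℝ) - 1) / (n - 2) with hp
  have hφc : ContinuousOn φ (Icc (-1) 1) := fun t ht =>
    (hφ t ht).hasDerivAt.continuousAt.continuousWithinAt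
  have h1φ : ∀ t ∈ Icc (-1 : ℝ) 1, 0 < 1 + φ t := fun t ht => by
    linarith [(abs_le.1 (hφb t ht)).1]
  have hS : ∀ t ∈ Icc (-1 : ℝ) 1, HasStrictDerivAt (fun t => r * (1 + φ t)) (r * φ' t) t :=
    fun t ht => ((hφ t ht).const_add 1).const_mul r
  have hSpos : ∀ t ∈ Icc (-1 : ℝ) 1, 0 < r * (1 + φ t) := fun t ht => mul_pos hr (h1φ t ht)
  have hkc : ContinuousOn (fun t => r * (1 + φ t) / ‖a‖) (Icc (-1) 1) :=
    (continuousOn_const.mul (continuousOn_const.add hφc)).div_const _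
  have hF : ContinuousOn (fun t => (centerFactor n ‖a‖ *
      (1 + relSize n ‖a‖ * pot n (r * (1 + φ t) / ‖a‖) t)) ^ p) (Icc (-1) 1) := by
    unfold pot
    refine ContinuousOn.rpow_const (continuousOn_const.mul (continuousOn_const.add
      (continuousOn_const.mul (ContinuousOn.sub (ContinuousOn.rpow_const ?_ fun t ht => Or.inl ?_)
      continuousOn_const)))) fun t ht => Or.inl ?_
    · exact (continuousOn_const.add ((continuousOn_const.mul hkc).mul continuousOn_id)).add
        (hkc.pow 2)
    · exact ((factor_nonneg (n := n) hr hρ (hφb t ht)).2 ht).1.ne'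
    · exact (mul_pos hc ((factor_nonneg hr hρ (hφb t ht)).2 ht).2).ne'
  have key := lintegral_radialGraph (two_le_finrank hn) he hS hSpos (continuousOn_const.mul hφ')
    (w := fun z => u a z ^ p) ((measurable_u a).pow_const p) hF
    (fun t ht => Real.rpow_nonneg (mul_pos hc ((factor_nonneg hr hρ (hφb t ht)).2 ht).2).le _)
    (fun θ => by
      have ht := inner_mem_Icc he θ
      rw [u_smul hρ0 θ ((factor_nonneg (n := n) hr hρ (hφb _ ht)).2 ht).1.le])
  have hmeas : MeasurableSet (range fun θ : sphere (0 : E n) 1 =>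
      (r * (1 + φ (inner ℝ e (θ : E n)))) • (θ : E n)) := by
    refine (isCompact_range ?_).isClosed.measurableSet
    have hcc : ContinuousOn (fun t => r * (1 + φ t)) (Icc (-1) 1) :=
      continuousOn_const.mul (continuousOn_const.add hφc)
    exact (hcc.comp_continuous (by fun_prop) fun θ => inner_mem_Icc he θ).smul
      continuous_subtype_val
  rw [finrank_euclideanSpace_fin] at key
  rw [radialMap_image_sphere hr, area_apply a hmeas, key, toSphere_univ hn,
    ← ENNReal.ofReal_mul (omega_pos hn).le,
    ← integral_const_mul (r ^ (n - 1) * centerFactor n ‖a‖ ^ p)]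
  congr 2
  have hm := (isZonal_euclidean hn he).ae_mem
  refine integral_congr_ae (hm.mono fun t ht => ?_)
  have h0 := h1φ t ht
  have hn1 : n - 1 = n - 2 + 1 := by omega
  dsimp only [graphJacobian]
  rw [Real.mul_rpow hc.le ((factor_nonneg hr hρ (hφb t ht)).2 ht).2.le,
    show r * (1 + φ t) / ‖a‖ = r / ‖a‖ * (1 + φ t) by ring,
    show (r * (1 + φ t)) ^ 2 + (r * φ' t) ^ 2 * (1 - t ^ 2) =
      r ^ 2 * ((1 + φ t) ^ 2 + φ' t ^ 2 * (1 - t ^ 2)) by ring,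
    Real.sqrt_mul (sq_nonneg r), Real.sqrt_sq hr.le, mul_pow, hn1, pow_succ]
  ring

/-- The volume of the region enclosed by the radial graph of `r (1 + φ)`. -/
theorem vol_radialMap_ball (hn : 3 ≤ n) {a : E n} {r : ℝ} (hr : 0 < r) (hρ : 2 * r ≤ ‖a‖)
    {φ : ℝ → ℝ} (hφc : ContinuousOn φ (Icc (-1) 1)) (hφb : ∀ t ∈ Icc (-1 : ℝ) 1, |φ t| ≤ 1 / 2)
    (hB : MeasurableSet (radialMap (‖a‖⁻¹ • a) (fun t => 1 + φ t) '' ball 0 r)) :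
    vol a (radialMap (‖a‖⁻¹ • a) (fun t => 1 + φ t) '' ball 0 r) =
      ENNReal.ofReal (omega n * (1 / n * r ^ n *
        centerFactor n ‖a‖ ^ (2 * (n : ℝ) / (n - 2)) *
        volMean φ (zonalLaw (‖a‖⁻¹ • a)) n r ‖a‖)) := by
  have hρ0 : 0 < ‖a‖ := by linarith
  have hn0 : (n : ℝ) ≠ 0 := by positivity
  have he := norm_direction hρ0
  have hc := centerFactor_pos (d := n) hρ0
  set e := ‖a‖⁻¹ • a with hedef
  obtain ⟨q, hq⟩ : ∃ q : ℝ, q = 2 * (n : ℝ) / (n - 2) := ⟨_, rfl⟩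
  have h1φ : ∀ t ∈ Icc (-1 : ℝ) 1, 0 < 1 + φ t := fun t ht => by
    linarith [(abs_le.1 (hφb t ht)).1]
  have hfac : ∀ x ∈ Icc (0 : ℝ) 1, ∀ t ∈ Icc (-1 : ℝ) 1,
      0 < 1 + 2 * (x * (r / ‖a‖) * (1 + φ t)) * t + (x * (r / ‖a‖) * (1 + φ t)) ^ 2 ∧
      0 < 1 + relSize n ‖a‖ * pot n (x * (r / ‖a‖) * (1 + φ t)) t := by
    intro x hx t ht
    have hk := (factor_nonneg (n := n) (t := t) hr hρ (hφb t ht)).1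
    have hx' : x * (r / ‖a‖) * (1 + φ t) ∈ Ioo (-1 : ℝ) 1 := by
      have e1 : x * (r / ‖a‖) * (1 + φ t) = x * (r * (1 + φ t) / ‖a‖) := by ring
      rw [e1]
      exact ⟨by nlinarith [hx.1, hx.2, hk.1], by nlinarith [hx.1, hx.2, hk.1, hk.2]⟩
    exact ⟨IsZonal.base_pos hx' ht, factor_pos hρ0 hx' ht⟩
  have hF : ContinuousOn (fun z : ℝ × ℝ => r ^ n * centerFactor n ‖a‖ ^ q * (1 / n) *
      (n * z.1 ^ (n - 1) * volIntegrand φ n r ‖a‖ z.1 z.2)) (Icc 0 1 ×ˢ Icc (-1) 1) := by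
    have c1 : ContinuousOn (fun z : ℝ × ℝ => 1 + φ z.2) (Icc 0 1 ×ˢ Icc (-1) 1) :=
      continuousOn_const.add (hφc.comp continuousOn_snd fun z hz => hz.2)
    have c2 : ContinuousOn (fun z : ℝ × ℝ => z.1 * (r / ‖a‖) * (1 + φ z.2))
        (Icc 0 1 ×ˢ Icc (-1) 1) := ContinuousOn.mul (by fun_prop) c1
    refine continuousOn_const.mul (ContinuousOn.mul (by fun_prop) ?_)
    unfold volIntegrand pot
    refine ContinuousOn.mul (ContinuousOn.rpow_const (continuousOn_const.add
      (continuousOn_const.mul (ContinuousOn.sub (ContinuousOn.rpow_const ?_ fun z hz => Or.inl ?_)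
      continuousOn_const))) fun z hz => Or.inl (hfac z.1 hz.1 z.2 hz.2).2.ne') (c1.pow n)
    · exact (continuousOn_const.add ((continuousOn_const.mul c2).mul continuousOn_snd)).add
        (c2.pow 2)
    · exact (hfac z.1 hz.1 z.2 hz.2).1.ne'
  have key := lintegral_radialMap_ball (two_le_finrank hn) he h1φ hr hB
    (w := fun z => u a z ^ q) ((measurable_u a).pow_const q) hF ?_ ?_
  · have e3 : ∀ x : ℝ, ∫ t, r ^ n * centerFactor n ‖a‖ ^ q * (1 / n) *
        (n * x ^ (n - 1) * volIntegrand φ n r ‖a‖ x t) ∂(zonalLaw e) =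
        r ^ n * centerFactor n ‖a‖ ^ q * (1 / n) *
          (n * x ^ (n - 1) * ∫ t, volIntegrand φ n r ‖a‖ x t ∂(zonalLaw e)) := fun x => by
      rw [integral_const_mul, integral_const_mul]
    simp only [e3] at key
    rw [vol_apply hn a hB, ← hq, key, toSphere_univ hn, ← ENNReal.ofReal_mul (omega_pos hn).le,
      integral_const_mul, volMean]
    congr 2
    ring
  · intro x hx t ht
    have h1 := (hfac x hx t ht).2
    have h2 := h1φ t ht
    have h3 := hx.1
    unfold volIntegrand
    positivity
  · intro θ x hx
    have ht := inner_mem_Icc he θ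
    have hx' : x ∈ Icc (0 : ℝ) 1 := ⟨hx.1.le, hx.2.le⟩
    have e1 : x * (r * (1 + φ (inner ℝ e (θ : E n)))) / ‖a‖ =
        x * (r / ‖a‖) * (1 + φ (inner ℝ e (θ : E n))) := by ring
    obtain ⟨h1, h2⟩ := hfac x hx' _ ht
    dsimp only
    rw [finrank_euclideanSpace_fin, u_smul hρ0 θ (by rw [← hedef, e1]; exact h1.le), ← hedef, e1,
      Real.mul_rpow hc.le h2.le, mul_pow, volIntegrand, ← hq]
    field_simp

/-! ### Coordinate balls, the normalization, and the unit normal -/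

theorem radialMap_one {V : Type*} [NormedAddCommGroup V] [InnerProductSpace ℝ V] (e : V) :
    radialMap e (fun _ => 1 + 0) = id := by
  funext x
  simp [radialMap]

theorem area_sphere (hn : 3 ≤ n) {a : E n} {r : ℝ} (hr : 0 < r) (hρ : 2 * r ≤ ‖a‖) :
    area a (sphere 0 r) = ENNReal.ofReal (omega n * (r ^ (n - 1) *
      centerFactor n ‖a‖ ^ (2 * ((n : ℝ) - 1) / (n - 2)) *
        sphereMean (zonalLaw (‖a‖⁻¹ • a)) n r ‖a‖)) := by
  have key := area_radialMap_sphere hn hr hρ (φ := fun _ => 0) (φ' := fun _ => 0)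
    (fun t _ => hasStrictDerivAt_const t 0) continuousOn_const fun t _ => by norm_num
  rw [radialMap_one, image_id] at key
  rw [key]
  simp [sphereMean, relFactor]

theorem vol_closedBall (hn : 3 ≤ n) {a : E n} {r : ℝ} (hr : 0 < r) (hρ : 2 * r ≤ ‖a‖) :
    vol a (closedBall 0 r) = ENNReal.ofReal (omega n * (1 / n * r ^ n *
      centerFactor n ‖a‖ ^ (2 * (n : ℝ) / (n - 2)) *
        volMean (fun _ => 0) (zonalLaw (‖a‖⁻¹ • a)) n r ‖a‖)) := by
  have key := vol_radialMap_ball hn hr hρ (φ := fun _ => 0) continuousOn_const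
    (fun t _ => by norm_num) (by rw [radialMap_one, image_id]; exact measurableSet_ball)
  rw [radialMap_one, image_id] at key
  have hnull : vol a (sphere 0 r) = 0 := by
    rw [vol_eq hn]
    exact withDensity_absolutelyContinuous _ _ (Measure.addHaar_sphere_of_ne_zero _ _ hr.ne')
  rw [← key]
  refine le_antisymm ?_ (measure_mono ball_subset_closedBall)
  rw [← ball_union_sphere]
  exact (measure_union_le _ _).trans (by rw [hnull, add_zero])

theorem f_smul {a : E n} (ha : 0 < ‖a‖) (r c : ℝ) (θ : sphere (0 : E n) 1) :
    f a r c (r • (θ : E n)) =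
      r * (amplitude n r ‖a‖ * (1 - n * inner ℝ (‖a‖⁻¹ • a) (θ : E n) ^ 2)) + c := by
  unfold f amplitude
  rw [real_inner_smul_right, real_inner_smul_left, Real.rpow_neg ha.le, Real.rpow_natCast, pow_add]
  field_simp

theorem integral_area_sphere (hn : 3 ≤ n) {a : E n} {r : ℝ} (hr : 0 < r) (hρ : 2 * r ≤ ‖a‖)
    (c : ℝ) : ∫ y in sphere (0 : E n) r, f a r c y ∂(area a) =
      omega n * (r ^ (n - 1) * centerFactor n ‖a‖ ^ (2 * ((n : ℝ) - 1) / (n - 2)) *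
        (r * (amplitude n r ‖a‖ * ∫ t, (1 - n * t ^ 2) *
          relFactor n r ‖a‖ t ^ (2 * ((n : ℝ) - 1) / (n - 2)) ∂(zonalLaw (‖a‖⁻¹ • a))) +
        c * ∫ t, relFactor n r ‖a‖ t ^ (2 * ((n : ℝ) - 1) / (n - 2))
          ∂(zonalLaw (‖a‖⁻¹ • a)))) := by
  have hρ0 : 0 < ‖a‖ := by linarith
  have he := norm_direction hρ0
  have hz := isZonal_euclidean hn he
  have hc := centerFactor_pos (d := n) hρ0
  set e := ‖a‖⁻¹ • a with hedef
  obtain ⟨p, hp⟩ : ∃ p : ℝ, p = 2 * ((n : ℝ) - 1) / (n - 2) := ⟨_, rfl⟩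
  have hrel : ∀ t ∈ Icc (-1 : ℝ) 1, 0 < relFactor n r ‖a‖ t := fun t ht =>
    relFactor_pos hr (by linarith) ht
  have crel : ContinuousOn (fun t => relFactor n r ‖a‖ t ^ p) (Icc (-1) 1) :=
    (continuousOn_relFactor hr (by linarith)).rpow_const fun t ht => Or.inl (hrel t ht).ne'
  have hrange : sphere (0 : E n) r = range fun θ : sphere (0 : E n) 1 => r • (θ : E n) := by
    have := radialMap_image_sphere (e := e) (S := fun _ => 1 + 0) hr
    rw [radialMap_one, image_id] at this
    simpa using this
  have hμ := restrict_radialGraph (two_le_finrank hn) he (S := fun _ => r) (S' := fun _ => 0)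
    (fun t _ => hasStrictDerivAt_const t r) (fun _ _ => hr) continuousOn_const
  have hJ : ∀ t, graphJacobian n (fun _ => r) (fun _ => 0) t = r ^ (n - 1) := fun t => by
    have hn1 : n - 1 = n - 2 + 1 := by omega
    simp only [graphJacobian]
    rw [zero_pow two_ne_zero, zero_mul, add_zero, Real.sqrt_sq hr.le, hn1, pow_succ]
  simp only [finrank_euclideanSpace_fin, hJ] at hμ
  rw [← hrange] at hμ
  have hG : Measurable fun θ : sphere (0 : E n) 1 => r • (θ : E n) :=
    Continuous.measurable (by fun_prop)
  have hum : Measurable fun y => ENNReal.ofReal (u a y ^ p) :=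
    ((measurable_u a).pow_const p).ennreal_ofReal
  have hfc : Continuous (f a r c) := by unfold f; fun_prop
  have hsm : StronglyMeasurable fun y => (ENNReal.ofReal (u a y ^ p)).toReal • f a r c y :=
    (hum.ennreal_toReal.mul hfc.measurable).stronglyMeasurable
  rw [area, restrict_withDensity isClosed_sphere.measurableSet, ← hp,
    integral_withDensity_eq_integral_toReal_smul hum (Eventually.of_forall fun y =>
      ENNReal.ofReal_lt_top), hμ, integral_map hG.aemeasurable hsm.aestronglyMeasurable,
    withDensity_const, integral_smul_measure, ENNReal.toReal_ofReal (by positivity)]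
  have hH : ContinuousOn (fun t => r * amplitude n r ‖a‖ * ((1 - n * t ^ 2) *
      relFactor n r ‖a‖ t ^ p) + c * relFactor n r ‖a‖ t ^ p) (Icc (-1) 1) :=
    (continuousOn_const.mul (ContinuousOn.mul (by fun_prop) crel)).add (continuousOn_const.mul crel)
  have h0 := toSphere_univ_ne_zero (two_le_finrank hn)
  have hω := omega_pos hn
  have key : ∫ θ, (r * amplitude n r ‖a‖ * ((1 - n * inner ℝ e (θ : E n) ^ 2) *
      relFactor n r ‖a‖ (inner ℝ e (θ : E n)) ^ p) +
        c * relFactor n r ‖a‖ (inner ℝ e (θ : E n)) ^ p)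
        ∂(volume : Measure (E n)).toSphere = omega n *
      (r * amplitude n r ‖a‖ * (∫ t, (1 - n * t ^ 2) * relFactor n r ‖a‖ t ^ p ∂(zonalLaw e)) +
        c * ∫ t, relFactor n r ‖a‖ t ^ p ∂(zonalLaw e)) := by
    have h1 := integral_zonalLaw e hH he
    rw [← omega_eq hn] at h1
    have i1 : Integrable (fun t => r * amplitude n r ‖a‖ * ((1 - n * t ^ 2) *
        relFactor n r ‖a‖ t ^ p)) (zonalLaw e) :=
      hz.integrable (continuousOn_const.mul (ContinuousOn.mul (by fun_prop) crel))
    have i2 : Integrable (fun t => c * relFactor n r ‖a‖ t ^ p) (zonalLaw e) :=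
      hz.integrable (continuousOn_const.mul crel)
    rw [integral_add i1 i2, integral_const_mul, integral_const_mul] at h1
    rw [h1, ← mul_assoc, mul_inv_cancel₀ hω.ne', one_mul]
  have hpt : ∀ θ : sphere (0 : E n) 1, (ENNReal.ofReal (u a (r • (θ : E n)) ^ p)).toReal •
      f a r c (r • (θ : E n)) = centerFactor n ‖a‖ ^ p *
        (r * amplitude n r ‖a‖ * ((1 - n * inner ℝ e (θ : E n) ^ 2) *
      relFactor n r ‖a‖ (inner ℝ e (θ : E n)) ^ p) +
        c * relFactor n r ‖a‖ (inner ℝ e (θ : E n)) ^ p) := fun θ => by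
    have ht := inner_mem_Icc he θ
    have hk := ratio_mem hr (by linarith : r < ‖a‖)
    rw [ENNReal.toReal_ofReal (Real.rpow_nonneg (u_pos _ _).le _), f_smul hρ0,
      u_smul hρ0 θ (IsZonal.base_pos ⟨by linarith [hk.1], hk.2⟩ ht).le]
    change (centerFactor n ‖a‖ * relFactor n r ‖a‖ (inner ℝ e (θ : E n))) ^ p • _ = _
    rw [Real.mul_rpow hc.le (hrel _ ht).le, smul_eq_mul]
    ring
  simp only [hpt]
  rw [integral_const_mul, key, smul_eq_mul]
  ring

/-- The normalization determines the additive constant. -/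
theorem meanZero_iff (hn : 3 ≤ n) {a : E n} {r : ℝ} (hr : 0 < r) (hρ : 2 * r ≤ ‖a‖) (c : ℝ) :
    MeanZero a r c ↔ c = r * meanShift (zonalLaw (‖a‖⁻¹ • a)) n r ‖a‖ := by
  have hρ0 : 0 < ‖a‖ := by linarith
  have he := norm_direction hρ0
  have hz := isZonal_euclidean hn he
  have hprob := hz.prob
  have hc := centerFactor_pos (d := n) hρ0
  have hω := omega_pos hn
  unfold MeanZero
  rw [integral_area_sphere hn hr hρ c]
  unfold meanShift
  set e := ‖a‖⁻¹ • a with hedef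
  obtain ⟨p, hp⟩ : ∃ p : ℝ, p = 2 * ((n : ℝ) - 1) / (n - 2) := ⟨_, rfl⟩
  rw [← hp]
  have hI : 0 < ∫ t, relFactor n r ‖a‖ t ^ p ∂(zonalLaw e) := by
    have hrel : ∀ t ∈ Icc (-1 : ℝ) 1, 0 < relFactor n r ‖a‖ t := fun t ht =>
      relFactor_pos hr (by linarith) ht
    have crel : ContinuousOn (fun t => relFactor n r ‖a‖ t ^ p) (Icc (-1) 1) :=
      (continuousOn_relFactor hr (by linarith)).rpow_const fun t ht => Or.inl (hrel t ht).ne'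
    rw [integral_pos_iff_support_of_nonneg_ae (hz.ae_mem.mono fun t ht =>
      Real.rpow_nonneg (hrel t ht).le _) (hz.integrable crel)]
    have hsub : Icc (-1 : ℝ) 1 ⊆ Function.support fun t => relFactor n r ‖a‖ t ^ p := fun t ht =>
      (Real.rpow_pos_of_pos (hrel t ht) _).ne'
    refine lt_of_lt_of_le ?_ (measure_mono hsub)
    rw [(mem_ae_iff_prob_eq_one measurableSet_Icc).1 hz.ae_mem]
    exact one_pos
  set I := ∫ t, relFactor n r ‖a‖ t ^ p ∂(zonalLaw e) with hIdef
  set J := ∫ t, (1 - n * t ^ 2) * relFactor n r ‖a‖ t ^ p ∂(zonalLaw e) with hJdef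
  have hK : r ^ (n - 1) * centerFactor n ‖a‖ ^ p ≠ 0 := by positivity
  rw [mul_eq_zero, or_iff_right hω.ne', mul_eq_zero, or_iff_right hK]
  constructor
  · intro h
    have : c * I = -(r * (amplitude n r ‖a‖ * J)) := by linarith
    field_simp
    linarith
  · rintro rfl
    field_simp
    ring

theorem metricInner_eq (a y v w : E n) :
    metricInner a y v w = u a y ^ ((4 : ℝ) / ((n : ℝ) - 2)) * inner ℝ v w := by
  unfold metricInner metric
  simp only [Matrix.smul_apply, Matrix.one_apply, smul_eq_mul, PiLp.inner_apply, Finset.mul_sum]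
  refine Finset.sum_congr rfl fun i _ => ?_
  rw [Finset.sum_eq_single i (fun j _ hj => by simp [hj.symm]) (by simp)]
  simp
  ring

/-- The length of a Euclidean unit vector at `y`. -/
noncomputable def unitLength (a y : E n) : ℝ := u a y ^ (2 / ((n : ℝ) - 2))

theorem unitLength_pos (a y : E n) : 0 < unitLength a y := Real.rpow_pos_of_pos (u_pos a y) _

theorem isOuterUnitNormal_iff {a y ν : E n} (hy : y ≠ 0) :
    IsOuterUnitNormal a y ν ↔ ν = (‖y‖ * unitLength a y)⁻¹ • y := by
  have hl := unitLength_pos a y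
  have hy0 : 0 < ‖y‖ := norm_pos_iff.2 hy
  have hu : u a y ^ ((4 : ℝ) / ((n : ℝ) - 2)) = unitLength a y ^ 2 := by
    rw [unitLength, ← Real.rpow_natCast, ← Real.rpow_mul (u_pos a y).le]
    congr 1
    push_cast
    ring
  unfold IsOuterUnitNormal
  simp only [metricInner_eq, hu]
  constructor
  · rintro ⟨h1, h2, h3⟩
    -- the part of `ν` orthogonal to `y` vanishes
    have horth : inner ℝ y (ν - (inner ℝ y ν / ‖y‖ ^ 2) • y) = 0 := by
      rw [inner_sub_right, real_inner_smul_right, real_inner_self_eq_norm_sq]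
      field_simp
      ring
    have h4 := h1 _ horth
    rw [mul_eq_zero, or_iff_right (by positivity)] at h4
    have h5 : ν - (inner ℝ y ν / ‖y‖ ^ 2) • y = 0 := by
      rw [← inner_self_eq_zero (𝕜 := ℝ), inner_sub_left, real_inner_smul_left, h4, horth]
      ring
    rw [sub_eq_zero] at h5
    set s := inner ℝ y ν / ‖y‖ ^ 2 with hs
    have hs0 : 0 < s := by positivity
    rw [h5, real_inner_smul_left, real_inner_smul_right, real_inner_self_eq_norm_sq] at h2
    have h6 : (s * (‖y‖ * unitLength a y)) ^ 2 = 1 := by linarith [h2]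
    have h7 : s * (‖y‖ * unitLength a y) = 1 := by
      have : 0 < s * (‖y‖ * unitLength a y) := by positivity
      nlinarith
    rw [h5, eq_inv_of_mul_eq_one_left h7]
  · rintro rfl
    refine ⟨fun w hw => by rw [real_inner_smul_left, hw]; ring, ?_, ?_⟩
    · rw [real_inner_smul_left, real_inner_smul_right, real_inner_self_eq_norm_sq]
      field_simp
    · rw [real_inner_smul_right, real_inner_self_eq_norm_sq]
      positivity

/-! ### Geodesics of a conformally flat metric -/

section Quad

variable {V : Type*} [NormedAddCommGroup V] [InnerProductSpace ℝ V]

/-- The acceleration `|v|² G - 2 ⟪G, v⟫ v` of a geodesic with velocity `v` in the conformally flat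
metric `λ² δ`, where `G = ∇ log λ`. -/
noncomputable def quadField (G : V → V) (x v : V) : V :=
  ‖v‖ ^ 2 • G x - (2 * inner ℝ (G x) v) • v

theorem norm_quadField_le {G : V → V} {x v : V} {L B : ℝ} (hL : ‖G x‖ ≤ L) (hB : ‖v‖ ≤ B) :
    ‖quadField G x v‖ ≤ 3 * L * B ^ 2 := by
  have hL0 : 0 ≤ L := (norm_nonneg _).trans hL
  have hB0 : 0 ≤ B := (norm_nonneg _).trans hB
  have h1 : ‖‖v‖ ^ 2 • G x‖ ≤ B ^ 2 * L := by
    rw [norm_smul, norm_pow, norm_norm]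
    gcongr
  have h2 : ‖(2 * inner ℝ (G x) v) • v‖ ≤ 2 * (L * B) * B := by
    rw [norm_smul, norm_mul, Real.norm_ofNat]
    have := norm_inner_le_norm (𝕜 := ℝ) (G x) v
    have h3 : ‖inner ℝ (G x) v‖ ≤ L * B := this.trans (by gcongr)
    gcongr
  calc _ ≤ _ := norm_sub_le _ _
    _ ≤ _ := by linarith

theorem quadField_sub_le {G : V → V} {x₁ x₂ v₁ v₂ : V} {L L' B : ℝ} (hL₁ : ‖G x₁‖ ≤ L)
    (hL₂ : ‖G x₂‖ ≤ L) (hL' : ‖G x₁ - G x₂‖ ≤ L' * ‖x₁ - x₂‖) (h₁ : ‖v₁‖ ≤ B) (h₂ : ‖v₂‖ ≤ B) :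
    ‖quadField G x₁ v₁ - quadField G x₂ v₂‖ ≤
      3 * B ^ 2 * L' * ‖x₁ - x₂‖ + 6 * B * L * ‖v₁ - v₂‖ := by
  have hL0 : 0 ≤ L := (norm_nonneg _).trans hL₁
  have hB0 : 0 ≤ B := (norm_nonneg _).trans h₁
  have hX : 0 ≤ L' * ‖x₁ - x₂‖ := (norm_nonneg _).trans hL'
  have e : quadField G x₁ v₁ - quadField G x₂ v₂ =
      (‖v₁‖ ^ 2 • (G x₁ - G x₂) + ((‖v₁‖ + ‖v₂‖) * (‖v₁‖ - ‖v₂‖)) • G x₂) -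
      ((2 * inner ℝ (G x₁ - G x₂) v₁) • v₁ + (2 * inner ℝ (G x₂) (v₁ - v₂)) • v₁ +
        (2 * inner ℝ (G x₂) v₂) • (v₁ - v₂)) := by
    simp only [quadField, inner_sub_left, inner_sub_right]
    module
  have a1 : ‖‖v₁‖ ^ 2 • (G x₁ - G x₂)‖ ≤ B ^ 2 * (L' * ‖x₁ - x₂‖) := by
    rw [norm_smul, norm_pow, norm_norm]
    gcongr
  have a2 : ‖((‖v₁‖ + ‖v₂‖) * (‖v₁‖ - ‖v₂‖)) • G x₂‖ ≤ (B + B) * ‖v₁ - v₂‖ * L := by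
    rw [norm_smul, norm_mul, Real.norm_of_nonneg (by positivity)]
    have : ‖‖v₁‖ - ‖v₂‖‖ ≤ ‖v₁ - v₂‖ := abs_norm_sub_norm_le _ _
    gcongr
  have a3 : ‖(2 * inner ℝ (G x₁ - G x₂) v₁) • v₁‖ ≤ 2 * (L' * ‖x₁ - x₂‖ * B) * B := by
    rw [norm_smul, norm_mul, Real.norm_ofNat]
    have h3 : ‖inner ℝ (G x₁ - G x₂) v₁‖ ≤ L' * ‖x₁ - x₂‖ * B :=
      (norm_inner_le_norm _ _).trans (by gcongr)
    gcongr
  have a4 : ‖(2 * inner ℝ (G x₂) (v₁ - v₂)) • v₁‖ ≤ 2 * (L * ‖v₁ - v₂‖) * B := by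
    rw [norm_smul, norm_mul, Real.norm_ofNat]
    have h3 : ‖inner ℝ (G x₂) (v₁ - v₂)‖ ≤ L * ‖v₁ - v₂‖ :=
      (norm_inner_le_norm _ _).trans (by gcongr)
    gcongr
  have a5 : ‖(2 * inner ℝ (G x₂) v₂) • (v₁ - v₂)‖ ≤ 2 * (L * B) * ‖v₁ - v₂‖ := by
    rw [norm_smul, norm_mul, Real.norm_ofNat]
    have h3 : ‖inner ℝ (G x₂) v₂‖ ≤ L * B := (norm_inner_le_norm _ _).trans (by gcongr)
    gcongr
  rw [e]
  calc _ ≤ _ := norm_sub_le _ _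
    _ ≤ _ := add_le_add (norm_add_le _ _) ((norm_add_le _ _).trans
      (add_le_add (norm_add_le _ _) le_rfl))
    _ ≤ _ := by linarith

/-- A solution on `[0, 1]` of the geodesic equation for the field `G`. -/
structure IsQuadSolution (G : V → V) (γ γ' : ℝ → V) : Prop where
  pos : ∀ t ∈ Icc (0 : ℝ) 1, HasDerivWithinAt γ (γ' t) (Icc 0 1) t
  vel : ∀ t ∈ Icc (0 : ℝ) 1, HasDerivWithinAt γ' (quadField G (γ t) (γ' t)) (Icc 0 1) t

/-- Picard–Lindelöf on the whole interval `[0, 1]`, for an initial velocity that is small compared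
with the bound `L` for `G`. -/
theorem exists_isQuadSolution [CompleteSpace V] {G : V → V} {y v : V} {L L' M : ℝ} (hM : 0 < M)
    (hM2 : 2 * M ≤ 1) (hLM : 12 * L * M ≤ 1) (hv : ‖v‖ ≤ M)
    (hG : ∀ x ∈ closedBall y 1, ‖G x‖ ≤ L)
    (hG' : ∀ x₁ ∈ closedBall y 1, ∀ x₂ ∈ closedBall y 1, ‖G x₁ - G x₂‖ ≤ L' * ‖x₁ - x₂‖)
    (hL' : 0 ≤ L') :
    ∃ γ γ' : ℝ → V, IsQuadSolution G γ γ' ∧ γ 0 = y ∧ γ' 0 = v ∧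
      ∀ t ∈ Icc (0 : ℝ) 1, ‖γ t - y‖ ≤ 1 ∧ ‖γ' t‖ ≤ 2 * M := by
  have hL0 : 0 ≤ L := (norm_nonneg _).trans (hG y (mem_closedBall_self zero_le_one))
  -- the velocity is rescaled by `M`, so that both components vary by at most one
  set F : ℝ → V × V → V × V := fun _ p => (M • p.2, M • quadField G p.1 p.2) with hF
  set p₀ : V × V := (y, M⁻¹ • v) with hp₀
  have hMv : ‖M⁻¹ • v‖ ≤ 1 := by
    rw [norm_smul, norm_inv, Real.norm_of_nonneg hM.le, inv_mul_le_iff₀ hM, mul_one]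
    exact hv
  have hball : ∀ p ∈ closedBall p₀ 1, p.1 ∈ closedBall y 1 ∧ ‖p.2‖ ≤ 2 := by
    intro p hp
    rw [mem_closedBall, Prod.dist_eq, max_le_iff] at hp
    refine ⟨hp.1, ?_⟩
    have h2 : ‖p.2 - M⁻¹ • v‖ ≤ 1 := by rw [← dist_eq_norm]; exact hp.2
    have := norm_le_norm_add_norm_sub' p.2 (M⁻¹ • v)
    linarith
  have hPL : IsPicardLindelof F (⟨0, by simp⟩ : Icc (0 : ℝ) 1) p₀ 1 0 1
      ⟨M * (1 + 12 * L' + 12 * L), by positivity⟩ := by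
    refine ⟨fun t _ => ?_, fun x _ => continuousOn_const, fun t _ p hp => ?_, by simp⟩
    · refine LipschitzOnWith.of_dist_le_mul fun p hp q hq => ?_
      obtain ⟨hp1, hp2⟩ := hball p hp
      obtain ⟨hq1, hq2⟩ := hball q hq
      have d1 : ‖p.1 - q.1‖ ≤ dist p q := by rw [← dist_eq_norm]; exact le_max_left _ _
      have d2 : ‖p.2 - q.2‖ ≤ dist p q := by rw [← dist_eq_norm]; exact le_max_right _ _
      have hd : 0 ≤ dist p q := dist_nonneg
      rw [Prod.dist_eq]
      change max _ _ ≤ M * (1 + 12 * L' + 12 * L) * dist p q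
      refine max_le ?_ ?_
      · rw [dist_eq_norm]
        simp only [hF]
        rw [← smul_sub, norm_smul, Real.norm_of_nonneg hM.le, mul_assoc]
        refine mul_le_mul_of_nonneg_left ?_ hM.le
        nlinarith
      · rw [dist_eq_norm]
        simp only [hF]
        rw [← smul_sub, norm_smul, Real.norm_of_nonneg hM.le, mul_assoc]
        refine mul_le_mul_of_nonneg_left ?_ hM.le
        have := quadField_sub_le (hG _ hp1) (hG _ hq1) (hG' _ hp1 _ hq1) hp2 hq2
        nlinarith
    · obtain ⟨hp1, hp2⟩ := hball p hp
      rw [Prod.norm_def, NNReal.coe_one]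
      refine max_le ?_ ?_
      · simp only [hF]
        rw [norm_smul, Real.norm_of_nonneg hM.le]
        nlinarith
      · simp only [hF]
        rw [norm_smul, Real.norm_of_nonneg hM.le]
        have := norm_quadField_le (hG _ hp1) hp2
        nlinarith
  obtain ⟨α, hα⟩ := ODE.FunSpace.exists_isFixedPt_next hPL (mem_closedBall_self le_rfl)
  have hmem : ∀ t, α.compProj t ∈ closedBall p₀ 1 := fun t =>
    α.compProj_mem_closedBall hPL.mul_max_le
  have h0 : α.compProj 0 = p₀ := by
    have := ODE.FunSpace.compProj_val (α := α) (t := ⟨0, by simp⟩)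
    rw [this, ← hα]
    exact ODE.FunSpace.next_apply₀ hPL (mem_closedBall_self le_rfl) α
  have hder : ∀ t ∈ Icc (0 : ℝ) 1,
      HasDerivWithinAt α.compProj (F t (α.compProj t)) (Icc 0 1) t := by
    intro t ht
    apply ODE.hasDerivWithinAt_picard_Icc (⟨0, by simp⟩ : Icc (0 : ℝ) 1).2 hPL.continuousOn_uncurry
      α.continuous_compProj.continuousOn (fun _ _ => α.compProj_mem_closedBall hPL.mul_max_le)
      p₀ ht |>.congr_of_mem _ ht
    intro t' ht'
    nth_rw 1 [← hα]
    rw [ODE.FunSpace.compProj_of_mem ht']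
    exact ODE.FunSpace.next_apply hPL (mem_closedBall_self le_rfl) α
  refine ⟨fun t => (α.compProj t).1, fun t => M • (α.compProj t).2,
    ⟨fun t ht => ?_, fun t ht => ?_⟩,
    ?_, ?_, fun t ht => ?_⟩
  · exact (hasFDerivAt_fst (𝕜 := ℝ) (p := α.compProj t)).comp_hasDerivWithinAt t (hder t ht)
  · have h := ((hasFDerivAt_snd (𝕜 := ℝ) (p := α.compProj t)).comp_hasDerivWithinAt t
      (hder t ht)).const_smul M
    refine h.congr_deriv ?_
    simp only [hF, quadField, ContinuousLinearMap.coe_snd', norm_smul, Real.norm_of_nonneg hM.le,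
      real_inner_smul_right]
    module
  · dsimp only
    rw [h0]
  · dsimp only
    rw [h0, smul_inv_smul₀ hM.ne']
  · obtain ⟨h1, h2⟩ := hball _ (hmem t)
    refine ⟨by rw [← dist_eq_norm]; exact h1, ?_⟩
    rw [norm_smul, Real.norm_of_nonneg hM.le]
    nlinarith

theorem norm_sub_le_of_deriv_bound {F : ℝ → V} {F' : ℝ → V} {C : ℝ}
    (hF : ∀ t ∈ Icc (0 : ℝ) 1, HasDerivWithinAt F (F' t) (Icc 0 1) t)
    (hC : ∀ t ∈ Icc (0 : ℝ) 1, ‖F' t‖ ≤ C) {t : ℝ} (ht : t ∈ Icc (0 : ℝ) 1) :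
    ‖F t - F 0‖ ≤ C := by
  have h := (convex_Icc (0 : ℝ) 1).norm_image_sub_le_of_norm_hasDerivWithin_le hF hC
    (left_mem_Icc.2 zero_le_one) ht
  refine h.trans ?_
  have hC0 : 0 ≤ C := (norm_nonneg _).trans (hC t ht)
  rw [sub_zero, Real.norm_of_nonneg ht.1]
  exact mul_le_of_le_one_right hC0 ht.2

/-- The end point of a geodesic is close to that of the straight line. -/
theorem IsQuadSolution.norm_end_sub_le {G : V → V} {γ γ' : ℝ → V} {L B : ℝ}
    (h : IsQuadSolution G γ γ') (hG : ∀ t ∈ Icc (0 : ℝ) 1, ‖G (γ t)‖ ≤ L)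
    (hB : ∀ t ∈ Icc (0 : ℝ) 1, ‖γ' t‖ ≤ B) : ‖γ 1 - γ 0 - γ' 0‖ ≤ 3 * L * B ^ 2 := by
  have h1 : ∀ t ∈ Icc (0 : ℝ) 1, ‖γ' t - γ' 0‖ ≤ 3 * L * B ^ 2 := fun t ht =>
    norm_sub_le_of_deriv_bound h.vel (fun t ht => norm_quadField_le (hG t ht) (hB t ht)) ht
  have h2 : ∀ t ∈ Icc (0 : ℝ) 1, HasDerivWithinAt (fun t => γ t - t • γ' 0) (γ' t - γ' 0)
      (Icc 0 1) t := fun t ht => by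
    have := (h.pos t ht).sub (((hasDerivAt_id t).smul_const (γ' 0)).hasDerivWithinAt
      (s := Icc (0 : ℝ) 1))
    exact HasDerivWithinAt.congr_deriv (f := fun t => γ t - t • γ' 0) this (by simp)
  have := norm_sub_le_of_deriv_bound h2 h1 (right_mem_Icc.2 zero_le_one)
  simp only [one_smul, zero_smul, sub_zero] at this
  rwa [sub_right_comm]

/-- The deviation of a geodesic from the straight line depends on the initial data in a Lipschitz
way. -/
theorem IsQuadSolution.norm_end_sub_sub_le {G : V → V} {γ₁ γ₁' γ₂ γ₂' : ℝ → V} {L L' B : ℝ}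
    (h₁ : IsQuadSolution G γ₁ γ₁') (h₂ : IsQuadSolution G γ₂ γ₂')
    (hG₁ : ∀ t ∈ Icc (0 : ℝ) 1, ‖G (γ₁ t)‖ ≤ L) (hG₂ : ∀ t ∈ Icc (0 : ℝ) 1, ‖G (γ₂ t)‖ ≤ L)
    (hG' : ∀ t ∈ Icc (0 : ℝ) 1, ‖G (γ₁ t) - G (γ₂ t)‖ ≤ L' * ‖γ₁ t - γ₂ t‖)
    (hB₁ : ∀ t ∈ Icc (0 : ℝ) 1, ‖γ₁' t‖ ≤ B) (hB₂ : ∀ t ∈ Icc (0 : ℝ) 1, ‖γ₂' t‖ ≤ B)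
    (hL'0 : 0 ≤ L') (hBL' : 3 * B ^ 2 * L' ≤ 1 / 8) (hBL : 6 * B * L ≤ 1 / 8) :
    ‖(γ₁ 1 - γ₁ 0 - γ₁' 0) - (γ₂ 1 - γ₂ 0 - γ₂' 0)‖ ≤
      2 * (3 * B ^ 2 * L' * (2 * (‖γ₁ 0 - γ₂ 0‖ + 2 * ‖γ₁' 0 - γ₂' 0‖)) +
        6 * B * L * ‖γ₁' 0 - γ₂' 0‖) := by
  have h01 : (0 : ℝ) ∈ Icc (0 : ℝ) 1 := left_mem_Icc.2 zero_le_one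
  have hL0 : 0 ≤ L := (norm_nonneg _).trans (hG₁ 0 h01)
  have hB0 : 0 ≤ B := (norm_nonneg _).trans (hB₁ 0 h01)
  have hne : (Icc (0 : ℝ) 1).Nonempty := ⟨0, h01⟩
  -- the largest deviations of position and velocity
  obtain ⟨s, hs, hX⟩ := isCompact_Icc.exists_isMaxOn hne (f := fun t => ‖γ₁ t - γ₂ t‖)
    (fun t ht => ((h₁.pos t ht).sub (h₂.pos t ht)).continuousWithinAt.norm)
  obtain ⟨s', hs', hW⟩ := isCompact_Icc.exists_isMaxOn hne (f := fun t => ‖γ₁' t - γ₂' t‖)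
    (fun t ht => ((h₁.vel t ht).sub (h₂.vel t ht)).continuousWithinAt.norm)
  set X := ‖γ₁ s - γ₂ s‖ with hXdef
  set W := ‖γ₁' s' - γ₂' s'‖ with hWdef
  have hX' : ∀ t ∈ Icc (0 : ℝ) 1, ‖γ₁ t - γ₂ t‖ ≤ X := fun t ht => hX ht
  have hW' : ∀ t ∈ Icc (0 : ℝ) 1, ‖γ₁' t - γ₂' t‖ ≤ W := fun t ht => hW ht
  set V₀ := ‖γ₁' 0 - γ₂' 0‖ with hV₀
  set Y₀ := ‖γ₁ 0 - γ₂ 0‖ with hY₀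
  set Q := 3 * B ^ 2 * L' * X + 6 * B * L * W with hQ
  have d1 : ∀ t ∈ Icc (0 : ℝ) 1, ‖(γ₁' t - γ₂' t) - (γ₁' 0 - γ₂' 0)‖ ≤ Q := fun t ht => by
    refine norm_sub_le_of_deriv_bound (F := fun t => γ₁' t - γ₂' t)
      (fun t ht => (h₁.vel t ht).sub (h₂.vel t ht)) (fun t ht => ?_) ht
    refine (quadField_sub_le (hG₁ t ht) (hG₂ t ht) (hG' t ht) (hB₁ t ht) (hB₂ t ht)).trans ?_
    have := hX' t ht
    have := hW' t ht
    rw [hQ]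
    gcongr
  have d2 : ∀ t ∈ Icc (0 : ℝ) 1, ‖(γ₁ t - γ₂ t) - (γ₁ 0 - γ₂ 0)‖ ≤ W := fun t ht =>
    norm_sub_le_of_deriv_bound (F := fun t => γ₁ t - γ₂ t)
      (fun t ht => (h₁.pos t ht).sub (h₂.pos t ht)) hW' ht
  have d3 : ∀ t ∈ Icc (0 : ℝ) 1, HasDerivWithinAt
      (fun t => (γ₁ t - t • γ₁' 0) - (γ₂ t - t • γ₂' 0)) ((γ₁' t - γ₁' 0) - (γ₂' t - γ₂' 0))
      (Icc 0 1) t := fun t ht => by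
    have a := (h₁.pos t ht).sub (((hasDerivAt_id t).smul_const (γ₁' 0)).hasDerivWithinAt
      (s := Icc (0 : ℝ) 1))
    have b := (h₂.pos t ht).sub (((hasDerivAt_id t).smul_const (γ₂' 0)).hasDerivWithinAt
      (s := Icc (0 : ℝ) 1))
    exact HasDerivWithinAt.congr_deriv
      (f := fun t => (γ₁ t - t • γ₁' 0) - (γ₂ t - t • γ₂' 0)) (a.sub b) (by simp)
  have d4 := norm_sub_le_of_deriv_bound d3 (C := Q) (fun t ht => by
    rw [sub_sub_sub_comm]; exact d1 t ht) (right_mem_Icc.2 zero_le_one)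
  have d5 : ‖(γ₁ 1 - γ₁ 0 - γ₁' 0) - (γ₂ 1 - γ₂ 0 - γ₂' 0)‖ ≤ Q := by
    refine le_trans (le_of_eq ?_) d4
    simp only [one_smul, zero_smul, sub_zero]
    congr 1
    abel
  have hWle : W ≤ V₀ + Q := by
    have := norm_le_norm_add_norm_sub' (γ₁' s' - γ₂' s') (γ₁' 0 - γ₂' 0)
    linarith [d1 s' hs']
  have hXle : X ≤ Y₀ + W := by
    have := norm_le_norm_add_norm_sub' (γ₁ s - γ₂ s) (γ₁ 0 - γ₂ 0)
    linarith [d2 s hs]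
  have hX0 : 0 ≤ X := norm_nonneg _
  have hW0 : 0 ≤ W := norm_nonneg _
  have hV0 : 0 ≤ V₀ := norm_nonneg _
  have hY0 : 0 ≤ Y₀ := norm_nonneg _
  have hα : 0 ≤ 3 * B ^ 2 * L' := by positivity
  have hβ : 0 ≤ 6 * B * L := by positivity
  set α := 3 * B ^ 2 * L' with hαdef
  set β := 6 * B * L with hβdef
  have hQ1 : Q ≤ (X + W) / 8 := by nlinarith
  have hX2 : X ≤ 2 * (Y₀ + 2 * V₀) := by linarith
  have hQ2 : Q ≤ α * (2 * (Y₀ + 2 * V₀)) + β * (V₀ + Q) := by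
    have e1 : α * X ≤ α * (2 * (Y₀ + 2 * V₀)) := mul_le_mul_of_nonneg_left hX2 hα
    have e2 : β * W ≤ β * (V₀ + Q) := mul_le_mul_of_nonneg_left hWle hβ
    linarith
  have hQ0 : 0 ≤ Q := by positivity
  have hQ3 : β * Q ≤ Q / 8 := by nlinarith
  linarith

end Quad

/-! ### The geodesic equation of the metric -/

/-- The gradient `∇ log λ` of the logarithm of the conformal factor `λ = u ^ (2 / (n - 2))`. -/
noncomputable def gradLog (a x : E n) : E n := (-(2 / (‖x + a‖ ^ n + ‖x + a‖ ^ 2))) • (x + a)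

theorem hasFDerivAt_metricFactor (hn : 3 ≤ n) {a y : E n} (hy : y + a ≠ 0) :
    HasFDerivAt (fun z => u a z ^ ((4 : ℝ) / ((n : ℝ) - 2)))
      ((2 * u a y ^ ((4 : ℝ) / ((n : ℝ) - 2))) • innerSL ℝ (gradLog a y)) y := by
  have hd : (3 : ℝ) ≤ n := by exact_mod_cast hn
  have hd2 : (n : ℝ) - 2 ≠ 0 := by linarith
  have hu := u_pos a y
  have hz : 0 < ‖y + a‖ := norm_pos_iff.2 hy
  have h1 : HasFDerivAt (fun z : E n => ‖z + a‖ ^ 2) (2 • innerSL ℝ (y + a)) y := by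
    have := ((hasFDerivAt_id y).add_const a).norm_sq
    simpa using this
  have h2 : HasFDerivAt (fun z : E n => (‖z + a‖ ^ 2) ^ ((2 - (n : ℝ)) / 2))
      (((2 - (n : ℝ)) / 2 * (‖y + a‖ ^ 2) ^ ((2 - (n : ℝ)) / 2 - 1)) • (2 • innerSL ℝ (y + a))) y :=
    h1.rpow_const (Or.inl (by positivity))
  have e : ∀ z : E n, u a z = 1 + (‖z + a‖ ^ 2) ^ ((2 - (n : ℝ)) / 2) := fun z => by
    unfold u
    rw [← Real.rpow_natCast, ← Real.rpow_mul (norm_nonneg _)]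
    congr 2
    push_cast
    ring
  have h3 : HasFDerivAt (u a) (((2 - (n : ℝ)) / 2 * (‖y + a‖ ^ 2) ^ ((2 - (n : ℝ)) / 2 - 1)) •
      (2 • innerSL ℝ (y + a))) y := by
    rw [show u a = fun z => 1 + (‖z + a‖ ^ 2) ^ ((2 - (n : ℝ)) / 2) from funext e]
    exact h2.const_add 1
  have h4 := h3.rpow_const (p := (4 : ℝ) / ((n : ℝ) - 2)) (Or.inl hu.ne')
  refine h4.congr_fderiv ?_
  have e2 : (‖y + a‖ ^ 2) ^ ((2 - (n : ℝ)) / 2 - 1) = (‖y + a‖ ^ n)⁻¹ := by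
    rw [← Real.rpow_natCast, ← Real.rpow_natCast, ← Real.rpow_mul (norm_nonneg _),
      ← Real.rpow_neg (norm_nonneg _)]
    congr 1
    push_cast
    ring
  have e3 : u a y = (‖y + a‖ ^ n + ‖y + a‖ ^ 2) / ‖y + a‖ ^ n := by
    unfold u
    rw [Real.rpow_sub hz, Real.rpow_natCast, Real.rpow_two]
    field_simp
  have e4 : ∀ x : ℝ, x / u a y * (u a y * ‖y + a‖ ^ n) = x * ‖y + a‖ ^ n := fun x => by
    field_simp
  rw [Real.rpow_sub_one hu.ne', e2]
  ext w
  simp only [gradLog, _root_.smul_apply, innerSL_apply_apply, real_inner_smul_left,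
    smul_eq_mul, nsmul_eq_mul]
  generalize u a y ^ ((4 : ℝ) / ((n : ℝ) - 2)) = U
  generalize inner ℝ (y + a) w = I
  rw [e3]
  have hp : 0 < ‖y + a‖ ^ n := by positivity
  have hs : 0 < ‖y + a‖ ^ n + ‖y + a‖ ^ 2 := by positivity
  push_cast
  field_simp
  ring

/-- The Christoffel symbols of a conformally flat metric: the geodesic equation is
`γ'' = |γ'|² G - 2 ⟪G, γ'⟫ γ'` with `G = ∇ log λ`. -/
theorem geodesicAccel_eq (hn : 3 ≤ n) {a y : E n} (hy : y + a ≠ 0) (v : E n) :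
    geodesicAccel a y v = quadField (gradLog a) y v := by
  have hu := u_pos a y
  obtain ⟨U, hU⟩ : ∃ U : ℝ, U = u a y ^ ((4 : ℝ) / ((n : ℝ) - 2)) := ⟨_, rfl⟩
  have hU0 : U ≠ 0 := by rw [hU]; positivity
  have hder : ∀ i j l : Fin n, metricDeriv a y i j l =
      2 * U * gradLog a y i * (if j = l then 1 else 0) := by
    intro i j l
    have h := (hasFDerivAt_metricFactor hn hy).mul_const (if j = l then (1 : ℝ) else 0)
    have e : (fun z : E n => metric a z j l) = fun z =>
        u a z ^ ((4 : ℝ) / ((n : ℝ) - 2)) * (if j = l then (1 : ℝ) else 0) := by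
      funext z
      simp [metric, Matrix.one_apply]
    unfold metricDeriv
    rw [e, h.fderiv, ← hU]
    rw [_root_.smul_apply, _root_.smul_apply, innerSL_apply_apply,
      EuclideanSpace.inner_single_right]
    simp only [smul_eq_mul, one_mul, conj_trivial]
    ring
  have hinv : (metric a y)⁻¹ = U⁻¹ • (1 : Matrix (Fin n) (Fin n) ℝ) := by
    refine Matrix.inv_eq_left_inv ?_
    rw [metric, ← hU, smul_mul_smul_comm, inv_mul_cancel₀ hU0, one_smul, one_mul]
  have hΓ : ∀ k i j : Fin n, christoffel a y k i j =
      gradLog a y i * (if j = k then 1 else 0) + gradLog a y j * (if i = k then 1 else 0) -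
        gradLog a y k * (if i = j then 1 else 0) := by
    intro k i j
    unfold christoffel
    simp only [hinv, hder, Matrix.smul_apply, Matrix.one_apply, smul_eq_mul]
    rw [Finset.sum_eq_single k (fun l _ hl => by simp [hl.symm]) (by simp)]
    simp only [if_true]
    field_simp
  ext k
  have hin : inner ℝ (gradLog a y) v = ∑ i, gradLog a y i * v i := by
    simp [PiLp.inner_apply, mul_comm]
  have hnorm : ‖v‖ ^ 2 = ∑ i, v i * v i := by
    rw [EuclideanSpace.norm_sq_eq]
    exact Finset.sum_congr rfl fun i _ => by rw [Real.norm_eq_abs, sq_abs, sq]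
  simp only [geodesicAccel, hΓ, quadField]
  have e1 : ∀ i j : Fin n, (gradLog a y i * (if j = k then 1 else 0) +
      gradLog a y j * (if i = k then 1 else 0) - gradLog a y k * (if i = j then 1 else 0)) *
      v i * v j = (gradLog a y i * v i) * (v j * (if j = k then 1 else 0)) +
      (v i * (if i = k then 1 else 0)) * (gradLog a y j * v j) -
      gradLog a y k * (v i * (v j * (if i = j then 1 else 0))) := fun i j => by ring
  simp only [e1, Finset.sum_sub_distrib, Finset.sum_add_distrib, ← Finset.mul_sum,
    ← Finset.sum_mul]
  simp only [mul_ite, mul_one, mul_zero, Finset.sum_ite_eq, Finset.sum_ite_eq', Finset.mem_univ,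
    if_true, PiLp.sub_apply, PiLp.smul_apply, smul_eq_mul, hin, hnorm]
  ring

/-! ### Bounds for the gradient of the conformal factor -/

theorem norm_gradLog_le {a x : E n} {δ : ℝ} (hδ : 0 < δ) (hx : δ ≤ ‖x + a‖) :
    ‖gradLog a x‖ ≤ 2 / δ := by
  have h0 : 0 < ‖x + a‖ := hδ.trans_le hx
  unfold gradLog
  rw [norm_smul, norm_neg, norm_div, Real.norm_ofNat, Real.norm_of_nonneg (by positivity)]
  calc 2 / (‖x + a‖ ^ n + ‖x + a‖ ^ 2) * ‖x + a‖ ≤ 2 / ‖x + a‖ ^ 2 * ‖x + a‖ := by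
        gcongr
        linarith [pow_pos h0 n]
    _ = 2 / ‖x + a‖ := by field_simp
    _ ≤ 2 / δ := by gcongr

theorem pow_sub_pow_le {s t : ℝ} (hs : 0 ≤ s) (hst : s ≤ t) (m : ℕ) :
    (t ^ m - s ^ m) * t ≤ m * t ^ m * (t - s) := by
  have ht : 0 ≤ t := hs.trans hst
  induction m with
  | zero => simp
  | succ k ih =>
    have h1 : s ^ k ≤ t ^ k := pow_le_pow_left₀ hs hst k
    have h2 : 0 ≤ t * (t - s) := mul_nonneg ht (by linarith)
    push_cast
    rw [pow_succ, pow_succ]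
    nlinarith [mul_le_mul_of_nonneg_right ih ht, mul_le_mul_of_nonneg_right h1 h2]

theorem inv_one_add_pow_sub_le {s t δ : ℝ} (hδ : 0 < δ) (hs : δ ≤ s) (ht : δ ≤ t) (m : ℕ) :
    |(1 + s ^ m)⁻¹ - (1 + t ^ m)⁻¹| ≤ m / δ * |s - t| := by
  wlog hst : s ≤ t generalizing s t
  · rw [abs_sub_comm, abs_sub_comm s]
    exact this ht hs (le_of_not_ge hst)
  have hs0 : 0 < s := hδ.trans_le hs
  have ht0 : 0 < t := hδ.trans_le ht
  have hsm : 0 < s ^ m := pow_pos hs0 m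
  have htm : 0 < t ^ m := pow_pos ht0 m
  have h1 := pow_sub_pow_le hs0.le hst m
  have h2 : s ^ m ≤ t ^ m := pow_le_pow_left₀ hs0.le hst m
  have e : (1 + s ^ m)⁻¹ - (1 + t ^ m)⁻¹ = (t ^ m - s ^ m) / ((1 + s ^ m) * (1 + t ^ m)) := by
    field_simp
    ring
  rw [e, abs_of_nonneg (by apply div_nonneg <;> [linarith; positivity]), abs_sub_comm,
    abs_of_nonneg (by linarith), div_le_iff₀ (by positivity)]
  have h3 : t ^ m - s ^ m ≤ m * t ^ m * (t - s) / δ := by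
    rw [le_div_iff₀ hδ]
    exact (mul_le_mul_of_nonneg_left ht (by linarith)).trans h1
  refine h3.trans ?_
  have h4 : t ^ m ≤ (1 + s ^ m) * (1 + t ^ m) := by nlinarith
  have h5 : 0 ≤ (m : ℝ) / δ * (t - s) := by
    have : 0 ≤ t - s := by linarith
    positivity
  calc m * t ^ m * (t - s) / δ = m / δ * (t - s) * t ^ m := by ring
    _ ≤ _ := mul_le_mul_of_nonneg_left h4 h5

theorem norm_inversion_sub_le {V : Type*} [NormedAddCommGroup V] [InnerProductSpace ℝ V] {z w : V}
    {δ : ℝ} (hδ : 0 < δ) (hz : δ ≤ ‖z‖) (hw : δ ≤ ‖w‖) :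
    ‖(‖z‖ ^ 2)⁻¹ • z - (‖w‖ ^ 2)⁻¹ • w‖ ≤ (δ ^ 2)⁻¹ * ‖z - w‖ := by
  have hz0 : 0 < ‖z‖ := hδ.trans_le hz
  have hw0 : 0 < ‖w‖ := hδ.trans_le hw
  have h : ‖(‖z‖ ^ 2)⁻¹ • z - (‖w‖ ^ 2)⁻¹ • w‖ ^ 2 = ((‖z‖ * ‖w‖)⁻¹ * ‖z - w‖) ^ 2 := by
    rw [mul_pow, norm_sub_sq_real, norm_sub_sq_real, norm_smul, norm_smul, real_inner_smul_left,
      real_inner_smul_right, norm_inv, norm_inv, norm_pow, norm_pow, norm_norm, norm_norm]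
    field_simp
    ring
  rw [(sq_eq_sq₀ (norm_nonneg _) (by positivity)).1 h]
  gcongr
  rw [pow_two]
  gcongr

/-- The Lipschitz constant of `∇ log λ` at distance `δ` from the puncture is `O(δ⁻²)`: the field is
`-2 (1 + |z| ^ (n - 2))⁻¹` times the inversion `z / |z|²`, where `z = x + a`. -/
theorem norm_gradLog_sub_le (hn : 3 ≤ n) {a x₁ x₂ : E n} {δ : ℝ} (hδ : 0 < δ)
    (h₁ : δ ≤ ‖x₁ + a‖) (h₂ : δ ≤ ‖x₂ + a‖) :
    ‖gradLog a x₁ - gradLog a x₂‖ ≤ 2 * (n + 1) / δ ^ 2 * ‖x₁ - x₂‖ := by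
  have hn2 : n = n - 2 + 2 := by omega
  have e : ∀ x : E n, δ ≤ ‖x + a‖ → gradLog a x =
      (-2 : ℝ) • ((1 + ‖x + a‖ ^ (n - 2))⁻¹ • ((‖x + a‖ ^ 2)⁻¹ • (x + a))) := by
    intro x hx
    have h0 : 0 < ‖x + a‖ := hδ.trans_le hx
    unfold gradLog
    rw [smul_smul, smul_smul]
    congr 1
    rw [show ‖x + a‖ ^ n = ‖x + a‖ ^ (n - 2) * ‖x + a‖ ^ 2 by rw [← pow_add, ← hn2]]
    field_simp
    ring
  set z := x₁ + a with hz
  set w := x₂ + a with hw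
  have hzw : x₁ - x₂ = z - w := by rw [hz, hw]; abel
  have hz0 : 0 < ‖z‖ := hδ.trans_le h₁
  have hw0 : 0 < ‖w‖ := hδ.trans_le h₂
  rw [e _ h₁, e _ h₂, hzw, ← smul_sub, norm_smul, norm_neg, Real.norm_ofNat]
  have e2 : (1 + ‖z‖ ^ (n - 2))⁻¹ • ((‖z‖ ^ 2)⁻¹ • z) - (1 + ‖w‖ ^ (n - 2))⁻¹ • ((‖w‖ ^ 2)⁻¹ • w) =
      (1 + ‖z‖ ^ (n - 2))⁻¹ • ((‖z‖ ^ 2)⁻¹ • z - (‖w‖ ^ 2)⁻¹ • w) +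
      ((1 + ‖z‖ ^ (n - 2))⁻¹ - (1 + ‖w‖ ^ (n - 2))⁻¹) • ((‖w‖ ^ 2)⁻¹ • w) := by module
  have b1 : ‖(1 + ‖z‖ ^ (n - 2))⁻¹‖ ≤ 1 := by
    rw [norm_inv, Real.norm_of_nonneg (by positivity)]
    exact inv_le_one_of_one_le₀ (by linarith [pow_pos hz0 (n - 2)])
  have b2 : ‖(‖w‖ ^ 2)⁻¹ • w‖ ≤ δ⁻¹ := by
    rw [norm_smul, norm_inv, norm_pow, norm_norm,
      show (‖w‖ ^ 2)⁻¹ * ‖w‖ = ‖w‖⁻¹ by field_simp]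
    gcongr
  have b3 := inv_one_add_pow_sub_le hδ h₁ h₂ (n - 2)
  have b4 : |‖z‖ - ‖w‖| ≤ ‖z - w‖ := abs_norm_sub_norm_le _ _
  have b5 : ((n - 2 : ℕ) : ℝ) ≤ n := by exact_mod_cast Nat.sub_le n 2
  rw [e2]
  have c1 : ‖(1 + ‖z‖ ^ (n - 2))⁻¹ • ((‖z‖ ^ 2)⁻¹ • z - (‖w‖ ^ 2)⁻¹ • w)‖ ≤
      1 * ((δ ^ 2)⁻¹ * ‖z - w‖) := by
    rw [norm_smul]
    exact mul_le_mul b1 (norm_inversion_sub_le hδ h₁ h₂) (norm_nonneg _) zero_le_one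
  have c2 : ‖((1 + ‖z‖ ^ (n - 2))⁻¹ - (1 + ‖w‖ ^ (n - 2))⁻¹) • ((‖w‖ ^ 2)⁻¹ • w)‖ ≤
      n / δ * ‖z - w‖ * δ⁻¹ := by
    rw [norm_smul]
    refine mul_le_mul (b3.trans ?_) b2 (norm_nonneg _) (by positivity)
    gcongr
  calc _ ≤ 2 * (1 * ((δ ^ 2)⁻¹ * ‖z - w‖) + n / δ * ‖z - w‖ * δ⁻¹) := by
        gcongr
        exact (norm_add_le _ _).trans (add_le_add c1 c2)
    _ = _ := by
        field_simp
        ring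

/-! ### Existence and uniqueness of geodesics -/

theorem isGeodesic_iff (hn : 3 ≤ n) (a : E n) (γ γ' : ℝ → E n) :
    IsGeodesic a γ γ' ↔ (∀ t ∈ Icc (0 : ℝ) 1, γ t + a ≠ 0) ∧ IsQuadSolution (gradLog a) γ γ' := by
  constructor
  · intro h
    have h0 : ∀ t ∈ Icc (0 : ℝ) 1, γ t + a ≠ 0 := fun t ht hc =>
      (h t ht).1 (eq_neg_of_add_eq_zero_left hc)
    exact ⟨h0, ⟨fun t ht => (h t ht).2.1, fun t ht => by
      rw [← geodesicAccel_eq hn (h0 t ht)]; exact (h t ht).2.2⟩⟩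
  · rintro ⟨h0, h1⟩ t ht
    refine ⟨fun hc => h0 t ht (by rw [hc]; simp), h1.pos t ht, ?_⟩
    rw [geodesicAccel_eq hn (h0 t ht)]
    exact h1.vel t ht

/-- Geodesics are determined by their initial data. By compactness both of them stay away from the
puncture and have bounded velocity, so that the geodesic equation is Lipschitz along them. -/
theorem geodesic_unique (hn : 3 ≤ n) {a : E n} {γ₁ γ₁' γ₂ γ₂' : ℝ → E n}
    (h₁ : IsGeodesic a γ₁ γ₁') (h₂ : IsGeodesic a γ₂ γ₂') (h0 : γ₁ 0 = γ₂ 0)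
    (h0' : γ₁' 0 = γ₂' 0) : γ₁ 1 = γ₂ 1 := by
  obtain ⟨n₁, s₁⟩ := (isGeodesic_iff hn a γ₁ γ₁').1 h₁
  obtain ⟨n₂, s₂⟩ := (isGeodesic_iff hn a γ₂ γ₂').1 h₂
  have hne : (Icc (0 : ℝ) 1).Nonempty := ⟨0, left_mem_Icc.2 zero_le_one⟩
  have key : ∀ γ γ' : ℝ → E n, (∀ t ∈ Icc (0 : ℝ) 1, γ t + a ≠ 0) →
      IsQuadSolution (gradLog a) γ γ' → ∃ δ B : ℝ, 0 < δ ∧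
        ∀ t ∈ Icc (0 : ℝ) 1, δ ≤ ‖γ t + a‖ ∧ ‖γ' t‖ ≤ B := by
    intro γ γ' hγ hs
    obtain ⟨t₀, ht₀, hmin⟩ := isCompact_Icc.exists_isMinOn hne (f := fun t => ‖γ t + a‖)
      (fun t ht => ((hs.pos t ht).continuousWithinAt.add continuousWithinAt_const).norm)
    obtain ⟨t₁, ht₁, hmax⟩ := isCompact_Icc.exists_isMaxOn hne (f := fun t => ‖γ' t‖)
      (fun t ht => (hs.vel t ht).continuousWithinAt.norm)
    exact ⟨_, _, norm_pos_iff.2 (hγ t₀ ht₀), fun t ht => ⟨hmin ht, hmax ht⟩⟩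
  obtain ⟨δ₁, B₁, hδ₁, hb₁⟩ := key γ₁ γ₁' n₁ s₁
  obtain ⟨δ₂, B₂, hδ₂, hb₂⟩ := key γ₂ γ₂' n₂ s₂
  set δ := min δ₁ δ₂ with hδ
  set B := max B₁ B₂ with hB
  have hδ0 : 0 < δ := lt_min hδ₁ hδ₂
  have hB0 : 0 ≤ B := (norm_nonneg _).trans
    ((hb₁ 0 (left_mem_Icc.2 zero_le_one)).2.trans (le_max_left _ _))
  set K : Set (E n × E n) := {p | δ ≤ ‖p.1 + a‖ ∧ ‖p.2‖ ≤ B} with hK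
  set F : ℝ → E n × E n → E n × E n := fun _ p => (p.2, quadField (gradLog a) p.1 p.2) with hF
  have hlip : LipschitzOnWith ⟨1 + 3 * B ^ 2 * (2 * (n + 1) / δ ^ 2) + 6 * B * (2 / δ),
      by positivity⟩ (F 0) K := by
    refine LipschitzOnWith.of_dist_le_mul fun p hp q hq => ?_
    change dist _ _ ≤ (1 + 3 * B ^ 2 * (2 * (n + 1) / δ ^ 2) + 6 * B * (2 / δ)) * dist p q
    have d1 : ‖p.1 - q.1‖ ≤ dist p q := by rw [← dist_eq_norm]; exact le_max_left _ _
    have d2 : ‖p.2 - q.2‖ ≤ dist p q := by rw [← dist_eq_norm]; exact le_max_right _ _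
    have hd : 0 ≤ dist p q := dist_nonneg
    have c1 : 0 ≤ 3 * B ^ 2 * (2 * ((n : ℝ) + 1) / δ ^ 2) := by positivity
    have c2 : 0 ≤ 6 * B * (2 / δ) := by positivity
    rw [Prod.dist_eq]
    refine max_le ?_ ?_
    · rw [dist_eq_norm]
      simp only [hF]
      nlinarith
    · rw [dist_eq_norm]
      simp only [hF]
      have := quadField_sub_le (norm_gradLog_le hδ0 hp.1) (norm_gradLog_le hδ0 hq.1)
        (norm_gradLog_sub_le hn hδ0 hp.1 hq.1) hp.2 hq.2
      nlinarith [mul_le_mul_of_nonneg_left d1 c1, mul_le_mul_of_nonneg_left d2 c2]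
  have hcont : ∀ γ γ' : ℝ → E n, IsQuadSolution (gradLog a) γ γ' →
      ∀ t ∈ Icc (0 : ℝ) 1, HasDerivWithinAt (fun t => (γ t, γ' t)) (F t (γ t, γ' t)) (Icc 0 1) t :=
    fun γ γ' hs t ht => (hs.pos t ht).prodMk (hs.vel t ht)
  have hright : ∀ γ γ' : ℝ → E n, IsQuadSolution (gradLog a) γ γ' →
      ∀ t ∈ Ico (0 : ℝ) 1, HasDerivWithinAt (fun t => (γ t, γ' t)) (F t (γ t, γ' t)) (Ici t) t :=
    fun γ γ' hs t ht => (hcont γ γ' hs t (Ico_subset_Icc_self ht)).mono_of_mem_nhdsWithin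
      (mem_of_superset (Icc_mem_nhdsGE ht.2) (Icc_subset_Icc_left ht.1))
  have := ODE_solution_unique_of_mem_Icc_right (v := F) (s := fun _ => K) (a := 0) (b := 1)
    (f := fun t => (γ₁ t, γ₁' t)) (g := fun t => (γ₂ t, γ₂' t)) (fun t _ => hlip)
    (fun t ht => (hcont _ _ s₁ t ht).continuousWithinAt) (hright _ _ s₁)
    (fun t ht => ⟨(min_le_left _ _).trans (hb₁ t (Ico_subset_Icc_self ht)).1,
      (hb₁ t (Ico_subset_Icc_self ht)).2.trans (le_max_left _ _)⟩)
    (fun t ht => (hcont _ _ s₂ t ht).continuousWithinAt) (hright _ _ s₂)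
    (fun t ht => ⟨(min_le_right _ _).trans (hb₂ t (Ico_subset_Icc_self ht)).1,
      (hb₂ t (Ico_subset_Icc_self ht)).2.trans (le_max_right _ _)⟩)
    (by simp [h0, h0'])
  exact congrArg Prod.fst (this (right_mem_Icc.2 zero_le_one))

/-! ### The exponential map -/

/-- The exponential map of the metric, with value `0` where it is not defined. It is a choice from
the relation `IsExp`, which is single-valued by `geodesic_unique`. -/
noncomputable def expMap (a y v : E n) : E n := open Classical in
  if h : ∃ z, IsExp a y v z then h.choose else 0

/-- Uniqueness of geodesics turns the relation `IsExp` into a function. -/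
theorem isExp_iff_eq_expMap (hn : 3 ≤ n) {a y v : E n} (h : ∃ z, IsExp a y v z) (z : E n) :
    IsExp a y v z ↔ z = expMap a y v := by
  have h0 : IsExp a y v (expMap a y v) := by
    rw [expMap, dif_pos h]
    exact h.choose_spec
  constructor
  · intro hz
    obtain ⟨γ₁, γ₁', g₁, p₁, v₁, rfl⟩ := hz
    obtain ⟨γ₂, γ₂', g₂, p₂, v₂, e₂⟩ := h0
    rw [← e₂]
    exact geodesic_unique hn g₁ g₂ (p₁.trans p₂.symm) (v₁.trans v₂.symm)
  · rintro rfl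
    exact h0

/-- Short geodesics exist, and their end point is the value of the exponential map. -/
theorem exists_geodesic (hn : 3 ≤ n) {a y v : E n} {δ M : ℝ} (hδ : 0 < δ) (hM : 0 < M)
    (hM1 : 2 * M ≤ 1) (hMδ : 24 * M ≤ δ) (hv : ‖v‖ ≤ M)
    (hy : ∀ x ∈ closedBall y 1, δ ≤ ‖x + a‖) :
    (∃ z, IsExp a y v z) ∧ ∃ γ γ' : ℝ → E n, IsQuadSolution (gradLog a) γ γ' ∧ γ 0 = y ∧
      γ' 0 = v ∧ γ 1 = expMap a y v ∧
      ∀ t ∈ Icc (0 : ℝ) 1, δ ≤ ‖γ t + a‖ ∧ ‖γ' t‖ ≤ 2 * M := by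
  obtain ⟨γ, γ', hs, h0, h0', hb⟩ := exists_isQuadSolution (G := gradLog a) (y := y) (v := v)
    (L := 2 / δ) (L' := 2 * (n + 1) / δ ^ 2) hM hM1
    (by rw [show 12 * (2 / δ) * M = 24 * M / δ by ring, div_le_one hδ]; exact hMδ) hv
    (fun x hx => norm_gradLog_le hδ (hy x hx))
    (fun x hx x' hx' => norm_gradLog_sub_le hn hδ (hy x hx) (hy x' hx')) (by positivity)
  have hfar : ∀ t ∈ Icc (0 : ℝ) 1, δ ≤ ‖γ t + a‖ := fun t ht =>
    hy _ (by rw [mem_closedBall, dist_eq_norm]; exact (hb t ht).1)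
  have hgeo : IsGeodesic a γ γ' := (isGeodesic_iff hn a γ γ').2
    ⟨fun t ht => norm_pos_iff.1 (hδ.trans_le (hfar t ht)), hs⟩
  have hexp : IsExp a y v (γ 1) := ⟨γ, γ', hgeo, h0, h0', rfl⟩
  exact ⟨⟨_, hexp⟩, γ, γ', hs, h0, h0', (isExp_iff_eq_expMap hn ⟨_, hexp⟩ _).1 hexp,
    fun t ht => ⟨hfar t ht, (hb t ht).2⟩⟩

/-- For short velocities the exponential map at distance `δ` from the puncture differs from
`y + v` only quadratically in `v`, with an additional factor `1 / δ`. -/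
theorem norm_expMap_sub_le (hn : 3 ≤ n) {a y v : E n} {δ M : ℝ} (hδ : 0 < δ) (hM : 0 < M)
    (hM1 : 2 * M ≤ 1) (hMδ : 24 * M ≤ δ) (hv : ‖v‖ ≤ M)
    (hy : ∀ x ∈ closedBall y 1, δ ≤ ‖x + a‖) :
    ‖expMap a y v - y - v‖ ≤ 24 * M ^ 2 / δ := by
  obtain ⟨-, γ, γ', hs, h0, h0', h1, hb⟩ := exists_geodesic hn hδ hM hM1 hMδ hv hy
  have := hs.norm_end_sub_le (fun t ht => norm_gradLog_le hδ (hb t ht).1) (fun t ht => (hb t ht).2)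
  rw [h0, h0', h1] at this
  exact this.trans (le_of_eq (by ring))

/-- The difference between the exponential map and `y + v` is Lipschitz in the initial data, with a
constant that is small like `M² / δ² + M / δ`. -/
theorem norm_expMap_sub_sub_le (hn : 3 ≤ n) {a y₁ y₂ v₁ v₂ : E n} {δ M : ℝ} (hδ : 0 < δ)
    (hM : 0 < M) (hM1 : 2 * M ≤ 1) (hMδ : 192 * M ≤ δ) (hMδ' : 192 * (n + 1) * M ^ 2 ≤ δ ^ 2)
    (hv₁ : ‖v₁‖ ≤ M) (hv₂ : ‖v₂‖ ≤ M) (hy₁ : ∀ x ∈ closedBall y₁ 1, δ ≤ ‖x + a‖)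
    (hy₂ : ∀ x ∈ closedBall y₂ 1, δ ≤ ‖x + a‖) :
    ‖(expMap a y₁ v₁ - y₁ - v₁) - (expMap a y₂ v₂ - y₂ - v₂)‖ ≤
      96 * (n + 1) * M ^ 2 / δ ^ 2 * (‖y₁ - y₂‖ + 2 * ‖v₁ - v₂‖) + 48 * M / δ * ‖v₁ - v₂‖ := by
  obtain ⟨-, γ₁, γ₁', hs₁, h0₁, h0₁', h1₁, hb₁⟩ :=
    exists_geodesic hn hδ hM hM1 (by linarith) hv₁ hy₁
  obtain ⟨-, γ₂, γ₂', hs₂, h0₂, h0₂', h1₂, hb₂⟩ :=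
    exists_geodesic hn hδ hM hM1 (by linarith) hv₂ hy₂
  have := hs₁.norm_end_sub_sub_le hs₂ (L := 2 / δ) (L' := 2 * (n + 1) / δ ^ 2) (B := 2 * M)
    (fun t ht => norm_gradLog_le hδ (hb₁ t ht).1) (fun t ht => norm_gradLog_le hδ (hb₂ t ht).1)
    (fun t ht => norm_gradLog_sub_le hn hδ (hb₁ t ht).1 (hb₂ t ht).1)
    (fun t ht => (hb₁ t ht).2) (fun t ht => (hb₂ t ht).2) (by positivity)
    (by
      rw [show 3 * (2 * M) ^ 2 * (2 * ((n : ℝ) + 1) / δ ^ 2) = 24 * (n + 1) * M ^ 2 / δ ^ 2 by ring,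
        div_le_iff₀ (by positivity)]
      linarith)
    (by
      rw [show 6 * (2 * M) * (2 / δ) = 24 * M / δ by ring, div_le_iff₀ hδ]
      linarith)
  rw [h0₁, h0₁', h1₁, h0₂, h0₂', h1₂] at this
  exact this.trans (le_of_eq (by ring))

/-! ### Positively homogeneous extensions from a sphere -/

section Homogeneous

variable {V : Type*} [NormedAddCommGroup V] [InnerProductSpace ℝ V]

/-- The positively homogeneous extension, of degree one, of a map given on the sphere of radius `r`
around the origin. -/
noncomputable def homogeneousExt (r : ℝ) (w : V → V) (x : V) : V :=
  (‖x‖ / r) • w ((r / ‖x‖) • x)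

theorem homogeneousExt_of_mem {r : ℝ} (hr : 0 < r) (w : V → V) {y : V} (hy : y ∈ sphere (0 : V) r) :
    homogeneousExt r w y = w y := by
  rw [mem_sphere_zero_iff_norm] at hy
  rw [homogeneousExt, hy, div_self hr.ne', one_smul, one_smul]

theorem smul_mem_sphere {r : ℝ} (hr : 0 < r) {x : V} (hx : x ≠ 0) :
    (r / ‖x‖) • x ∈ sphere (0 : V) r := by
  rw [mem_sphere_zero_iff_norm, norm_smul, norm_div, norm_norm, Real.norm_of_nonneg hr.le,
    div_mul_cancel₀ _ (norm_ne_zero_iff.2 hx)]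

theorem norm_homogeneousExt_le {r A : ℝ} (hr : 0 < r) {w : V → V}
    (hA : ∀ y ∈ sphere (0 : V) r, ‖w y‖ ≤ A * r) (x : V) : ‖homogeneousExt r w x‖ ≤ A * ‖x‖ := by
  rcases eq_or_ne x 0 with rfl | hx
  · simp [homogeneousExt]
  rw [homogeneousExt, norm_smul, norm_div, norm_norm, Real.norm_of_nonneg hr.le]
  calc ‖x‖ / r * ‖w ((r / ‖x‖) • x)‖ ≤ ‖x‖ / r * (A * r) := by
        gcongr
        exact hA _ (smul_mem_sphere hr hx)
    _ = A * ‖x‖ := by field_simp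

/-- The extension is Lipschitz with a constant controlled by the size of `w`, which bounds the
radial derivative, and by its Lipschitz constant on the sphere. -/
theorem norm_homogeneousExt_sub_le {r A B : ℝ} (hr : 0 < r) (hB0 : 0 ≤ B) {w : V → V}
    (hA : ∀ y ∈ sphere (0 : V) r, ‖w y‖ ≤ A * r)
    (hB : ∀ y ∈ sphere (0 : V) r, ∀ y' ∈ sphere (0 : V) r, ‖w y - w y'‖ ≤ B * ‖y - y'‖) (x x' : V) :
    ‖homogeneousExt r w x - homogeneousExt r w x'‖ ≤ (A + 2 * B) * ‖x - x'‖ := by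
  have hz : homogeneousExt r w 0 = 0 := by simp [homogeneousExt]
  have hle : A ≤ A + 2 * B := by linarith
  rcases eq_or_ne x 0 with rfl | hx
  · rw [hz, zero_sub, norm_neg, zero_sub, norm_neg]
    exact (norm_homogeneousExt_le hr hA x').trans (by gcongr)
  rcases eq_or_ne x' 0 with rfl | hx'
  · rw [hz, sub_zero, sub_zero]
    exact (norm_homogeneousExt_le hr hA x).trans (by gcongr)
  have hxn : 0 < ‖x‖ := norm_pos_iff.2 hx
  have hxn' : 0 < ‖x'‖ := norm_pos_iff.2 hx'
  set y := (r / ‖x‖) • x with hy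
  set y' := (r / ‖x'‖) • x' with hy'
  have hd : |‖x‖ - ‖x'‖| ≤ ‖x - x'‖ := abs_norm_sub_norm_le _ _
  have e : homogeneousExt r w x - homogeneousExt r w x' =
      (‖x‖ / r) • (w y - w y') + ((‖x‖ - ‖x'‖) / r) • w y' := by
    simp only [homogeneousExt, ← hy, ← hy', sub_div]
    module
  have h1 : ‖x‖ / r * ‖y - y'‖ ≤ 2 * ‖x - x'‖ := by
    have e2 : (‖x‖ / r) • (y - y') = (x - x') + ((‖x'‖ - ‖x‖) / ‖x'‖) • x' := by
      rw [hy, hy', smul_sub, smul_smul, smul_smul, div_mul_div_cancel₀ hr.ne', div_self hxn.ne',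
        one_smul, div_mul_div_cancel₀ hr.ne', sub_div, div_self hxn'.ne', sub_smul, one_smul]
      abel
    calc ‖x‖ / r * ‖y - y'‖ = ‖(‖x‖ / r) • (y - y')‖ := by
          rw [norm_smul, norm_div, norm_norm, Real.norm_of_nonneg hr.le]
      _ ≤ ‖x - x'‖ + ‖((‖x'‖ - ‖x‖) / ‖x'‖) • x'‖ := by rw [e2]; exact norm_add_le _ _
      _ = ‖x - x'‖ + |‖x‖ - ‖x'‖| := by
          rw [norm_smul, norm_div, norm_norm, div_mul_cancel₀ _ hxn'.ne', Real.norm_eq_abs,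
            abs_sub_comm]
      _ ≤ 2 * ‖x - x'‖ := by linarith
  have h2 : ‖(‖x‖ / r) • (w y - w y')‖ ≤ 2 * B * ‖x - x'‖ := by
    rw [norm_smul, norm_div, norm_norm, Real.norm_of_nonneg hr.le]
    calc ‖x‖ / r * ‖w y - w y'‖ ≤ ‖x‖ / r * (B * ‖y - y'‖) := by
          gcongr
          exact hB _ (smul_mem_sphere hr hx) _ (smul_mem_sphere hr hx')
      _ = B * (‖x‖ / r * ‖y - y'‖) := by ring
      _ ≤ B * (2 * ‖x - x'‖) := by gcongr
      _ = 2 * B * ‖x - x'‖ := by ring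
  have h3 : ‖((‖x‖ - ‖x'‖) / r) • w y'‖ ≤ A * ‖x - x'‖ := by
    rw [norm_smul, norm_div, Real.norm_eq_abs, Real.norm_of_nonneg hr.le]
    calc |‖x‖ - ‖x'‖| / r * ‖w y'‖ ≤ ‖x - x'‖ / r * (A * r) := by
          gcongr
          exact hA _ (smul_mem_sphere hr hx')
      _ = A * ‖x - x'‖ := by field_simp
  rw [e]
  linarith [norm_add_le ((‖x‖ / r) • (w y - w y')) (((‖x‖ - ‖x'‖) / r) • w y')]

/-- A radial map is the sum of the identity and a homogeneous extension. -/
theorem radialMap_eq_add_homogeneousExt {r : ℝ} (hr : 0 < r) (e : V) (φ : ℝ → ℝ) (x : V) :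
    radialMap e (fun t => 1 + φ t) x =
      x + homogeneousExt r (fun y => φ (inner ℝ e y / r) • y) x := by
  rcases eq_or_ne x 0 with rfl | hx
  · simp [homogeneousExt, radialMap]
  have hxn : ‖x‖ ≠ 0 := norm_ne_zero_iff.2 hx
  simp only [homogeneousExt, radialMap, real_inner_smul_right]
  rw [show r / ‖x‖ * inner ℝ e x / r = inner ℝ e x / ‖x‖ by field_simp, add_smul, one_smul,
    smul_smul, smul_smul]
  congr 2
  field_simp

/-! ### Small Lipschitz perturbations of the identity -/

/-- A perturbation of the identity with Lipschitz constant at most `1 / 2` is a homeomorphism of the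
whole space. -/
theorem exists_homeomorph_of_lipschitz [CompleteSpace V] [Nontrivial V] {h : V → V}
    (hh : ∀ x y, ‖h x - h y‖ ≤ 1 / 2 * ‖x - y‖) : ∃ H : V ≃ₜ V, ∀ x, H x = x + h x := by
  have ha : ApproximatesLinearOn (fun x => x + h x) (ContinuousLinearEquiv.refl ℝ V : V →L[ℝ] V)
      univ (1 / 2 : ℝ≥0) := by
    intro x _ y _
    have e : x + h x - (y + h y) - (ContinuousLinearEquiv.refl ℝ V : V →L[ℝ] V) (x - y) =
        h x - h y := by
      change x + h x - (y + h y) - (x - y) = _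
      abel
    rw [e]
    simpa using hh x y
  refine ⟨ha.toHomeomorph _ (Or.inr ?_), fun x => rfl⟩
  have : ‖((ContinuousLinearEquiv.refl ℝ V).symm : V →L[ℝ] V)‖₊ = 1 := by
    change ‖ContinuousLinearMap.id ℝ V‖₊ = 1
    ext
    exact ContinuousLinearMap.norm_id
  rw [this, inv_one]
  exact one_half_lt_one

theorem norm_sub_le_two_mul {h : V → V} (hh : ∀ x y, ‖h x - h y‖ ≤ 1 / 2 * ‖x - y‖) (x y : V) :
    ‖x - y‖ ≤ 2 * ‖(x + h x) - (y + h y)‖ := by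
  have h1 : ‖x - y‖ ≤ ‖(x + h x) - (y + h y)‖ + ‖h x - h y‖ := by
    have := norm_sub_le ((x + h x) - (y + h y)) (h x - h y)
    rwa [show (x + h x) - (y + h y) - (h x - h y) = x - y by abel] at this
  linarith [hh x y]

/-! ### The region enclosed by the image of a sphere -/

/-- Outside the ball the connected component contains a ray, inside it is contained in the ball.
In this form the statement needs no connectedness of the exterior. -/
theorem isBounded_connectedComponentIn_iff [Nontrivial V] {r : ℝ} (hr : 0 < r) {x : V}
    (hx : x ∉ sphere (0 : V) r) :
    Bornology.IsBounded (connectedComponentIn (sphere (0 : V) r)ᶜ x) ↔ x ∈ ball (0 : V) r := by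
  constructor
  · intro hb
    by_contra hxb
    have hxr : r < ‖x‖ := by
      rw [mem_ball_zero_iff, not_lt] at hxb
      rw [mem_sphere_zero_iff_norm] at hx
      exact lt_of_le_of_ne hxb (Ne.symm hx)
    -- the component contains the ray from `x` to infinity
    have hray : (fun s : ℝ => s • x) '' Ici 1 ⊆ connectedComponentIn (sphere (0 : V) r)ᶜ x := by
      refine IsPreconnected.subset_connectedComponentIn
        (isPreconnected_Ici.image _ (by fun_prop)) ⟨1, self_mem_Ici, one_smul _ _⟩ ?_
      rintro _ ⟨s, hs, rfl⟩ hmem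
      rw [mem_sphere_zero_iff_norm, norm_smul, Real.norm_of_nonneg (zero_le_one.trans hs)] at hmem
      nlinarith [mem_Ici.1 hs]
    obtain ⟨B, hB⟩ := (hb.subset hray).exists_norm_le
    have hs : (1 : ℝ) ≤ 1 + |B| / r := by
      have : 0 ≤ |B| / r := by positivity
      linarith
    have := hB _ ⟨1 + |B| / r, hs, rfl⟩
    rw [norm_smul, Real.norm_of_nonneg (zero_le_one.trans hs)] at this
    have h1 : (1 + |B| / r) * r = r + |B| := by field_simp
    nlinarith [le_abs_self B]
  · intro hxb
    refine (isBounded_ball (x := (0 : V)) (r := r)).subset fun z hz => ?_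
    have hpre : IsPreconnected (norm '' connectedComponentIn (sphere (0 : V) r)ᶜ x) :=
      isPreconnected_connectedComponentIn.image _ continuous_norm.continuousOn
    by_contra hzb
    have hxmem : x ∈ connectedComponentIn (sphere (0 : V) r)ᶜ x := mem_connectedComponentIn hx
    have := hpre.ordConnected.out ⟨x, hxmem, rfl⟩ ⟨z, hz, rfl⟩
      (⟨(mem_ball_zero_iff.1 hxb).le, by simpa using hzb⟩ : r ∈ Icc ‖x‖ ‖z‖)
    obtain ⟨w, hw, hwr⟩ := this
    exact connectedComponentIn_subset _ _ hw (by simpa using hwr)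

end Homogeneous

/-- A homeomorphism of the space that preserves boundedness maps the region enclosed by a sphere to
the region enclosed by its image. This takes the place of the Jordan–Brouwer theorem. -/
theorem enclosed_image_sphere (hn : 3 ≤ n) {r : ℝ} (hr : 0 < r) (H : E n ≃ₜ E n)
    (hH : ∀ s : Set (E n), Bornology.IsBounded (H '' s) ↔ Bornology.IsBounded s) :
    enclosed (H '' sphere 0 r) = H '' ball 0 r := by
  have : Nontrivial (E n) := by
    have := two_le_finrank hn
    exact Module.nontrivial_of_finrank_pos (R := ℝ) (by omega)
  ext z
  obtain ⟨x, rfl⟩ := H.surjective z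
  rw [H.injective.mem_set_image]
  simp only [enclosed, mem_ofPred_eq, H.injective.mem_set_image]
  have hcompl : (H '' sphere 0 r)ᶜ = H '' (sphere 0 r)ᶜ := (image_compl_eq H.bijective).symm
  constructor
  · rintro ⟨hx, hb⟩
    rw [hcompl, ← H.image_connectedComponentIn hx, hH] at hb
    exact (isBounded_connectedComponentIn_iff hr hx).1 hb
  · intro hx
    have hx' : x ∉ sphere (0 : E n) r := fun h => by
      rw [mem_ball_zero_iff] at hx
      rw [mem_sphere_zero_iff_norm] at h
      exact hx.ne h
    refine ⟨hx', ?_⟩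
    rw [hcompl, ← H.image_connectedComponentIn hx', hH]
    exact (isBounded_connectedComponentIn_iff hr hx').2 hx

/-! ### Area and volume under almost isometric maps -/

/-- A `K`-Lipschitz homeomorphism that increases the density at most by the factor `M` increases the
weighted `d`-dimensional measure at most by the factor `K ^ d * M`. -/
theorem withDensity_hausdorffE_image_le {X : Type*} [EMetricSpace X] [MeasurableSpace X]
    [BorelSpace X] (d : ℕ) (T : X ≃ₜ X) {K : ℝ≥0} (hT : ∀ x y, edist (T x) (T y) ≤ K * edist x y)
    {w : X → ℝ≥0∞} (hw : Measurable w) {M : ℝ≥0∞} {S : Set X} (hS : MeasurableSet S)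
    (hM : ∀ x ∈ S, w (T x) ≤ M * w x) :
    (μHE[d] : Measure X).withDensity w (T '' S) ≤
      K ^ d * M * (μHE[d] : Measure X).withDensity w S := by
  have hTS : MeasurableSet (T '' S) := T.measurableEmbedding.measurableSet_image.2 hS
  have hle : (μHE[d] : Measure X).restrict (T '' S) ≤
      ((K : ℝ≥0∞) ^ d) • ((μHE[d] : Measure X).restrict S).map T := by
    refine Measure.le_iff.2 fun B hB => ?_
    rw [Measure.restrict_apply hB, Measure.smul_apply, smul_eq_mul,
      Measure.map_apply T.measurable hB, Measure.restrict_apply (T.measurable hB),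
      inter_comm, ← image_inter_preimage, inter_comm]
    have := hausdorffE_image_le d T id (T ⁻¹' B ∩ S) K fun x _ y _ => hT x y
    rwa [image_id] at this
  rw [withDensity_apply _ hTS, withDensity_apply _ hS]
  calc ∫⁻ x in T '' S, w x ∂μHE[d]
      ≤ ∫⁻ x, w x ∂(((K : ℝ≥0∞) ^ d) • ((μHE[d] : Measure X).restrict S).map T) :=
        lintegral_mono' hle le_rfl
    _ = (K : ℝ≥0∞) ^ d * ∫⁻ x in S, w (T x) ∂μHE[d] := by
        rw [lintegral_smul_measure, smul_eq_mul, lintegral_map hw T.measurable]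
    _ ≤ (K : ℝ≥0∞) ^ d * ∫⁻ x in S, M * w x ∂μHE[d] := by
        exact mul_le_mul' le_rfl (setLIntegral_mono (hw.const_mul M) hM)
    _ = _ := by rw [lintegral_const_mul _ hw, mul_assoc]

/-- The factor `u` is nearly constant under small relative changes of the distance to the
puncture. -/
theorem u_le_of_norm_le (hn : 3 ≤ n) {a z z' : E n} {ε : ℝ} (hε : 0 ≤ ε) (hz : 0 < ‖z + a‖)
    (h : ‖z + a‖ ≤ (1 + ε) * ‖z' + a‖) : u a z' ≤ (1 + ε) ^ ((n : ℝ) - 2) * u a z := by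
  have hd : (3 : ℝ) ≤ n := by exact_mod_cast hn
  have h1 : 0 < 1 + ε := by linarith
  have hz' : 0 < ‖z' + a‖ := pos_of_mul_pos_right (hz.trans_le h) h1.le
  have h2 : ‖z' + a‖ ^ (2 - (n : ℝ)) ≤ (1 + ε) ^ ((n : ℝ) - 2) * ‖z + a‖ ^ (2 - (n : ℝ)) := by
    have h3 := Real.rpow_le_rpow_of_nonpos hz h (by linarith : 2 - (n : ℝ) ≤ 0)
    rw [Real.mul_rpow h1.le hz'.le] at h3
    calc ‖z' + a‖ ^ (2 - (n : ℝ)) = (1 + ε) ^ ((n : ℝ) - 2) *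
          ((1 + ε) ^ (2 - (n : ℝ)) * ‖z' + a‖ ^ (2 - (n : ℝ))) := by
          rw [← mul_assoc, ← Real.rpow_add h1]
          simp
      _ ≤ _ := by gcongr
  have h4 : 1 ≤ (1 + ε) ^ ((n : ℝ) - 2) := Real.one_le_rpow (by linarith) (by linarith)
  unfold u
  linarith

theorem u_rpow_le_of_norm_le (hn : 3 ≤ n) {a z z' : E n} {ε s : ℝ} (hε : 0 ≤ ε) (hs : 0 ≤ s)
    (hz : 0 < ‖z + a‖) (h : ‖z + a‖ ≤ (1 + ε) * ‖z' + a‖) :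
    ENNReal.ofReal (u a z' ^ (2 * s / ((n : ℝ) - 2))) ≤
      ENNReal.ofReal ((1 + ε) ^ (2 * s)) * ENNReal.ofReal (u a z ^ (2 * s / ((n : ℝ) - 2))) := by
  have hd : (3 : ℝ) ≤ n := by exact_mod_cast hn
  have h1 : 0 < 1 + ε := by linarith
  rw [← ENNReal.ofReal_mul (by positivity)]
  refine ENNReal.ofReal_le_ofReal ?_
  have hp : 0 ≤ 2 * s / ((n : ℝ) - 2) := div_nonneg (by linarith) (by linarith)
  refine (Real.rpow_le_rpow (u_pos a z').le (u_le_of_norm_le hn hε hz h) hp).trans (le_of_eq ?_)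
  rw [Real.mul_rpow (by positivity) (u_pos a z).le, ← Real.rpow_mul h1.le,
    mul_div_cancel₀ _ (by linarith)]

section Perturbation

variable {h₀ h : E n → E n} {κ : ℝ}

/-- Two small Lipschitz perturbations of the identity whose difference is even smaller map a set
near the origin to sets of almost equal area and volume. -/
theorem area_vol_image_le (hn : 3 ≤ n) (hh₀ : ∀ x y, ‖h₀ x - h₀ y‖ ≤ 1 / 2 * ‖x - y‖)
    (hh : ∀ x y, ‖h x - h y‖ ≤ 1 / 2 * ‖x - y‖) (hz₀ : h₀ 0 = 0) (hz : h 0 = 0) (hκ : 0 ≤ κ)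
    (hd : ∀ x y, ‖(h x - h₀ x) - (h y - h₀ y)‖ ≤ κ * ‖x - y‖) {H₀ H : E n ≃ₜ E n}
    (hH₀ : ∀ x, H₀ x = x + h₀ x) (hH : ∀ x, H x = x + h x) {a : E n} {r : ℝ} (hr : 0 < r)
    (ha : 4 * r ≤ ‖a‖) {A : Set (E n)} (hA : MeasurableSet A) (hAr : A ⊆ closedBall 0 r) :
    area a (H '' A) ≤ ENNReal.ofReal ((1 + 2 * κ) ^ (3 * (n - 1))) * area a (H₀ '' A) ∧
      vol a (H '' A) ≤ ENNReal.ofReal ((1 + 2 * κ) ^ (3 * n)) * vol a (H₀ '' A) := by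
  have h1 : 0 < 1 + 2 * κ := by linarith
  set T : E n ≃ₜ E n := H₀.symm.trans H with hTdef
  have hTH : ∀ x, T (H₀ x) = H x := fun x => by simp [hTdef]
  have hTA : H '' A = T '' (H₀ '' A) := by
    rw [image_image]
    simp only [hTH]
  have hS : MeasurableSet (H₀ '' A) := H₀.measurableEmbedding.measurableSet_image.2 hA
  set K : ℝ≥0 := ⟨1 + 2 * κ, h1.le⟩ with hK
  have hT : ∀ z w, edist (T z) (T w) ≤ K * edist z w := by
    intro z w
    obtain ⟨x, rfl⟩ := H₀.surjective z
    obtain ⟨y, rfl⟩ := H₀.surjective w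
    have hreal : dist (T (H₀ x)) (T (H₀ y)) ≤ K * dist (H₀ x) (H₀ y) := by
      change _ ≤ (1 + 2 * κ) * _
      rw [hTH, hTH, dist_eq_norm, dist_eq_norm, hH, hH, hH₀, hH₀]
      have e1 : x + h x - (y + h y) = ((x + h₀ x) - (y + h₀ y)) +
          ((h x - h₀ x) - (h y - h₀ y)) := by abel
      have e2 := norm_sub_le_two_mul hh₀ x y
      rw [e1]
      refine (norm_add_le _ _).trans ?_
      nlinarith [hd x y]
    rw [edist_dist, edist_dist, ← ENNReal.ofReal_coe_nnreal, ← ENNReal.ofReal_mul K.coe_nonneg]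
    exact ENNReal.ofReal_le_ofReal hreal
  have hfar : ∀ z ∈ H₀ '' A, 0 < ‖z + a‖ ∧ ‖z + a‖ ≤ (1 + 2 * κ) * ‖T z + a‖ := by
    rintro _ ⟨x, hx, rfl⟩
    have hxr : ‖x‖ ≤ r := by simpa using hAr hx
    have a1 : ‖h₀ x‖ ≤ 1 / 2 * ‖x‖ := by simpa [hz₀] using hh₀ x 0
    have a2 : ‖h x‖ ≤ 1 / 2 * ‖x‖ := by simpa [hz] using hh x 0
    have a3 : ‖h x - h₀ x‖ ≤ κ * ‖x‖ := by simpa [hz₀, hz] using hd x 0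
    have a4 : ‖x‖ ≤ 2 * ‖x + h x‖ := by simpa [hz] using norm_sub_le_two_mul hh x 0
    have b : ∀ v : E n, ‖v‖ ≤ 1 / 2 * ‖x‖ → ‖a‖ - 3 / 2 * ‖x‖ ≤ ‖x + v + a‖ := fun v hv => by
      have t1 := norm_sub_le (x + v + a) (x + v)
      have t2 := norm_add_le x v
      rw [add_sub_cancel_left] at t1
      linarith
    rw [hTH, hH, hH₀]
    refine ⟨by linarith [b _ a1], ?_⟩
    have e1 : x + h₀ x + a = (x + h x + a) - (h x - h₀ x) := by abel
    rw [e1]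
    refine (norm_sub_le _ _).trans ?_
    have b2 := b _ a2
    have : κ * ‖x‖ ≤ κ * (2 * ‖x + h x + a‖) := by
      gcongr
      linarith
    linarith
  have hmeas : ∀ s : ℝ, Measurable fun y => ENNReal.ofReal (u a y ^ s) := fun s =>
    ((measurable_u a).pow_const s).ennreal_ofReal
  have hd1 : (3 : ℝ) ≤ n := by exact_mod_cast hn
  -- `K ^ d` from the Lipschitz constant, `K ^ (2 d)` from the density `u ^ (2 d / (n - 2))`
  have hpow : ∀ d : ℕ, (K : ℝ≥0∞) ^ d * ENNReal.ofReal ((1 + 2 * κ) ^ (2 * (d : ℝ))) =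
      ENNReal.ofReal ((1 + 2 * κ) ^ (3 * d)) := fun d => by
    rw [← ENNReal.ofReal_coe_nnreal, ← ENNReal.ofReal_pow K.coe_nonneg,
      ← ENNReal.ofReal_mul (by positivity)]
    congr 1
    change (1 + 2 * κ) ^ d * _ = _
    rw [show 2 * (d : ℝ) = ((2 * d : ℕ) : ℝ) by push_cast; ring, Real.rpow_natCast, ← pow_add]
    congr 1
    ring
  have hn1 : ((n - 1 : ℕ) : ℝ) = n - 1 := by
    rw [Nat.cast_sub (by omega), Nat.cast_one]
  constructor
  · rw [hTA, ← hpow, hn1]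
    refine withDensity_hausdorffE_image_le (n - 1) T hT (hmeas _) hS fun z hz => ?_
    exact u_rpow_le_of_norm_le hn (by linarith) (by linarith) (hfar z hz).1 (hfar z hz).2
  · rw [hTA, ← hpow, vol_eq hn, ← InnerProductSpace.euclideanHausdorffMeasure_eq_volume,
      finrank_euclideanSpace_fin]
    refine withDensity_hausdorffE_image_le n T hT (hmeas _) hS fun z hz => ?_
    exact u_rpow_le_of_norm_le hn (by linarith) (by linarith) (hfar z hz).1 (hfar z hz).2

end Perturbation

/-- Two positive numbers that bound each other up to a factor close to one. -/
theorem exists_eq_mul_one_add {x y : ℝ≥0∞} {Y t : ℝ} {N : ℕ} (hY : 0 < Y)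
    (hy : y = ENNReal.ofReal Y) (ht : 0 ≤ t) (ht1 : t ≤ 1)
    (hxy : x ≤ ENNReal.ofReal ((1 + t) ^ N) * y) (hyx : y ≤ ENNReal.ofReal ((1 + t) ^ N) * x) :
    x ≠ ⊤ ∧ ∃ s : ℝ, |s| ≤ 2 ^ N * t ∧ x.toReal = Y * (1 + s) := by
  have hx : x ≠ ⊤ := by
    refine ne_top_of_le_ne_top ?_ hxy
    rw [hy]
    exact ENNReal.mul_ne_top ENNReal.ofReal_ne_top ENNReal.ofReal_ne_top
  have hp : 0 ≤ (1 + t) ^ N := by positivity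
  have hX0 : 0 ≤ x.toReal := ENNReal.toReal_nonneg
  have h1 : x.toReal ≤ (1 + t) ^ N * Y := by
    rw [hy, ← ENNReal.ofReal_mul hp] at hxy
    exact ENNReal.toReal_le_of_le_ofReal (by positivity) hxy
  have h2 : Y ≤ (1 + t) ^ N * x.toReal := by
    rw [hy, ← ENNReal.ofReal_toReal hx, ← ENNReal.ofReal_mul hp] at hyx
    exact (ENNReal.ofReal_le_ofReal_iff (by positivity)).1 hyx
  have h3 : (1 + t) ^ N ≤ 1 + (2 ^ N - 1) * t := by
    clear hxy hyx hp h1 h2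
    induction N with
    | zero => simp
    | succ k ih =>
      have h2k : (1 : ℝ) ≤ 2 ^ k := one_le_pow₀ (by norm_num)
      rw [pow_succ, pow_succ]
      have h4 : (1 + t) ^ k * (1 + t) ≤ (1 + (2 ^ k - 1) * t) * (1 + t) := by gcongr
      nlinarith [mul_nonneg (mul_nonneg ht (sub_nonneg.2 h2k)) (sub_nonneg.2 ht1)]
  replace h3 : (1 + t) ^ N ≤ 1 + 2 ^ N * t := by linarith
  refine ⟨hx, x.toReal / Y - 1, ?_, by field_simp; ring⟩
  rw [abs_le]
  have hP : 1 ≤ (1 + t) ^ N := one_le_pow₀ (by linarith)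
  constructor
  · have h4 : 1 ≤ (1 + 2 ^ N * t) * (x.toReal / Y) := by
      rw [← mul_div_assoc, le_div_iff₀ hY]
      nlinarith
    have h5 : 0 ≤ 2 ^ N * t := by positivity
    have h6 : 0 ≤ x.toReal / Y := by positivity
    by_contra hc
    push Not at hc
    nlinarith
  · have : x.toReal / Y ≤ (1 + t) ^ N := by rwa [div_le_iff₀ hY]
    linarith

/-! ### The normal graph as a perturbation of a radial graph -/

/-- In polar coordinates the tangent vector `f ν`, whose exponential is taken, is `relDisp` times
the position vector. -/
theorem normal_displacement_eq (m : Measure ℝ) {a : E n} {r : ℝ} (hr : 0 < r)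
    (hρ : 2 * r ≤ ‖a‖) {y : E n} (hy : y ∈ sphere (0 : E n) r) :
    f a r (r * meanShift m n r ‖a‖) y • ((‖y‖ * unitLength a y)⁻¹ • y) =
      relDisp m n r ‖a‖ (inner ℝ (‖a‖⁻¹ • a) y / r) • y := by
  have hρ0 : 0 < ‖a‖ := by linarith
  have he := norm_direction hρ0
  have hc := centerFactor_pos (d := n) hρ0
  have hy' : ‖y‖ = r := by simpa using hy
  set e := ‖a‖⁻¹ • a with hedef
  obtain ⟨θ, rfl⟩ : ∃ θ : sphere (0 : E n) 1, y = r • (θ : E n) :=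
    ⟨⟨r⁻¹ • y, by simp [norm_smul, hy', abs_of_pos hr, hr.ne']⟩, by
      dsimp only; rw [smul_inv_smul₀ hr.ne']⟩
  have ht := inner_mem_Icc he θ
  have hk := ratio_mem hr (by linarith : r < ‖a‖)
  have hrel := relFactor_pos (d := n) hr (by linarith : r < ‖a‖) ht
  have hu : u a (r • (θ : E n)) = centerFactor n ‖a‖ * relFactor n r ‖a‖ (inner ℝ e (θ : E n)) :=
    u_smul hρ0 θ (IsZonal.base_pos ⟨by linarith [hk.1], hk.2⟩ ht).le
  rw [f_smul hρ0, smul_smul, hy', real_inner_smul_right, mul_div_cancel_left₀ _ hr.ne', relDisp,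
    unitLength, hu, ← hedef]
  congr 1
  rw [neg_div, Real.rpow_neg (mul_pos hc hrel).le]
  have : 0 < (centerFactor n ‖a‖ * relFactor n r ‖a‖ (inner ℝ e (θ : E n))) ^ (2 / ((n : ℝ) - 2)) :=
    Real.rpow_pos_of_pos (mul_pos hc hrel) _
  field_simp

theorem abs_sub_le_of_strictDeriv {φ φ' : ℝ → ℝ} {D : ℝ}
    (hφ : ∀ t ∈ Icc (-1 : ℝ) 1, HasStrictDerivAt φ (φ' t) t)
    (hD : ∀ t ∈ Icc (-1 : ℝ) 1, |φ' t| ≤ D) {s t : ℝ} (hs : s ∈ Icc (-1 : ℝ) 1)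
    (ht : t ∈ Icc (-1 : ℝ) 1) : |φ s - φ t| ≤ D * |s - t| :=
  (convex_Icc (-1 : ℝ) 1).norm_image_sub_le_of_norm_hasDerivWithin_le
    (fun x hx => (hφ x hx).hasDerivAt.hasDerivWithinAt) hD ht hs

theorem inner_div_mem_Icc {e : E n} (he : ‖e‖ = 1) {r : ℝ} (hr : 0 < r) {y : E n}
    (hy : y ∈ sphere (0 : E n) r) : inner ℝ e y / r ∈ Icc (-1 : ℝ) 1 := by
  have h := abs_real_inner_le_norm e y
  rw [he, mem_sphere_zero_iff_norm.1 hy, one_mul] at h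
  rw [mem_Icc, ← abs_le, abs_div, abs_of_pos hr, div_le_one hr]
  exact h

/-- Lipschitz bound for a radial vector field `φ(⟪e, y⟫ / r) y` on the sphere of radius `r`, in
terms of a common bound for `φ` and `φ'`. -/
theorem norm_radial_displacement_sub_le {e : E n} (he : ‖e‖ = 1) {r : ℝ} (hr : 0 < r)
    {φ φ' : ℝ → ℝ} {D : ℝ} (hφ : ∀ t ∈ Icc (-1 : ℝ) 1, HasStrictDerivAt φ (φ' t) t)
    (hD : ∀ t ∈ Icc (-1 : ℝ) 1, |φ t| ≤ D) (hD' : ∀ t ∈ Icc (-1 : ℝ) 1, |φ' t| ≤ D) {y y' : E n}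
    (hy : y ∈ sphere (0 : E n) r) (hy' : y' ∈ sphere (0 : E n) r) :
    ‖φ (inner ℝ e y / r) • y - φ (inner ℝ e y' / r) • y'‖ ≤ 2 * D * ‖y - y'‖ := by
  have ht := inner_div_mem_Icc he hr hy
  have ht' := inner_div_mem_Icc he hr hy'
  have hD0 : 0 ≤ D := (abs_nonneg _).trans (hD _ ht)
  have e1 : φ (inner ℝ e y / r) • y - φ (inner ℝ e y' / r) • y' =
      φ (inner ℝ e y / r) • (y - y') + (φ (inner ℝ e y / r) - φ (inner ℝ e y' / r)) • y' := by
    module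
  have h1 : |inner ℝ e y / r - inner ℝ e y' / r| * r ≤ ‖y - y'‖ := by
    rw [← sub_div, ← inner_sub_right, abs_div, abs_of_pos hr, div_mul_cancel₀ _ hr.ne']
    simpa [he] using abs_real_inner_le_norm e (y - y')
  have h2 := abs_sub_le_of_strictDeriv hφ hD' ht ht'
  have h3 : ‖(φ (inner ℝ e y / r) - φ (inner ℝ e y' / r)) • y'‖ ≤ D * ‖y - y'‖ := by
    rw [norm_smul, mem_sphere_zero_iff_norm.1 hy', Real.norm_eq_abs]
    calc _ ≤ D * |inner ℝ e y / r - inner ℝ e y' / r| * r := by gcongr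
      _ = D * (|inner ℝ e y / r - inner ℝ e y' / r| * r) := by ring
      _ ≤ _ := by gcongr
  have h4 : ‖φ (inner ℝ e y / r) • (y - y')‖ ≤ D * ‖y - y'‖ := by
    rw [norm_smul, Real.norm_eq_abs]
    gcongr
    exact hD _ ht
  rw [e1]
  linarith [norm_add_le (φ (inner ℝ e y / r) • (y - y'))
    ((φ (inner ℝ e y / r) - φ (inner ℝ e y' / r)) • y')]

/-- The exponential map of a small radial vector field `φ y` on a sphere extends to a perturbation
`h` of the identity which is close to the perturbation `h₀` that extends `φ y` itself. -/
theorem exists_perturbation (hn : 3 ≤ n) {a : E n} {r : ℝ} (hr : 0 < r)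
    (hρ : 2 * (r + 1) ≤ ‖a‖) {φ φ' : ℝ → ℝ} {D : ℝ} (hD0 : 0 < D) (hD20 : 20 * D ≤ 1)
    (hDr : 384 * (n + 1) * (D * r) ≤ 1)
    (hφ : ∀ t ∈ Icc (-1 : ℝ) 1, HasStrictDerivAt φ (φ' t) t)
    (hD : ∀ t ∈ Icc (-1 : ℝ) 1, |φ t| ≤ D) (hD' : ∀ t ∈ Icc (-1 : ℝ) 1, |φ' t| ≤ D) {κ : ℝ}
    (hκ : (1000 * r + 2000 * (n + 1) * r ^ 2) * (D ^ 2 / ‖a‖) ≤ κ) (hκ4 : κ ≤ 1 / 4) :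
    ∃ h₀ h : E n → E n, (∀ x y, ‖h₀ x - h₀ y‖ ≤ 1 / 2 * ‖x - y‖) ∧
      (∀ x y, ‖h x - h y‖ ≤ 1 / 2 * ‖x - y‖) ∧ h₀ 0 = 0 ∧ h 0 = 0 ∧
      (∀ x y, ‖(h x - h₀ x) - (h y - h₀ y)‖ ≤ κ * ‖x - y‖) ∧
      (∀ x, radialMap (‖a‖⁻¹ • a) (fun t => 1 + φ t) x = x + h₀ x) ∧
      ∀ y ∈ sphere (0 : E n) r, ∀ z,
        IsExp a y (φ (inner ℝ (‖a‖⁻¹ • a) y / r) • y) z ↔ z = y + h y := by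
  have hρ0 : 0 < ‖a‖ := by linarith
  have hρ1 : 1 ≤ ‖a‖ := by linarith
  have he := norm_direction hρ0
  set e := ‖a‖⁻¹ • a with hedef
  -- geodesics from the sphere of radius `r` stay at distance at least `δ` from the puncture
  set δ := ‖a‖ / 2 with hδ
  have hδ0 : 0 < δ := by positivity
  have hδ1 : 1 ≤ δ := by linarith
  set M := D * r with hM
  have hM0 : 0 < M := mul_pos hD0 hr
  have hn0 : (0 : ℝ) ≤ n := Nat.cast_nonneg n
  have hM384 : 384 * M ≤ 1 := by nlinarith
  have hfar : ∀ y ∈ sphere (0 : E n) r, ∀ x ∈ closedBall y 1, δ ≤ ‖x + a‖ := by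
    intro y hy x hx
    rw [mem_closedBall, dist_eq_norm] at hx
    rw [mem_sphere_zero_iff_norm] at hy
    have h1 := norm_sub_le (x + a) x
    have h2 := norm_le_norm_add_norm_sub' x y
    rw [add_sub_cancel_left] at h1
    rw [hδ]
    linarith
  set w₀ : E n → E n := fun y => φ (inner ℝ e y / r) • y with hw₀
  have hw₀A : ∀ y ∈ sphere (0 : E n) r, ‖w₀ y‖ ≤ D * r := fun y hy => by
    rw [hw₀]
    dsimp only
    rw [norm_smul, mem_sphere_zero_iff_norm.1 hy, Real.norm_eq_abs]
    gcongr
    exact hD _ (inner_div_mem_Icc he hr hy)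
  have hw₀B : ∀ y ∈ sphere (0 : E n) r, ∀ y' ∈ sphere (0 : E n) r,
      ‖w₀ y - w₀ y'‖ ≤ 2 * D * ‖y - y'‖ := fun y hy y' hy' =>
    norm_radial_displacement_sub_le he hr hφ hD hD' hy hy'
  -- the deviation of the geodesics from the straight segments
  set ψ : E n → E n := fun y => expMap a y (w₀ y) - y - w₀ y with hψ
  have hM2 : 192 * ((n : ℝ) + 1) * M ^ 2 ≤ δ ^ 2 := by
    have h1 : 384 * ((n : ℝ) + 1) * M * M ≤ 1 * M := by gcongr
    nlinarith
  have hψA : ∀ y ∈ sphere (0 : E n) r, ‖ψ y‖ ≤ 48 * r * (D ^ 2 / ‖a‖) * r := fun y hy => by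
    refine (norm_expMap_sub_le hn hδ0 hM0 (by linarith) (by linarith) (hw₀A y hy)
      (hfar y hy)).trans (le_of_eq ?_)
    rw [hM, hδ]
    field_simp
    ring
  have hψB : ∀ y ∈ sphere (0 : E n) r, ∀ y' ∈ sphere (0 : E n) r,
      ‖ψ y - ψ y'‖ ≤ (768 * (n + 1) * r ^ 2 + 192 * r) * (D ^ 2 / ‖a‖) * ‖y - y'‖ := by
    intro y hy y' hy'
    refine (norm_expMap_sub_sub_le hn hδ0 hM0 (by linarith) (by linarith) hM2 (hw₀A y hy)
      (hw₀A y' hy') (hfar y hy) (hfar y' hy')).trans ?_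
    have h1 := hw₀B y hy y' hy'
    have h2 : ‖y - y'‖ + 2 * ‖w₀ y - w₀ y'‖ ≤ 2 * ‖y - y'‖ := by
      nlinarith [norm_nonneg (y - y')]
    have h3 : 96 * (n + 1) * M ^ 2 / δ ^ 2 * (2 * ‖y - y'‖) ≤
        768 * (n + 1) * r ^ 2 * (D ^ 2 / ‖a‖) * ‖y - y'‖ := by
      have : 1 / ‖a‖ ^ 2 ≤ 1 / ‖a‖ := by
        apply one_div_le_one_div_of_le hρ0
        nlinarith
      calc 96 * (n + 1) * M ^ 2 / δ ^ 2 * (2 * ‖y - y'‖) =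
            768 * (n + 1) * r ^ 2 * D ^ 2 * ‖y - y'‖ * (1 / ‖a‖ ^ 2) := by
            rw [hM, hδ]
            field_simp
            ring
        _ ≤ 768 * (n + 1) * r ^ 2 * D ^ 2 * ‖y - y'‖ * (1 / ‖a‖) := by gcongr
        _ = _ := by ring
    calc _ ≤ 96 * (n + 1) * M ^ 2 / δ ^ 2 * (2 * ‖y - y'‖) +
          48 * M / δ * (2 * D * ‖y - y'‖) := by gcongr
      _ ≤ 768 * (n + 1) * r ^ 2 * (D ^ 2 / ‖a‖) * ‖y - y'‖ +
          48 * M / δ * (2 * D * ‖y - y'‖) := by gcongr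
      _ = _ := by
          rw [hM, hδ]
          field_simp
          ring
  have hq : 0 ≤ D ^ 2 / ‖a‖ := by positivity
  have hnr : 0 ≤ (n + 1) * r ^ 2 * (D ^ 2 / ‖a‖) := by positivity
  have hrq : 0 ≤ r * (D ^ 2 / ‖a‖) := by positivity
  have lip₀ : ∀ x y, ‖homogeneousExt r w₀ x - homogeneousExt r w₀ y‖ ≤ 1 / 4 * ‖x - y‖ :=
    fun x y => by
      refine (norm_homogeneousExt_sub_le hr (by linarith) hw₀A hw₀B x y).trans ?_
      gcongr
      linarith
  have lipψ : ∀ x y, ‖homogeneousExt r ψ x - homogeneousExt r ψ y‖ ≤ κ * ‖x - y‖ :=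
    fun x y => by
      refine (norm_homogeneousExt_sub_le hr (by positivity) hψA hψB x y).trans ?_
      gcongr
      refine le_trans ?_ hκ
      nlinarith
  refine ⟨homogeneousExt r w₀, fun x => homogeneousExt r w₀ x + homogeneousExt r ψ x,
    fun x y => (lip₀ x y).trans (by gcongr; norm_num), fun x y => ?_, by simp [homogeneousExt],
    by simp [homogeneousExt], fun x y => ?_, radialMap_eq_add_homogeneousExt hr e φ,
    fun y hy z => ?_⟩
  · rw [add_sub_add_comm]
    have : κ * ‖x - y‖ ≤ 1 / 4 * ‖x - y‖ := by gcongr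
    linarith [norm_add_le (homogeneousExt r w₀ x - homogeneousExt r w₀ y)
      (homogeneousExt r ψ x - homogeneousExt r ψ y), lip₀ x y, lipψ x y]
  · rw [add_sub_cancel_left, add_sub_cancel_left]
    exact lipψ x y
  · dsimp only
    rw [homogeneousExt_of_mem hr w₀ hy, homogeneousExt_of_mem hr ψ hy,
      isExp_iff_eq_expMap hn (exists_geodesic hn hδ0 hM0 (by linarith) (by linarith) (hw₀A y hy)
      (hfar y hy)).1]
    rw [show y + (w₀ y + ψ y) = expMap a y (w₀ y) by rw [hψ]; dsimp only; abel]

/-! ### The normal graph and its enclosed region -/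

theorem isBounded_image_iff {h : E n → E n} (hh : ∀ x y, ‖h x - h y‖ ≤ 1 / 2 * ‖x - y‖)
    {H : E n ≃ₜ E n} (hH : ∀ x, H x = x + h x) (s : Set (E n)) :
    Bornology.IsBounded (H '' s) ↔ Bornology.IsBounded s := by
  constructor
  · intro hb
    have hA : AntilipschitzWith 2 H := AntilipschitzWith.of_le_mul_dist fun x y => by
      rw [dist_eq_norm, dist_eq_norm, hH, hH]
      exact norm_sub_le_two_mul hh x y
    exact (hA.isBounded_preimage hb).subset (subset_preimage_image _ _)
  · intro hb
    have hL : LipschitzWith 2 H := LipschitzWith.of_dist_le_mul fun x y => by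
      rw [dist_eq_norm, dist_eq_norm, hH, hH, add_sub_add_comm]
      have := norm_add_le (x - y) (h x - h y)
      have := hh x y
      have := norm_nonneg (x - y)
      change _ ≤ (2 : ℝ) * _
      linarith
    exact hL.isBounded_image hb

/-- Everything about the normal graph except for the asymptotics: it is the image of the sphere
under a homeomorphism of the space, and its area and enclosed volume are close to those of the
radial graph of `relDisp`. -/
theorem graph_properties (hn : 3 ≤ n) {a : E n} {r D κ : ℝ} (hr : 0 < r) (hρ : 4 * (r + 1) ≤ ‖a‖)
    (hD0 : 0 < D) (hD20 : 20 * D ≤ 1) (hDr : 384 * (n + 1) * (D * r) ≤ 1) {m : Measure ℝ}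
    (hm : zonalLaw (‖a‖⁻¹ • a) = m)
    (hD : ∀ t ∈ Icc (-1 : ℝ) 1, |relDisp m n r ‖a‖ t| ≤ D)
    (hD' : ∀ t ∈ Icc (-1 : ℝ) 1, |relDispDeriv m n r ‖a‖ t| ≤ D)
    (hκ : (1000 * r + 2000 * (n + 1) * r ^ 2) * (D ^ 2 / ‖a‖) ≤ κ) (hκ4 : κ ≤ 1 / 4)
    (hA : 0 < areaMean m n r ‖a‖) (hB : 0 < volMean (relDisp m n r ‖a‖) m n r ‖a‖) {c : ℝ}
    (hc : MeanZero a r c) :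
    (∃ Φ : E n → E n, ContinuousOn Φ (sphere 0 r) ∧ InjOn Φ (sphere 0 r) ∧
      (∀ y ∈ sphere (0 : E n) r, ∃! ν, IsOuterUnitNormal a y ν) ∧
      ∀ y ∈ sphere (0 : E n) r, ∀ ν, IsOuterUnitNormal a y ν →
        ∀ z, IsExp a y (f a r c y • ν) z ↔ z = Φ y) ∧
    IsOpen (enclosed (graph a r c)) ∧ IsConnected (enclosed (graph a r c)) ∧
    frontier (enclosed (graph a r c)) = graph a r c ∧ -a ∉ closure (enclosed (graph a r c)) ∧
    area a (graph a r c) ≠ ⊤ ∧ vol a (enclosed (graph a r c)) ≠ ⊤ ∧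
    (∃ s : ℝ, |s| ≤ 2 ^ (3 * n) * (2 * κ) ∧ (area a (graph a r c)).toReal =
      omega n * (r ^ (n - 1) * centerFactor n ‖a‖ ^ (2 * ((n : ℝ) - 1) / (n - 2)) *
        areaMean m n r ‖a‖) * (1 + s)) ∧
    ∃ s : ℝ, |s| ≤ 2 ^ (3 * n) * (2 * κ) ∧ (vol a (enclosed (graph a r c))).toReal =
      omega n * (1 / n * r ^ n * centerFactor n ‖a‖ ^ (2 * (n : ℝ) / (n - 2)) *
        volMean (relDisp m n r ‖a‖) m n r ‖a‖) * (1 + s) := by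
  have hρ0 : 0 < ‖a‖ := by linarith
  have hn0 : (0 : ℝ) < n := by positivity
  have : Nontrivial (E n) := Module.nontrivial_of_finrank_pos (R := ℝ)
    (by have := two_le_finrank hn; omega)
  have hrel : ∀ t ∈ Icc (-1 : ℝ) 1, 0 < relFactor n r ‖a‖ t := fun t ht =>
    relFactor_pos hr (by linarith) ht
  have hφ : ∀ t ∈ Icc (-1 : ℝ) 1,
      HasStrictDerivAt (relDisp m n r ‖a‖) (relDispDeriv m n r ‖a‖ t) t := fun t ht =>
    hasStrictDerivAt_relDisp hr (by linarith) ht (hrel t ht)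
  have hφb : ∀ t ∈ Icc (-1 : ℝ) 1, |relDisp m n r ‖a‖ t| ≤ 1 / 2 := fun t ht =>
    (hD t ht).trans (by linarith)
  have hφc : ContinuousOn (relDisp m n r ‖a‖) (Icc (-1) 1) := fun t ht =>
    (hφ t ht).hasDerivAt.continuousAt.continuousWithinAt
  have hκ0 : 0 ≤ κ := le_trans (by positivity) hκ
  obtain ⟨h₀, h, lip₀, lip, z₀, z, hd, hrad, hexp⟩ :=
    exists_perturbation hn hr (by linarith) hD0 hD20 hDr hφ hD hD' hκ hκ4
  obtain ⟨H₀, hH₀⟩ := exists_homeomorph_of_lipschitz lip₀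
  obtain ⟨H, hH⟩ := exists_homeomorph_of_lipschitz lip
  have hnormal : ∀ y ∈ sphere (0 : E n) r, ∀ ν : E n, IsOuterUnitNormal a y ν ↔
      ν = (‖y‖ * unitLength a y)⁻¹ • y := fun y hy ν =>
    isOuterUnitNormal_iff (ne_zero_of_mem_sphere hr.ne' ⟨y, hy⟩)
  rw [meanZero_iff hn hr (by linarith), hm] at hc
  have hend : ∀ y ∈ sphere (0 : E n) r, ∀ ν, IsOuterUnitNormal a y ν →
      ∀ z, IsExp a y (f a r c y • ν) z ↔ z = H y := by
    intro y hy ν hν z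
    rw [(hnormal y hy ν).1 hν, hc, normal_displacement_eq m hr (by linarith) hy, hexp y hy, hH]
  have hgraph : graph a r c = H '' sphere 0 r := by
    ext z
    constructor
    · rintro ⟨y, hy, ν, hν, hz⟩
      exact ⟨y, hy, ((hend y hy ν hν z).1 hz).symm⟩
    · rintro ⟨y, hy, rfl⟩
      exact ⟨y, hy, _, (hnormal y hy _).2 rfl, (hend y hy _ ((hnormal y hy _).2 rfl) _).2 rfl⟩
  have henc : enclosed (graph a r c) = H '' ball 0 r := by
    rw [hgraph]
    exact enclosed_image_sphere hn hr H (isBounded_image_iff lip hH)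
  have hradH : radialMap (‖a‖⁻¹ • a) (fun t => 1 + relDisp m n r ‖a‖ t) = H₀ := by
    funext x
    rw [hrad, hH₀]
  have hd' : ∀ x y, ‖(h₀ x - h x) - (h₀ y - h y)‖ ≤ κ * ‖x - y‖ := fun x y => by
    refine le_trans (le_of_eq ?_) (hd x y)
    rw [← norm_neg]
    congr 1
    abel
  have hω := omega_pos hn
  have hcf := centerFactor_pos (d := n) hρ0
  have hpow : ∀ N ≤ 3 * n, (2 : ℝ) ^ N * (2 * κ) ≤ 2 ^ (3 * n) * (2 * κ) := fun N hN => by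
    gcongr
    norm_num
  have harea₀ := area_radialMap_sphere hn hr (by linarith) hφ
    (continuousOn_relDispDeriv hr (by linarith) hrel) hφb
  rw [hm, hradH] at harea₀
  have hvol₀ := vol_radialMap_ball hn hr (by linarith) hφc hφb
    (by rw [hradH]; exact H₀.measurableEmbedding.measurableSet_image.2 measurableSet_ball)
  rw [hm, hradH] at hvol₀
  have hS : MeasurableSet (sphere (0 : E n) r) := isClosed_sphere.measurableSet
  -- `H` and `H₀` play symmetric roles, which gives both bounds
  obtain ⟨fA, s₁, hs₁, eA⟩ := exists_eq_mul_one_add (x := area a (H '' sphere 0 r))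
    (Y := omega n * (r ^ (n - 1) * centerFactor n ‖a‖ ^ (2 * ((n : ℝ) - 1) / (n - 2)) *
      areaMean m n r ‖a‖)) (by positivity) harea₀ (by linarith : 0 ≤ 2 * κ) (by linarith)
    (area_vol_image_le hn lip₀ lip z₀ z hκ0 hd hH₀ hH hr (by linarith) hS
      sphere_subset_closedBall).1
    (area_vol_image_le hn lip lip₀ z z₀ hκ0 hd' hH hH₀ hr (by linarith) hS
      sphere_subset_closedBall).1
  obtain ⟨fV, s₂, hs₂, eV⟩ := exists_eq_mul_one_add (x := vol a (H '' ball 0 r))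
    (Y := omega n * (1 / n * r ^ n * centerFactor n ‖a‖ ^ (2 * (n : ℝ) / (n - 2)) *
      volMean (relDisp m n r ‖a‖) m n r ‖a‖)) (by positivity) hvol₀ (by linarith : 0 ≤ 2 * κ)
    (by linarith)
    (area_vol_image_le hn lip₀ lip z₀ z hκ0 hd hH₀ hH hr (by linarith) measurableSet_ball
      ball_subset_closedBall).2
    (area_vol_image_le hn lip lip₀ z z₀ hκ0 hd' hH hH₀ hr (by linarith) measurableSet_ball
      ball_subset_closedBall).2
  refine ⟨⟨H, H.continuous.continuousOn, H.injective.injOn, fun y hy =>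
    ⟨_, (hnormal y hy _).2 rfl, fun ν hν => (hnormal y hy ν).1 hν⟩, hend⟩, ?_⟩
  rw [henc, hgraph]
  refine ⟨H.isOpenMap _ isOpen_ball, ?_, ?_, ?_, fA, fV, ⟨s₁, hs₁.trans (hpow _ (by omega)), eA⟩,
    s₂, hs₂, eV⟩
  · exact ((convex_ball (0 : E n) r).isConnected ⟨0, mem_ball_self hr⟩).image _
      H.continuous.continuousOn
  · rw [← H.image_frontier, frontier_ball _ hr.ne']
  · rw [← H.image_closure, closure_ball _ hr.ne']
    rintro ⟨x, hx, hxa⟩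
    have h1 : ‖h x‖ ≤ 1 / 2 * ‖x‖ := by simpa [z] using lip x 0
    have h2 : ‖x‖ ≤ r := by simpa using hx
    have h3 := norm_add_le x (h x)
    rw [← hH, hxa, norm_neg] at h3
    linarith

/-! ### From asymptotics to uniform constants -/

/-- A property that holds eventually along `farLim R` holds for all `r ∈ (0, R]` from one threshold
for `ρ` on. -/
theorem exists_forall_of_eventually_farLim {R : ℝ} {p : ℝ × ℝ → Prop} (h : ∀ᶠ q in farLim R, p q) :
    ∃ A : ℝ, ∀ r ρ : ℝ, 0 < r → r ≤ R → A ≤ ρ → p (r, ρ) := by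
  obtain ⟨pa, ha, pb, hb, hp⟩ := eventually_prod_iff.1 h
  obtain ⟨A, hA⟩ := eventually_atTop.1 hb
  exact ⟨A, fun r ρ h0 hR hρ => hp (eventually_principal.1 ha r ⟨h0, hR⟩) (hA ρ hρ)⟩

theorem OP.exists_bound {α : Type*} {l : Filter α} {ρ : α → ℝ} {s : ℝ} {F : α → ℝ}
    (h : OP l ρ s F) (hρ : ∀ᶠ q in l, 0 ≤ ρ q) :
    ∃ C : ℝ, 0 < C ∧ ∀ᶠ q in l, |F q| ≤ C * ρ q ^ s := by
  obtain ⟨C, hC, hb⟩ := Asymptotics.IsBigO.exists_pos h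
  refine ⟨C, hC, ?_⟩
  filter_upwards [hb.bound, hρ] with q hq hq0
  rwa [Real.norm_eq_abs, Real.norm_of_nonneg (Real.rpow_nonneg hq0 s)] at hq

theorem eventually_mul_rpow_le {R s : ℝ} (hs : s < 0) (X : ℝ) {b : ℝ} (hb : 0 < b) :
    ∀ᶠ q in farLim R, X * q.2 ^ s ≤ b := by
  have h := ((tendsto_rpow_neg_atTop (y := -s) (by linarith)).const_mul X).comp
    (tendsto_snd_farLim R)
  rw [mul_zero, neg_neg] at h
  exact (h.eventually (gt_mem_nhds hb)).mono fun q hq => le_of_lt hq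

theorem bound_relDisp_self {R : ℝ} {m : Measure ℝ} (h : IsZonal n m) (hn : 3 ≤ n) :
    OP (farLimCos R) (fun q => q.1.2) (-n) fun q => relDisp m n q.1.1 q.1.2 q.2 := by
  have hd : (3 : ℝ) ≤ n := by exact_mod_cast hn
  have hρ := tendsto_farLimCos R
  exact (((bound_relDisp (R := R) h hd).mono hρ (by linarith)).add
    ((bound_leadCoeff hd).comp_fst.mul hρ (OP.legendre (d := n)) (by linarith))).congr
      fun q => by ring

theorem bound_relDispDeriv_self {R : ℝ} {m : Measure ℝ} (h : IsZonal n m) (hn : 3 ≤ n) :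
    OP (farLimCos R) (fun q => q.1.2) (-n) fun q => relDispDeriv m n q.1.1 q.1.2 q.2 := by
  have hd : (3 : ℝ) ≤ n := by exact_mod_cast hn
  have hρ := tendsto_farLimCos R
  exact (((bound_relDispDeriv (R := R) h hd).mono hρ (by linarith)).add
    ((bound_leadCoeff hd).comp_fst.mul hρ (OP.cosine.const_mul (-2 * (n : ℝ)))
      (by linarith))).congr fun q => by ring

/-- The isoperimetric ratio in terms of the normalized area and volume. -/
theorem area_eq_of_normalized (hn : 3 ≤ n) {ω r c A B : ℝ} (hω : 0 < ω) (hr : 0 < r) (hc : 0 < c)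
    (hB : 0 < B) :
    ω * (r ^ (n - 1) * c ^ (2 * ((n : ℝ) - 1) / (n - 2)) * A) =
      ((n : ℝ) ^ (n - 1) * ω) ^ (1 / (n : ℝ)) *
        (ω * (1 / n * r ^ n * c ^ (2 * (n : ℝ) / (n - 2)) * B)) ^ (((n : ℝ) - 1) / n) *
        (A * B ^ (-(((n : ℝ) - 1) / n))) := by
  have hd : (3 : ℝ) ≤ n := by exact_mod_cast hn
  have hn0 : (0 : ℝ) < n := by linarith
  have hn1 : ((n - 1 : ℕ) : ℝ) = n - 1 := by rw [Nat.cast_sub (by omega), Nat.cast_one]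
  have e1 : ((n : ℝ) ^ (n - 1)) ^ (1 / (n : ℝ)) = (n : ℝ) ^ (((n : ℝ) - 1) / n) := by
    rw [← Real.rpow_natCast, ← Real.rpow_mul hn0.le, hn1]
    congr 1
    ring
  have e2 : (r ^ n) ^ (((n : ℝ) - 1) / n) = r ^ (n - 1) := by
    rw [← Real.rpow_natCast, ← Real.rpow_natCast, ← Real.rpow_mul hr.le, hn1]
    congr 1
    field_simp
  have e3 : (c ^ (2 * (n : ℝ) / (n - 2))) ^ (((n : ℝ) - 1) / n) =
      c ^ (2 * ((n : ℝ) - 1) / (n - 2)) := by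
    rw [← Real.rpow_mul hc.le]
    congr 1
    field_simp
  have e4 : ω ^ (1 / (n : ℝ)) * ω ^ (((n : ℝ) - 1) / n) = ω := by
    rw [← Real.rpow_add hω, ← add_div, show 1 + ((n : ℝ) - 1) = n by ring, div_self hn0.ne',
      Real.rpow_one]
  have e5 : (1 / (n : ℝ)) ^ (((n : ℝ) - 1) / n) * (n : ℝ) ^ (((n : ℝ) - 1) / n) = 1 := by
    rw [← Real.mul_rpow (by positivity) hn0.le, one_div, inv_mul_cancel₀ hn0.ne', Real.one_rpow]
  have e6 : B ^ (((n : ℝ) - 1) / n) * B ^ (-(((n : ℝ) - 1) / n)) = 1 := by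
    rw [← Real.rpow_add hB, add_neg_cancel, Real.rpow_zero]
  have hcq : 0 < c ^ (2 * (n : ℝ) / (n - 2)) := Real.rpow_pos_of_pos hc _
  rw [Real.mul_rpow (by positivity) hω.le, Real.mul_rpow hω.le (by positivity),
    Real.mul_rpow (by positivity) hB.le, Real.mul_rpow (by positivity) hcq.le,
    Real.mul_rpow (by positivity) (by positivity), e1, e2, e3]
  generalize c ^ (2 * ((n : ℝ) - 1) / (n - 2)) = P
  generalize B ^ (((n : ℝ) - 1) / n) = X at *
  generalize B ^ (-(((n : ℝ) - 1) / n)) = X' at *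
  generalize (1 / (n : ℝ)) ^ (((n : ℝ) - 1) / n) = Y at *
  generalize (n : ℝ) ^ (((n : ℝ) - 1) / n) = Y' at *
  generalize ω ^ (1 / (n : ℝ)) = W at *
  generalize ω ^ (((n : ℝ) - 1) / n) = W' at *
  calc ω * (r ^ (n - 1) * P * A) = (W * W') * (Y * Y') * (X * X') * (r ^ (n - 1) * P * A) := by
        rw [e4, e5, e6]; ring
    _ = _ := by ring

/-! ### Uniform constants -/

/-- The constants, uniform in the radius and the direction of `a`, in the description of the normal
graph: its displacement is `O(ρ ^ (-n))`, and the error made by replacing geodesics by straight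
lines is `O(ρ ^ (-2 n - 1))`. -/
theorem exists_graph_constants (hn : 3 ≤ n) {m : Measure ℝ} (h : IsZonal n m) (R : ℝ)
    (hR : 0 < R) : ∃ K : ℝ, 0 < K ∧ ∀ᶠ q in farLim R, ∃ D κ : ℝ, 0 < D ∧ 20 * D ≤ 1 ∧
      384 * (n + 1) * (D * q.1) ≤ 1 ∧ (∀ t ∈ Icc (-1 : ℝ) 1, |relDisp m n q.1 q.2 t| ≤ D) ∧
      (∀ t ∈ Icc (-1 : ℝ) 1, |relDispDeriv m n q.1 q.2 t| ≤ D) ∧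
      (1000 * q.1 + 2000 * (n + 1) * q.1 ^ 2) * (D ^ 2 / q.2) ≤ κ ∧ κ ≤ 1 / 4 ∧
      2 ^ (3 * n) * (2 * κ) = K * q.2 ^ (-2 * (n : ℝ) - 1) ∧
      2 ^ (3 * n) * (2 * κ) ≤ 1 / 2 := by
  have hd : (3 : ℝ) ≤ n := by exact_mod_cast hn
  have hρ0 : ∀ᶠ q in farLimCos R, 0 ≤ q.1.2 := (tendsto_farLimCos R).eventually_ge_atTop 0
  obtain ⟨C₁, hC₁, b₁⟩ := (bound_relDisp_self (R := R) h hn).exists_bound hρ0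
  obtain ⟨C₂, hC₂, b₂⟩ := (bound_relDispDeriv_self (R := R) h hn).exists_bound hρ0
  unfold farLimCos at b₁ b₂
  rw [eventually_prod_principal_iff] at b₁ b₂
  set C := C₁ + C₂ with hC
  have hC0 : 0 < C := by positivity
  set L := (1000 * R + 2000 * (n + 1) * R ^ 2) * C ^ 2 with hL
  have hL0 : 0 < L := by positivity
  refine ⟨2 ^ (3 * n) * (2 * L), by positivity, ?_⟩
  filter_upwards [b₁, b₂, eventually_farLim R,
    eventually_mul_rpow_le (R := R) (s := -n) (by linarith) (20 * C) one_pos,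
    eventually_mul_rpow_le (R := R) (s := -n) (by linarith) (384 * (n + 1) * (C * R)) one_pos,
    eventually_mul_rpow_le (R := R) (s := -2 * (n : ℝ) - 1) (by linarith) L
      (by norm_num : (0 : ℝ) < 1 / 4),
    eventually_mul_rpow_le (R := R) (s := -2 * (n : ℝ) - 1) (by linarith) (2 ^ (3 * n) * (2 * L))
      (by norm_num : (0 : ℝ) < 1 / 2)] with q q₁ q₂ hq s₁ s₂ s₃ s₄
  obtain ⟨hr, hrR, hρ1, hρR⟩ := hq
  have hρ : 0 < q.2 := by linarith
  have hp : 0 < q.2 ^ (-(n : ℝ)) := Real.rpow_pos_of_pos hρ _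
  have hpow : (q.2 ^ (-(n : ℝ))) ^ 2 / q.2 = q.2 ^ (-2 * (n : ℝ) - 1) := by
    rw [Real.rpow_sub_one hρ.ne', ← Real.rpow_natCast, ← Real.rpow_mul hρ.le]
    congr 2
    push_cast
    ring
  refine ⟨C * q.2 ^ (-(n : ℝ)), L * q.2 ^ (-2 * (n : ℝ) - 1), by positivity, by linarith, ?_,
    fun t ht => (q₁ t ht).trans ?_, fun t ht => (q₂ t ht).trans ?_, ?_, s₃, by ring, by linarith⟩
  · refine le_trans ?_ s₂
    calc 384 * ((n : ℝ) + 1) * (C * q.2 ^ (-(n : ℝ)) * q.1) ≤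
          384 * ((n : ℝ) + 1) * (C * q.2 ^ (-(n : ℝ)) * R) := by gcongr
      _ = _ := by ring
  · gcongr
    linarith
  · gcongr
    linarith
  · rw [mul_pow, mul_div_assoc, hpow, hL]
    calc _ ≤ (1000 * R + 2000 * (n + 1) * R ^ 2) * (C ^ 2 * q.2 ^ (-2 * (n : ℝ) - 1)) := by
          gcongr
      _ = _ := by ring

theorem exists_abs_le_of_sub {x y b : ℝ} (h : |x - y| ≤ b) : ∃ e, |e| ≤ b ∧ x = y + e :=
  ⟨x - y, h, by ring⟩

/-- The statements for large `ρ`, with the additional information that the enclosed volume is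
positive. -/
theorem eventually_graph_properties (hn : 3 ≤ n) {m : Measure ℝ} (h : IsZonal n m) (R : ℝ)
    (hR : 0 < R) : ∃ C : ℝ, 0 < C ∧ ∀ᶠ q in farLim R, ∀ a : E n, ‖a‖ = q.2 →
      zonalLaw (‖a‖⁻¹ • a) = m → ∀ c : ℝ, MeanZero a q.1 c →
      ((∃ Φ : E n → E n, ContinuousOn Φ (sphere 0 q.1) ∧ InjOn Φ (sphere 0 q.1) ∧
        (∀ y ∈ sphere (0 : E n) q.1, ∃! ν, IsOuterUnitNormal a y ν) ∧
        ∀ y ∈ sphere (0 : E n) q.1, ∀ ν, IsOuterUnitNormal a y ν →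
          ∀ z, IsExp a y (f a q.1 c y • ν) z ↔ z = Φ y) ∧
      IsOpen (enclosed (graph a q.1 c)) ∧ IsConnected (enclosed (graph a q.1 c)) ∧
      frontier (enclosed (graph a q.1 c)) = graph a q.1 c ∧
      -a ∉ closure (enclosed (graph a q.1 c)) ∧
      area a (graph a q.1 c) ≠ ⊤ ∧ vol a (enclosed (graph a q.1 c)) ≠ ⊤ ∧
      ∃ e : ℝ, |e| ≤ C * ‖a‖ ^ (-2 * (n : ℝ) - 1) ∧ (area a (graph a q.1 c)).toReal =
        ((n : ℝ) ^ (n - 1) * omega n) ^ (1 / (n : ℝ)) *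
          (vol a (enclosed (graph a q.1 c))).toReal ^ (((n : ℝ) - 1) / (n : ℝ)) *
          (1 - 2 * ((n : ℝ) - 2) * ((n : ℝ) - 1) ^ 2 /
            (((n : ℝ) + 1) * ((n : ℝ) + 2) * ((n : ℝ) + 4)) * (q.1 ^ 4 / ‖a‖ ^ (2 * n)) + e)) ∧
      0 < (vol a (enclosed (graph a q.1 c))).toReal := by
  have hd : (3 : ℝ) ≤ n := by exact_mod_cast hn
  have hω := omega_pos hn
  obtain ⟨K, hK, hev⟩ := exists_graph_constants hn h R hR
  have hρ0 : ∀ᶠ q in farLim R ×ˢ 𝓟 (Icc (-K) K ×ˢ Icc (-K) K), 0 ≤ q.1.2 :=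
    ((tendsto_snd_farLim R).comp tendsto_fst).eventually_ge_atTop 0
  obtain ⟨C, hC, hiso⟩ := (isoperimetricRatio_expansion (R := R) h hn K).exists_bound hρ0
  rw [eventually_prod_principal_iff] at hiso
  refine ⟨C, hC, ?_⟩
  filter_upwards [hev, hiso, eventually_farLim R,
    (tendsto_snd_farLim R).eventually_ge_atTop (4 * (R + 1)),
    (bound_areaMean_sub_one (R := R) h hn).eventually_pos (tendsto_snd_farLim R) (by linarith),
    (bound_volMean_sub_one (R := R) h hn).eventually_pos (tendsto_snd_farLim R) (by linarith)]
    with q hq hiso hq' hρR hA hB a ha hm c hc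
  obtain ⟨r, ρ⟩ := q
  dsimp only at *
  subst ha
  obtain ⟨D, κ, hD0, hD20, hDr, hD, hD', hκ, hκ4, hκK, hκ2⟩ := hq
  obtain ⟨hr, hrR, hρ1, -⟩ := hq'
  have hA0 : 0 < areaMean m n r ‖a‖ := by linarith [(abs_le.1 hA).1]
  have hB0 : 0 < volMean (relDisp m n r ‖a‖) m n r ‖a‖ := by linarith [(abs_le.1 hB).1]
  have hcf := centerFactor_pos (d := n) (by linarith : 0 < ‖a‖)
  obtain ⟨hΦ, hopen, hconn, hfr, hpun, fA, fV, ⟨s₁, hs₁, eA⟩, s₂, hs₂, eV⟩ :=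
    graph_properties hn hr (by linarith) hD0 hD20 hDr hm hD hD' hκ hκ4 hA0 hB0 hc
  set P := ‖a‖ ^ (-2 * (n : ℝ) - 1) with hP
  have hP0 : 0 < P := Real.rpow_pos_of_pos (by linarith) _
  have hs₂' := (abs_le.1 (hs₂.trans hκ2)).1
  have hmem : ∀ s : ℝ, |s| ≤ 2 ^ (3 * n) * (2 * κ) → s / P ∈ Icc (-K) K := fun s hs => by
    rw [mem_Icc, ← abs_le, abs_div, abs_of_pos hP0, div_le_iff₀ hP0, ← hκK]
    exact hs
  have hb := hiso (s₁ / P, s₂ / P) ⟨hmem _ hs₁, hmem _ hs₂⟩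
  simp only [div_mul_cancel₀ _ hP0.ne'] at hb
  have hB2 : 0 < volMean (relDisp m n r ‖a‖) m n r ‖a‖ * (1 + s₂) :=
    mul_pos hB0 (by linarith)
  have hvol : 0 < (vol a (enclosed (graph a r c))).toReal := by
    rw [eV]
    have : 0 < 1 + s₂ := by linarith
    have : (0 : ℝ) < n := by linarith
    positivity
  obtain ⟨e, he, hee⟩ := exists_abs_le_of_sub hb
  refine ⟨⟨hΦ, hopen, hconn, hfr, hpun, fA, fV, e, he, ?_⟩, hvol⟩
  rw [eA, eV, ← hee]
  have := area_eq_of_normalized hn (A := areaMean m n r ‖a‖ * (1 + s₁)) hω hr hcf hB2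
  simp only [mul_assoc] at this ⊢
  exact this

/-- The expansions for the coordinate balls. -/
theorem eventually_ball_properties (hn : 3 ≤ n) {m : Measure ℝ} (h : IsZonal n m) (R : ℝ) :
    ∃ C : ℝ, 0 < C ∧ ∀ᶠ q in farLim R, ∀ a : E n, ‖a‖ = q.2 →
      zonalLaw (‖a‖⁻¹ • a) = m →
      area a (sphere 0 q.1) ≠ ⊤ ∧ vol a (closedBall 0 q.1) ≠ ⊤ ∧
      (∃ e : ℝ, |e| ≤ C * ‖a‖ ^ (-2 * (n : ℝ) - 1) ∧ (area a (sphere 0 q.1)).toReal =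
        omega n * q.1 ^ (n - 1) *
          (1 + ‖a‖ ^ (2 - (n : ℝ))) ^ (2 * ((n : ℝ) - 1) / ((n : ℝ) - 2)) *
          (1 + ((n : ℝ) - 1) * q.1 ^ 2 / ‖a‖ ^ (2 * (n : ℝ) - 2) *
              (1 + ‖a‖ ^ (2 - (n : ℝ))) ^ (-2 : ℝ)
            + (n : ℝ) * ((n : ℝ) - 1) ^ 2 / (2 * ((n : ℝ) + 2)) * (q.1 ^ 4 / ‖a‖ ^ (2 * n))
            + e)) ∧
      ∃ e : ℝ, |e| ≤ C * ‖a‖ ^ (-2 * (n : ℝ) - 1) ∧ (vol a (closedBall 0 q.1)).toReal =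
        1 / (n : ℝ) * omega n * q.1 ^ n *
          (1 + ‖a‖ ^ (2 - (n : ℝ))) ^ (2 * (n : ℝ) / ((n : ℝ) - 2)) *
          (1 + (n : ℝ) * q.1 ^ 2 / ‖a‖ ^ (2 * (n : ℝ) - 2) *
              (1 + ‖a‖ ^ (2 - (n : ℝ))) ^ (-2 : ℝ)
            + (n : ℝ) ^ 2 * ((n : ℝ) - 1) / (2 * ((n : ℝ) + 4)) * (q.1 ^ 4 / ‖a‖ ^ (2 * n))
            + e) := by
  have hd : (3 : ℝ) ≤ n := by exact_mod_cast hn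
  have hω := omega_pos hn
  have hρ0 : ∀ᶠ q in farLim R, 0 ≤ q.2 := (tendsto_snd_farLim R).eventually_ge_atTop 0
  obtain ⟨C₁, hC₁, b₁⟩ := (sphereMean_expansion (R := R) h hn).exists_bound hρ0
  obtain ⟨C₂, hC₂, b₂⟩ := (ballMean_expansion (R := R) h hn).exists_bound hρ0
  refine ⟨C₁ + C₂, by positivity, ?_⟩
  filter_upwards [b₁, b₂, eventually_farLim R] with q b₁ b₂ hq a ha hm
  obtain ⟨hr, hrR, hρ1, hρR⟩ := hq
  rw [← ha] at b₁ b₂ hρ1 hρR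
  have hcf := centerFactor_pos (d := n) (by linarith : 0 < ‖a‖)
  have hP0 : 0 < ‖a‖ ^ (-2 * (n : ℝ) - 1) := Real.rpow_pos_of_pos (by linarith) _
  obtain ⟨e₁, he₁, ee₁⟩ := exists_abs_le_of_sub b₁
  obtain ⟨e₂, he₂, ee₂⟩ := exists_abs_le_of_sub b₂
  have hS : 0 ≤ sphereMean m n q.1 ‖a‖ := by
    have hz := h.ae_mem
    exact integral_nonneg_of_ae (hz.mono fun t ht => Real.rpow_nonneg
      (relFactor_pos hr (by linarith) ht).le _)
  have hV : 0 ≤ volMean (fun _ => 0) m n q.1 ‖a‖ := by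
    refine setIntegral_nonneg measurableSet_Icc fun x hx => ?_
    have hk := ratio_mem hr (by linarith : q.1 < ‖a‖)
    have h1 : ∀ t ∈ Icc (-1 : ℝ) 1, 0 ≤ volIntegrand (fun _ => 0) n q.1 ‖a‖ x t := fun t ht => by
      have hx' : x * (q.1 / ‖a‖) * (1 + 0) ∈ Ioo (-1 : ℝ) 1 :=
        ⟨by nlinarith [hx.1, hk.1], by nlinarith [hx.1, hx.2, hk.1, hk.2]⟩
      have := factor_pos (d := n) (by linarith : 0 < ‖a‖) hx' ht
      unfold volIntegrand
      positivity
    have := hx.1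
    have := integral_nonneg_of_ae (h.ae_mem.mono fun t ht => h1 t ht)
    positivity
  have hn0 : (0 : ℝ) < n := by linarith
  rw [area_sphere hn hr (by linarith), vol_closedBall hn hr (by linarith), hm]
  refine ⟨ENNReal.ofReal_ne_top, ENNReal.ofReal_ne_top, ⟨e₁, he₁.trans (by gcongr; linarith), ?_⟩,
    e₂, he₂.trans (by gcongr; linarith), ?_⟩
  · rw [ENNReal.toReal_ofReal (by positivity), ee₁]
    unfold centerFactor
    ring
  · rw [ENNReal.toReal_ofReal (by positivity), ee₂]
    unfold centerFactor
    ring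

end OffCenter

theorem corollaryA5 (n : ℕ) (hn : 3 ≤ n) (R : ℝ) (hR : 0 < R) :
    ∃ C A₀ : ℝ, R < A₀ ∧
      (∀ (r : ℝ) (a : OffCenter.E n), 0 < r → r ≤ R → A₀ ≤ ‖a‖ →
        -- the coordinate ball: area of the boundary, and volume
        OffCenter.area a (Metric.sphere 0 r) ≠ ⊤ ∧
        OffCenter.vol a (Metric.closedBall 0 r) ≠ ⊤ ∧
        (∃ e : ℝ, |e| ≤ C * ‖a‖ ^ (-2 * (n : ℝ) - 1) ∧
          (OffCenter.area a (Metric.sphere 0 r)).toReal =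
            OffCenter.omega n * r ^ (n - 1) *
              (1 + ‖a‖ ^ (2 - (n : ℝ))) ^ (2 * ((n : ℝ) - 1) / ((n : ℝ) - 2)) *
              (1 + ((n : ℝ) - 1) * r ^ 2 / ‖a‖ ^ (2 * (n : ℝ) - 2) *
                  (1 + ‖a‖ ^ (2 - (n : ℝ))) ^ (-2 : ℝ)
                + (n : ℝ) * ((n : ℝ) - 1) ^ 2 / (2 * ((n : ℝ) + 2)) * (r ^ 4 / ‖a‖ ^ (2 * n))
                + e)) ∧
        (∃ e : ℝ, |e| ≤ C * ‖a‖ ^ (-2 * (n : ℝ) - 1) ∧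
          (OffCenter.vol a (Metric.closedBall 0 r)).toReal =
            1 / (n : ℝ) * OffCenter.omega n * r ^ n *
              (1 + ‖a‖ ^ (2 - (n : ℝ))) ^ (2 * (n : ℝ) / ((n : ℝ) - 2)) *
              (1 + (n : ℝ) * r ^ 2 / ‖a‖ ^ (2 * (n : ℝ) - 2) *
                  (1 + ‖a‖ ^ (2 - (n : ℝ))) ^ (-2 : ℝ)
                + (n : ℝ) ^ 2 * ((n : ℝ) - 1) / (2 * ((n : ℝ) + 4)) * (r ^ 4 / ‖a‖ ^ (2 * n))
                + e)) ∧
        -- the constant in the perturbation is determined by the normalization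
        (∃! c : ℝ, OffCenter.MeanZero a r c) ∧
        ∀ c : ℝ, OffCenter.MeanZero a r c →
          -- the normal graph is defined and embedded
          (∃ Φ : OffCenter.E n → OffCenter.E n,
            ContinuousOn Φ (Metric.sphere 0 r) ∧ Set.InjOn Φ (Metric.sphere 0 r) ∧
            (∀ y ∈ Metric.sphere (0 : OffCenter.E n) r, ∃! ν, OffCenter.IsOuterUnitNormal a y ν) ∧
            ∀ y ∈ Metric.sphere (0 : OffCenter.E n) r, ∀ ν, OffCenter.IsOuterUnitNormal a y ν →
              ∀ z, OffCenter.IsExp a y (OffCenter.f a r c y • ν) z ↔ z = Φ y) ∧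
          -- it bounds the enclosed region, which stays away from the puncture
          IsOpen (OffCenter.enclosed (OffCenter.graph a r c)) ∧
          IsConnected (OffCenter.enclosed (OffCenter.graph a r c)) ∧
          frontier (OffCenter.enclosed (OffCenter.graph a r c)) = OffCenter.graph a r c ∧
          -a ∉ closure (OffCenter.enclosed (OffCenter.graph a r c)) ∧
          OffCenter.area a (OffCenter.graph a r c) ≠ ⊤ ∧
          OffCenter.vol a (OffCenter.enclosed (OffCenter.graph a r c)) ≠ ⊤ ∧
          -- the isoperimetric ratio
          ∃ e : ℝ, |e| ≤ C * ‖a‖ ^ (-2 * (n : ℝ) - 1) ∧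
            (OffCenter.area a (OffCenter.graph a r c)).toReal =
              ((n : ℝ) ^ (n - 1) * OffCenter.omega n) ^ (1 / (n : ℝ)) *
                (OffCenter.vol a (OffCenter.enclosed (OffCenter.graph a r c))).toReal
                  ^ (((n : ℝ) - 1) / (n : ℝ)) *
                (1 - 2 * ((n : ℝ) - 2) * ((n : ℝ) - 1) ^ 2
                      / (((n : ℝ) + 1) * ((n : ℝ) + 2) * ((n : ℝ) + 4))
                      * (r ^ 4 / ‖a‖ ^ (2 * n))
                  + e)) ∧
      -- strictly better than a Euclidean ball
      (∀ r₀ : ℝ, 0 < r₀ → ∃ A₁ : ℝ, ∀ (r : ℝ) (a : OffCenter.E n),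
        r₀ ≤ r → r ≤ R → A₁ ≤ ‖a‖ → ∀ c : ℝ, OffCenter.MeanZero a r c →
          (OffCenter.area a (OffCenter.graph a r c)).toReal <
            ((n : ℝ) ^ (n - 1) * OffCenter.omega n) ^ (1 / (n : ℝ)) *
              (OffCenter.vol a (OffCenter.enclosed (OffCenter.graph a r c))).toReal
                ^ (((n : ℝ) - 1) / (n : ℝ))) := by
  have hd : (3 : ℝ) ≤ n := by exact_mod_cast hn
  -- the law of the cosine of the angle with `a` does not depend on `a`
  obtain ⟨e₀, he₀⟩ : ∃ e₀ : OffCenter.E n, ‖e₀‖ = 1 :=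
    ⟨EuclideanSpace.single (⟨0, by omega⟩ : Fin n) (1 : ℝ), by simp⟩
  have hz := OffCenter.isZonal_euclidean hn he₀
  set m := OffCenter.zonalLaw e₀ with hmdef
  have hlaw : ∀ a : OffCenter.E n, 0 < ‖a‖ → OffCenter.zonalLaw (‖a‖⁻¹ • a) = m := fun a ha =>
    OffCenter.zonalLaw_eq (OffCenter.two_le_finrank hn)
      ((OffCenter.norm_direction ha).trans he₀.symm)
  obtain ⟨C₁, hC₁, ev₁⟩ := OffCenter.eventually_ball_properties hn hz R
  obtain ⟨C₂, hC₂, ev₂⟩ := OffCenter.eventually_graph_properties hn hz R hR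
  obtain ⟨A, hA⟩ := OffCenter.exists_forall_of_eventually_farLim (ev₁.and ev₂)
  have hA₀ : ∀ ρ : ℝ, |A| + 2 * R + 1 ≤ ρ → A ≤ ρ ∧ 0 < ρ ∧ 2 * R ≤ ρ := fun ρ hρ => by
    have h1 := le_abs_self A
    have h2 := abs_nonneg A
    exact ⟨by linarith, by linarith, by linarith⟩
  refine ⟨C₁ + C₂, |A| + 2 * R + 1, by linarith [abs_nonneg A], fun r a hr hrR ha => ?_,
    fun r₀ hr₀ => ?_⟩
  · obtain ⟨hAa, ha0, haR⟩ := hA₀ _ ha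
    obtain ⟨hb, hg⟩ := hA r ‖a‖ hr hrR hAa
    have hP0 : 0 < ‖a‖ ^ (-2 * (n : ℝ) - 1) := Real.rpow_pos_of_pos ha0 _
    obtain ⟨b1, b2, ⟨e₁, he₁, ee₁⟩, e₂, he₂, ee₂⟩ := hb a rfl (hlaw a ha0)
    refine ⟨b1, b2, ⟨e₁, he₁.trans (by gcongr; linarith), ee₁⟩,
      ⟨e₂, he₂.trans (by gcongr; linarith), ee₂⟩, ?_, fun c hc => ?_⟩
    · simp only [OffCenter.meanZero_iff hn hr (by linarith : 2 * r ≤ ‖a‖)]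
      exact ⟨_, rfl, fun _ h => h⟩
    · obtain ⟨⟨g1, g2, g3, g4, g5, g6, g7, e, he, hee⟩, -⟩ := hg a rfl (hlaw a ha0) c hc
      exact ⟨g1, g2, g3, g4, g5, g6, g7, e, he.trans (by gcongr; linarith), hee⟩
  · obtain ⟨k, hk⟩ : ∃ k : ℝ, k = 2 * ((n : ℝ) - 2) * ((n : ℝ) - 1) ^ 2 /
        (((n : ℝ) + 1) * ((n : ℝ) + 2) * ((n : ℝ) + 4)) := ⟨_, rfl⟩
    have hk0 : 0 < k := by
      rw [hk]
      have h2 : 0 < (n : ℝ) - 2 := by linarith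
      have h1 : 0 < (n : ℝ) - 1 := by linarith
      positivity
    refine ⟨|A| + 2 * R + 1 + C₂ / (k * r₀ ^ 4), fun r a hr hrR ha c hc => ?_⟩
    have hq : 0 ≤ C₂ / (k * r₀ ^ 4) := by positivity
    obtain ⟨hAa, ha0, haR⟩ := hA₀ ‖a‖ (by linarith)
    have hr' : 0 < r := hr₀.trans_le hr
    obtain ⟨⟨-, -, -, -, -, -, -, e, he, hee⟩, hvol⟩ :=
      (hA r ‖a‖ hr' hrR hAa).2 a rfl (hlaw a ha0) c hc
    have hω := OffCenter.omega_pos hn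
    have hn0 : (0 : ℝ) < n := by linarith
    rw [hee, ← hk]
    refine mul_lt_of_lt_one_right (by positivity) ?_
    -- the error is smaller than the quartic term as soon as `‖a‖ > C₂ / (k r₀ ^ 4)`
    have hpow : ‖a‖ ^ (-2 * (n : ℝ) - 1) = 1 / ‖a‖ ^ (2 * n) / ‖a‖ := by
      rw [Real.rpow_sub_one ha0.ne', ← Real.rpow_natCast, one_div, ← Real.rpow_neg ha0.le]
      congr 2
      push_cast
      ring
    have hlt : C₂ / ‖a‖ < k * r ^ 4 := by
      have h1 : C₂ / (k * r₀ ^ 4) < ‖a‖ := by linarith [abs_nonneg A]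
      rw [div_lt_iff₀ (by positivity)] at h1
      rw [div_lt_iff₀ ha0]
      have : k * r₀ ^ 4 ≤ k * r ^ 4 := by gcongr
      nlinarith
    have hinv : 0 < 1 / ‖a‖ ^ (2 * n) := by positivity
    have h2 : C₂ * ‖a‖ ^ (-2 * (n : ℝ) - 1) < k * (r ^ 4 / ‖a‖ ^ (2 * n)) := by
      rw [hpow]
      calc C₂ * (1 / ‖a‖ ^ (2 * n) / ‖a‖) = C₂ / ‖a‖ * (1 / ‖a‖ ^ (2 * n)) := by ring
        _ < k * r ^ 4 * (1 / ‖a‖ ^ (2 * n)) := by gcongr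
        _ = _ := by ring
    linarith [(abs_le.1 he).2]
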